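/- **Setting.** All quantum systems are finite-dimensional with a preferred basis; channels are CPTP maps, $\|M\|_1=\operatorname{tr}\sqrt{M^\dagger M}$. *Finite resources.* A finite resource $(\mathcal N:\omega\otimes\rho)$ is a channel $\mathcal N:A'S\to AB$, $A'=A^{\rm abs}A^{\rm rel}$, from Alice and a Source to Alice and Bob, with a test state $\omega$ on $A^{\rm rel}$ and a source state $\rho$ on $S$ (any system may be one-dimensional). Tensor products are taken componentwise. A depth-$\ell$ resource is an unordered collection of $\ell$ finite resources; $N^{\otimes k}$ is the componentwise tensor power, $N^{\times k}$ is the depth-$k\ell$ collection of $k$ copies, and ${\bf S}[N]$ is the tensor product of the components. $\rho'^{S'}$ is called a restriction of $\rho^S$ if $S= S'T$ and $\rho=\rho'\otimes\sigma$; then $S'\to S$ denotes appending $\sigma^T$. We write $(\mathcal N:\omega\otimes\rho)\stackrel{*}{\ge}(\mathcal N':\omega'\otimes\rho')$ if $\rho'$ is a restriction of $\rho$ and $\mathcal N'=(\mathcal D_A\otimes\mathcal D_B)\circ\mathcal N\circ(\mathcal E\otimes(S'\to S))$ with local channels, where $\mathcal E$ takes every state with marginal $\omega'$ on the new test system to a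 state with marginal $\omega$ on $A^{\rm rel}$; for depth $\ell,\ell'$ it means such reductions between $N_{f(i)}$ and $N'_i$ for an injective $f:[\ell']\to[\ell]$. *Protocols.* A protocol on a depth-$\ell$ resource $(\mathcal N_i:\omega_i\otimes\rho_i)_i$ with target test and source states $\Omega,\Theta$ ($\Theta$ a restriction of $\bigotimes_i\rho_i$, the remaining sources being emitted in their states) uses each component once in an order $\pi$ of its choice: a channel $\mathcal E_0$ of Alice, then for $i=1,\dots,\ell$ an isometry of Alice from her memory to $A'_{\pi(i)}$ and an auxiliary system followed by $\mathcal N_{\pi(i)}$, then a final channel $\mathcal E_{\ell+1}$ of Alice and a channel $\mathcal D$ of Bob on all his outputs. It creates $(\mathcal P:\Omega\otimes\Theta)$, $\mathcal P$ being the composed channel. It is $\eta$-valid if, for every extension $\xi$ of $\Omega\otimes\Theta$ (a state on the inputs of $\mathcal P$ and an arbitrary reference), just before the use of $\mathcal N_{\pi(i)}$ the state of $A^{\rm rel}_{\pi(i)}$ is within $\eta$ of $\omega_{\pi(i)}$ in trace norm, for all $i$. Its distance to $(\mathcal M:\Omega\otimes\Theta)$ is $\max_\xi\|(\mathcal P\otimes{\rm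 id})\xi-(\mathcal M\otimes{\rm id})\xi\|_1$ over such extensions. *Asymptotic resources.* An asymptotic resource $\alpha\in\mathcal R$ is a sequence $(\alpha_n)$ of resources of a fixed depth such that $\alpha_n\stackrel{*}{\ge}\alpha_{n-1}$ for all large $n$, and for all $\delta\in(0,1)$, integers $k\ge1$ and all large $n$, $\alpha_{\lfloor n(1+\delta)\rfloor}\stackrel{*}{\ge}(\alpha_{\lfloor n/k\rfloor})^{\otimes k}\stackrel{*}{\ge}\alpha_{\lfloor n(1-\delta)\rfloor}$. Put $(\alpha+\beta)_n=(\alpha_n,\beta_n)$ (concatenation) and $(z\alpha)_n=\alpha_{\lfloor zn\rfloor}$ for $z>0$. The inequality $\alpha\ge\beta$ means: for every $\delta\in(0,1)$ there is $k\ge1$ such that for every $\epsilon>0$ and all large $n$ there is an $\epsilon$-valid protocol on $(\alpha_{\lfloor n/k\rfloor})^{\times k}$ within distance $\epsilon$ of ${\bf S}[\beta_{\lfloor(1-\delta)n\rfloor}]$. The unit resources $[q\to q]$, $[q\,q]$, $[c\to c:\tau]$ are the sequences of $n$-th tensor powers of, respectively, the perfect qubit channel, the two-qubit maximally entangled state handed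 to Alice and Bob, and the completely dephasing qubit channel with maximally mixed test state. *Coherent decoupling.* Let component $i$ of the consumed resource be classical. It is $\epsilon$-coherently decoupled in a protocol if the following holds for suitable isometric (Stinespring) extensions of $\mathcal E_0$, $\mathcal E_{\ell+1}$, the other components, and $\mathcal D$, where the extension of $\mathcal D$ may be controlled by the classical value Bob receives from component $i$ (all of its values $y$ giving extensions of $\mathcal D$ with a common environment). Run the protocol with these extensions and with component $i$ preceded by a copy of its input, in the preferred basis, to a register $X$, its classical output being likewise a classical variable. Then, for every extension of $\Omega\otimes\Theta$ and every extension of the state of the unused sources, the final state satisfies $\|\sigma^{XQE}-\sigma^X\otimes\sigma^{QE}\|_1\le\epsilon$, where $QE$ consists of all outputs, references and environments. The classical resource $\gamma$ is coherently decoupled in $\alpha+\gamma\ge\beta$ if the protocols in the definition of this inequality can be chosen such that every component of every copy of $\gamma$ is $\epsilon$-coherently decoupled. **Theorem (Rule I).** Let $\alpha,\beta\in\mathcal R$ and $R>0$. If $$\alpha+R\,[c\to c:\tau]\ \ge\ \beta$$ and the classical resource $R\,[c\to c:\tau]$ is coherently decoupled in this inequality, then $$\alpha+\tfrac R2\,[q\to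 q]\ \ge\ \beta+\tfrac R2\,[q\,q].$$ -/

import Mathlib

open scoped Matrix Kronecker ComplexOrder

noncomputable section

namespace QShannon

/-! ### Finite quantum systems, operators and channels -/

/-- A finite-dimensional quantum system, given by the (nonempty, finite) index set of its
preferred orthonormal basis. -/
structure QSys where
  carrier : Type
  [fintype : Fintype carrier]
  [decEq : DecidableEq carrier]
  [nonempty : Nonempty carrier]

instance : CoeSort QSys Type := ⟨QSys.carrier⟩
instance (X : QSys) : Fintype X.carrier := X.fintype
instance (X : QSys) : DecidableEq X.carrier := X.decEq
instance (X : QSys) : Nonempty X.carrier := X.nonempty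

/-- The null (one-dimensional) system. -/
abbrev QSys.unit : QSys := ⟨Unit⟩

/-- The qubit. -/
abbrev QSys.qubit : QSys := ⟨Fin 2⟩

/-- The composite system (tensor product). -/
abbrev QSys.prod (X Y : QSys) : QSys := ⟨X.carrier × Y.carrier⟩

infixr:70 " ⊠ " => QSys.prod

/-- Operators on the Hilbert space of `X`. -/
abbrev Op (X : QSys) : Type := Matrix X.carrier X.carrier ℂ

/-- Linear maps from operators on `X` to operators on `Y`. -/
abbrev SuperOp (X Y : QSys) : Type := Op X →ₗ[ℂ] Op Y

/-- Density operators. -/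
def IsState {X : QSys} (ρ : Op X) : Prop := ρ.PosSemidef ∧ ρ.trace = 1

/-- The trace norm `‖M‖₁ = tr √(M† M)`. -/
def traceNorm {X : QSys} (M : Op X) : ℝ :=
  ∑ i, √((Matrix.isHermitian_conjTranspose_mul_self M).eigenvalues i)

/-- `ρ ↦ V ρ V†`. -/
def conj {X Y : QSys} (V : Matrix Y.carrier X.carrier ℂ) : SuperOp X Y where
  toFun ρ := V * ρ * Vᴴ
  map_add' a b := by rw [Matrix.mul_add, Matrix.add_mul]
  map_smul' c a := by simp

/-- Identification of two systems through a bijection of their preferred bases. -/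
def relabel {X Y : QSys} (e : X.carrier ≃ Y.carrier) : SuperOp X Y where
  toFun ρ := Matrix.of fun y y' => ρ (e.symm y) (e.symm y')
  map_add' _ _ := rfl
  map_smul' _ _ := rfl

/-- `Φ ⊗ id` with an idle system `W`. -/
def ext {X Y : QSys} (Φ : SuperOp X Y) (W : QSys) : SuperOp (X ⊠ W) (Y ⊠ W) where
  toFun M := Matrix.of fun p q => Φ (Matrix.of fun x x' => M (x, p.2) (x', q.2)) p.1 q.1
  map_add' M M' := by
    ext p q
    have h : (Matrix.of fun x x' => (M + M') (x, p.2) (x', q.2) : Op X)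
        = (Matrix.of fun x x' => M (x, p.2) (x', q.2))
          + Matrix.of fun x x' => M' (x, p.2) (x', q.2) := rfl
    simp only [Matrix.of_apply, Matrix.add_apply]
    simp only [Matrix.add_apply] at h
    rw [h, map_add, Matrix.add_apply]
  map_smul' c M := by
    ext p q
    have h : (Matrix.of fun x x' => (c • M) (x, p.2) (x', q.2) : Op X)
        = c • (Matrix.of fun x x' => M (x, p.2) (x', q.2)) := rfl
    simp only [Matrix.of_apply, Matrix.smul_apply, RingHom.id_apply]
    simp only [Matrix.smul_apply] at h
    rw [h, map_smul, Matrix.smul_apply]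

/-- `Φ ⊗ Ψ`: first `Φ` on the left factor, then `Ψ` on the right factor. -/
def tensor {X Y X' Y' : QSys} (Φ : SuperOp X Y) (Ψ : SuperOp X' Y') :
    SuperOp (X ⊠ X') (Y ⊠ Y') :=
  relabel (X := Y' ⊠ Y) (Y := Y ⊠ Y') (Equiv.prodComm _ _) ∘ₗ ext Ψ Y ∘ₗ
    relabel (X := Y ⊠ X') (Y := X' ⊠ Y) (Equiv.prodComm _ _) ∘ₗ ext Φ X'

/-- The partial trace over the right factor. -/
def ptrace {X W : QSys} : SuperOp (X ⊠ W) X where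
  toFun M := Matrix.of fun x x' => ∑ w, M (x, w) (x', w)
  map_add' M M' := by ext; simp [Finset.sum_add_distrib]
  map_smul' c M := by ext; simp [Finset.mul_sum]

/-- The partial trace over the left factor. -/
def ptraceLeft {X W : QSys} : SuperOp (W ⊠ X) X where
  toFun M := Matrix.of fun x x' => ∑ w, M (w, x) (w, x')
  map_add' M M' := by ext; simp [Finset.sum_add_distrib]
  map_smul' c M := by ext; simp [Finset.mul_sum]

/-- `ρ ↦ ρ ⊗ σ`. -/
def append {X W : QSys} (σ : Op W) : SuperOp X (X ⊠ W) where
  toFun ρ := ρ ⊗ₖ σ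
  map_add' _ _ := Matrix.add_kronecker _ _ _
  map_smul' _ _ := Matrix.smul_kronecker _ _ _

/-- Quantum operations (CPTP maps), through Kraus representations. -/
def IsChannel {X Y : QSys} (Φ : SuperOp X Y) : Prop :=
  ∃ (κ : Type) (_ : Fintype κ) (K : κ → Matrix Y.carrier X.carrier ℂ),
    ∑ i, (K i)ᴴ * K i = 1 ∧ ∀ ρ, Φ ρ = ∑ i, K i * ρ * (K i)ᴴ

theorem IsChannel.comp {X Y Z : QSys} {Φ : SuperOp X Y} {Ψ : SuperOp Y Z}
    (hΨ : IsChannel Ψ) (hΦ : IsChannel Φ) : IsChannel (Ψ ∘ₗ Φ) := by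
  obtain ⟨κ, _, K, hK, hKρ⟩ := hΦ
  obtain ⟨κ', _, L, hL, hLρ⟩ := hΨ
  refine ⟨κ × κ', inferInstance, fun p => L p.2 * K p.1, ?_, fun ρ => ?_⟩
  · rw [Fintype.sum_prod_type, ← hK]
    refine Finset.sum_congr rfl fun i _ => ?_
    have : ∀ j, (L j * K i)ᴴ * (L j * K i) = (K i)ᴴ * ((L j)ᴴ * L j) * K i := by
      intro j; simp only [Matrix.conjTranspose_mul, Matrix.mul_assoc]
    simp only [this]
    rw [← Matrix.sum_mul, ← Matrix.mul_sum, hL, Matrix.mul_one]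
  · rw [LinearMap.comp_apply, hLρ, hKρ, Fintype.sum_prod_type_right]
    refine Finset.sum_congr rfl fun j _ => ?_
    rw [Matrix.mul_sum, Matrix.sum_mul]
    refine Finset.sum_congr rfl fun i _ => ?_
    simp only [Matrix.conjTranspose_mul, Matrix.mul_assoc]

theorem isChannel_conj {X Y : QSys} (V : Matrix Y.carrier X.carrier ℂ) (hV : Vᴴ * V = 1) :
    IsChannel (conj V) :=
  ⟨Unit, inferInstance, fun _ => V, by simpa using hV, fun ρ => by simp [conj]⟩

theorem isChannel_relabel {X Y : QSys} (e : X.carrier ≃ Y.carrier) :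
    IsChannel (relabel e) := by
  refine ⟨Unit, inferInstance, fun _ => Matrix.of fun y x => if e x = y then 1 else 0, ?_, ?_⟩
  · ext x x'
    simp [Matrix.mul_apply, Matrix.one_apply, e.injective.eq_iff, eq_comm]
  · intro ρ
    ext y y'
    have h : ∀ (x : X.carrier) (y : Y.carrier), (e x = y) = (x = e.symm y) := by
      intro x y; rw [Equiv.eq_symm_apply]
    simp [Matrix.mul_apply, h]
    rfl

theorem IsChannel.ext {X Y : QSys} {Φ : SuperOp X Y} (hΦ : IsChannel Φ) (W : QSys) :
    IsChannel (ext Φ W) := by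
  obtain ⟨κ, _, K, hK, hKρ⟩ := hΦ
  refine ⟨κ, inferInstance, fun i => K i ⊗ₖ (1 : Op W), ?_, fun M => ?_⟩
  · have : ∀ i, (K i ⊗ₖ (1 : Op W))ᴴ * (K i ⊗ₖ (1 : Op W)) = ((K i)ᴴ * K i) ⊗ₖ (1 : Op W) := by
      intro i
      rw [Matrix.conjTranspose_kronecker, Matrix.conjTranspose_one, ← Matrix.mul_kronecker_mul,
        Matrix.one_mul]
    simp only [this]
    ext p q
    have h := congrFun (congrFun hK p.1) q.1
    rw [Matrix.sum_apply] at h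
    simp only [Matrix.sum_apply, Matrix.kroneckerMap_apply]
    rw [← Finset.sum_mul, h]
    rcases p with ⟨p1, p2⟩
    rcases q with ⟨q1, q2⟩
    simp only [Matrix.one_apply, Prod.mk.injEq]
    split_ifs <;> simp_all
  · ext p q
    simp only [QShannon.ext, LinearMap.coe_mk, AddHom.coe_mk, Matrix.of_apply, hKρ,
      Matrix.sum_apply]
    refine Finset.sum_congr rfl fun i _ => ?_
    simp only [Matrix.mul_apply, Matrix.conjTranspose_apply, Matrix.kroneckerMap_apply,
      Matrix.of_apply, Fintype.sum_prod_type, Matrix.one_apply]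
    simp [apply_ite (starRingEnd ℂ)]

theorem IsChannel.tensor {X Y X' Y' : QSys} {Φ : SuperOp X Y} {Ψ : SuperOp X' Y'}
    (hΦ : IsChannel Φ) (hΨ : IsChannel Ψ) : IsChannel (tensor Φ Ψ) :=
  (isChannel_relabel _).comp ((hΨ.ext _).comp ((isChannel_relabel _).comp (hΦ.ext _)))

theorem IsState.kron {X Y : QSys} {ρ : Op X} {σ : Op Y} (hρ : IsState ρ) (hσ : IsState σ) :
    IsState (X := X ⊠ Y) (ρ ⊗ₖ σ) :=
  ⟨hρ.1.kronecker hσ.1, by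
    have h := Matrix.trace_kronecker ρ σ
    rw [hρ.2, hσ.2, mul_one] at h
    exact h⟩

theorem isState_unit : IsState (X := QSys.unit) 1 :=
  ⟨(Matrix.PosSemidef.one : (1 : Matrix Unit Unit ℂ).PosSemidef), by simp [Matrix.trace]⟩

/-- A family `(V l)` of isometric extensions (Stinespring dilations) of one map `Φ`, all with the
same environment; for `L = Unit` this is a single isometric extension. -/
structure Dilation (L : Type) {X Y : QSys} (Φ : SuperOp X Y) where
  Env : QSys
  V : L → Matrix (Y ⊠ Env).carrier X.carrier ℂ
  isometry : ∀ l, (V l)ᴴ * V l = 1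
  dilates : ∀ l ρ, ptrace (conj (V l) ρ) = Φ ρ

/-! ### Finite resources -/

/-- A finite (depth-1, generalized) resource `(N : ω ⊗ ρ)`: a quantum operation
`N : A^abs A^rel S → A B` with a test state `ω` on `A^rel` and a source state `ρ` on `S`. -/
structure Resource where
  Aabs : QSys
  Arel : QSys
  S : QSys
  Aout : QSys
  Bout : QSys
  chan : SuperOp ((Aabs ⊠ Arel) ⊠ S) (Aout ⊠ Bout)
  isChannel : IsChannel chan
  test : Op Arel
  isState_test : IsState test
  source : Op S
  isState_source : IsState source

namespace Resource

/-- Alice's input system `A' = A^abs A^rel`. -/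
abbrev Alice (r : Resource) : QSys := r.Aabs ⊠ r.Arel

/-- The whole input system `A' S`. -/
abbrev In (r : Resource) : QSys := r.Alice ⊠ r.S

/-- The whole output system `A B`. -/
abbrev Out (r : Resource) : QSys := r.Aout ⊠ r.Bout

/-- `ξ`, a state on the inputs `A^abs A^rel S` and a reference system `R`, is an extension of
`ω ⊗ ρ`. -/
def IsExtension (r : Resource) {R : QSys} (ξ : Op (r.In ⊠ R)) : Prop :=
  IsState ξ ∧
    (Matrix.of fun p q : r.Arel.carrier × r.S.carrier =>
      ∑ a, ∑ c, ξ (((a, p.1), p.2), c) (((a, q.1), q.2), c)) = r.test ⊗ₖ r.source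

/-- The trivial resource (all systems null), the empty tensor product. -/
def trivial : Resource where
  Aabs := QSys.unit
  Arel := QSys.unit
  S := QSys.unit
  Aout := QSys.unit
  Bout := QSys.unit
  chan := relabel (X := (QSys.unit ⊠ QSys.unit) ⊠ QSys.unit) (Y := QSys.unit ⊠ QSys.unit)
    (Equiv.prodUnique _ _)
  isChannel := isChannel_relabel _
  test := 1
  isState_test := isState_unit
  source := 1
  isState_source := isState_unit

/-- The tensor product of resources,
`(N₁ : ω₁) ⊗ (N₂ : ω₂) = (N₁ ⊗ N₂ : ω₁ ⊗ ω₂)`. -/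
def tensor (r s : Resource) : Resource where
  Aabs := r.Aabs ⊠ s.Aabs
  Arel := r.Arel ⊠ s.Arel
  S := r.S ⊠ s.S
  Aout := r.Aout ⊠ s.Aout
  Bout := r.Bout ⊠ s.Bout
  chan :=
    relabel (X := (r.Aout ⊠ r.Bout) ⊠ (s.Aout ⊠ s.Bout))
        (Y := (r.Aout ⊠ s.Aout) ⊠ (r.Bout ⊠ s.Bout)) (Equiv.prodProdProdComm _ _ _ _)
      ∘ₗ QShannon.tensor r.chan s.chan
      ∘ₗ relabel (X := ((r.Aabs ⊠ s.Aabs) ⊠ (r.Arel ⊠ s.Arel)) ⊠ (r.S ⊠ s.S)) (Y := r.In ⊠ s.In)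
        { toFun := fun p => (((p.1.1.1, p.1.2.1), p.2.1), ((p.1.1.2, p.1.2.2), p.2.2))
          invFun := fun q => (((q.1.1.1, q.2.1.1), (q.1.1.2, q.2.1.2)), (q.1.2, q.2.2))
          left_inv := fun _ => rfl
          right_inv := fun _ => rfl }
  isChannel := (isChannel_relabel _).comp
    ((r.isChannel.tensor s.isChannel).comp (isChannel_relabel _))
  test := r.test ⊗ₖ s.test
  isState_test := r.isState_test.kron s.isState_test
  source := r.source ⊗ₖ s.source
  isState_source := r.isState_source.kron s.isState_source

/-- The tensor power `r^{⊗ k}`. -/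
def pow (r : Resource) : ℕ → Resource
  | 0 => trivial
  | k + 1 => (r.pow k).tensor r

/-- The tensor product of a list of resources. -/
def tensorList : List Resource → Resource
  | [] => trivial
  | r :: l => r.tensor (tensorList l)

end Resource

/-- The state `ρ'` on `S'` is a restriction of the state `ρ` on `S` to a tensor factor `S'` of
`S`: `S` is identified with `S' T` in such a way that `ρ = ρ' ⊗ σ`.  The Source is passive, so
the remaining factor `T` is emitted in the state `σ`. -/
structure SourceSplit {S S' : QSys} (ρ : Op S) (ρ' : Op S') where
  T : QSys
  σ : Op T
  isState : IsState σ
  e : (S' ⊠ T).carrier ≃ S.carrier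
  eq : relabel (X := S' ⊠ T) (Y := S) e (ρ' ⊗ₖ σ) = ρ

/-- The map `S' → S` that appends the state `σ` of the remaining factor. -/
def SourceSplit.embed {S S' : QSys} {ρ : Op S} {ρ' : Op S'} (c : SourceSplit ρ ρ') :
    SuperOp S' S :=
  relabel (X := S' ⊠ c.T) (Y := S) c.e ∘ₗ append c.σ

/-- The reduction `r ≥* r'` of depth-1 resources: `N' = D ∘ N ∘ E` with local encodings and
decodings such that `E` takes the test and source states of `r'` to those of `r`. -/
def Resource.Reduces (r r' : Resource) : Prop :=
  ∃ (EA : SuperOp r'.Alice r.Alice) (c : SourceSplit r.source r'.source)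
    (DA : SuperOp r.Aout r'.Aout) (DB : SuperOp r.Bout r'.Bout),
    IsChannel EA ∧ IsChannel DA ∧ IsChannel DB ∧
    (∀ ξ : Op r'.Alice, IsState ξ → ptraceLeft ξ = r'.test → ptraceLeft (EA ξ) = r.test) ∧
    r'.chan = QShannon.tensor DA DB ∘ₗ r.chan ∘ₗ QShannon.tensor EA c.embed

/-! ### Protocols

A depth-`ℓ` resource is a family `N : ι → Resource` with `ι` finite, `ℓ = |ι|`. -/

section Protocol

variable {ι : Type}

/-- The joint system `F j₁ ⊗ F j₂ ⊗ ⋯` along a list of indices. -/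
abbrev sysList (F : ι → QSys) : List ι → QSys
  | [] => QSys.unit
  | j :: l => F j ⊠ sysList F l

/-- The source systems of the listed resources. -/
abbrev srcSys (N : ι → Resource) (l : List ι) : QSys := sysList (fun j => (N j).S) l

/-- Bob's output systems of the listed resources. -/
abbrev bobSys (N : ι → Resource) (l : List ι) : QSys := sysList (fun j => (N j).Bout) l

/-- The joint source state of the listed resources. -/
def srcState (N : ι → Resource) : (l : List ι) → Op (srcSys N l)
  | [] => (1 : Op QSys.unit)
  | j :: l => (N j).source ⊗ₖ srcState N l

/-- Alice's encoding layers, for the resources of `N` used in the order given by the list, from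
her memory `M` at the beginning to her memory at the end: before each use of a resource she
performs an isometry from her memory to the input system of the resource and an auxiliary
system; after it her memory consists of her output of the resource and the auxiliary system. -/
inductive Layers (N : ι → Resource) : List ι → QSys → QSys → Type 1
  | nil (M : QSys) : Layers N [] M M
  | cons {M M' : QSys} (j : ι) {l : List ι} (aux : QSys)
      (V : Matrix ((N j).Alice ⊠ aux).carrier M.carrier ℂ) (hV : Vᴴ * V = 1)
      (rest : Layers N l ((N j).Aout ⊠ aux) M') : Layers N (j :: l) M M'

/-- A family, labelled by `L`, of maps from the input systems of `r` to its output systems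
together with a further environment system `Z`. -/
structure ExtMap (L : Type) (r : Resource) where
  Z : QSys
  map : L → SuperOp r.In (r.Out ⊠ Z)

/-- The channel of the resource itself, with a null environment. -/
def ExtMap.plain (r : Resource) : ExtMap Unit r where
  Z := QSys.unit
  map _ := append 1 ∘ₗ r.chan

/-- The joint environment. -/
abbrev envSys {N : ι → Resource} {L : Type} (E : ∀ j, ExtMap L (N j)) (l : List ι) : QSys :=
  sysList (fun j => (E j).Z) l

/-- Alice's memory and the source systems, after her isometry and before the use of the first
resource: her new memory is brought in the form (input of the resource, rest). -/
def encodeStep {N : ι → Resource} {M : QSys} (j : ι) (l : List ι) (aux : QSys)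
    (V : Matrix ((N j).Alice ⊠ aux).carrier M.carrier ℂ) :
    SuperOp (M ⊠ srcSys N (j :: l)) ((N j).In ⊠ (aux ⊠ srcSys N l)) :=
  relabel (X := ((N j).Alice ⊠ aux) ⊠ ((N j).S ⊠ srcSys N l))
      (Y := ((N j).Alice ⊠ (N j).S) ⊠ (aux ⊠ srcSys N l)) (Equiv.prodProdProdComm _ _ _ _)
    ∘ₗ ext (conj (Y := (N j).Alice ⊠ aux) V) ((N j).S ⊠ srcSys N l)

/-- The composition of the encoding layers and the resources, with the channel of each resource
replaced by the member labelled `lab` of a family of maps with environments. -/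
def Layers.run {N : ι → Resource} {L : Type} (E : ∀ j, ExtMap L (N j)) (lab : L) :
    {l : List ι} → {M M' : QSys} → Layers N l M M' →
      SuperOp (M ⊠ srcSys N l) ((M' ⊠ bobSys N l) ⊠ envSys E l)
  | _, _, _, .nil M =>
      (append (X := M ⊠ QSys.unit) (W := QSys.unit) 1 :
        SuperOp (M ⊠ QSys.unit) ((M ⊠ QSys.unit) ⊠ QSys.unit))
  | _, _, _, .cons (M' := M') j (l := l) aux V _ rest =>
      relabel
          (X := ((M' ⊠ bobSys N l) ⊠ envSys E l) ⊠ ((N j).Bout ⊠ (E j).Z))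
          (Y := (M' ⊠ ((N j).Bout ⊠ bobSys N l)) ⊠ ((E j).Z ⊠ envSys E l))
          { toFun := fun p => ((p.1.1.1, (p.2.1, p.1.1.2)), (p.2.2, p.1.2))
            invFun := fun q => (((q.1.1, q.1.2.2), q.2.2), (q.1.2.1, q.2.1))
            left_inv := fun _ => rfl
            right_inv := fun _ => rfl }
        ∘ₗ ext (rest.run E lab) ((N j).Bout ⊠ (E j).Z)
        ∘ₗ relabel
          (X := (((N j).Aout ⊠ (N j).Bout) ⊠ (E j).Z) ⊠ (aux ⊠ srcSys N l))
          (Y := (((N j).Aout ⊠ aux) ⊠ srcSys N l) ⊠ ((N j).Bout ⊠ (E j).Z))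
          { toFun := fun p => (((p.1.1.1, p.2.1), p.2.2), (p.1.1.2, p.1.2))
            invFun := fun q => (((q.1.1.1, q.2.1), q.2.2), (q.1.1.2, q.1.2))
            left_inv := fun _ => rfl
            right_inv := fun _ => rfl }
        ∘ₗ ext ((E j).map lab) (aux ⊠ srcSys N l)
        ∘ₗ encodeStep j l aux V

/-- `η`-validity of the encoding layers on a joint state of Alice's memory and the source
systems: at each use of a resource, the state of `A^rel` is `η`-close to the test state.  (Bob's
outputs do not influence this condition, and are traced out.) -/
def Layers.Valid {N : ι → Resource} (η : ℝ) :
    {l : List ι} → {M M' : QSys} → Layers N l M M' → Op (M ⊠ srcSys N l) → Prop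
  | _, _, _, .nil _, _ => True
  | _, _, _, .cons j (l := l) aux V _ rest, ρ =>
      traceNorm (X := (N j).Arel)
          (ptraceLeft (ptrace (ptrace (encodeStep j l aux V ρ))) - (N j).test) ≤ η ∧
      rest.Valid η
        (ptrace (relabel
          (X := ((N j).Aout ⊠ (N j).Bout) ⊠ (aux ⊠ srcSys N l))
          (Y := (((N j).Aout ⊠ aux) ⊠ srcSys N l) ⊠ (N j).Bout)
          { toFun := fun p => (((p.1.1, p.2.1), p.2.2), p.1.2)
            invFun := fun q => ((q.1.1.1, q.2), (q.1.1.2, q.1.2))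
            left_inv := fun _ => rfl
            right_inv := fun _ => rfl }
          (ext (N j).chan (aux ⊠ srcSys N l) (encodeStep j l aux V ρ))))

/-- A protocol that consumes the resources of the family `N`, each of them once and in an order
of its choice, and creates a depth-1 resource with the systems, the test state and the source
state of `T`. -/
structure Protocol (N : ι → Resource) (T : Resource) where
  order : List ι
  nodup : order.Nodup
  complete : ∀ j, j ∈ order
  split : SourceSplit (srcState N order) T.source
  M₀ : QSys
  M₁ : QSys
  E₀ : SuperOp T.Alice M₀
  isChannel_E₀ : IsChannel E₀
  layers : Layers N order M₀ M₁
  E₁ : SuperOp M₁ T.Aout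
  isChannel_E₁ : IsChannel E₁
  D : SuperOp (bobSys N order) T.Bout
  isChannel_D : IsChannel D

namespace Protocol

variable {N : ι → Resource} {T : Resource} (P : Protocol N T)

/-- The operation `A' S → A B` created by the protocol. -/
def chan : SuperOp T.In T.Out :=
  tensor P.E₁ P.D ∘ₗ ptrace ∘ₗ P.layers.run (fun j => ExtMap.plain (N j)) ()
    ∘ₗ tensor P.E₀ P.split.embed

/-- `η`-validity, for all extensions of the test and source states of the created resource. -/
def Valid (η : ℝ) : Prop :=
  ∀ (R : QSys) (ξ : Op (T.In ⊠ R)), T.IsExtension ξ →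
    P.layers.Valid η (tensor P.E₀ P.split.embed (ptrace ξ))

/-- The created resource is `ε`-close to the resource `T`. -/
def Close (ε : ℝ) : Prop :=
  ∀ (R : QSys) (ξ : Op (T.In ⊠ R)), T.IsExtension ξ →
    traceNorm (X := T.Out ⊠ R) (ext P.chan R ξ - ext T.chan R ξ) ≤ ε

end Protocol

/-- The isometric extension of a resource. -/
def ExtMap.dilated {L : Type} {r : Resource} (d : Dilation Unit r.chan) : ExtMap L r where
  Z := d.Env
  map _ := conj (d.V ())

/-- The branches of a classical resource: the input has the value `x` and Bob's output has the
value `y`, in the preferred bases. -/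
def ExtMap.branch (r : Resource) : ExtMap (r.In.carrier × r.Bout.carrier) r where
  Z := QSys.unit
  map xy := append 1
    ∘ₗ conj (X := r.Out) (Y := r.Out) ((1 : Op r.Aout) ⊗ₖ Matrix.single xy.2 xy.2 (1 : ℂ))
    ∘ₗ r.chan
    ∘ₗ conj (X := r.In) (Y := r.In) (Matrix.single xy.1 xy.1 (1 : ℂ))

/-- The classical-quantum operator `∑ₓ |x⟩⟨x| ⊗ σₓ`. -/
def cqOp {X Q : QSys} (σ : X.carrier → Op Q) : Op (X ⊠ Q) :=
  Matrix.of fun p q => if p.1 = q.1 then σ p.1 p.2 q.2 else 0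

namespace Protocol

variable [DecidableEq ι] {N : ι → Resource} {T : Resource} (P : Protocol N T)

/-- The maps that replace the resources when the (classical) resource `i` is followed classically,
and all others are isometrically extended. -/
def cohMaps (i : ι) (dil : ∀ j, Dilation Unit (N j).chan) :
    ∀ j, ExtMap ((N i).In.carrier × (N i).Bout.carrier) (N j) :=
  Function.update (fun j => ExtMap.dilated (dil j)) i (ExtMap.branch (N i))

/-- The final state, restricted to the branch in which the input and output of the classical
resource `i` are `x` and `y`, of the protocol in which all other operations are isometrically
extended, on: Alice's output and her final environment, Bob's output and environment, the
environments of the resources, and the passive systems (environment of `E₀`, reference `R`,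
purification `R'` of the unused sources).  Bob's isometric extension may depend on his outcome
`y`. -/
def branchState (i : ι) (dil : ∀ j, Dilation Unit (N j).chan)
    (d₀ : Dilation Unit P.E₀) (d₁ : Dilation Unit P.E₁) (dB : Dilation (N i).Bout.carrier P.D)
    {R R' : QSys} (ξ : Op (T.In ⊠ R)) (ζ : Op (P.split.T ⊠ R'))
    (x : (N i).In.carrier) (y : (N i).Bout.carrier) :
    Op ((((T.Aout ⊠ d₁.Env) ⊠ (T.Bout ⊠ dB.Env)) ⊠ envSys (cohMaps i dil) P.order)
      ⊠ (d₀.Env ⊠ (R ⊠ R'))) :=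
  ext (ext (tensor (conj (Y := T.Aout ⊠ d₁.Env) (d₁.V ())) (conj (Y := T.Bout ⊠ dB.Env) (dB.V y)))
      (envSys (cohMaps i dil) P.order)) (d₀.Env ⊠ (R ⊠ R'))
    (ext (P.layers.run (cohMaps i dil) (x, y)) (d₀.Env ⊠ (R ⊠ R'))
      (relabel
        (X := (((P.M₀ ⊠ d₀.Env) ⊠ T.S) ⊠ R) ⊠ (P.split.T ⊠ R'))
        (Y := (P.M₀ ⊠ srcSys N P.order) ⊠ (d₀.Env ⊠ (R ⊠ R')))
        { toFun := fun p => ((p.1.1.1.1, P.split.e (p.1.1.2, p.2.1)),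
            (p.1.1.1.2, (p.1.2, p.2.2)))
          invFun := fun q => ((((q.1.1, q.2.1), (P.split.e.symm q.1.2).1), q.2.2.1),
            ((P.split.e.symm q.1.2).2, q.2.2.2))
          left_inv := fun p => by simp
          right_inv := fun q => by simp }
        (append ζ (ext (ext (conj (Y := P.M₀ ⊠ d₀.Env) (d₀.V ())) T.S) R ξ))))

/-- The classical resource `i` is `ε`-coherently decoupled with respect to the protocol: for
suitable isometric extensions of all other operations, `‖σ^{XQE} - σ^X ⊗ σ^{QE}‖₁ ≤ ε` for all
extensions of the test and source states, `X` being a copy of the input of the resource `i`. -/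
def CohDecoupled (i : ι) (ε : ℝ) : Prop :=
  ∃ (dil : ∀ j, Dilation Unit (N j).chan) (d₀ : Dilation Unit P.E₀) (d₁ : Dilation Unit P.E₁)
    (dB : Dilation (N i).Bout.carrier P.D),
    ∀ (R R' : QSys) (ξ : Op (T.In ⊠ R)) (ζ : Op (P.split.T ⊠ R')),
      T.IsExtension ξ → IsState ζ → ptrace ζ = P.split.σ →
      ∀ σ, σ = cqOp (X := (N i).In) (fun x => ∑ y, P.branchState i dil d₀ d₁ dB ξ ζ x y) →
        traceNorm (σ - ptrace σ ⊗ₖ ptraceLeft σ) ≤ ε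

end Protocol

end Protocol

/-! ### Asymptotic resources -/

/-- A sequence of finite resources of a fixed depth. -/
structure ResourceSeq where
  depth : ℕ
  comp : ℕ → Fin depth → Resource

namespace ResourceSeq

/-- The reduction of depth-`ℓ` to depth-`ℓ'` resources. -/
def DepthReduces {ℓ ℓ' : ℕ} (N : Fin ℓ → Resource) (N' : Fin ℓ' → Resource) : Prop :=
  ∃ f : Fin ℓ' → Fin ℓ, Function.Injective f ∧ ∀ i, (N (f i)).Reduces (N' i)

/-- The tensor power of a depth-`ℓ` resource. -/
def depthPow {ℓ : ℕ} (N : Fin ℓ → Resource) (k : ℕ) : Fin ℓ → Resource := fun i => (N i).pow k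

/-- The standard protocol: the tensor product of the components of a depth-`ℓ` resource. -/
def flat {ℓ : ℕ} (N : Fin ℓ → Resource) : Resource := Resource.tensorList (List.ofFn N)

/-- The two conditions that define asymptotic resources among sequences of finite resources. -/
def IsAsymptotic (α : ResourceSeq) : Prop :=
  (∃ n₀ : ℕ, ∀ n ≥ n₀, DepthReduces (α.comp n) (α.comp (n - 1))) ∧
  ∀ δ : ℝ, 0 < δ → δ < 1 → ∀ k : ℕ, 0 < k → ∃ n₀ : ℕ, ∀ n ≥ n₀,
    DepthReduces (α.comp ⌊(n : ℝ) * (1 + δ)⌋₊) (depthPow (α.comp (n / k)) k) ∧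
    DepthReduces (depthPow (α.comp (n / k)) k) (α.comp ⌊(n : ℝ) * (1 - δ)⌋₊)

/-- `⟨N : ω⟩`, the i.i.d. resource. -/
def iid (r : Resource) : ResourceSeq := ⟨1, fun n _ => r.pow n⟩

/-- The sum of resources. -/
def add (α β : ResourceSeq) : ResourceSeq :=
  ⟨α.depth + β.depth, fun n => Fin.append (α.comp n) (β.comp n)⟩

instance : Add ResourceSeq := ⟨add⟩

/-- The multiple `z α` of a resource. -/
def smul (z : ℝ) (α : ResourceSeq) : ResourceSeq := ⟨α.depth, fun n => α.comp ⌊z * n⌋₊⟩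

instance : SMul ℝ ResourceSeq := ⟨smul⟩

/-- `k` copies of a depth-`ℓ` resource. -/
def copies {ℓ : ℕ} (N : Fin ℓ → Resource) (k : ℕ) : Fin k × Fin ℓ → Resource := fun p => N p.2

/-- The asymptotic resource inequality `α ≥ β`. -/
def Ineq (α β : ResourceSeq) : Prop :=
  ∀ δ : ℝ, 0 < δ → δ < 1 → ∃ k : ℕ, 0 < k ∧ ∀ ε : ℝ, 0 < ε → ∃ n₀ : ℕ, ∀ n ≥ n₀,
    ∃ P : Protocol (copies (α.comp (n / k)) k) (flat (β.comp ⌊(1 - δ) * (n : ℝ)⌋₊)),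
      P.Valid ε ∧ P.Close ε

/-- The asymptotic resource inequality `α + γ ≥ β` holds, with the classical resource `γ`
coherently decoupled: each component of each of the copies of `γ` consumed by the protocols is
`ε`-coherently decoupled. -/
def IneqCohDecoupled (α γ β : ResourceSeq) : Prop :=
  ∀ δ : ℝ, 0 < δ → δ < 1 → ∃ k : ℕ, 0 < k ∧ ∀ ε : ℝ, 0 < ε → ∃ n₀ : ℕ, ∀ n ≥ n₀,
    ∃ P : Protocol (copies ((α.add γ).comp (n / k)) k) (flat (β.comp ⌊(1 - δ) * (n : ℝ)⌋₊)),
      P.Valid ε ∧ P.Close ε ∧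
      ∀ (c : Fin k) (j : Fin γ.depth), P.CohDecoupled (c, Fin.natAdd α.depth j) ε

end ResourceSeq

/-! ### Unit resources -/

/-- The maximally mixed state of a qubit. -/
def mixedQubit : Op QSys.qubit := (1 / 2 : ℂ) • (1 : Matrix (Fin 2) (Fin 2) ℂ)

theorem isState_mixedQubit : IsState mixedQubit := by
  refine ⟨(Matrix.PosSemidef.one : (1 : Matrix (Fin 2) (Fin 2) ℂ).PosSemidef).smul
    (show (0 : ℂ) ≤ 1 / 2 by norm_num [Complex.le_def]), ?_⟩
  simp [mixedQubit, Matrix.trace_smul]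

/-- The perfect qubit channel `id₂`, with absolute input. -/
def qubitChannel : Resource where
  Aabs := QSys.qubit
  Arel := QSys.unit
  S := QSys.unit
  Aout := QSys.unit
  Bout := QSys.qubit
  chan := relabel (X := (QSys.qubit ⊠ QSys.unit) ⊠ QSys.unit) (Y := QSys.unit ⊠ QSys.qubit)
    { toFun := fun p => ((), p.1.1)
      invFun := fun q => ((q.2, ()), ())
      left_inv := fun _ => rfl
      right_inv := fun _ => rfl }
  isChannel := isChannel_relabel _
  test := 1
  isState_test := isState_unit
  source := 1
  isState_source := isState_unit

/-- The dephasing map: `ρ ↦ ∑ₓ |x⟩⟨x| ρ |x⟩⟨x|`. -/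
def dephase (X : QSys) : SuperOp X X := ∑ x, conj (X := X) (Y := X) (Matrix.single x x (1 : ℂ))

theorem isChannel_dephase (X : QSys) : IsChannel (dephase X) := by
  refine ⟨X.carrier, inferInstance, fun x => Matrix.single x x 1, ?_, fun ρ => ?_⟩
  · ext a b
    simp only [Matrix.conjTranspose_single, Matrix.single_mul_single_same, star_one, mul_one,
      Matrix.sum_apply, Matrix.single_apply, Matrix.one_apply]
    by_cases h : a = b
    · subst h; simp
    · rw [if_neg h]
      exact Finset.sum_eq_zero fun c _ => if_neg fun hc => h (hc.1.symm.trans hc.2)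
  · simp [dephase, conj]

/-- The perfect classical bit channel (the completely dephasing qubit channel), with the maximally
mixed test state. -/
def cbitChannelRel : Resource where
  Aabs := QSys.unit
  Arel := QSys.qubit
  S := QSys.unit
  Aout := QSys.unit
  Bout := QSys.qubit
  chan := relabel (X := (QSys.unit ⊠ QSys.qubit) ⊠ QSys.unit) (Y := QSys.unit ⊠ QSys.qubit)
      { toFun := fun p => ((), p.1.2)
        invFun := fun q => (((), q.2), ())
        left_inv := fun _ => rfl
        right_inv := fun _ => rfl }
    ∘ₗ dephase ((QSys.unit ⊠ QSys.qubit) ⊠ QSys.unit)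
  isChannel := (isChannel_relabel _).comp (isChannel_dephase _)
  test := mixedQubit
  isState_test := isState_mixedQubit
  source := 1
  isState_source := isState_unit

/-- The column vector of the state `|Φ₂⟩ = (|00⟩ + |11⟩)/√2`, as a map from the null system. -/
def ebitVec : Matrix (QSys.qubit ⊠ QSys.qubit).carrier
    ((QSys.unit ⊠ QSys.unit) ⊠ QSys.unit).carrier ℂ :=
  Matrix.of fun p _ => if p.1 = p.2 then ((1 / √2 : ℝ) : ℂ) else 0

theorem ebitVec_isometry : ebitVecᴴ * ebitVec = 1 := by
  ext a b
  have h : (((√2 : ℝ) : ℂ))⁻¹ * ((√2 : ℝ) : ℂ)⁻¹ = 1 / 2 := by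
    rw [← mul_inv, ← Complex.ofReal_mul, Real.mul_self_sqrt (by norm_num)]
    norm_num
  obtain rfl : a = b := Subsingleton.elim _ _
  simp [ebitVec, Matrix.mul_apply, Fintype.sum_prod_type, h]

/-- The static resource `Φ₂`: the maximally entangled state of two qubits is handed to Alice and
Bob. -/
def ebitState : Resource where
  Aabs := QSys.unit
  Arel := QSys.unit
  S := QSys.unit
  Aout := QSys.qubit
  Bout := QSys.qubit
  chan := conj (X := (QSys.unit ⊠ QSys.unit) ⊠ QSys.unit) (Y := QSys.qubit ⊠ QSys.qubit) ebitVec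
  isChannel := isChannel_conj _ ebitVec_isometry
  test := 1
  isState_test := isState_unit
  source := 1
  isState_source := isState_unit

/-- The asymptotic resource `[q → q]`. -/
def qubits : ResourceSeq := .iid qubitChannel

/-- The asymptotic resource `[c → c : τ]`. -/
def cbitsRel : ResourceSeq := .iid cbitChannelRel

/-- The asymptotic resource `[q q]`. -/
def ebits : ResourceSeq := .iid ebitState

end QShannon

end

noncomputable section

namespace QShannon

open LinearMap (comp_apply comp_assoc)
open Matrix
  (mul_apply of_apply one_apply single_apply conjTranspose_apply conjTranspose_mul mul_kronecker_mul kroneckerMap_apply single_kronecker_single conjTranspose_kronecker trace_smul)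
open Finset
  (sum_congr mul_sum sum_comm sum_eq_single sum_le_sum sum_eq_zero sum_add_distrib sum_mul)
open Fintype (sum_prod_type)
open Equiv (prodProdProdComm prodPUnit prodAssoc punitProd prodComm)

/-! ### Contractions and the trace norm -/

section Contractions

variable {m n p : Type} [Fintype m] [Fintype n] [Fintype p]

/-- The squared Euclidean norm of a vector. -/
def nsq (v : n → ℂ) : ℝ := ∑ i, ‖v i‖ ^ 2

theorem nsq_nonneg (v : n → ℂ) : 0 ≤ nsq v := Finset.sum_nonneg fun _ _ => by positivity

theorem nsq_eq_dotProduct (v : n → ℂ) : ((nsq v : ℝ) : ℂ) = star v ⬝ᵥ v := by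
  simp [nsq, dotProduct, Complex.conj_mul']

theorem norm_dotProduct_le (v w : n → ℂ) : ‖v ⬝ᵥ w‖ ≤ √(nsq v) * √(nsq w) := by
  calc ‖v ⬝ᵥ w‖ ≤ ∑ i, ‖v i‖ * ‖w i‖ := by
        refine (norm_sum_le _ _).trans (le_of_eq ?_)
        simp
    _ ≤ _ := Real.sum_mul_le_sqrt_mul_sqrt _ _ _

theorem nsq_star (v : n → ℂ) : nsq (star v) = nsq v := by simp [nsq]

/-- Operators of norm at most one. -/
def IsContr (C : Matrix m n ℂ) : Prop := ∀ v : n → ℂ, nsq (C *ᵥ v) ≤ nsq v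

theorem nsq_mulVec (C : Matrix m n ℂ) (v : n → ℂ) :
    ((nsq (C *ᵥ v) : ℝ) : ℂ) = star v ⬝ᵥ ((Cᴴ * C) *ᵥ v) := by
  rw [nsq_eq_dotProduct, Matrix.star_mulVec, ← Matrix.mulVec_mulVec, Matrix.dotProduct_mulVec,
    Matrix.dotProduct_mulVec, Matrix.dotProduct_mulVec]

theorem nsq_mulVec_of_isometry [DecidableEq n] {C : Matrix m n ℂ} (h : Cᴴ * C = 1) (v : n → ℂ) :
    nsq (C *ᵥ v) = nsq v := by
  have := nsq_mulVec C v
  rw [h, Matrix.one_mulVec, ← nsq_eq_dotProduct] at this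
  exact_mod_cast this

theorem IsContr.of_isometry [DecidableEq n] {C : Matrix m n ℂ} (h : Cᴴ * C = 1) : IsContr C :=
  fun v => (nsq_mulVec_of_isometry h v).le

theorem IsContr.mul {C : Matrix m n ℂ} {D : Matrix n p ℂ} (hC : IsContr C) (hD : IsContr D) :
    IsContr (C * D) := fun v => by
  rw [← Matrix.mulVec_mulVec]; exact (hC _).trans (hD v)

theorem IsContr.conjTranspose {C : Matrix m n ℂ} (hC : IsContr C) : IsContr Cᴴ := fun v => by
  have h1 : ((nsq (Cᴴ *ᵥ v) : ℝ) : ℂ) = star v ⬝ᵥ (C *ᵥ (Cᴴ *ᵥ v)) := by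
    rw [nsq_mulVec, Matrix.conjTranspose_conjTranspose, ← Matrix.mulVec_mulVec]
  have h2 : nsq (Cᴴ *ᵥ v) ≤ √(nsq v) * √(nsq (Cᴴ *ᵥ v)) := by
    have := norm_dotProduct_le (star v) (C *ᵥ (Cᴴ *ᵥ v))
    rw [← h1, nsq_star, Complex.norm_real, Real.norm_of_nonneg (nsq_nonneg _)] at this
    exact this.trans (mul_le_mul_of_nonneg_left (Real.sqrt_le_sqrt (hC _)) (Real.sqrt_nonneg _))
  set a := nsq (Cᴴ *ᵥ v) with ha
  have ha0 : 0 ≤ a := nsq_nonneg _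
  by_cases h0 : √a = 0
  · rw [Real.sqrt_eq_zero ha0] at h0
    rw [h0]; exact nsq_nonneg _
  · have hpos : 0 < √a := lt_of_le_of_ne (Real.sqrt_nonneg _) (Ne.symm h0)
    have h3 : √a ≤ √(nsq v) := by
      refine le_of_mul_le_mul_right ?_ hpos
      rw [Real.mul_self_sqrt ha0]; exact h2
    exact (Real.sqrt_le_sqrt_iff (nsq_nonneg _)).1 h3

theorem IsContr.one [DecidableEq n] : IsContr (1 : Matrix n n ℂ) := fun v => by simp

theorem IsContr.kron_one {C : Matrix m n ℂ} (hC : IsContr C) (w : Type) [Fintype w]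
    [DecidableEq w] : IsContr (C ⊗ₖ (1 : Matrix w w ℂ)) := fun v => by
  have h : ∀ a b, ((C ⊗ₖ (1 : Matrix w w ℂ)) *ᵥ v) (a, b) = (C *ᵥ fun x => v (x, b)) a := by
    intro a b
    simp [Matrix.mulVec, dotProduct, sum_prod_type, one_apply]
  simp only [nsq, sum_prod_type, h]
  rw [sum_comm, sum_comm (s := (Finset.univ : Finset n))]
  exact sum_le_sum fun b _ => hC _

theorem IsContr.one_kron {C : Matrix m n ℂ} (hC : IsContr C) (w : Type) [Fintype w]
    [DecidableEq w] : IsContr ((1 : Matrix w w ℂ) ⊗ₖ C) := fun v => by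
  have h : ∀ a b, (((1 : Matrix w w ℂ) ⊗ₖ C) *ᵥ v) (b, a) = (C *ᵥ fun x => v (b, x)) a := by
    intro a b
    simp [Matrix.mulVec, dotProduct, sum_prod_type, one_apply]
  simp only [nsq, sum_prod_type, h]
  exact sum_le_sum fun b _ => hC _

theorem IsContr.kron {q : Type} [Fintype q] [DecidableEq m] [DecidableEq q] {C : Matrix m n ℂ}
    {D : Matrix p q ℂ} (hC : IsContr C) (hD : IsContr D) : IsContr (C ⊗ₖ D) := by
  have : C ⊗ₖ D = ((1 : Matrix m m ℂ) ⊗ₖ D) * (C ⊗ₖ (1 : Matrix q q ℂ)) := by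
    rw [← mul_kronecker_mul]; simp
  rw [this]
  exact (hD.one_kron m).mul (hC.kron_one q)

theorem IsContr.nsq_row {C : Matrix m n ℂ} [DecidableEq m] (hC : IsContr C) (i : m) :
    nsq (C i) ≤ 1 := by
  have h := hC.conjTranspose (Pi.single i 1)
  have h1 : Cᴴ *ᵥ Pi.single i 1 = star (C i) := by
    ext j; simp [Matrix.mulVec_single]
  have h2 : nsq (Pi.single i (1 : ℂ) : m → ℂ) = 1 := by
    simp [nsq, Pi.single_apply, apply_ite]
  rwa [h1, nsq_star, h2] at h

end Contractions

section TraceNorm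

variable {X : QSys}

theorem exists_unitary_diag (M : Op X) :
    ∃ (U : Op X) (d : X → ℝ), Uᴴ * U = 1 ∧ U * Uᴴ = 1 ∧ (∀ i, 0 ≤ d i) ∧
      (M * U)ᴴ * (M * U) = Matrix.diagonal (fun i => ((d i : ℝ) : ℂ)) ∧
      traceNorm M = ∑ i, √(d i) := by
  have hM := Matrix.isHermitian_conjTranspose_mul_self M
  refine ⟨hM.eigenvectorUnitary, hM.eigenvalues, ?_, ?_, ?_, ?_, rfl⟩
  · exact Unitary.coe_star_mul_self hM.eigenvectorUnitary
  · exact Unitary.coe_mul_star_self hM.eigenvectorUnitary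
  · exact (Matrix.posSemidef_conjTranspose_mul_self M).eigenvalues_nonneg
  · have h := hM.conjStarAlgAut_star_eigenvectorUnitary
    rw [conjTranspose_mul]
    simp only [Unitary.conjStarAlgAut_apply] at h
    rw [show ((hM.eigenvectorUnitary : Op X)ᴴ * Mᴴ) * (M * (hM.eigenvectorUnitary : Op X))
      = (hM.eigenvectorUnitary : Op X)ᴴ * (Mᴴ * M) * (hM.eigenvectorUnitary : Op X) by
        simp only [Matrix.mul_assoc]]
    simpa [Matrix.star_eq_conjTranspose, Function.comp_def] using h

theorem norm_trace_mul_le {O : Op X} (hO : IsContr O) (M : Op X) :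
    ‖(O * M).trace‖ ≤ traceNorm M := by
  obtain ⟨U, d, hU, hU', hd, hMU, htn⟩ := exists_unitary_diag M
  have h1 : (O * M).trace = ((Uᴴ * O) * (M * U)).trace := by
    rw [Matrix.mul_assoc, Matrix.trace_mul_comm Uᴴ, Matrix.mul_assoc, Matrix.mul_assoc, hU',
      Matrix.mul_one]
  have hcol : ∀ i, nsq (fun k => (M * U) k i) = d i := by
    intro i
    have := congrFun (congrFun hMU i) i
    rw [Matrix.diagonal_apply_eq, mul_apply] at this
    have h2 : ((nsq (fun k => (M * U) k i) : ℝ) : ℂ) = (d i : ℂ) := by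
      rw [nsq_eq_dotProduct, ← this]
      simp [dotProduct]
    exact_mod_cast h2
  have hc : IsContr (Uᴴ * O) := by
    refine IsContr.mul (IsContr.of_isometry ?_) hO
    rw [Matrix.conjTranspose_conjTranspose, hU']
  rw [h1, htn, Matrix.trace]
  refine (norm_sum_le _ _).trans (sum_le_sum fun i _ => ?_)
  rw [Matrix.diag_apply, mul_apply]
  refine (norm_dotProduct_le ((Uᴴ * O) i) (fun k => (M * U) k i)).trans ?_
  rw [hcol]
  calc _ ≤ 1 * √(d i) := by
        gcongr
        exact Real.sqrt_le_one.2 (hc.nsq_row i)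
    _ = _ := one_mul _

theorem exists_trace_mul_eq (M : Op X) :
    ∃ O : Op X, IsContr O ∧ (O * M).trace = ((traceNorm M : ℝ) : ℂ) := by
  obtain ⟨U, d, hU, hU', hd, hMU, htn⟩ := exists_unitary_diag M
  set Δ : Op X := Matrix.diagonal fun i => (((√(d i))⁻¹ : ℝ) : ℂ) with hΔ
  have hΔh : Δᴴ = Δ := by
    rw [hΔ, Matrix.diagonal_conjTranspose]; congr 1; ext i
    simp
  refine ⟨U * (Δ * (M * U)ᴴ), ?_, ?_⟩
  · refine (IsContr.of_isometry hU).mul ?_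
    have : Δ * (M * U)ᴴ = ((M * U) * Δ)ᴴ := by rw [conjTranspose_mul _ Δ, hΔh]
    rw [this]
    refine IsContr.conjTranspose fun v => ?_
    have h : ((nsq (((M * U) * Δ) *ᵥ v) : ℝ) : ℂ)
        = ((∑ i, ((√(d i))⁻¹ * d i * (√(d i))⁻¹) * ‖v i‖ ^ 2 : ℝ) : ℂ) := by
      rw [nsq_mulVec, conjTranspose_mul, hΔh,
        show Δ * (M * U)ᴴ * (M * U * Δ) = Δ * ((M * U)ᴴ * (M * U)) * Δ by
          simp only [Matrix.mul_assoc], hMU, hΔ, Matrix.diagonal_mul_diagonal,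
        Matrix.diagonal_mul_diagonal]
      simp only [dotProduct, Matrix.mulVec_diagonal, Pi.star_apply]
      push_cast
      refine sum_congr rfl fun i _ => ?_
      rw [← Complex.conj_mul']
      simp only [RCLike.star_def]
      ring
    rw [Complex.ofReal_inj] at h
    rw [h]
    refine sum_le_sum fun i _ => ?_
    refine mul_le_of_le_one_left (by positivity) ?_
    rcases (hd i).eq_or_lt with h0 | h0
    · simp [← h0]
    · have : √(d i) ≠ 0 := (Real.sqrt_pos.2 h0).ne'
      have h2 : d i = √(d i) * √(d i) := (Real.mul_self_sqrt h0.le).symm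
      apply le_of_eq
      field_simp
      nlinarith
  · rw [Matrix.mul_assoc, Matrix.trace_mul_comm, Matrix.mul_assoc, Matrix.mul_assoc, hMU, hΔ,
      Matrix.diagonal_mul_diagonal, Matrix.trace_diagonal, htn]
    push_cast
    refine sum_congr rfl fun i _ => ?_
    rcases (hd i).eq_or_lt with h0 | h0
    · simp [← h0]
    · rw [← Complex.ofReal_inv, ← Complex.ofReal_mul, Complex.ofReal_inj, inv_mul_eq_div,
        Real.div_sqrt]

theorem traceNorm_le_iff {M : Op X} {c : ℝ} :
    traceNorm M ≤ c ↔ ∀ O : Op X, IsContr O → ‖(O * M).trace‖ ≤ c := by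
  refine ⟨fun h O hO => (norm_trace_mul_le hO M).trans h, fun h => ?_⟩
  obtain ⟨O, hO, e⟩ := exists_trace_mul_eq M
  have := h O hO
  rw [e, Complex.norm_real] at this
  exact (le_abs_self _).trans this

theorem traceNorm_nonneg (M : Op X) : 0 ≤ traceNorm M :=
  Finset.sum_nonneg fun _ _ => Real.sqrt_nonneg _

theorem norm_trace_le (M : Op X) : ‖M.trace‖ ≤ traceNorm M := by
  simpa using norm_trace_mul_le IsContr.one M

theorem traceNorm_add_le (M M' : Op X) : traceNorm (M + M') ≤ traceNorm M + traceNorm M' :=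
  traceNorm_le_iff.2 fun O hO => by
    rw [Matrix.mul_add, Matrix.trace_add]
    exact (norm_add_le _ _).trans (add_le_add (norm_trace_mul_le hO _) (norm_trace_mul_le hO _))

theorem traceNorm_smul_le (c : ℂ) (M : Op X) : traceNorm (c • M) ≤ ‖c‖ * traceNorm M :=
  traceNorm_le_iff.2 fun O hO => by
    rw [Matrix.mul_smul, trace_smul, norm_smul]
    exact mul_le_mul_of_nonneg_left (norm_trace_mul_le hO _) (norm_nonneg _)

theorem traceNorm_zero : traceNorm (0 : Op X) = 0 :=
  le_antisymm (traceNorm_le_iff.2 fun O _ => by simp) (traceNorm_nonneg _)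

theorem traceNorm_neg_le (M : Op X) : traceNorm (-M) ≤ traceNorm M := by
  simpa using traceNorm_smul_le (-1) M

theorem traceNorm_sub_comm (M M' : Op X) : traceNorm (M - M') ≤ traceNorm (M' - M) := by
  rw [← neg_sub]; exact traceNorm_neg_le _

theorem traceNorm_sub_le (M₁ M₂ M₃ : Op X) :
    traceNorm (M₁ - M₃) ≤ traceNorm (M₁ - M₂) + traceNorm (M₂ - M₃) := by
  rw [← sub_add_sub_cancel M₁ M₂ M₃]; exact traceNorm_add_le _ _

theorem traceNorm_sum_le {κ : Type*} (s : Finset κ) (M : κ → Op X) :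
    traceNorm (∑ i ∈ s, M i) ≤ ∑ i ∈ s, traceNorm (M i) := by
  classical
  induction s using Finset.induction_on with
  | empty => simp [traceNorm_zero]
  | insert a s ha ih =>
    rw [Finset.sum_insert ha, Finset.sum_insert ha]
    exact (traceNorm_add_le _ _).trans (by gcongr)

theorem traceNorm_conj_le {Y : QSys} {C : Matrix Y X ℂ} (hC : IsContr C)
    (M : Op X) : traceNorm (conj C M) ≤ traceNorm M :=
  traceNorm_le_iff.2 fun O hO => by
    have : (O * conj C M).trace = ((Cᴴ * O * C) * M).trace := by
      change (O * (C * M * Cᴴ)).trace = _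
      rw [← Matrix.mul_assoc, Matrix.trace_mul_comm]
      simp only [Matrix.mul_assoc]
    rw [this]
    exact norm_trace_mul_le ((hC.conjTranspose.mul hO).mul hC) M

theorem traceNorm_ptrace_le {W : QSys} (M : Op (X ⊠ W)) : traceNorm (ptrace M) ≤ traceNorm M :=
  traceNorm_le_iff.2 fun O hO => by
    have : (O * ptrace M).trace = ((O ⊗ₖ (1 : Op W) : Op (X ⊠ W)) * M).trace := by
      simp only [Matrix.trace, Matrix.diag_apply, mul_apply, ptrace, LinearMap.coe_mk,
        AddHom.coe_mk, of_apply, sum_prod_type, kroneckerMap_apply,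
        one_apply, mul_sum]
      refine sum_congr rfl fun x _ => ?_
      rw [sum_comm]
      simp
    rw [this]
    exact norm_trace_mul_le (hO.kron_one _) M

/-- The rank-one operator `|v⟩⟨v|`. -/
def rankOne (v : X → ℂ) : Op X := Matrix.vecMulVec v (star v)

theorem trace_mul_rankOne (O : Op X) (v : X → ℂ) :
    (O * rankOne v).trace = star v ⬝ᵥ (O *ᵥ v) := by
  rw [rankOne, Matrix.mul_vecMulVec, Matrix.trace_vecMulVec, dotProduct_comm]

theorem trace_rankOne (v : X → ℂ) : (rankOne v).trace = ((nsq v : ℝ) : ℂ) := by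
  have := trace_mul_rankOne 1 v
  simpa [nsq_eq_dotProduct] using this

theorem traceNorm_rankOne_sub_le (u v : X → ℂ) :
    traceNorm (rankOne u - rankOne v) ≤ (√(nsq u) + √(nsq v)) * √(nsq (u - v)) :=
  traceNorm_le_iff.2 fun O hO => by
    rw [Matrix.mul_sub, Matrix.trace_sub, trace_mul_rankOne, trace_mul_rankOne]
    have : star u ⬝ᵥ (O *ᵥ u) - star v ⬝ᵥ (O *ᵥ v)
        = star u ⬝ᵥ (O *ᵥ (u - v)) + star (u - v) ⬝ᵥ (O *ᵥ v) := by
      rw [Matrix.mulVec_sub, dotProduct_sub, star_sub, sub_dotProduct]; ring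
    rw [this]
    calc _ ≤ √(nsq u) * √(nsq (u - v)) + √(nsq (u - v)) * √(nsq v) := by
          refine (norm_add_le _ _).trans (add_le_add ?_ ?_)
          · refine (norm_dotProduct_le _ _).trans ?_
            rw [nsq_star]
            exact mul_le_mul_of_nonneg_left (Real.sqrt_le_sqrt (hO _)) (Real.sqrt_nonneg _)
          · refine (norm_dotProduct_le _ _).trans ?_
            rw [nsq_star]
            exact mul_le_mul_of_nonneg_left (Real.sqrt_le_sqrt (hO _)) (Real.sqrt_nonneg _)
      _ = _ := by ring

theorem traceNorm_rankOne_le (v : X → ℂ) : traceNorm (rankOne v) ≤ nsq v := by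
  have h := traceNorm_rankOne_sub_le v 0
  have h0 : rankOne (0 : X → ℂ) = 0 := by simp [rankOne]
  have h1 : nsq (0 : X → ℂ) = 0 := by simp [nsq]
  simpa [h0, h1, Real.mul_self_sqrt (nsq_nonneg v)] using h

/-- The distance of two vectors up to a phase is controlled by the trace distance. -/
theorem nsq_add_nsq_sub_le (u v : X → ℂ) :
    nsq u + nsq v - 2 * ‖star u ⬝ᵥ v‖ ≤ 2 * traceNorm (rankOne u - rankOne v) := by
  wlog huv : nsq v ≤ nsq u generalizing u v
  · have := this v u (le_of_not_ge huv)
    have h2 : ‖star u ⬝ᵥ v‖ = ‖star v ⬝ᵥ u‖ := by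
      rw [← norm_star (star v ⬝ᵥ u), Matrix.star_dotProduct]
    have h3 := traceNorm_sub_comm (rankOne v) (rankOne u)
    rw [h2]; linarith
  have hu0 := nsq_nonneg u
  have hv0 := nsq_nonneg v
  set c := ‖star u ⬝ᵥ v‖ with hc
  have hc0 : 0 ≤ c := norm_nonneg _
  rcases hu0.eq_or_lt with h0 | hpos
  · have : nsq v = 0 := le_antisymm (by linarith) hv0
    have := traceNorm_nonneg (rankOne u - rankOne v)
    linarith
  have hcu : c ≤ nsq u := by
    refine (norm_dotProduct_le _ _).trans ?_
    rw [nsq_star]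
    calc _ ≤ √(nsq u) * √(nsq u) := by gcongr
      _ = _ := Real.mul_self_sqrt hu0
  -- the projection on `u`
  have hP : IsContr ((((nsq u)⁻¹ : ℝ) : ℂ) • rankOne u) := fun w => by
    have e : (((((nsq u)⁻¹ : ℝ) : ℂ) • rankOne u) *ᵥ w)
        = ((((nsq u)⁻¹ : ℝ) : ℂ) * (star u ⬝ᵥ w)) • u := by
      rw [rankOne, Matrix.smul_mulVec, Matrix.vecMulVec_mulVec]
      ext i; simp only [Pi.smul_apply, smul_eq_mul, MulOpposite.smul_eq_mul_unop,
        MulOpposite.unop_op]; ring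
    have e2 : ∀ (a : ℂ), nsq (a • u) = ‖a‖ ^ 2 * nsq u := by
      intro a; simp [nsq, mul_sum, mul_pow]
    rw [e, e2]
    have h3 : ‖star u ⬝ᵥ w‖ ^ 2 ≤ nsq u * nsq w := by
      have := norm_dotProduct_le (star u) w
      rw [nsq_star] at this
      calc _ ≤ (√(nsq u) * √(nsq w)) ^ 2 := by gcongr
        _ = _ := by rw [mul_pow, Real.sq_sqrt hu0, Real.sq_sqrt (nsq_nonneg w)]
    rw [norm_mul, Complex.norm_real, Real.norm_of_nonneg (by positivity), mul_pow]
    calc _ ≤ (nsq u)⁻¹ ^ 2 * (nsq u * nsq w) * nsq u := by gcongr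
      _ = nsq w := by field_simp
  have hq := norm_trace_mul_le hP (rankOne u - rankOne v)
  have key : (((((nsq u)⁻¹ : ℝ) : ℂ) • rankOne u) * (rankOne u - rankOne v)).trace
      = ((nsq u - (nsq u)⁻¹ * c ^ 2 : ℝ) : ℂ) := by
    rw [Matrix.mul_sub, Matrix.trace_sub, trace_mul_rankOne, trace_mul_rankOne,
      Matrix.smul_mulVec, Matrix.smul_mulVec, rankOne, Matrix.vecMulVec_mulVec,
      Matrix.vecMulVec_mulVec, ← nsq_eq_dotProduct]
    have h4 : star v ⬝ᵥ u = star (star u ⬝ᵥ v) := by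
      rw [Matrix.star_dotProduct]
    have h5 : star (star u ⬝ᵥ v) * (star u ⬝ᵥ v) = ((c ^ 2 : ℝ) : ℂ) := by
      rw [hc]; push_cast; exact Complex.conj_mul' _
    have hne : ((nsq u : ℝ) : ℂ) ≠ 0 := by exact_mod_cast hpos.ne'
    simp only [dotProduct_smul, MulOpposite.smul_eq_mul_unop, MulOpposite.unop_op,
      smul_eq_mul, ← nsq_eq_dotProduct]
    push_cast at h5 ⊢
    rw [h4, h5]
    field_simp
  rw [key, Complex.norm_real] at hq
  have h6 : nsq u - (nsq u)⁻¹ * c ^ 2 ≤ traceNorm (rankOne u - rankOne v) :=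
    (le_abs_self _).trans hq
  have h7 : nsq u - c ≤ nsq u - (nsq u)⁻¹ * c ^ 2 := by
    have : (nsq u)⁻¹ * c ^ 2 ≤ c := by
      rw [inv_mul_le_iff₀ hpos]; nlinarith
    linarith
  linarith

end TraceNorm

/-! ### Calculus of superoperators -/

section Calculus

variable {X Y Z W X' Y' Z' W' : QSys}

theorem superOp_ext {Φ Ψ : SuperOp X Y}
    (h : ∀ x x', Φ (Matrix.single x x' 1) = Ψ (Matrix.single x x' 1)) : Φ = Ψ := by
  refine Matrix.ext_linearMap (R := ℂ) fun x x' => LinearMap.ext_ring ?_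
  simpa using h x x'

theorem superOp_ext_kron {Φ Ψ : SuperOp (X ⊠ Y) Z}
    (h : ∀ (A : Op X) (B : Op Y), Φ (A ⊗ₖ B) = Ψ (A ⊗ₖ B)) : Φ = Ψ := by
  refine superOp_ext fun p q => ?_
  have : (Matrix.single p q (1 : ℂ) : Op (X ⊠ Y))
      = Matrix.single p.1 q.1 1 ⊗ₖ Matrix.single p.2 q.2 1 := by
    rw [single_kronecker_single]; simp
  rw [this]; exact h _ _

/-- `id ⊗ Ψ` with an idle system on the left. -/
def extL (Ψ : SuperOp X Y) (W : QSys) : SuperOp (W ⊠ X) (W ⊠ Y) :=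
  relabel (X := Y ⊠ W) (Y := W ⊠ Y) (prodComm _ _) ∘ₗ ext Ψ W ∘ₗ
    relabel (X := W ⊠ X) (Y := X ⊠ W) (prodComm _ _)

theorem ext_apply (Φ : SuperOp X Y) (M : Op (X ⊠ W)) (p q : (Y ⊠ W)) :
    ext Φ W M p q = Φ (Matrix.of fun x x' => M (x, p.2) (x', q.2)) p.1 q.1 := rfl

theorem extL_apply (Ψ : SuperOp X Y) (M : Op (W ⊠ X)) (p q : (W ⊠ Y)) :
    extL Ψ W M p q = Ψ (Matrix.of fun x x' => M (p.1, x) (q.1, x')) p.2 q.2 := rfl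

theorem ext_kron (Φ : SuperOp X Y) (A : Op X) (B : Op W) : ext Φ W (A ⊗ₖ B) = Φ A ⊗ₖ B := by
  ext p q
  rw [ext_apply, kroneckerMap_apply]
  have : (Matrix.of fun x x' => (A ⊗ₖ B) (x, p.2) (x', q.2)) = B p.2 q.2 • A := by
    ext; simp [mul_comm]
  rw [this, map_smul, Matrix.smul_apply, smul_eq_mul, mul_comm]

theorem extL_kron (Ψ : SuperOp X Y) (A : Op W) (B : Op X) : extL Ψ W (A ⊗ₖ B) = A ⊗ₖ Ψ B := by
  ext p q
  rw [extL_apply, kroneckerMap_apply]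
  have : (Matrix.of fun x x' => (A ⊗ₖ B) (p.1, x) (q.1, x')) = A p.1 q.1 • B := by
    ext; simp
  rw [this, map_smul, Matrix.smul_apply, smul_eq_mul]

theorem tensor_eq (Φ : SuperOp X Y) (Ψ : SuperOp X' Y') :
    tensor Φ Ψ = extL Ψ Y ∘ₗ ext Φ X' := rfl

theorem ext_comp_extL (Φ : SuperOp X Y) (Ψ : SuperOp X' Y') :
    ext Φ Y' ∘ₗ extL Ψ X = extL Ψ Y ∘ₗ ext Φ X' :=
  superOp_ext_kron fun A B => by
    simp only [comp_apply, ext_kron, extL_kron]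

theorem tensor_kron (Φ : SuperOp X Y) (Ψ : SuperOp X' Y') (A : Op X) (B : Op X') :
    tensor Φ Ψ (A ⊗ₖ B) = Φ A ⊗ₖ Ψ B := by
  rw [tensor_eq, comp_apply, ext_kron, extL_kron]

theorem ext_comp (Φ : SuperOp X Y) (Ψ : SuperOp Y Z) : ext (Ψ ∘ₗ Φ) W = ext Ψ W ∘ₗ ext Φ W := rfl

theorem extL_comp (Φ : SuperOp X Y) (Ψ : SuperOp Y Z) :
    extL (Ψ ∘ₗ Φ) W = extL Ψ W ∘ₗ extL Φ W := rfl

theorem tensor_comp (Φ : SuperOp X Y) (Ψ : SuperOp Y Z) (Φ' : SuperOp X' Y')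
    (Ψ' : SuperOp Y' Z') :
    tensor (Ψ ∘ₗ Φ) (Ψ' ∘ₗ Φ') = tensor Ψ Ψ' ∘ₗ tensor Φ Φ' :=
  superOp_ext_kron fun A B => by simp only [comp_apply, tensor_kron]

theorem ext_id : ext (LinearMap.id : SuperOp X X) W = LinearMap.id := rfl

theorem extL_id : extL (LinearMap.id : SuperOp X X) W = LinearMap.id := rfl

theorem tensor_id_right (Φ : SuperOp X Y) : tensor Φ (LinearMap.id : SuperOp W W) = ext Φ W := rfl

theorem tensor_id_left (Φ : SuperOp X Y) : tensor (LinearMap.id : SuperOp W W) Φ = extL Φ W := rfl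

theorem relabel_apply (e : X ≃ Y) (ρ : Op X) (y y' : Y) :
    relabel e ρ y y' = ρ (e.symm y) (e.symm y') := rfl

theorem relabel_symm_relabel (e : X ≃ Y) (ρ : Op X) :
    relabel e.symm (relabel e ρ) = ρ := by
  ext; simp [relabel_apply]

theorem relabel_relabel_symm (e : X ≃ Y) (ρ : Op Y) :
    relabel e (relabel e.symm ρ) = ρ := by
  ext; simp [relabel_apply]

theorem ptrace_kron (A : Op X) (B : Op Y) : ptrace (A ⊗ₖ B) = B.trace • A := by
  ext p q
  simp [ptrace, Matrix.trace, ← mul_sum, mul_comm]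

theorem ptraceLeft_kron (A : Op X) (B : Op Y) : ptraceLeft (A ⊗ₖ B) = A.trace • B := by
  ext p q
  simp [ptraceLeft, Matrix.trace, sum_mul]

theorem trace_kron (A : Op X) (B : Op Y) :
    (A ⊗ₖ B : Op (X ⊠ Y)).trace = A.trace * B.trace := Matrix.trace_kronecker A B

theorem trace_ptrace (M : Op (X ⊠ Y)) : (ptrace M).trace = M.trace := by
  simp [ptrace, Matrix.trace, sum_prod_type]

theorem trace_ptraceLeft (M : Op (X ⊠ Y)) : (ptraceLeft M).trace = M.trace := by
  simp [ptraceLeft, Matrix.trace, Fintype.sum_prod_type_right]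

theorem trace_relabel (e : X ≃ Y) (ρ : Op X) : (relabel e ρ).trace = ρ.trace := by
  simp only [Matrix.trace, Matrix.diag_apply, relabel_apply]
  exact e.symm.sum_comp (fun x => ρ x x)

/-- Trace preserving superoperators. -/
def TracePreserving (Φ : SuperOp X Y) : Prop := ∀ M, (Φ M).trace = M.trace

theorem ptrace_ext (Φ : SuperOp X Y) (M : Op (X ⊠ W)) : ptrace (ext Φ W M) = Φ (ptrace M) := by
  have : ptrace ∘ₗ ext Φ W = Φ ∘ₗ ptrace := superOp_ext_kron fun A B => by
    simp only [comp_apply, ext_kron, ptrace_kron, map_smul]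
  exact LinearMap.congr_fun this M

theorem ptraceLeft_extL (Φ : SuperOp X Y) (M : Op (W ⊠ X)) :
    ptraceLeft (extL Φ W M) = Φ (ptraceLeft M) := by
  have : ptraceLeft ∘ₗ extL Φ W = Φ ∘ₗ ptraceLeft := superOp_ext_kron fun A B => by
    simp only [comp_apply, extL_kron, ptraceLeft_kron, map_smul]
  exact LinearMap.congr_fun this M

theorem ptraceLeft_ext {Φ : SuperOp X Y} (h : TracePreserving Φ) (M : Op (X ⊠ W)) :
    ptraceLeft (ext Φ W M) = ptraceLeft M := by
  have : ptraceLeft ∘ₗ ext Φ W = ptraceLeft := superOp_ext_kron fun A B => by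
    simp only [comp_apply, ext_kron, ptraceLeft_kron, h A]
  exact LinearMap.congr_fun this M

theorem ptrace_extL {Φ : SuperOp X Y} (h : TracePreserving Φ) (M : Op (W ⊠ X)) :
    ptrace (extL Φ W M) = ptrace M := by
  have : ptrace ∘ₗ extL Φ W = ptrace := superOp_ext_kron fun A B => by
    simp only [comp_apply, extL_kron, ptrace_kron, h B]
  exact LinearMap.congr_fun this M

theorem trace_ext (Φ : SuperOp X Y) (M : Op (X ⊠ W)) :
    (ext Φ W M).trace = (Φ (ptrace M)).trace := by
  rw [← trace_ptrace, ptrace_ext]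

theorem conj_apply (V : Matrix Y X ℂ) (ρ : Op X) : conj V ρ = V * ρ * Vᴴ := rfl

theorem conj_comp (V : Matrix Y X ℂ) (U : Matrix Z Y ℂ) :
    conj U ∘ₗ conj V = conj (U * V) := by
  ext1 ρ
  simp only [comp_apply, conj_apply, conjTranspose_mul, Matrix.mul_assoc]

theorem conj_one : conj (1 : Op X) = LinearMap.id := by
  ext1 ρ; simp [conj_apply]

theorem ext_conj (V : Matrix Y X ℂ) :
    ext (conj V) W = conj (X := X ⊠ W) (Y := Y ⊠ W) (V ⊗ₖ (1 : Op W)) :=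
  superOp_ext_kron fun A B => by
    rw [ext_kron, conj_apply, conj_apply, conjTranspose_kronecker,
      ← mul_kronecker_mul, ← mul_kronecker_mul]; simp

theorem extL_conj (V : Matrix Y X ℂ) :
    extL (conj V) W = conj (X := W ⊠ X) (Y := W ⊠ Y) ((1 : Op W) ⊗ₖ V) :=
  superOp_ext_kron fun A B => by
    rw [extL_kron, conj_apply, conj_apply, conjTranspose_kronecker,
      ← mul_kronecker_mul, ← mul_kronecker_mul]; simp

theorem tensor_conj (V : Matrix Y X ℂ) (U : Matrix Y' X' ℂ) :
    tensor (conj V) (conj U) = conj (X := X ⊠ X') (Y := Y ⊠ Y') (V ⊗ₖ U) :=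
  superOp_ext_kron fun A B => by
    rw [tensor_kron, conj_apply, conj_apply, conj_apply, conjTranspose_kronecker,
      ← mul_kronecker_mul, ← mul_kronecker_mul]

/-- The matrix of a map of preferred bases. -/
def basisMap (f : X → Y) : Matrix Y X ℂ :=
  Matrix.of fun y x => if f x = y then 1 else 0

theorem basisMap_apply (f : X → Y) (y : Y) (x : X) :
    basisMap f y x = if f x = y then 1 else 0 := rfl

theorem basisMap_isometry {f : X → Y} (hf : Function.Injective f) :
    (basisMap f)ᴴ * basisMap f = 1 := by
  ext x x'
  simp [basisMap, mul_apply, one_apply, hf.eq_iff, eq_comm]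

/-- `|x⟩ ↦ |f x⟩`. -/
def push (f : X → Y) : SuperOp X Y := conj (basisMap f)

theorem push_apply (f : X → Y) (ρ : Op X) (y y' : Y) :
    push f ρ y y' = ∑ x, ∑ x', if f x = y ∧ f x' = y' then ρ x x' else 0 := by
  simp only [push, conj_apply, mul_apply, basisMap_apply, conjTranspose_apply,
    sum_mul]
  rw [sum_comm]
  refine sum_congr rfl fun x _ => sum_congr rfl fun x' _ => ?_
  by_cases h1 : f x = y <;> by_cases h2 : f x' = y' <;> simp [h1, h2]

theorem isChannel_push {f : X → Y} (hf : Function.Injective f) :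
    IsChannel (push f) := isChannel_conj _ (basisMap_isometry hf)

theorem push_single (f : X → Y) (x x' : X) :
    push f (Matrix.single x x' 1) = Matrix.single (f x) (f x') 1 := by
  ext y y'
  rw [push_apply, single_apply]
  simp only [single_apply, ← ite_and]
  rw [sum_eq_single x, sum_eq_single x']
  · simp
  · intro b _ hb; simp [Ne.symm hb]
  · simp
  · intro b _ hb; exact sum_eq_zero fun c _ => by simp [Ne.symm hb]
  · simp

theorem push_comp (f : X → Y) (g : Y → Z) :
    push g ∘ₗ push f = push (X := X) (Y := Z) (g ∘ f) :=
  superOp_ext fun x x' => by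
    rw [comp_apply, push_single, push_single, push_single]; rfl

theorem push_equiv (e : X ≃ Y) : push e = relabel e :=
  superOp_ext fun x x' => by
    rw [push_single]
    ext y y'
    simp [relabel_apply, single_apply, Equiv.eq_symm_apply]

theorem push_id : push (fun x : X => x) = LinearMap.id :=
  superOp_ext fun x x' => by rw [push_single]; rfl

theorem ext_push (f : X → Y) :
    ext (push f) W = push (X := X ⊠ W) (Y := Y ⊠ W) (Prod.map f id) :=
  superOp_ext fun p q => by
    have : ∀ (A : QSys) (p q : (A ⊠ W)), (Matrix.single p q (1 : ℂ) : Op (A ⊠ W))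
        = Matrix.single p.1 q.1 1 ⊗ₖ Matrix.single p.2 q.2 1 := by
      intro A p q
      rw [single_kronecker_single]; simp
    rw [push_single, this, ext_kron, push_single, this]; rfl

theorem extL_push (f : X → Y) :
    extL (push f) W = push (X := W ⊠ X) (Y := W ⊠ Y) (Prod.map id f) :=
  superOp_ext fun p q => by
    have : ∀ (A : QSys) (p q : (W ⊠ A)), (Matrix.single p q (1 : ℂ) : Op (W ⊠ A))
        = Matrix.single p.1 q.1 1 ⊗ₖ Matrix.single p.2 q.2 1 := by
      intro A p q
      rw [single_kronecker_single]; simp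
    rw [push_single, this, extL_kron, push_single, this]; rfl

/-! ### Channels -/

theorem IsChannel.tracePreserving {Φ : SuperOp X Y} (h : IsChannel Φ) : TracePreserving Φ := by
  obtain ⟨κ, _, K, hK, hΦ⟩ := h
  intro M
  rw [hΦ, Matrix.trace_sum]
  have : ∀ i, (K i * M * (K i)ᴴ).trace = (((K i)ᴴ * K i) * M).trace := fun i => by
    rw [Matrix.trace_mul_comm, Matrix.mul_assoc]
  simp only [this]
  rw [← Matrix.trace_sum, ← Matrix.sum_mul, hK, Matrix.one_mul]

theorem IsChannel.posSemidef {Φ : SuperOp X Y} (h : IsChannel Φ) {M : Op X}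
    (hM : M.PosSemidef) : (Φ M).PosSemidef := by
  obtain ⟨κ, _, K, hK, hΦ⟩ := h
  rw [hΦ]
  exact Matrix.posSemidef_sum _ fun i _ => hM.mul_mul_conjTranspose_same _

theorem IsChannel.isState {Φ : SuperOp X Y} (h : IsChannel Φ) {M : Op X} (hM : IsState M) :
    IsState (Φ M) := ⟨h.posSemidef hM.1, by rw [h.tracePreserving, hM.2]⟩

theorem isChannel_id : IsChannel (LinearMap.id : SuperOp X X) := by
  rw [← conj_one]; exact isChannel_conj _ (by simp)

theorem IsChannel.extL {Φ : SuperOp X Y} (h : IsChannel Φ) (W : QSys) : IsChannel (extL Φ W) :=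
  (isChannel_relabel _).comp ((h.ext W).comp (isChannel_relabel _))

theorem isChannel_ptrace : IsChannel (ptrace : SuperOp (X ⊠ W) X) := by
  refine ⟨W, inferInstance, fun w => Matrix.of fun x p => if p = (x, w) then 1 else 0,
    ?_, fun ρ => ?_⟩
  · ext p q
    simp only [Matrix.sum_apply, mul_apply, conjTranspose_apply, of_apply,
      one_apply]
    rw [sum_eq_single p.2, sum_eq_single p.1]
    · by_cases h : p = q <;> simp [h, eq_comm]
    · intro b _ hb
      rw [if_neg (fun h => hb (congrArg Prod.fst h).symm)]; simp
    · simp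
    · intro b _ hb
      refine sum_eq_zero fun c _ => ?_
      rw [if_neg (fun h => hb (congrArg Prod.snd h).symm)]; simp
    · simp
  · ext x x'
    simp only [ptrace, LinearMap.coe_mk, AddHom.coe_mk, of_apply, Matrix.sum_apply,
      mul_apply, conjTranspose_apply]
    simp [ite_mul]

theorem isChannel_ptraceLeft : IsChannel (ptraceLeft : SuperOp (W ⊠ X) X) := by
  have : (ptraceLeft : SuperOp (W ⊠ X) X) = ptrace ∘ₗ
    relabel (X := W ⊠ X) (Y := X ⊠ W) (prodComm _ _) := rfl
  rw [this]; exact isChannel_ptrace.comp (isChannel_relabel _)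

open scoped MatrixOrder in
theorem exists_sqrt {ρ : Op X} (h : ρ.PosSemidef) : ∃ S : Op X, ρ = S * Sᴴ := by
  obtain ⟨B, hB⟩ := CStarAlgebra.nonneg_iff_eq_star_mul_self.mp h.nonneg
  exact ⟨Bᴴ, by rw [hB, Matrix.conjTranspose_conjTranspose, Matrix.star_eq_conjTranspose]⟩

theorem isChannel_append {σ : Op W} (h : IsState σ) : IsChannel (append σ : SuperOp X (X ⊠ W)) := by
  obtain ⟨S, hS⟩ := exists_sqrt h.1
  refine ⟨W, inferInstance,
    fun w => Matrix.of fun p x => if p.1 = x then S p.2 w else 0, ?_, fun ρ => ?_⟩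
  · ext x x'
    have ht : ∑ w, ∑ v, star (S v w) * S v w = 1 := by
      have h2 := h.2
      rw [hS, Matrix.trace] at h2
      simp only [Matrix.diag_apply, mul_apply, conjTranspose_apply] at h2
      rw [← h2, sum_comm]
      simp only [mul_comm]
    simp only [Matrix.sum_apply, mul_apply, conjTranspose_apply, of_apply,
      one_apply, sum_prod_type]
    by_cases hx : x = x'
    · subst hx
      rw [if_pos rfl, ← ht]
      refine sum_congr rfl fun w _ => ?_
      rw [sum_eq_single x]
      · simp
      · intro b _ hb; simp [hb]
      · simp
    · rw [if_neg hx]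
      refine sum_eq_zero fun w _ => sum_eq_zero fun a _ =>
        sum_eq_zero fun b _ => ?_
      by_cases h1 : a = x
      · have : a ≠ x' := fun h => hx (h1.symm.trans h)
        simp [this]
      · simp [h1]
  · ext p q
    have : (append σ ρ : Op (X ⊠ W)) p q = ρ p.1 q.1 * ∑ w, S p.2 w * star (S q.2 w) := by
      change ρ p.1 q.1 * σ p.2 q.2 = _
      rw [hS, mul_apply]
      rfl
    rw [this, mul_sum]
    simp only [Matrix.sum_apply, mul_apply, conjTranspose_apply, of_apply]
    refine sum_congr rfl fun w _ => ?_
    rw [sum_eq_single q.1, sum_eq_single p.1]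
    · simp; ring
    · intro b _ hb; simp [hb.symm]
    · simp
    · intro b _ hb; simp [hb.symm]
    · simp

theorem IsChannel.average {κ : Type} [Fintype κ] [Nonempty κ] {Φ : κ → SuperOp X Y}
    (h : ∀ i, IsChannel (Φ i)) : IsChannel ((Fintype.card κ : ℂ)⁻¹ • ∑ i, Φ i) := by
  choose τ hτ K hK hΦ using h
  have hc : (Fintype.card κ : ℂ) ≠ 0 := by exact_mod_cast Fintype.card_ne_zero
  have hs : ((√(Fintype.card κ : ℝ) : ℝ) : ℂ)⁻¹ * ((√(Fintype.card κ : ℝ) : ℝ) : ℂ)⁻¹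
      = (Fintype.card κ : ℂ)⁻¹ := by
    rw [← mul_inv, ← Complex.ofReal_mul, Real.mul_self_sqrt (by positivity)]; simp
  refine ⟨Σ i, τ i, inferInstance,
    fun p => ((√(Fintype.card κ : ℝ) : ℝ) : ℂ)⁻¹ • K p.1 p.2, ?_, fun ρ => ?_⟩
  · simp only [Matrix.conjTranspose_smul, Matrix.smul_mul, Matrix.mul_smul, smul_smul,
      Fintype.sum_sigma]
    have : star (((√(Fintype.card κ : ℝ) : ℝ) : ℂ)⁻¹) = ((√(Fintype.card κ : ℝ) : ℝ) : ℂ)⁻¹ := by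
      simp
    rw [this, hs]
    simp only [← Finset.smul_sum, hK]
    rw [Finset.sum_const, Finset.card_univ, ← Nat.cast_smul_eq_nsmul ℂ, smul_smul,
      inv_mul_cancel₀ hc, one_smul]
  · have : star (((√(Fintype.card κ : ℝ) : ℝ) : ℂ)⁻¹) = ((√(Fintype.card κ : ℝ) : ℝ) : ℂ)⁻¹ := by
      simp
    simp only [Matrix.conjTranspose_smul, Matrix.smul_mul, Matrix.mul_smul, smul_smul,
      Fintype.sum_sigma, this, hs, ← Finset.smul_sum, LinearMap.smul_apply, LinearMap.sum_apply,
      hΦ]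

theorem exists_dilation {Φ : SuperOp X Y} (h : IsChannel Φ) : Nonempty (Dilation Unit Φ) := by
  obtain ⟨κ, _, K, hK, hΦ⟩ := h
  classical
  by_cases hκ : Nonempty κ
  swap
  · rw [not_nonempty_iff] at hκ
    rw [Finset.univ_eq_empty, Finset.sum_empty] at hK
    have := congrFun (congrFun hK (Classical.arbitrary _)) (Classical.arbitrary _)
    simp at this
  let E : QSys := ⟨κ⟩
  refine ⟨⟨E, fun _ => Matrix.of fun p x => K p.2 p.1 x, fun _ => ?_, fun _ M => ?_⟩⟩
  · rw [← hK]
    ext x x'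
    simp only [mul_apply, conjTranspose_apply, Matrix.sum_apply]
    exact Fintype.sum_prod_type_right _
  · rw [hΦ]
    ext y y'
    simp only [Matrix.sum_apply]
    rfl

theorem traceNorm_channel_le {Φ : SuperOp X Y} (h : IsChannel Φ) (M : Op X) :
    traceNorm (Φ M) ≤ traceNorm M := by
  obtain ⟨d⟩ := exists_dilation h
  rw [← d.dilates () M]
  exact (traceNorm_ptrace_le _).trans (traceNorm_conj_le (IsContr.of_isometry (d.isometry ())) M)

end Calculus

/-! ### Uniqueness of dilations -/

section Uniqueness

theorem exists_unitary_of_gram {e a : Type} [Fintype e] [DecidableEq e] [Fintype a]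
    [DecidableEq a] (A B : Matrix e a ℂ) (h : Aᴴ * A = Bᴴ * B) :
    ∃ U : Matrix e e ℂ, Uᴴ * U = 1 ∧ U * A = B := by
  let fA := Matrix.toEuclideanLin A
  let fB := Matrix.toEuclideanLin B
  have hn : ∀ x, ‖fA x‖ = ‖fB x‖ := by
    intro x
    have key : ∀ C : Matrix e a ℂ, ((‖Matrix.toEuclideanLin C x‖ ^ 2 : ℝ) : ℂ)
        = star x.ofLp ⬝ᵥ ((Cᴴ * C) *ᵥ x.ofLp) := by
      intro C
      rw [← nsq_mulVec, EuclideanSpace.norm_sq_eq]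
      rfl
    have := (key A).trans ((congrArg (fun M => star x.ofLp ⬝ᵥ (M *ᵥ x.ofLp)) h).trans (key B).symm)
    rw [Complex.ofReal_inj] at this
    exact (sq_eq_sq₀ (norm_nonneg _) (norm_nonneg _)).1 this
  obtain ⟨g, hg⟩ := fA.rangeRestrict.exists_rightInverse_of_surjective fA.range_rangeRestrict
  have hgA : ∀ s : LinearMap.range fA, fA (g s) = s := fun s =>
    congrArg Subtype.val (LinearMap.congr_fun hg s)
  let L : LinearMap.range fA →ₗᵢ[ℂ] EuclideanSpace ℂ e :=
    { toLinearMap := fB ∘ₗ g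
      norm_map' := fun s => by
        rw [comp_apply, ← hn, hgA]; rfl }
  have hL : ∀ x, L.extend (fA x) = fB x := by
    intro x
    have h1 := L.extend_apply ⟨fA x, LinearMap.mem_range_self _ x⟩
    refine h1.trans ?_
    change fB (g ⟨fA x, _⟩) = fB x
    rw [← sub_eq_zero, ← map_sub, ← norm_eq_zero, ← hn, map_sub, hgA, sub_self, norm_zero]
  let U : Matrix e e ℂ := Matrix.toEuclideanLin.symm L.extend.toLinearMap
  have hU : ∀ v, Matrix.toEuclideanLin U v = L.extend v := fun v => by
    simp only [U, LinearEquiv.apply_symm_apply]; rfl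
  refine ⟨U, ?_, ?_⟩
  · have hiso : ∀ v w : e → ℂ, star v ⬝ᵥ ((Uᴴ * U) *ᵥ w) = star v ⬝ᵥ w := by
      intro v w
      have h1 := L.extend.inner_map_map (WithLp.toLp 2 v) (WithLp.toLp 2 w)
      rw [← hU, ← hU] at h1
      simp only [EuclideanSpace.inner_eq_star_dotProduct] at h1
      have h2 : star v ⬝ᵥ ((Uᴴ * U) *ᵥ w) = (U *ᵥ w) ⬝ᵥ star (U *ᵥ v) := by
        rw [dotProduct_comm (U *ᵥ w), Matrix.star_mulVec, ← Matrix.mulVec_mulVec,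
          Matrix.dotProduct_mulVec]
      rw [h2, dotProduct_comm (star v)]
      exact h1
    ext i j
    have := hiso (Pi.single i 1) (Pi.single j 1)
    simpa [Matrix.mulVec_single, one_apply, Pi.single_apply, eq_comm] using this
  · ext i j
    have h1 := hL (WithLp.toLp 2 (Pi.single j 1))
    rw [← hU] at h1
    have h2 := congrArg (fun v : EuclideanSpace ℂ e => v i) h1
    have h3 : (U *ᵥ (A *ᵥ Pi.single j 1)) i = (B *ᵥ Pi.single j 1) i := h2
    rw [Matrix.mulVec_mulVec] at h3
    simpa [Matrix.mulVec_single] using h3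

theorem exists_contr_of_gram {e e' a : Type} [Fintype e] [DecidableEq e] [Fintype e']
    [DecidableEq e'] [Fintype a] [DecidableEq a] (A : Matrix e a ℂ) (B : Matrix e' a ℂ)
    (h : Aᴴ * A = Bᴴ * B) : ∃ C : Matrix e' e ℂ, IsContr C ∧ C * A = B := by
  obtain ⟨U, hU, hUA⟩ := exists_unitary_of_gram (Matrix.fromRows A (0 : Matrix e' a ℂ))
    (Matrix.fromRows (0 : Matrix e a ℂ) B) (by
      simp [Matrix.conjTranspose_fromRows_eq_fromCols_conjTranspose, Matrix.fromCols_mul_fromRows,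
        h])
  refine ⟨U.toBlocks₂₁, fun v => ?_, ?_⟩
  · have h1 := nsq_mulVec_of_isometry hU (Sum.elim v 0)
    have h2 : nsq (Sum.elim v (0 : e' → ℂ)) = nsq v := by simp [nsq]
    have h3 : ∀ i, (U *ᵥ Sum.elim v 0) (Sum.inr i) = (U.toBlocks₂₁ *ᵥ v) i := by
      intro i; simp [Matrix.mulVec, dotProduct, Matrix.toBlocks₂₁]
    rw [h2] at h1
    rw [← h1]
    simp only [nsq, Fintype.sum_sum_type, h3]
    exact le_add_of_nonneg_left (Finset.sum_nonneg fun _ _ => by positivity)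
  · ext i j
    have := congrFun (congrFun hUA (Sum.inr i)) j
    simpa [mul_apply, Matrix.toBlocks₂₁] using this

variable {X Y E E' : QSys}

theorem gram_of_dilates {Φ : SuperOp X Y} {V : Matrix (Y ⊠ E) X ℂ}
    (h : ∀ ρ, ptrace (conj V ρ) = Φ ρ) (p q : Y × X) :
    ((Matrix.of fun (e : E) (p : Y × X) => V (p.1, e) p.2)ᴴ *
      (Matrix.of fun (e : E) (p : Y × X) => V (p.1, e) p.2)) p q
      = Φ (Matrix.single q.2 p.2 1) q.1 p.1 := by
  rw [← h, mul_apply]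
  simp only [ptrace, LinearMap.coe_mk, AddHom.coe_mk, conj_apply, of_apply,
    conjTranspose_apply]
  refine sum_congr rfl fun e _ => ?_
  rw [mul_apply, sum_eq_single p.2]
  · rw [mul_apply, sum_eq_single q.2]
    · simp [mul_comm]
    · intro b _ hb; simp [hb.symm]
    · simp
  · intro b _ hb
    rw [mul_apply, sum_eq_zero, zero_mul]
    intro c _; simp [hb.symm]
  · simp

theorem exists_contr_of_dilates {Φ : SuperOp X Y} {V : Matrix (Y ⊠ E) X ℂ}
    {V' : Matrix (Y ⊠ E') X ℂ}
    (h : ∀ ρ, ptrace (conj V ρ) = Φ ρ) (h' : ∀ ρ, ptrace (conj V' ρ) = Φ ρ) :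
    ∃ C : Matrix E' E ℂ, IsContr C ∧
      ((1 : Op Y) ⊗ₖ C : Matrix (Y ⊠ E') (Y ⊠ E) ℂ) * V = V' := by
  obtain ⟨C, hC, e⟩ := exists_contr_of_gram
    (Matrix.of fun (e : E) (p : Y × X) => V (p.1, e) p.2)
    (Matrix.of fun (e : E') (p : Y × X) => V' (p.1, e) p.2)
    (by ext p q; rw [gram_of_dilates h, gram_of_dilates h'])
  refine ⟨C, hC, ?_⟩
  ext p x
  have := congrFun (congrFun e p.2) (p.1, x)
  rw [of_apply] at this
  rw [show V' p x = V' (p.1, p.2) x from rfl, ← this, mul_apply, mul_apply,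
    sum_prod_type, sum_eq_single p.1]
  · simp
  · intro b _ hb; simp [hb.symm]
  · simp

theorem exists_unitary_of_dilates {Φ : SuperOp X Y} {V V' : Matrix (Y ⊠ E) X ℂ}
    (h : ∀ ρ, ptrace (conj V ρ) = Φ ρ) (h' : ∀ ρ, ptrace (conj V' ρ) = Φ ρ) :
    ∃ U : Op E, Uᴴ * U = 1 ∧
      ((1 : Op Y) ⊗ₖ U : Op (Y ⊠ E)) * V = V' := by
  obtain ⟨C, hC, e⟩ := exists_unitary_of_gram
    (Matrix.of fun (e : E) (p : Y × X) => V (p.1, e) p.2)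
    (Matrix.of fun (e : E) (p : Y × X) => V' (p.1, e) p.2)
    (by ext p q; rw [gram_of_dilates h, gram_of_dilates h'])
  refine ⟨C, hC, ?_⟩
  ext p x
  have := congrFun (congrFun e p.2) (p.1, x)
  rw [of_apply] at this
  rw [show V' p x = V' (p.1, p.2) x from rfl, ← this, mul_apply, mul_apply,
    sum_prod_type, sum_eq_single p.1]
  · simp
  · intro b _ hb; simp [hb.symm]
  · simp

end Uniqueness

/-! ### Pure inputs -/

section Pure

variable {X Y Z R : QSys}

/-- A matrix regarded as a vector of the composite system. -/
def vec (ψ : Matrix X R ℂ) : (X ⊠ R) → ℂ := fun p => ψ p.1 p.2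

/-- The pure state with amplitudes `ψ`. -/
def pureOp (ψ : Matrix X R ℂ) : Op (X ⊠ R) := rankOne (vec ψ)

theorem posSemidef_rankOne (v : X → ℂ) : (rankOne v).PosSemidef :=
  Matrix.posSemidef_vecMulVec_self_star v

theorem conj_rankOne (C : Matrix Y X ℂ) (v : X → ℂ) :
    conj C (rankOne v) = rankOne (C *ᵥ v) := by
  rw [conj_apply, rankOne, rankOne, Matrix.mul_vecMulVec, Matrix.vecMulVec_mul,
    Matrix.star_mulVec]

theorem ext_conj_pureOp (C : Matrix Y X ℂ) (ψ : Matrix X R ℂ) :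
    ext (conj C) R (pureOp ψ) = pureOp (C * ψ) := by
  rw [ext_conj, pureOp, conj_rankOne]
  unfold pureOp
  congr 1
  ext p
  simp [vec, Matrix.mulVec, dotProduct, sum_prod_type, mul_apply,
    one_apply]

theorem conj_single_apply (V : Matrix Y X ℂ) (x x' : X)
    (y y' : Y) :
    conj V (Matrix.single x x' 1) y y' = V y x * star (V y' x') := by
  rw [conj_apply, mul_apply, sum_eq_single x']
  · rw [mul_apply, sum_eq_single x]
    · simp
    · intro b _ hb; simp [hb.symm]
    · simp
  · intro b _ hb
    rw [mul_apply, sum_eq_zero, zero_mul]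
    intro c _; simp [hb.symm]
  · simp

theorem nsq_vec_mul_of_isometry {V : Matrix Y X ℂ} (hV : Vᴴ * V = 1)
    (ψ : Matrix X R ℂ) : nsq (vec (V * ψ)) = nsq (vec ψ) := by
  have h : ∀ (Z : QSys) (φ : Matrix Z R ℂ),
      nsq (vec φ) = ∑ r, nsq (fun z => φ z r) := by
    intro Z φ
    simp only [nsq, vec, sum_prod_type]
    exact sum_comm
  rw [h, h]
  refine sum_congr rfl fun r _ => ?_
  rw [← nsq_mulVec_of_isometry hV fun x => ψ x r]
  rfl

theorem nsq_smul {n : Type} [Fintype n] (a : ℂ) (u : n → ℂ) : nsq (a • u) = ‖a‖ ^ 2 * nsq u := by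
  simp [nsq, mul_sum, mul_pow]

theorem nsq_add_le {n : Type} [Fintype n] (u v : n → ℂ) :
    nsq (u + v) ≤ 2 * nsq u + 2 * nsq v := by
  simp only [nsq, mul_sum, ← sum_add_distrib]
  refine sum_le_sum fun i _ => ?_
  have h1 := norm_add_le (u i) (v i)
  have h2 := norm_nonneg (u i + v i)
  rw [Pi.add_apply]
  nlinarith [sq_nonneg (‖u i‖ - ‖v i‖)]

theorem nsq_neg {n : Type} [Fintype n] (u : n → ℂ) : nsq (-u) = nsq u := by simp [nsq]

theorem nsq_sub_le {n : Type} [Fintype n] (u v w : n → ℂ) :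
    nsq (u - w) ≤ 2 * nsq (u - v) + 2 * nsq (v - w) := by
  rw [← sub_add_sub_cancel u v w]; exact nsq_add_le _ _

theorem nsq_sub_comm {n : Type} [Fintype n] (u v : n → ℂ) : nsq (u - v) = nsq (v - u) := by
  rw [← neg_sub, nsq_neg]

theorem exists_phase {n : Type} [Fintype n] (u v : n → ℂ) :
    ∃ θ : ℂ, ‖θ‖ = 1 ∧ nsq (u - θ • v) = nsq u + nsq v - 2 * ‖star u ⬝ᵥ v‖ := by
  have key : ∀ θ : ℂ, ‖θ‖ = 1 →
      nsq (u - θ • v) = nsq u + nsq v - 2 * (θ * (star u ⬝ᵥ v)).re := by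
    intro θ hθ
    simp only [nsq, dotProduct, mul_sum, Complex.re_sum, ← sum_add_distrib,
      ← Finset.sum_sub_distrib]
    refine sum_congr rfl fun i _ => ?_
    have h1 : ‖v i‖ ^ 2 = ‖θ * v i‖ ^ 2 := by rw [norm_mul, hθ, one_mul]
    rw [h1, Pi.sub_apply, Pi.smul_apply, smul_eq_mul, ← Complex.normSq_eq_norm_sq,
      ← Complex.normSq_eq_norm_sq, ← Complex.normSq_eq_norm_sq, Complex.normSq_sub]
    have h2 : (u i * (starRingEnd ℂ) (θ * v i)).re = (θ * (star u i * v i)).re := by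
      rw [← Complex.conj_re]
      simp only [map_mul, Complex.conj_conj, Pi.star_apply, RCLike.star_def]
      ring_nf
    rw [h2]
  by_cases h : star u ⬝ᵥ v = 0
  · refine ⟨1, by simp, ?_⟩
    rw [key 1 (by simp), h]; simp
  · refine ⟨star (star u ⬝ᵥ v) / ‖star u ⬝ᵥ v‖, ?_, ?_⟩
    · rw [norm_div, norm_star, Complex.norm_real, norm_norm,
        div_self (norm_ne_zero_iff.2 h)]
    · rw [key]
      · have : star (star u ⬝ᵥ v) / (‖star u ⬝ᵥ v‖ : ℂ) * (star u ⬝ᵥ v) = (‖star u ⬝ᵥ v‖ : ℂ) := by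
          rw [div_mul_eq_mul_div, RCLike.star_def, Complex.conj_mul', sq, mul_div_assoc,
            div_self, mul_one]
          exact_mod_cast norm_ne_zero_iff.2 h
        rw [this, Complex.ofReal_re]
      · rw [norm_div, norm_star, Complex.norm_real, norm_norm,
          div_self (norm_ne_zero_iff.2 h)]

end Pure

/-! ### Phase alignment -/

section Phases

variable {I Y : QSys} {α : Type} [Fintype α] [Nonempty α]

/-- The direct sum of two references. -/
abbrev QSys.sum (X Y : QSys) : QSys := ⟨X ⊕ Y⟩

/-- The equal superposition of two pure inputs, flagged by the reference. -/
def superpose {R₀ R₁ : QSys} (ψ₀ : Matrix I R₀ ℂ)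
    (ψ₁ : Matrix I R₁ ℂ) : Matrix I (R₀.sum R₁) ℂ :=
  (((√2)⁻¹ : ℝ) : ℂ) • Matrix.fromCols ψ₀ ψ₁

theorem nsq_vec_superpose {R₀ R₁ : QSys} (ψ₀ : Matrix I R₀ ℂ)
    (ψ₁ : Matrix I R₁ ℂ) :
    nsq (vec (superpose ψ₀ ψ₁)) = (nsq (vec ψ₀) + nsq (vec ψ₁)) / 2 := by
  have h : ((√2)⁻¹) ^ 2 = (1 / 2 : ℝ) := by
    rw [inv_pow, Real.sq_sqrt (by norm_num)]; norm_num
  simp only [nsq, vec, superpose, sum_prod_type, Fintype.sum_sum_type, Matrix.smul_apply,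
    smul_eq_mul, norm_mul, mul_pow, Complex.norm_real, Matrix.fromCols_apply_inl,
    Matrix.fromCols_apply_inr, Real.norm_eq_abs, sq_abs, h, sum_add_distrib,
    ← mul_sum]
  ring

theorem superpose_comb {R₀ R₁ : QSys} (A B : Matrix Y I ℂ) (θ : ℂ)
    (ψ₀ : Matrix I R₀ ℂ) (ψ₁ : Matrix I R₁ ℂ) :
    vec (A * superpose ψ₀ ψ₁) - θ • vec (B * superpose ψ₀ ψ₁)
      = vec (superpose (A * ψ₀ - θ • (B * ψ₀)) (A * ψ₁ - θ • (B * ψ₁))) := by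
  ext ⟨y, r⟩
  simp only [vec, superpose, Matrix.mul_smul, Matrix.mul_fromCols, Pi.sub_apply, Pi.smul_apply,
    Matrix.smul_apply]
  cases r <;> simp <;> ring

/-- If the pure outputs `F a ψ` are almost independent of `a` as states, then they are so as
vectors, up to phases that do not depend on `ψ`. -/
theorem exists_phases (Adm : ∀ R : QSys, Matrix I R ℂ → Prop)
    (hsup : ∀ R₀ R₁ ψ₀ ψ₁, Adm R₀ ψ₀ → Adm R₁ ψ₁ → Adm _ (superpose ψ₀ ψ₁))
    {R₀ : QSys} {ψ₀ : Matrix I R₀ ℂ} (h₀ : Adm R₀ ψ₀)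
    (F : α → Matrix Y I ℂ) {ε : ℝ}
    (hn : ∀ R ψ, Adm R ψ → ∑ a, nsq (vec (F a * ψ)) = 1)
    (hF : ∀ R ψ, Adm R ψ → ∑ a, traceNorm (X := Y ⊠ R)
      (pureOp (F a * ψ) - (Fintype.card α : ℂ)⁻¹ • ∑ b, pureOp (F b * ψ)) ≤ ε) :
    ∃ ω : α → ℂ, (∀ a, ‖ω a‖ = 1) ∧ ∀ R ψ, Adm R ψ →
      ∑ a, ∑ b, nsq (ω a • vec (F a * ψ) - ω b • vec (F b * ψ)) ≤ Fintype.card α * (128 * ε) := by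
  set d : ℝ := (Fintype.card α : ℝ) with hd
  have hd0 : 0 < d := by rw [hd]; exact_mod_cast Fintype.card_pos
  -- phases for one input
  have step : ∀ R ψ, Adm R ψ → ∃ θ : α → α → ℂ, (∀ a b, ‖θ a b‖ = 1) ∧
      ∑ a, ∑ b, nsq (vec (F a * ψ) - θ a b • vec (F b * ψ)) ≤ d * (4 * ε) := by
    intro R ψ h
    choose θ hθ1 hθ2 using fun a b => exists_phase (vec (F a * ψ)) (vec (F b * ψ))
    refine ⟨θ, hθ1, ?_⟩
    set S := (Fintype.card α : ℂ)⁻¹ • ∑ b, pureOp (F b * ψ)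
    calc _ ≤ ∑ a, ∑ b, (2 * traceNorm (X := Y ⊠ R) (pureOp (F a * ψ) - S)
          + 2 * traceNorm (X := Y ⊠ R) (pureOp (F b * ψ) - S)) := by
          refine sum_le_sum fun a _ => sum_le_sum fun b _ => ?_
          rw [hθ2]
          refine (nsq_add_nsq_sub_le (X := Y ⊠ R) _ _).trans ?_
          have h1 := traceNorm_sub_le (X := Y ⊠ R) (pureOp (F a * ψ)) S (pureOp (F b * ψ))
          have h2 := traceNorm_sub_comm (X := Y ⊠ R) S (pureOp (F b * ψ))
          change 2 * traceNorm (X := Y ⊠ R) (pureOp (F a * ψ) - pureOp (F b * ψ)) ≤ _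
          linarith
      _ = d * (4 * ∑ a, traceNorm (X := Y ⊠ R) (pureOp (F a * ψ) - S)) := by
          simp only [sum_add_distrib, Finset.sum_const, Finset.card_univ, nsmul_eq_mul,
            ← mul_sum]
          ring
      _ ≤ _ := by gcongr; exact hF R ψ h
  have hw : ∀ R ψ, Adm R ψ → ∑ a, |nsq (vec (F a * ψ)) - d⁻¹| ≤ ε := by
    intro R ψ h
    refine (sum_le_sum fun a _ => ?_).trans (hF R ψ h)
    refine le_trans (le_of_eq ?_) (norm_trace_le (X := Y ⊠ R) _)
    rw [Matrix.trace_sub, trace_smul, Matrix.trace_sum]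
    have ht : ∀ b, (pureOp (F b * ψ)).trace = ((nsq (vec (F b * ψ)) : ℝ) : ℂ) :=
      fun b => trace_rankOne (X := Y ⊠ R) _
    rw [ht, sum_congr rfl fun b _ => ht b, ← Complex.ofReal_sum, hn R ψ h, smul_eq_mul, Complex.ofReal_one, mul_one,
      ← Complex.ofReal_natCast, ← Complex.ofReal_inv, ← Complex.ofReal_sub, Complex.norm_real,
      Real.norm_eq_abs]
  obtain ⟨θ₀, hθ₀, hθ₀s⟩ := step R₀ ψ₀ h₀
  obtain ⟨b₀, hb₀⟩ : ∃ b, ∑ a, nsq (vec (F a * ψ₀) - θ₀ a b • vec (F b * ψ₀)) ≤ 4 * ε := by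
    by_contra hcon
    push Not at hcon
    rw [sum_comm] at hθ₀s
    have : ∑ _b : α, 4 * ε < ∑ b, ∑ a, nsq (vec (F a * ψ₀) - θ₀ a b • vec (F b * ψ₀)) :=
      Finset.sum_lt_sum_of_nonempty Finset.univ_nonempty fun b _ => hcon b
    rw [Finset.sum_const, Finset.card_univ, nsmul_eq_mul] at this
    linarith
  set ω : α → ℂ := fun a => star (θ₀ a b₀) with hω
  have hω1 : ∀ a, ‖ω a‖ = 1 := fun a => by rw [hω]; simp [hθ₀]
  have hωω : ∀ a, ω a * star (ω a) = 1 := fun a => by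
    rw [RCLike.star_def, Complex.mul_conj', hω1]; simp
  have rot : ∀ (R : QSys) (a b : α) (u v : (Y ⊠ R) → ℂ),
      nsq (ω a • u - ω b • v) = nsq (u - (star (ω a) * ω b) • v) := by
    intro R a b u v
    have : ω a • u - ω b • v = ω a • (u - (star (ω a) * ω b) • v) := by
      rw [smul_sub, smul_smul, ← mul_assoc, hωω, one_mul]
    rw [this, nsq_smul, hω1]; ring
  refine ⟨ω, hω1, fun R ψ hψ => ?_⟩
  obtain ⟨θ, hθ, hθs⟩ := step _ _ (hsup _ _ _ _ h₀ hψ)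
  have hs : ∀ a b, nsq (vec (F a * superpose ψ₀ ψ) - θ a b • vec (F b * superpose ψ₀ ψ))
      = (nsq (vec (F a * ψ₀) - θ a b • vec (F b * ψ₀))
        + nsq (vec (F a * ψ) - θ a b • vec (F b * ψ))) / 2 := by
    intro a b
    rw [superpose_comb, nsq_vec_superpose]; rfl
  simp only [hs] at hθs
  -- notation
  set f₀ : α → (Y ⊠ R₀) → ℂ := fun a => vec (F a * ψ₀) with hf₀
  set f₁ : α → (Y ⊠ R) → ℂ := fun a => vec (F a * ψ) with hf₁
  have hf₀' : ∑ a, ∑ b, nsq (f₀ a - (star (ω a) * ω b) • f₀ b) ≤ d * (16 * ε) := by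
    have h1 : ∀ a, nsq (ω a • f₀ a - f₀ b₀) = nsq (f₀ a - θ₀ a b₀ • f₀ b₀) := by
      intro a
      have : ω a • f₀ a - f₀ b₀ = ω a • (f₀ a - θ₀ a b₀ • f₀ b₀) := by
        have h2 : ω a * θ₀ a b₀ = 1 := by
          have := hωω a
          simpa [hω] using this
        rw [smul_sub, smul_smul, h2, one_smul]
      rw [this, nsq_smul, hω1]; ring
    calc _ ≤ ∑ a, ∑ b, (2 * nsq (f₀ a - θ₀ a b₀ • f₀ b₀) + 2 * nsq (f₀ b - θ₀ b b₀ • f₀ b₀)) := by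
          refine sum_le_sum fun a _ => sum_le_sum fun b _ => ?_
          rw [← rot R₀ a b, ← h1 a, ← h1 b, nsq_sub_comm (ω b • f₀ b)]
          exact nsq_sub_le _ _ _
      _ = d * (4 * ∑ a, nsq (f₀ a - θ₀ a b₀ • f₀ b₀)) := by
          simp only [sum_add_distrib, Finset.sum_const, Finset.card_univ, nsmul_eq_mul,
            ← mul_sum]
          ring
      _ ≤ d * (4 * (4 * ε)) := by gcongr
      _ = _ := by ring
  have hpt : ∀ a b, nsq (ω a • f₁ a - ω b • f₁ b) ≤ 2 * nsq (f₁ a - θ a b • f₁ b)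
      + 2 * (2 * nsq (f₀ a - θ a b • f₀ b) + 2 * nsq (f₀ a - (star (ω a) * ω b) • f₀ b)
        + 4 * (|nsq (f₁ b) - d⁻¹| + |nsq (f₀ b) - d⁻¹|)) := by
    intro a b
    set η := star (ω a) * ω b
    have hη : ‖η‖ = 1 := by rw [norm_mul, norm_star, hω1, hω1, one_mul]
    rw [rot R a b]
    refine (nsq_sub_le _ (θ a b • f₁ b) _).trans ?_
    rw [← sub_smul, nsq_smul]
    have h1 : ‖θ a b - η‖ ^ 2 * nsq (f₀ b) ≤ 2 * nsq (f₀ a - θ a b • f₀ b)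
        + 2 * nsq (f₀ a - η • f₀ b) := by
      rw [← nsq_smul, sub_smul, nsq_sub_comm (f₀ a) (θ a b • f₀ b)]
      exact nsq_sub_le _ _ _
    have h2 : ‖θ a b - η‖ ^ 2 ≤ 4 := by
      have := norm_sub_le (θ a b) η
      rw [hθ, hη] at this
      nlinarith [norm_nonneg (θ a b - η)]
    have h3 : nsq (f₁ b) ≤ nsq (f₀ b) + (|nsq (f₁ b) - d⁻¹| + |nsq (f₀ b) - d⁻¹|) := by
      have := le_abs_self (nsq (f₁ b) - d⁻¹)
      have := neg_abs_le (nsq (f₀ b) - d⁻¹)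
      linarith
    have h4 : 0 ≤ |nsq (f₁ b) - d⁻¹| + |nsq (f₀ b) - d⁻¹| := by positivity
    have h5 : ‖θ a b - η‖ ^ 2 * nsq (f₁ b) ≤ ‖θ a b - η‖ ^ 2 * nsq (f₀ b)
        + 4 * (|nsq (f₁ b) - d⁻¹| + |nsq (f₀ b) - d⁻¹|) := by
      calc _ ≤ ‖θ a b - η‖ ^ 2 * (nsq (f₀ b) + (|nsq (f₁ b) - d⁻¹| + |nsq (f₀ b) - d⁻¹|)) := by
            gcongr
        _ ≤ _ := by rw [mul_add]; gcongr
    linarith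
  refine (sum_le_sum fun a _ => sum_le_sum fun b _ => hpt a b).trans ?_
  have e0 := hw _ _ h₀
  have e1 := hw _ _ hψ
  simp only [sum_add_distrib, ← mul_sum, Finset.sum_const, Finset.card_univ,
    nsmul_eq_mul, ← Finset.sum_div, add_div] at hθs ⊢
  change ∑ a, |nsq (f₀ a) - d⁻¹| ≤ ε at e0
  change ∑ a, |nsq (f₁ a) - d⁻¹| ≤ ε at e1
  have e2 : d * (∑ a, |nsq (f₁ a) - d⁻¹| + ∑ a, |nsq (f₀ a) - d⁻¹|) ≤ d * (2 * ε) := by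
    gcongr; linarith
  set A₀ := ∑ a, ∑ b, nsq (f₀ a - θ a b • f₀ b)
  set A₁ := ∑ a, ∑ b, nsq (f₁ a - θ a b • f₁ b)
  have hA₀ : 0 ≤ A₀ := Finset.sum_nonneg fun _ _ => Finset.sum_nonneg fun _ _ => nsq_nonneg _
  have hA₁ : 0 ≤ A₁ := Finset.sum_nonneg fun _ _ => Finset.sum_nonneg fun _ _ => nsq_nonneg _
  linarith

end Phases

/-! ### Approximation of superoperators on extensions -/

section Near

/-- `Φ` and `Ψ` are `ε`-close on all extensions of the test and source states of `T`. -/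
def Near (T : Resource) (ε : ℝ) {Y : QSys} (Φ Ψ : SuperOp T.In Y) : Prop :=
  ∀ (R : QSys) (ξ : Op (T.In ⊠ R)), T.IsExtension ξ →
    traceNorm (X := Y ⊠ R) (ext Φ R ξ - ext Ψ R ξ) ≤ ε

/-- The marginal on the test and source systems. -/
def Resource.marginal (T : Resource) : SuperOp T.In (T.Arel ⊠ T.S) := ext ptraceLeft T.S

theorem Resource.isExtension_iff (T : Resource) {R : QSys} (ξ : Op (T.In ⊠ R)) :
    T.IsExtension ξ ↔ IsState ξ ∧ T.marginal (ptrace ξ) = T.test ⊗ₖ T.source := Iff.rfl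

variable {T : Resource} {Y Y' : QSys}

theorem Near.trans {ε ε' : ℝ} {Φ Ψ Θ : SuperOp T.In Y} (h : Near T ε Φ Ψ) (h' : Near T ε' Ψ Θ) :
    Near T (ε + ε') Φ Θ := fun R ξ hξ =>
  (traceNorm_sub_le (X := Y ⊠ R) _ (ext Ψ R ξ) _).trans (add_le_add (h R ξ hξ) (h' R ξ hξ))

theorem Near.refl {ε : ℝ} (hε : 0 ≤ ε) (Φ : SuperOp T.In Y) : Near T ε Φ Φ := fun R ξ _ => by
  rw [sub_self]; exact (traceNorm_zero (X := Y ⊠ R)).le.trans hε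

theorem Near.comp {ε : ℝ} {Φ Ψ : SuperOp T.In Y} {Θ : SuperOp Y Y'} (hΘ : IsChannel Θ)
    (h : Near T ε Φ Ψ) : Near T ε (Θ ∘ₗ Φ) (Θ ∘ₗ Ψ) := fun R ξ hξ => by
  rw [ext_comp, ext_comp, comp_apply, comp_apply, ← map_sub]
  exact (traceNorm_channel_le (hΘ.ext R) _).trans (h R ξ hξ)

theorem exists_purification {X R : QSys} {ξ : Op (X ⊠ R)} (h : ξ.PosSemidef) :
    ∃ (R' : QSys) (ψ : Matrix X (R ⊠ R') ℂ),
      ptrace (relabel (X := X ⊠ (R ⊠ R')) (Y := (X ⊠ R) ⊠ R') (prodAssoc _ _ _).symm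
        (pureOp ψ)) = ξ := by
  obtain ⟨S, hS⟩ := exists_sqrt h
  refine ⟨X ⊠ R, Matrix.of fun x p => S (x, p.1) p.2, ?_⟩
  rw [hS]; rfl

theorem near_of_pure {ε : ℝ} {Φ Ψ : SuperOp T.In Y}
    (h : ∀ (R : QSys) (ψ : Matrix T.In R ℂ), T.IsExtension (pureOp ψ) →
      traceNorm (X := Y ⊠ R) (ext Φ R (pureOp ψ) - ext Ψ R (pureOp ψ)) ≤ ε) :
    Near T ε Φ Ψ := by
  intro R ξ hξ
  obtain ⟨R', ψ, hψ⟩ := exists_purification hξ.1.1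
  have key : ∀ Θ : SuperOp T.In Y, ext Θ R ξ = ptrace (relabel (X := Y ⊠ (R ⊠ R'))
      (Y := (Y ⊠ R) ⊠ R') (prodAssoc _ _ _).symm (ext Θ (R ⊠ R') (pureOp ψ))) := by
    intro Θ
    rw [← hψ, ← ptrace_ext]; rfl
  have hp : ptrace (pureOp ψ) = ptrace ξ := by
    rw [← hψ]
    ext i j
    exact sum_prod_type _
  have hst : IsState (pureOp ψ) := ⟨posSemidef_rankOne _, by
    rw [← trace_ptrace, hp, trace_ptrace, hξ.1.2]⟩
  have := h _ ψ ((T.isExtension_iff _).2 ⟨hst, by rw [hp]; exact ((T.isExtension_iff _).1 hξ).2⟩)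
  rw [key, key, ← map_sub, ← map_sub]
  exact (traceNorm_ptrace_le _).trans ((traceNorm_channel_le (isChannel_relabel _) _).trans this)

theorem ptrace_pureOp_superpose {I R₀ R₁ : QSys} (ψ₀ : Matrix I R₀ ℂ)
    (ψ₁ : Matrix I R₁ ℂ) :
    ptrace (pureOp (superpose ψ₀ ψ₁))
      = (1 / 2 : ℂ) • (ptrace (pureOp ψ₀) + ptrace (pureOp ψ₁)) := by
  have h : ((((√2)⁻¹ : ℝ) : ℂ)) * (((√2)⁻¹ : ℝ) : ℂ) = 1 / 2 := by
    rw [← Complex.ofReal_mul, ← mul_inv, Real.mul_self_sqrt (by norm_num)]; norm_num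
  ext i j
  change ∑ r : R₀ ⊕ R₁, superpose ψ₀ ψ₁ i r * star (superpose ψ₀ ψ₁ j r)
    = (1 / 2 : ℂ) * (∑ r, ψ₀ i r * star (ψ₀ j r) + ∑ r, ψ₁ i r * star (ψ₁ j r))
  rw [Fintype.sum_sum_type, mul_add, mul_sum, mul_sum, ← h]
  congr 1 <;>
  · refine sum_congr rfl fun r _ => ?_
    simp [superpose]
    ring

theorem isExtension_superpose {R₀ R₁ : QSys} {ψ₀ : Matrix T.In R₀ ℂ}
    {ψ₁ : Matrix T.In R₁ ℂ} (h₀ : T.IsExtension (pureOp ψ₀))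
    (h₁ : T.IsExtension (pureOp ψ₁)) : T.IsExtension (pureOp (superpose ψ₀ ψ₁)) := by
  rw [Resource.isExtension_iff] at h₀ h₁ ⊢
  refine ⟨⟨posSemidef_rankOne _, ?_⟩, ?_⟩
  · rw [← trace_ptrace, ptrace_pureOp_superpose, trace_smul, Matrix.trace_add, trace_ptrace,
      trace_ptrace, h₀.1.2, h₁.1.2]
    norm_num
  · rw [ptrace_pureOp_superpose, map_smul, map_add, h₀.2, h₁.2, ← two_smul ℂ, smul_smul]
    norm_num

theorem exists_pure_extension (T : Resource) :
    ∃ (R : QSys) (ψ : Matrix T.In R ℂ), T.IsExtension (pureOp ψ) := by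
  let a₀ : T.Aabs := Classical.arbitrary _
  let ρ : Op T.In := (Matrix.single a₀ a₀ (1 : ℂ) ⊗ₖ T.test) ⊗ₖ T.source
  have h1 : IsState (X := T.Aabs) (Matrix.single a₀ a₀ (1 : ℂ)) := by
    refine ⟨?_, by simp⟩
    have : (Matrix.single a₀ a₀ (1 : ℂ)) = Matrix.vecMulVec (Pi.single a₀ 1)
        (star (Pi.single a₀ (1 : ℂ))) := by
      ext i j
      by_cases hi : i = a₀ <;> by_cases hj : j = a₀ <;>
        simp [Matrix.vecMulVec_apply, hi, hj, eq_comm]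
    rw [this]
    exact Matrix.posSemidef_vecMulVec_self_star _
  have hρ : IsState ρ := (h1.kron T.isState_test).kron T.isState_source
  obtain ⟨S, hS⟩ := exists_sqrt hρ.1
  have hp : ptrace (X := T.In) (W := T.In) (pureOp S) = ρ := by rw [hS]; rfl
  refine ⟨T.In, S, (T.isExtension_iff _).2 ⟨⟨posSemidef_rankOne _, ?_⟩, ?_⟩⟩
  · rw [← trace_ptrace, hp, hρ.2]
  · rw [hp, Resource.marginal, ext_kron, ptraceLeft_kron, h1.2, one_smul]

end Near

/-! ### Replacing the copied values one by one -/

section Hybrid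

theorem stepOp_isometry {ι : Type} {K : ι → QSys} {E : QSys} {U : ∀ j, (K j) → Op E}
    (hU : ∀ j a, (U j a)ᴴ * U j a = 1) (j : ι) (a b : (K j)) :
    ((U j a)ᴴ * U j b)ᴴ * ((U j a)ᴴ * U j b) = 1 := by
  rw [conjTranspose_mul, Matrix.conjTranspose_conjTranspose, Matrix.mul_assoc,
    ← Matrix.mul_assoc (U j a), mul_eq_one_comm.1 (hU j a), Matrix.one_mul, hU]

variable {ι : Type} [Fintype ι] [DecidableEq ι]

/-- The tensor product of a finite family of systems, with the preferred basis labelled by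
functions. -/
abbrev QSys.pi (K : ι → QSys) : QSys := ⟨∀ j, (K j)⟩

variable {K : ι → QSys} {E Q : QSys}

/-- The values of `k'` at the indices of the list, and those of `k` elsewhere. -/
def mix (L : List ι) (k k' : (QSys.pi K)) : (QSys.pi K) :=
  fun j => if j ∈ L then k' j else k j

/-- The corrections which replace, at the indices of the list, the values of `k` by those of
`k'`. -/
def hybridOp (U : ∀ j, (K j) → Op E) :
    List ι → (QSys.pi K) → (QSys.pi K) → Op E
  | [], _, _ => 1
  | j :: L, k, k' => (U j (k' j))ᴴ * U j (k j) * hybridOp U L k k'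

theorem hybridOp_isometry {U : ∀ j, (K j) → Op E} (hU : ∀ j a, (U j a)ᴴ * U j a = 1)
    (L : List ι) (k k' : (QSys.pi K)) :
    (hybridOp U L k k')ᴴ * hybridOp U L k k' = 1 := by
  induction L with
  | nil => simp [hybridOp]
  | cons j L ih =>
    rw [hybridOp, conjTranspose_mul, Matrix.mul_assoc,
      ← Matrix.mul_assoc _ _ (hybridOp U L k k'), stepOp_isometry hU, Matrix.one_mul, ih]

theorem mix_involutive (L : List ι) : Function.Involutive
    (fun p : (QSys.pi K) × (QSys.pi K) => (mix L p.1 p.2, mix L p.2 p.1)) := by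
  intro p
  ext j <;> by_cases h : j ∈ L <;> simp [mix, h]

theorem sum_pi_apply (j : ι) (g : (K j) → ℝ) :
    (Fintype.card (K j) : ℝ) * ∑ k : (QSys.pi K), g (k j)
      = Fintype.card (QSys.pi K) * ∑ a, g a := by
  let e := Equiv.piSplitAt j fun i => (K i)
  have h1 : ∑ k : (QSys.pi K), g (k j)
      = Fintype.card (∀ i : {i // i ≠ j}, (K i)) * ∑ a, g a := by
    rw [Fintype.sum_equiv e (fun k => g (k j)) (fun p => g p.1) fun k => rfl,
      sum_prod_type]
    simp [mul_sum]
  have h2 : Fintype.card (QSys.pi K)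
      = Fintype.card (K j) * Fintype.card (∀ i : {i // i ≠ j}, (K i)) := by
    rw [← Fintype.card_prod]; exact Fintype.card_congr e
  rw [h1, h2]; push_cast; ring

theorem hybrid_bound {U : ∀ j, (K j) → Op E} (hU : ∀ j a, (U j a)ᴴ * U j a = 1)
    (G : (QSys.pi K) → Matrix E Q ℂ) {ε : ℝ}
    (hs : ∀ j, ∑ k, ∑ a, nsq (vec ((U j a)ᴴ * U j (k j) * G k - G (Function.update k j a)))
      ≤ Fintype.card (K j) * ε) (L : List ι) (hL : L.Nodup) :
    ∑ k, ∑ k', nsq (vec (hybridOp U L k k' * G k - G (mix L k k')))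
      ≤ 2 * (2 ^ L.length - 1) * (Fintype.card (QSys.pi K) * ε) := by
  induction L with
  | nil =>
    have : ∀ k k' : (QSys.pi K), mix [] k k' = k := fun k k' => by ext j; simp [mix]
    simp [hybridOp, this, vec, nsq]
  | cons j L ih =>
    have hj := (List.nodup_cons.1 hL).1
    have ih := ih (List.nodup_cons.1 hL).2
    have hmix : ∀ k k' : (QSys.pi K),
        mix (j :: L) k k' = Function.update (mix L k k') j (k' j) := by
      intro k k'
      ext i
      by_cases h : i = j
      · subst h; simp [mix]
      · simp [mix, h]
    have hkj : ∀ k k' : (QSys.pi K), mix L k k' j = k j := by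
      intro k k'; simp [mix, hj]
    set φ : (QSys.pi K) → (K j) → ℝ := fun k a =>
      nsq (vec ((U j a)ᴴ * U j (k j) * G k - G (Function.update k j a))) with hφ
    have h1 : ∀ k k' : (QSys.pi K),
        nsq (vec (hybridOp U (j :: L) k k' * G k - G (mix (j :: L) k k')))
        ≤ 2 * nsq (vec (hybridOp U L k k' * G k - G (mix L k k')))
          + 2 * φ (mix L k k') (mix L k' k j) := by
      intro k k'
      rw [hybridOp, hmix, hφ]
      simp only [hkj]
      refine (nsq_sub_le _ (vec ((U j (k' j))ᴴ * U j (k j) * G (mix L k k'))) _).trans ?_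
      refine add_le_add (mul_le_mul_of_nonneg_left (le_of_eq ?_) zero_le_two) le_rfl
      rw [← nsq_vec_mul_of_isometry (stepOp_isometry hU j (k' j) (k j))
        (hybridOp U L k k' * G k - G (mix L k k')), Matrix.mul_sub, ← Matrix.mul_assoc]
      rfl
    have h2 : ∑ k : (QSys.pi K), ∑ k' : (QSys.pi K),
        φ (mix L k k') (mix L k' k j) ≤ Fintype.card (QSys.pi K) * ε := by
      let e := Function.Involutive.toPerm _ (mix_involutive (K := K) L)
      rw [← Fintype.sum_prod_type' (f := fun k k' => φ (mix L k k') (mix L k' k j)),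
        ← Equiv.sum_comp e]
      have : ∀ p : (QSys.pi K) × (QSys.pi K),
          φ (mix L (e p).1 (e p).2)
            (mix L (e p).2 (e p).1 j)
          = φ p.1 (p.2 j) := by
        intro p
        have := mix_involutive L p
        simp only [Prod.ext_iff] at this
        change φ (mix L (mix L p.1 p.2) (mix L p.2 p.1)) (mix L (mix L p.2 p.1) (mix L p.1 p.2) j) = _
        rw [this.1, this.2]
      simp only [this]
      rw [sum_prod_type]
      have hc : (0 : ℝ) < Fintype.card (K j) := by exact_mod_cast Fintype.card_pos
      have h3 : (Fintype.card (K j) : ℝ) * ∑ k : (QSys.pi K),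
          ∑ k' : (QSys.pi K), φ k (k' j)
          ≤ Fintype.card (K j) * (Fintype.card (QSys.pi K) * ε) := by
        rw [mul_sum]
        rw [sum_congr rfl fun k _ => sum_pi_apply j (φ k), ← mul_sum]
        calc _ ≤ (Fintype.card (QSys.pi K) : ℝ) * (Fintype.card (K j) * ε) := by
              gcongr; exact hs j
          _ = _ := by ring
      exact le_of_mul_le_mul_left h3 hc
    refine (sum_le_sum fun k _ => sum_le_sum fun k' _ => h1 k k').trans ?_
    simp only [sum_add_distrib, ← mul_sum]
    rw [List.length_cons, pow_succ]
    linarith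

end Hybrid

/-! ### Coherent decoding -/

section Decoding

/-- `|o, b, k⟩ ↦ |o, k⟩|b, k⟩`: the register `k` is coherently copied to Bob. -/
def spread (O B K : QSys) : SuperOp ((O ⊠ B) ⊠ K) ((O ⊠ K) ⊠ (B ⊠ K)) :=
  push fun p => ((p.1.1, p.2), (p.1.2, p.2))

theorem isChannel_spread (O B K : QSys) : IsChannel (spread O B K) :=
  isChannel_push fun p q h => by
    simp only [Prod.mk.injEq] at h
    exact Prod.ext (Prod.ext h.1.1 h.2.1) h.1.2

/-- The maximally entangled state of two copies of `K`. -/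
def maxEntOp (K : QSys) : Op (K ⊠ K) :=
  Matrix.of fun p q => if p.1 = p.2 ∧ q.1 = q.2 then (Fintype.card K : ℂ)⁻¹ else 0

/-- A maximally entangled state of two copies of `K` is handed to Alice and Bob. -/
def entangle (O T K : QSys) : SuperOp (O ⊠ T) ((O ⊠ K) ⊠ (T ⊠ K)) :=
  relabel (X := (O ⊠ T) ⊠ (K ⊠ K)) (Y := (O ⊠ K) ⊠ (T ⊠ K)) (prodProdProdComm _ _ _ _)
    ∘ₗ append (maxEntOp K)

theorem spread_apply {O B K : QSys} (M : Op ((O ⊠ B) ⊠ K)) (p q : ((O ⊠ K) ⊠ (B ⊠ K))) :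
    spread O B K M p q = if p.1.2 = p.2.2 ∧ q.1.2 = q.2.2 then
      M ((p.1.1, p.2.1), p.1.2) ((q.1.1, q.2.1), q.1.2) else 0 := by
  rw [spread, push_apply, sum_eq_single ((p.1.1, p.2.1), p.1.2),
    sum_eq_single ((q.1.1, q.2.1), q.1.2)]
  · obtain ⟨⟨a, b⟩, c, d⟩ := p
    obtain ⟨⟨a', b'⟩, c', d'⟩ := q
    simp
  · intro x _ hx
    rw [if_neg]
    rintro ⟨-, h⟩
    exact hx (by rw [← h])
  · simp
  · intro x _ hx
    refine sum_eq_zero fun y _ => if_neg ?_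
    rintro ⟨h, -⟩
    exact hx (by rw [← h])
  · simp

theorem card_inv_smul_sum_le {α : Type} [Fintype α] [Nonempty α] {X : QSys}
    (u v : α → X → ℂ) {c t : ℝ} (ht : 0 < t)
    (hu : ∑ a, nsq (u a) = Fintype.card α) (hv : ∑ a, nsq (v a) = Fintype.card α)
    (h : ∑ a, nsq (u a - v a) ≤ Fintype.card α * c) :
    traceNorm ((Fintype.card α : ℂ)⁻¹ • ∑ a, (rankOne (u a) - rankOne (v a)))
      ≤ 2 * t + c / (2 * t) := by
  have hc : (0 : ℝ) < Fintype.card α := by exact_mod_cast Fintype.card_pos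
  have h1 : ∀ a, traceNorm (rankOne (u a) - rankOne (v a))
      ≤ t * (nsq (u a) + nsq (v a)) + nsq (u a - v a) / (2 * t) := by
    intro a
    refine (traceNorm_rankOne_sub_le _ _).trans ?_
    have h2 := Real.sq_sqrt (nsq_nonneg (u a))
    have h3 := Real.sq_sqrt (nsq_nonneg (v a))
    have h4 := Real.sq_sqrt (nsq_nonneg (u a - v a))
    set x := √(nsq (u a))
    set y := √(nsq (v a))
    set z := √(nsq (u a - v a))
    rw [← h2, ← h3, ← h4]
    have h5 : t * (x ^ 2 + y ^ 2) + z ^ 2 / (2 * t) - (x + y) * z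
        = (t * (x - y) ^ 2 / 2) + (t * (x + y) - z) ^ 2 / (2 * t) := by
      field_simp; ring
    have h6 : 0 ≤ (t * (x - y) ^ 2 / 2) + (t * (x + y) - z) ^ 2 / (2 * t) := by positivity
    linarith
  refine (traceNorm_smul_le _ _).trans ?_
  rw [norm_inv, Complex.norm_natCast, inv_mul_le_iff₀ hc]
  refine (traceNorm_sum_le _ _).trans ((sum_le_sum fun a _ => h1 a).trans ?_)
  rw [sum_add_distrib, ← mul_sum, sum_add_distrib, hu, hv, ← Finset.sum_div]
  have : (∑ a, nsq (u a - v a)) / (2 * t) ≤ Fintype.card α * c / (2 * t) := by gcongr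
  calc _ ≤ t * (Fintype.card α + Fintype.card α) + Fintype.card α * c / (2 * t) := by linarith
    _ = _ := by ring

variable {ι : Type} [Fintype ι] [DecidableEq ι] {K : ι → QSys} {E O B T' W : QSys}

/-- Bob's decoding isometry: the isometry `V`, and then the operator `w k` on the environment,
controlled by the copied value `k`. -/
def ctrlDecoder {K : QSys} (V : Matrix (T' ⊠ E) B ℂ) (w : K → Op E) :
    Matrix ((T' ⊠ K) ⊠ E) (B ⊠ K) ℂ :=
  Matrix.of fun p q => if p.1.2 = q.2 then
    (((1 : Op T') ⊗ₖ w q.2 : Op (T' ⊠ E)) * V) (p.1.1, p.2) q.1 else 0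

theorem ctrlDecoder_isometry {K : QSys} {V : Matrix (T' ⊠ E) B ℂ}
    (hV : Vᴴ * V = 1) {w : K → Op E} (hw : ∀ k, (w k)ᴴ * w k = 1) :
    (ctrlDecoder V w)ᴴ * ctrlDecoder V w = 1 := by
  have h : ∀ k, (((1 : Op T') ⊗ₖ w k : Op (T' ⊠ E)) * V)ᴴ *
      (((1 : Op T') ⊗ₖ w k : Op (T' ⊠ E)) * V) = 1 := by
    intro k
    rw [conjTranspose_mul, Matrix.mul_assoc, ← Matrix.mul_assoc _ _ V,
      conjTranspose_kronecker, ← mul_kronecker_mul, hw]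
    simp [hV]
  ext ⟨b, k⟩ ⟨b', k'⟩
  rw [mul_apply]
  simp only [conjTranspose_apply, ctrlDecoder, of_apply, sum_prod_type]
  by_cases hk : k = k'
  · subst hk
    have h2 := congrFun (congrFun (h k) b) b'
    rw [mul_apply, sum_prod_type] at h2
    have h3 : (1 : Op (B ⊠ K)) (b, k) (b', k) = (1 : Op B) b b' := by
      simp [one_apply]
    rw [h3, ← h2]
    refine sum_congr rfl fun t _ => ?_
    rw [sum_eq_single k]
    · simp
    · intro c _ hc; simp [hc]
    · simp
  · have h3 : (1 : Op (B ⊠ K)) (b, k) (b', k') = 0 := by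
      simp [hk]
    rw [h3]
    refine sum_eq_zero fun t _ => sum_eq_zero fun c _ => sum_eq_zero fun e _ => ?_
    by_cases hc : c = k
    · have : c ≠ k' := fun h => hk (hc.symm.trans h)
      simp [this]
    · simp [hc]

/-- The vector of amplitudes with copied value `k`, after Bob's isometry `V`. -/
def decoded {K I : QSys} (V : Matrix (T' ⊠ E) B ℂ)
    (A : Matrix (((O ⊠ B) ⊠ K) ⊠ W) I ℂ) {R : QSys}
    (ψ : Matrix I R ℂ) (k : K) :
    Matrix E (((O ⊠ T') ⊠ W) ⊠ R) ℂ :=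
  Matrix.of fun e q => ∑ b, V (q.1.1.2, e) b * (A * ψ) (((q.1.1.1, b), k), q.1.2) q.2

/-- The amplitudes, diagonal in the two copies of `K`, given by a family of matrices. -/
def diagAmp {K I : QSys} (g : K → Matrix E (((O ⊠ T') ⊠ W) ⊠ I) ℂ) :
    Matrix (((O ⊠ K) ⊠ (T' ⊠ K)) ⊠ (E ⊠ W)) I ℂ :=
  Matrix.of fun p i => if p.1.1.2 = p.1.2.2 then
    g p.1.1.2 p.2.1 (((p.1.1.1, p.1.2.1), p.2.2), i) else 0

theorem nsq_vec_diagAmp {K I : QSys}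
    (g : K → Matrix E (((O ⊠ T') ⊠ W) ⊠ I) ℂ) :
    nsq (vec (diagAmp g)) = ∑ k, nsq (vec (g k)) := by
  simp only [nsq, vec, diagAmp, of_apply, sum_prod_type]
  have h : ∀ o k, (∑ t, ∑ k', ∑ e, ∑ w, ∑ i, ‖if k = k' then
      g k e (((o, t), w), i) else 0‖ ^ 2) = ∑ t, ∑ e, ∑ w, ∑ i, ‖g k e (((o, t), w), i)‖ ^ 2 := by
    intro o k
    refine sum_congr rfl fun t _ => ?_
    rw [sum_eq_single k]
    · simp
    · intro b _ hb; simp [hb.symm]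
    · simp
  simp only [h]
  rw [sum_comm]
  refine sum_congr rfl fun k _ => ?_
  rw [Finset.sum_comm' (s := Finset.univ) (t := fun _ => Finset.univ) (t' := Finset.univ)
    (s' := fun _ => Finset.univ) (by simp)]
  rw [sum_comm]
  have h2 : ∀ o : O, (∑ t, ∑ e, ∑ w, ∑ i, ‖g k e (((o, t), w), i)‖ ^ 2)
      = ∑ e, ∑ t, ∑ w, ∑ i, ‖g k e (((o, t), w), i)‖ ^ 2 := fun o => sum_comm
  simp only [h2]
  rw [sum_comm]

theorem ext_ptrace_conj_diagAmp {K I : QSys}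
    (g : K → Matrix E (((O ⊠ T') ⊠ W) ⊠ I) ℂ) {R : QSys}
    (ψ : Matrix I R ℂ) :
    ext (ptrace ∘ₗ conj (diagAmp g)) R (pureOp ψ)
      = ext ptrace R (pureOp (diagAmp (E := E) (O := O) (T' := T') (W := W) (I := R)
          fun k => Matrix.of fun e q => ∑ i, g k e (q.1, i) * ψ i q.2)) := by
  rw [ext_comp, comp_apply, ext_conj_pureOp]
  congr 2
  ext p r
  rw [mul_apply]
  simp only [diagAmp, of_apply]
  split_ifs <;> simp

theorem sum_sandwich {β γ : Type} [Fintype β] [Fintype γ] (P P' : β → ℂ) (a a' : β → γ → ℂ) :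
    ∑ b', (∑ b, P b * ∑ x, a b x * star (a' b' x)) * star (P' b')
      = ∑ x, (∑ b, P b * a b x) * star (∑ b', P' b' * a' b' x) := by
  simp only [star_sum, Finset.sum_mul_sum]
  rw [sum_comm (s := (Finset.univ : Finset γ))]
  simp only [sum_mul, mul_sum]
  rw [sum_comm]
  refine sum_congr rfl fun b _ => ?_
  rw [sum_comm (s := (Finset.univ : Finset γ))]
  refine sum_congr rfl fun b' _ => sum_congr rfl fun x _ => ?_
  rw [star_mul']; ring

theorem one_kron_mul_apply (w : Op E) (V : Matrix (T' ⊠ E) B ℂ)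
    (t : T') (e : E) (b : B) :
    (((1 : Op T') ⊗ₖ w : Op (T' ⊠ E)) * V) (t, e) b = ∑ e', w e e' * V (t, e') b := by
  rw [mul_apply, sum_prod_type, sum_eq_single t]
  · simp
  · intro t' _ h; simp [h.symm]
  · simp

theorem decoder_comp_spread {K I : QSys} {𝓕 : SuperOp I ((O ⊠ B) ⊠ K)}
    {A : Matrix (((O ⊠ B) ⊠ K) ⊠ W) I ℂ} (hA : ∀ ρ, ptrace (conj A ρ) = 𝓕 ρ)
    (V : Matrix (T' ⊠ E) B ℂ) (w : K → Op E) :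
    extL (ptrace ∘ₗ conj (ctrlDecoder V w)) (O ⊠ K) ∘ₗ spread O B K ∘ₗ 𝓕
      = ptrace ∘ₗ conj (diagAmp (E := E) (O := O) (T' := T') (W := W) (I := I)
          fun k => w k * decoded V A (1 : Op I) k) := by
  refine superOp_ext fun i i' => ?_
  ext ⟨⟨o, k⟩, t, k₂⟩ ⟨⟨o', k'⟩, t', k₂'⟩
  have hR : (ptrace ∘ₗ conj (diagAmp (E := E) (O := O) (T' := T') (W := W) (I := I)
          fun k => w k * decoded V A (1 : Op I) k)) (Matrix.single i i' 1)
          ((o, k), t, k₂) ((o', k'), t', k₂')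
      = ∑ e, ∑ x, diagAmp (E := E) (O := O) (T' := T') (W := W) (I := I)
          (fun k => w k * decoded V A (1 : Op I) k) (((o, k), t, k₂), (e, x)) i *
        star (diagAmp (E := E) (O := O) (T' := T') (W := W) (I := I)
          (fun k => w k * decoded V A (1 : Op I) k) (((o', k'), t', k₂'), (e, x)) i') := by
    rw [← Fintype.sum_prod_type' (f := fun e x => diagAmp (E := E) (O := O) (T' := T') (W := W)
      (I := I) (fun k => w k * decoded V A (1 : Op I) k) (((o, k), t, k₂), (e, x)) i *
        star (diagAmp (E := E) (O := O) (T' := T') (W := W) (I := I)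
          (fun k => w k * decoded V A (1 : Op I) k) (((o', k'), t', k₂'), (e, x)) i'))]
    refine sum_congr rfl fun z _ => ?_
    exact conj_single_apply _ _ _ _ _
  rw [hR]
  have hF : ∀ y y', 𝓕 (Matrix.single i i' 1) y y' = ∑ x, A (y, x) i * star (A (y', x) i') := by
    intro y y'
    rw [← hA]
    exact sum_congr rfl fun x _ => conj_single_apply _ _ _ _ _
  have hd : ∀ k e o t x i, (w k * decoded V A (1 : Op I) k) e (((o, t), x), i)
      = ∑ b, (((1 : Op T') ⊗ₖ w k : Op (T' ⊠ E)) * V) (t, e) b * A (((o, b), k), x) i := by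
    intro k e o t x i
    have h1 : ∀ b, (((1 : Op T') ⊗ₖ w k : Op (T' ⊠ E)) * V) (t, e) b * A (((o, b), k), x) i
        = ∑ e', w k e e' * (V (t, e') b * A (((o, b), k), x) i) := fun b => by
      rw [one_kron_mul_apply, sum_mul]
      exact sum_congr rfl fun e' _ => mul_assoc _ _ _
    rw [sum_congr rfl fun b _ => h1 b, sum_comm, mul_apply]
    refine sum_congr rfl fun e' _ => ?_
    change w k e e' * ∑ b, V (t, e') b * (A * (1 : Op I)) (((o, b), k), x) i = _
    rw [Matrix.mul_one, mul_sum]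
  obtain ⟨P, hP⟩ : ∃ P : K → T' → E → B → ℂ, ∀ k t e b,
      (((1 : Op T') ⊗ₖ w k : Op (T' ⊠ E)) * V) (t, e) b = P k t e b := ⟨_, fun _ _ _ _ => rfl⟩
  have hC : ∀ p q, ctrlDecoder V w p q = if p.1.2 = q.2 then P q.2 p.1.1 p.2 q.1 else 0 :=
    fun p q => by rw [← hP]; rfl
  simp only [hP] at hd
  simp only [diagAmp, of_apply, hd]
  -- the left-hand side
  rw [comp_apply, comp_apply, extL_apply, comp_apply]
  set c := spread O B K (𝓕 (Matrix.single i i' 1)) with hc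
  change ∑ e, conj (ctrlDecoder V w) _ ((t, k₂), e) ((t', k₂'), e) = _
  refine sum_congr rfl fun e _ => ?_
  rw [conj_apply, mul_apply]
  simp only [mul_apply, conjTranspose_apply, of_apply, hc, spread_apply,
    hC, sum_prod_type, hF]
  by_cases hk : k = k₂
  swap
  · simp only [hk, if_false, zero_mul, Finset.sum_const_zero]
    refine sum_eq_zero fun b' _ => sum_eq_zero fun a' _ => ?_
    rw [sum_eq_zero, zero_mul]
    refine fun b _ => sum_eq_zero fun a _ => ?_
    by_cases h1 : k₂ = a
    · have : ¬ (k = a ∧ k' = a') := fun h => hk (h.1.trans h1.symm)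
      rw [if_neg this, mul_zero]
    · rw [if_neg h1, zero_mul]
  by_cases hk' : k' = k₂'
  swap
  · simp only [hk', if_false, star_zero, mul_zero, Finset.sum_const_zero]
    refine sum_eq_zero fun b' _ => sum_eq_zero fun a' _ => ?_
    by_cases h1 : k₂' = a'
    · have : ∀ a, ¬ (k = a ∧ k' = a') := fun a h => hk' (h.2.trans h1.symm)
      simp [this]
    · rw [if_neg h1, star_zero, mul_zero]
  subst hk hk'
  have e1 : ∀ b' : B,
      (∑ a', (∑ b, ∑ a, (if k = a then P a t e b else 0) *
        (if k = a ∧ k' = a' then ∑ x, A (((o, b), k), x) i * star (A (((o', b'), k'), x) i') else 0))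
        * star (if k' = a' then P a' t' e b' else 0))
      = (∑ b, P k t e b *
          ∑ x, A (((o, b), k), x) i * star (A (((o', b'), k'), x) i'))
        * star (P k' t' e b') := by
    intro b'
    rw [sum_eq_single k']
    · rw [if_pos rfl]
      congr 1
      refine sum_congr rfl fun b _ => ?_
      rw [sum_eq_single k]
      · simp
      · intro a _ ha; simp [ha.symm]
      · simp
    · intro a _ ha; simp [ha.symm]
    · simp
  rw [sum_congr rfl fun b' _ => e1 b']
  simp only [if_true]
  exact sum_sandwich _ _ _ _

end Decoding

section CoherentDecoding

variable {O B T' E W I R : QSys}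

theorem traceNorm_ext_ptrace_le {X : QSys} (M : Op ((X ⊠ W) ⊠ R)) :
    traceNorm (ext (ptrace : SuperOp (X ⊠ W) X) R M) ≤ traceNorm M :=
  traceNorm_channel_le (isChannel_ptrace.ext R) M

theorem decoded_eq_sum {K : QSys} (V : Matrix (T' ⊠ E) B ℂ)
    (A : Matrix (((O ⊠ B) ⊠ K) ⊠ W) I ℂ) (ψ : Matrix I R ℂ)
    (w : Op E) (k : K) :
    (Matrix.of fun e q => ∑ i, (w * decoded V A (1 : Op I) k) e (q.1, i) * ψ i q.2 :
      Matrix E (((O ⊠ T') ⊠ W) ⊠ R) ℂ) = w * decoded V A ψ k := by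
  ext e q
  rw [of_apply, mul_apply]
  have h1 : ∀ i, (w * decoded V A (1 : Op I) k) e (q.1, i) * ψ i q.2
      = ∑ e', w e e' * decoded V A (1 : Op I) k e' (q.1, i) * ψ i q.2 := fun i => by
    rw [mul_apply, sum_mul]
  rw [sum_congr rfl fun i _ => h1 i, sum_comm]
  refine sum_congr rfl fun e' _ => ?_
  change ∑ i, w e e' * (∑ b, V (q.1.1.2, e') b * (A * (1 : Op I)) (((q.1.1.1, b), k), q.1.2) i)
      * ψ i q.2 = w e e' * ∑ b, V (q.1.1.2, e') b * (A * ψ) (((q.1.1.1, b), k), q.1.2) q.2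
  rw [Matrix.mul_one]
  simp only [mul_sum, sum_mul]
  rw [sum_comm]
  refine sum_congr rfl fun b _ => ?_
  rw [mul_apply, mul_sum, mul_sum]
  exact sum_congr rfl fun i _ => by ring

theorem ext_ptrace_conj_decoded {K : QSys} (V : Matrix (T' ⊠ E) B ℂ)
    (A : Matrix (((O ⊠ B) ⊠ K) ⊠ W) I ℂ) (ψ : Matrix I R ℂ)
    (w : K → Op E) (c : K → K) :
    ext (ptrace ∘ₗ conj (diagAmp (E := E) (O := O) (T' := T') (W := W)
      fun k => w k * decoded V A (1 : Op I) (c k))) R (pureOp ψ)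
      = ext ptrace R (pureOp (diagAmp (E := E) (O := O) (T' := T') (W := W) (I := R)
          fun k => w k * decoded V A ψ (c k))) := by
  rw [ext_ptrace_conj_diagAmp]
  exact congrArg _ (congrArg pureOp (congrArg diagAmp
    (funext fun k => decoded_eq_sum V A ψ (w k) (c k))))

theorem nsq_vec_eq_trace {X : QSys} (ψ : Matrix X R ℂ) :
    ((nsq (vec ψ) : ℝ) : ℂ) = (pureOp ψ).trace := (trace_rankOne (X := X ⊠ R) _).symm

theorem sum_nsq_decoded {K : QSys} {V : Matrix (T' ⊠ E) B ℂ} (hV : Vᴴ * V = 1)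
    {A : Matrix (((O ⊠ B) ⊠ K) ⊠ W) I ℂ} (hA : Aᴴ * A = 1)
    (ψ : Matrix I R ℂ) :
    ∑ k, nsq (vec (decoded V A ψ k)) = nsq (vec ψ) := by
  have hch : IsChannel (extL (ptrace ∘ₗ conj (ctrlDecoder (K := K) V fun _ => (1 : Op E))) (O ⊠ K)
      ∘ₗ spread O B K ∘ₗ ptrace ∘ₗ conj A) :=
    ((isChannel_ptrace.comp (isChannel_conj _ (ctrlDecoder_isometry hV (by simp)))).extL _).comp
      ((isChannel_spread O B K).comp (isChannel_ptrace.comp (isChannel_conj A hA)))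
  have h1 := decoder_comp_spread (𝓕 := ptrace ∘ₗ conj A) (A := A) (fun _ => rfl) V
    (fun _ => (1 : Op E))
  have h2 := ext_ptrace_conj_decoded V A ψ (fun _ => (1 : Op E)) (fun k => k)
  rw [← h1] at h2
  have h3 := congrArg Matrix.trace h2
  have h4 := (hch.ext R).tracePreserving (pureOp ψ)
  have h5 := (isChannel_ptrace.ext R).tracePreserving
    (pureOp (diagAmp (fun k => (1 : Op E) * decoded V A ψ k)))
  rw [h5, h4, ← nsq_vec_eq_trace, ← nsq_vec_eq_trace, nsq_vec_diagAmp] at h3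
  simp only [Matrix.one_mul] at h3
  exact_mod_cast h3.symm

theorem entangle_comp_decoder {K : QSys} {𝓕 : SuperOp I ((O ⊠ B) ⊠ K)} {D : SuperOp B T'}
    {A : Matrix (((O ⊠ B) ⊠ K) ⊠ W) I ℂ} (hA : ∀ ρ, ptrace (conj A ρ) = 𝓕 ρ)
    {V : Matrix (T' ⊠ E) B ℂ} (hV : ∀ ρ, ptrace (conj V ρ) = D ρ) :
    entangle O T' K ∘ₗ extL D O ∘ₗ ptrace ∘ₗ 𝓕
      = (Fintype.card K : ℂ)⁻¹ • ∑ k', ptrace ∘ₗ conj (diagAmp (E := E) (O := O) (T' := T')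
          (W := W) (I := I) (K := K) fun _ => decoded V A (1 : Op I) k') := by
  refine superOp_ext fun i i' => ?_
  ext ⟨⟨o, k⟩, t, k₂⟩ ⟨⟨o', k'⟩, t', k₂'⟩
  have hR : ∀ κ, (ptrace ∘ₗ conj (diagAmp (E := E) (O := O) (T' := T') (W := W) (I := I) (K := K)
          fun _ => decoded V A (1 : Op I) κ)) (Matrix.single i i' 1)
          ((o, k), t, k₂) ((o', k'), t', k₂')
      = if k = k₂ ∧ k' = k₂' then ∑ e, ∑ x, (∑ b, V (t, e) b * A (((o, b), κ), x) i) *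
        star (∑ b, V (t', e) b * A (((o', b), κ), x) i') else 0 := by
    intro κ
    trans ∑ z : E × W, (if k = k₂ then
        (∑ b, V (t, z.1) b * A (((o, b), κ), z.2) i) else 0) *
        star (if k' = k₂' then (∑ b, V (t', z.1) b * A (((o', b), κ), z.2) i') else 0)
    · refine sum_congr rfl fun z _ => ?_
      refine (conj_single_apply _ _ _ _ _).trans ?_
      simp only [diagAmp, decoded, of_apply, Matrix.mul_one]
    · rw [sum_prod_type]
      by_cases h : k = k₂ <;> by_cases h' : k' = k₂' <;> simp [h, h']
  have hF : ∀ y y', ptrace (𝓕 (Matrix.single i i' 1)) y y'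
      = ∑ z : K × W, A ((y, z.1), z.2) i * star (A ((y', z.1), z.2) i') := by
    intro y y'
    rw [sum_prod_type]
    refine sum_congr rfl fun κ _ => ?_
    rw [← hA]
    exact sum_congr rfl fun x _ => conj_single_apply _ _ _ _ _
  have hL : (entangle O T' K ∘ₗ extL D O ∘ₗ ptrace ∘ₗ 𝓕) (Matrix.single i i' 1)
      ((o, k), t, k₂) ((o', k'), t', k₂')
      = (extL D O (ptrace (𝓕 (Matrix.single i i' 1)))) (o, t) (o', t') *
        (if k = k₂ ∧ k' = k₂' then (Fintype.card K : ℂ)⁻¹ else 0) := rfl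
  rw [hL, LinearMap.smul_apply, LinearMap.sum_apply, Matrix.smul_apply, Matrix.sum_apply]
  simp only [hR]
  by_cases hk : k = k₂ ∧ k' = k₂'
  swap
  · simp [hk]
  simp only [hk, and_self, if_true]
  rw [mul_comm, smul_eq_mul]
  congr 1
  rw [extL_apply, ← hV]
  change ∑ e, conj V _ (t, e) (t', e) = _
  rw [sum_comm]
  refine sum_congr rfl fun e _ => ?_
  rw [conj_apply, mul_apply]
  simp only [mul_apply, conjTranspose_apply, of_apply, hF]
  rw [sum_sandwich, sum_prod_type]

end CoherentDecoding

/-- Bob's decoder: with a uniformly random value `k'`, the corrections from the copied value `k`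
to `k'` are applied to the environment of the original decoder. -/
def coherentDecoder {ι : Type} [Fintype ι] [DecidableEq ι] {K : ι → QSys} {E B T' : QSys}
    (V : Matrix (T' ⊠ E) B ℂ) (U : ∀ j, (K j) → Op E) :
    SuperOp (B ⊠ QSys.pi K) (T' ⊠ QSys.pi K) :=
  (Fintype.card (QSys.pi K) : ℂ)⁻¹ • ∑ k', ptrace ∘ₗ
    conj (ctrlDecoder V fun k => hybridOp U Finset.univ.toList k k')

theorem isChannel_coherentDecoder {ι : Type} [Fintype ι] [DecidableEq ι] {K : ι → QSys}
    {E B T' : QSys} {V : Matrix (T' ⊠ E) B ℂ} (hV : Vᴴ * V = 1)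
    {U : ∀ j, (K j) → Op E} (hU : ∀ j a, (U j a)ᴴ * U j a = 1) :
    IsChannel (coherentDecoder V U) :=
  IsChannel.average fun k' => isChannel_ptrace.comp
    (isChannel_conj _ (ctrlDecoder_isometry hV fun k => hybridOp_isometry hU _ k k'))

/-- If the environment of the decoder depends on each copied value only through a unitary, then the
coherent copies and the decoder create a maximally entangled state next to the decoded output. -/
theorem coherent_decoding {ι : Type} [Fintype ι] [DecidableEq ι] {K : ι → QSys}
    {O B T' E W : QSys} {T : Resource} {𝓕 : SuperOp T.In ((O ⊠ B) ⊠ QSys.pi K)}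
    {A : Matrix (((O ⊠ B) ⊠ QSys.pi K) ⊠ W) T.In ℂ} (hA : Aᴴ * A = 1)
    (hA𝓕 : ∀ ρ, ptrace (conj A ρ) = 𝓕 ρ) {D : SuperOp B T'}
    {V : Matrix (T' ⊠ E) B ℂ} (hV : Vᴴ * V = 1)
    (hVD : ∀ ρ, ptrace (conj V ρ) = D ρ) {U : ∀ j, (K j) → Op E}
    (hU : ∀ j a, (U j a)ᴴ * U j a = 1) {ε t : ℝ} (ht : 0 < t)
    (hs : ∀ (R : QSys) (ψ : Matrix T.In R ℂ), T.IsExtension (pureOp ψ) →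
      ∀ j, ∑ k, ∑ a, nsq (vec ((U j a)ᴴ * U j (k j) * decoded V A ψ k
        - decoded V A ψ (Function.update k j a))) ≤ Fintype.card (K j) * ε) :
    Near T (2 * t + 2 * (2 ^ Fintype.card ι - 1) * ε / (2 * t))
      (extL (coherentDecoder V U) (O ⊠ QSys.pi K) ∘ₗ spread O B (QSys.pi K) ∘ₗ 𝓕)
      (entangle O T' (QSys.pi K) ∘ₗ extL D O ∘ₗ ptrace ∘ₗ 𝓕) := by
  refine near_of_pure fun R ψ hψ => ?_
  have hn : nsq (vec ψ) = 1 := by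
    have := nsq_vec_eq_trace ψ
    rw [hψ.1.2] at this
    exact_mod_cast this
  set G := decoded V A ψ with hG
  have hGn : ∑ k, nsq (vec (G k)) = 1 := by rw [hG, sum_nsq_decoded hV hA, hn]
  let L : List ι := Finset.univ.toList
  have hb := hybrid_bound hU G (hs R ψ hψ) L (Finset.nodup_toList _)
  have hmix : ∀ k k' : (QSys.pi K), mix L k k' = k' := by
    intro k k'; ext j; simp [mix, L]
  have hlen : L.length = Fintype.card ι := by simp [L]
  simp only [hmix, hlen] at hb
  set u : (QSys.pi K) → _ := fun k' => vec (diagAmp (O := O) (T' := T') (W := W) (I := R)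
    fun k => hybridOp U L k k' * G k) with hu
  set v : (QSys.pi K) → _ := fun k' => vec (diagAmp (K := QSys.pi K) (O := O) (T' := T')
    (W := W) (I := R) fun _ => G k') with hv
  have h1 : extL (coherentDecoder V U) (O ⊠ QSys.pi K) ∘ₗ spread O B (QSys.pi K) ∘ₗ 𝓕
      = (Fintype.card (QSys.pi K) : ℂ)⁻¹ • ∑ k', ptrace ∘ₗ conj (diagAmp (E := E) (O := O)
        (T' := T') (W := W) fun k => hybridOp U L k k' * decoded V A (1 : Op T.In) k) := by
    have h2 : extL (coherentDecoder V U) (O ⊠ QSys.pi K)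
        = (Fintype.card (QSys.pi K) : ℂ)⁻¹ • ∑ k', extL (ptrace ∘ₗ
          conj (ctrlDecoder V fun k => hybridOp U L k k')) (O ⊠ QSys.pi K) := by
      refine LinearMap.ext fun M => Matrix.ext fun p q => ?_
      rw [extL_apply, coherentDecoder]
      simp only [LinearMap.smul_apply, LinearMap.sum_apply, Matrix.smul_apply, Matrix.sum_apply,
        extL_apply]
      rfl
    rw [h2, LinearMap.smul_comp]
    congr 1
    refine LinearMap.ext fun M => ?_
    simp only [comp_apply, LinearMap.sum_apply]
    refine sum_congr rfl fun k' _ => ?_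
    exact LinearMap.congr_fun (decoder_comp_spread hA𝓕 V fun k => hybridOp U L k k') M
  have hext : ∀ (c : ℂ) (Φ : (QSys.pi K) → SuperOp T.In ((O ⊠ QSys.pi K) ⊠ (T' ⊠ QSys.pi K))),
      ext (c • ∑ k', Φ k') R (pureOp ψ) = c • ∑ k', ext (Φ k') R (pureOp ψ) := by
    intro c Φ
    ext p q
    simp only [ext_apply, LinearMap.smul_apply, LinearMap.sum_apply, Matrix.smul_apply,
      Matrix.sum_apply]
  have h3 : ∀ k', ext (ptrace ∘ₗ conj (diagAmp (E := E) (O := O) (T' := T') (W := W)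
      fun k => hybridOp U L k k' * decoded V A (1 : Op T.In) k)) R (pureOp ψ)
      = ext ptrace R (rankOne (u k')) := by
    intro k'
    exact ext_ptrace_conj_decoded V A ψ _ (fun k => k)
  have h4 : ∀ k', ext (ptrace ∘ₗ conj (diagAmp (K := QSys.pi K) (E := E) (O := O) (T' := T')
      (W := W) fun _ => decoded V A (1 : Op T.In) k')) R (pureOp ψ)
      = ext ptrace R (rankOne (v k')) := by
    intro k'
    have h5 := ext_ptrace_conj_decoded V A ψ (fun _ => (1 : Op E)) (fun _ => k')
    simp only [Matrix.one_mul] at h5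
    exact h5
  rw [h1, entangle_comp_decoder hA𝓕 hVD, hext, hext]
  simp only [h3, h4]
  have h6 : (Fintype.card (QSys.pi K) : ℂ)⁻¹ • ∑ k', ext ptrace R (rankOne (u k'))
      - (Fintype.card (QSys.pi K) : ℂ)⁻¹ • ∑ k', ext ptrace R (rankOne (v k'))
      = ext ptrace R ((Fintype.card (QSys.pi K) : ℂ)⁻¹ •
        ∑ k', (rankOne (u k') - rankOne (v k'))) := by
    rw [map_smul, map_sum, ← smul_sub, ← Finset.sum_sub_distrib]
    simp only [map_sub]
  rw [h6]
  refine (traceNorm_ext_ptrace_le _).trans (card_inv_smul_sum_le u v ht ?_ ?_ ?_)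
  · have : ∀ k', nsq (u k') = 1 := by
      intro k'
      refine (nsq_vec_diagAmp _).trans ?_
      rw [← hGn]
      exact sum_congr rfl fun k _ => nsq_vec_mul_of_isometry (hybridOp_isometry hU _ _ _) _
    simp [this]
  · have : ∀ k', nsq (v k') = Fintype.card (QSys.pi K) * nsq (vec (G k')) := by
      intro k'
      refine (nsq_vec_diagAmp _).trans ?_
      rw [Finset.sum_const, Finset.card_univ, nsmul_eq_mul]
    simp only [this]
    rw [← mul_sum, hGn, mul_one]
  · have : ∀ k', nsq (u k' - v k')
        = ∑ k, nsq (vec (hybridOp U L k k' * G k - G k')) := by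
      intro k'
      rw [← nsq_vec_diagAmp]
      congr 1
      ext ⟨p, i⟩
      change diagAmp _ p i - diagAmp _ p i = diagAmp _ p i
      simp only [diagAmp, of_apply]
      split_ifs
      · rfl
      · exact sub_zero _
    simp only [this]
    rw [sum_comm]
    refine hb.trans (le_of_eq ?_)
    ring

section IsConj

variable {X Y Z W X' Y' : QSys}

/-- Conjugation by an isometry. -/
def IsConj (Φ : SuperOp X Y) : Prop :=
  ∃ V : Matrix Y X ℂ, Vᴴ * V = 1 ∧ Φ = conj V

theorem IsConj.isChannel {Φ : SuperOp X Y} (h : IsConj Φ) : IsChannel Φ := by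
  obtain ⟨V, hV, rfl⟩ := h
  exact isChannel_conj V hV

theorem IsConj.comp {Φ : SuperOp X Y} {Ψ : SuperOp Y Z} (hΨ : IsConj Ψ) (hΦ : IsConj Φ) :
    IsConj (Ψ ∘ₗ Φ) := by
  obtain ⟨V, hV, rfl⟩ := hΦ
  obtain ⟨U, hU, rfl⟩ := hΨ
  refine ⟨U * V, ?_, conj_comp V U⟩
  rw [conjTranspose_mul, Matrix.mul_assoc, ← Matrix.mul_assoc Uᴴ, hU, Matrix.one_mul, hV]

theorem isConj_push {f : X → Y} (hf : Function.Injective f) : IsConj (push f) :=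
  ⟨basisMap f, basisMap_isometry hf, rfl⟩

theorem isConj_relabel (e : X ≃ Y) : IsConj (relabel e) := by
  rw [← push_equiv]; exact isConj_push e.injective

theorem isConj_append_one : IsConj (append (1 : Op QSys.unit) : SuperOp X (X ⊠ QSys.unit)) := by
  have : (append (1 : Op QSys.unit) : SuperOp X (X ⊠ QSys.unit))
      = relabel (X := X) (Y := X ⊠ QSys.unit) (prodPUnit _).symm := by
    refine LinearMap.ext fun M => Matrix.ext fun p q => ?_
    exact mul_one _
  rw [this]
  exact isConj_relabel _

theorem isConj_id : IsConj (LinearMap.id : SuperOp X X) :=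
  ⟨1, by simp, conj_one.symm⟩

theorem IsConj.ext {Φ : SuperOp X Y} (h : IsConj Φ) (W : QSys) : IsConj (ext Φ W) := by
  obtain ⟨V, hV, rfl⟩ := h
  refine ⟨V ⊗ₖ (1 : Op W), ?_, ext_conj V⟩
  rw [conjTranspose_kronecker, ← mul_kronecker_mul, hV]
  simp

theorem IsConj.tensor {Φ : SuperOp X Y} {Ψ : SuperOp X' Y'} (h : IsConj Φ) (h' : IsConj Ψ) :
    IsConj (tensor Φ Ψ) := by
  obtain ⟨V, hV, rfl⟩ := h
  obtain ⟨U, hU, rfl⟩ := h'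
  refine ⟨V ⊗ₖ U, ?_, tensor_conj V U⟩
  rw [conjTranspose_kronecker, ← mul_kronecker_mul, hV, hU]
  simp

end IsConj

/-! ### Runs of encoding layers -/

section Run

/-- The trace, as an operation to the null system. -/
def discard (X : QSys) : SuperOp X QSys.unit := ptraceLeft ∘ₗ append (1 : Op QSys.unit)

theorem discard_apply {X : QSys} (M : Op X) : discard X M = M.trace • (1 : Op QSys.unit) :=
  ptraceLeft_kron _ _

theorem isChannel_discard (X : QSys) : IsChannel (discard X) :=
  isChannel_ptraceLeft.comp (isChannel_append isState_unit)

theorem append_comp_ptrace {X W : QSys} :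
    append (1 : Op QSys.unit) ∘ₗ ptrace = extL (discard W) X := by
  refine superOp_ext_kron fun A B => ?_
  rw [extL_kron, comp_apply, ptrace_kron, discard_apply]
  exact (Matrix.smul_kronecker _ _ _).trans (Matrix.kronecker_smul _ _ _).symm

variable {ι : Type}

/-- The tensor product of maps between the systems along a list. -/
def envMap {Z Z' : ι → QSys} (Θ : ∀ j, SuperOp (Z j) (Z' j)) :
    (l : List ι) → SuperOp (sysList Z l) (sysList Z' l)
  | [] => LinearMap.id
  | j :: l => tensor (Θ j) (envMap Θ l)

theorem isChannel_envMap {Z Z' : ι → QSys} {Θ : ∀ j, SuperOp (Z j) (Z' j)}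
    (h : ∀ j, IsChannel (Θ j)) (l : List ι) : IsChannel (envMap Θ l) := by
  induction l with
  | nil => exact isChannel_id
  | cons j l ih => exact (h j).tensor ih

variable {N : ι → Resource}

theorem isConj_encodeStep {M : QSys} (j : ι) (l : List ι) (aux : QSys)
    {V : Matrix ((N j).Alice ⊠ aux) M ℂ} (hV : Vᴴ * V = 1) :
    IsConj (encodeStep j l aux V) :=
  (isConj_relabel _).comp (IsConj.ext ⟨V, hV, rfl⟩ _)

theorem Layers.isConj_run {L : Type} {E : ∀ j, ExtMap L (N j)} {lab : L}
    (h : ∀ j, IsConj ((E j).map lab)) : ∀ {l : List ι} {M M' : QSys} (ly : Layers N l M M'),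
    IsConj (ly.run E lab)
  | _, _, _, .nil _ => isConj_append_one
  | _, _, _, .cons j aux _ hV rest =>
    (isConj_relabel _).comp ((IsConj.ext (Layers.isConj_run h rest) _).comp
      ((isConj_relabel _).comp (((h j).ext _).comp (isConj_encodeStep j _ aux hV))))

theorem Layers.isChannel_run {L : Type} {E : ∀ j, ExtMap L (N j)} {lab : L}
    (h : ∀ j, IsChannel ((E j).map lab)) : ∀ {l : List ι} {M M' : QSys} (ly : Layers N l M M'),
    IsChannel (ly.run E lab)
  | _, _, _, .nil _ => isConj_append_one.isChannel
  | _, _, _, .cons j aux _ hV rest =>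
    (isChannel_relabel _).comp ((IsChannel.ext (Layers.isChannel_run h rest) _).comp
      ((isChannel_relabel _).comp (((h j).ext _).comp (isConj_encodeStep j _ aux hV).isChannel)))

theorem Layers.run_env {L L' : Type} {E : ∀ j, ExtMap L (N j)} {E' : ∀ j, ExtMap L' (N j)}
    {lab : L} {lab' : L'} {Θ : ∀ j, SuperOp (E j).Z (E' j).Z}
    (h : ∀ j, (E' j).map lab' = extL (Θ j) (N j).Out ∘ₗ (E j).map lab) :
    ∀ {l : List ι} {M M' : QSys} (ly : Layers N l M M'),
    ly.run E' lab' = extL (envMap Θ l) (M' ⊠ bobSys N l) ∘ₗ ly.run E lab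
  | _, _, _, .nil M => by
    change _ = extL LinearMap.id _ ∘ₗ _
    rw [extL_id]; rfl
  | _, _, _, .cons (M := M) (M' := M') j (l := l) aux V hV rest => by
    let m := (E j).map lab
    let r := rest.run E lab
    have h1 : ext ((E' j).map lab') (aux ⊠ srcSys N l)
        = ext (extL (Θ j) (N j).Out) (aux ⊠ srcSys N l) ∘ₗ ext m (aux ⊠ srcSys N l) := by
      rw [h, ext_comp]
    have h2 : ext (rest.run E' lab') ((N j).Bout ⊠ (E' j).Z)
        = ext (extL (envMap Θ l) (M' ⊠ bobSys N l)) ((N j).Bout ⊠ (E' j).Z) ∘ₗ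
          ext r ((N j).Bout ⊠ (E' j).Z) := by
      rw [Layers.run_env h rest, ext_comp]
    rw [Layers.run, Layers.run, h1, h2]
    have h3 := ext_comp_extL r (extL (Θ j) (N j).Bout)
    refine LinearMap.ext fun ρ => ?_
    simp only [comp_apply]
    have h4 := LinearMap.congr_fun h3 (relabel
          (X := (((N j).Aout ⊠ (N j).Bout) ⊠ (E j).Z) ⊠ (aux ⊠ srcSys N l))
          (Y := (((N j).Aout ⊠ aux) ⊠ srcSys N l) ⊠ ((N j).Bout ⊠ (E j).Z))
          ⟨fun p => (((p.1.1.1, p.2.1), p.2.2), (p.1.1.2, p.1.2)),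
           fun q => (((q.1.1.1, q.2.1), q.2.2), (q.1.1.2, q.1.2)), fun _ => rfl, fun _ => rfl⟩
          (ext m (aux ⊠ srcSys N l) (encodeStep j l aux V ρ)))
    refine (congrArg (fun z => relabel
          (X := ((M' ⊠ bobSys N l) ⊠ envSys E' l) ⊠ ((N j).Bout ⊠ (E' j).Z))
          (Y := (M' ⊠ ((N j).Bout ⊠ bobSys N l)) ⊠ ((E' j).Z ⊠ envSys E' l))
          ⟨fun p => ((p.1.1.1, (p.2.1, p.1.1.2)), (p.2.2, p.1.2)),
           fun q => (((q.1.1, q.1.2.2), q.2.2), (q.1.2.1, q.2.1)), fun _ => rfl, fun _ => rfl⟩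
          (ext (extL (envMap Θ l) (M' ⊠ bobSys N l)) ((N j).Bout ⊠ (E' j).Z) z)) h4).trans ?_
    rfl

theorem Layers.ptrace_run {L : Type} {E : ∀ j, ExtMap L (N j)} {lab : L}
    (h : ∀ j, ptrace ∘ₗ (E j).map lab = (N j).chan) {l : List ι} {M M' : QSys}
    (ly : Layers N l M M') :
    ptrace ∘ₗ ly.run E lab = ptrace ∘ₗ ly.run (fun j => ExtMap.plain (N j)) () := by
  have h1 := ly.run_env (E := E) (E' := fun j => ExtMap.plain (N j)) (lab := lab) (lab' := ())
    (Θ := fun j => discard (E j).Z) fun j => by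
      have h2 := append_comp_ptrace (X := (N j).Out) (W := (E j).Z)
      refine Eq.trans (b := (append 1 ∘ₗ ptrace) ∘ₗ (E j).map lab) ?_
        (congrArg (· ∘ₗ (E j).map lab) h2)
      rw [comp_assoc, h]
      rfl
  rw [h1]
  refine LinearMap.ext fun ρ => ?_
  exact (ptrace_extL (isChannel_envMap (fun j => isChannel_discard _) l).tracePreserving _).symm

end Run

/-! ### Joint systems along a list -/

section SysList

variable {ι : Type} {F F' G : ι → QSys}

/-- The basis element of the joint system with the given components. -/
def sysMk (g : ∀ j, (F j)) : (l : List ι) → (sysList F l)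
  | [] => ()
  | j :: l => (g j, sysMk g l)

theorem sysMk_congr {g g' : ∀ j, (F j)} : ∀ {l : List ι}, (∀ j ∈ l, g j = g' j) →
    sysMk g l = sysMk g' l
  | [], _ => rfl
  | j :: l, h => Prod.ext (h j (by simp)) (sysMk_congr fun j hj => h j (by simp [hj]))

theorem sysMk_eq_iff {g g' : ∀ j, (F j)} : ∀ {l : List ι}, sysMk g l = sysMk g' l ↔
    ∀ j ∈ l, g j = g' j
  | [] => ⟨fun _ _ h => absurd h List.not_mem_nil, fun _ => rfl⟩
  | j :: l => by
    rw [sysMk, sysMk, Prod.mk.injEq, sysMk_eq_iff]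
    simp

theorem exists_sysMk [DecidableEq ι] : ∀ {l : List ι}, l.Nodup →
    ∀ z : (sysList F l), ∃ g, sysMk g l = z
  | [], _, _ => ⟨fun j => Classical.arbitrary _, rfl⟩
  | j :: l, h, z => by
    obtain ⟨g, hg⟩ := exists_sysMk (List.nodup_cons.1 h).2 z.2
    refine ⟨Function.update g j z.1, Prod.ext (Function.update_self ..) ?_⟩
    rw [← hg]
    refine sysMk_congr fun i hi => Function.update_of_ne ?_ _ _
    rintro rfl
    exact (List.nodup_cons.1 h).1 hi

/-- The joint system along a list without repetitions of all indices. -/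
def sysPi [DecidableEq ι] {l : List ι} (h : l.Nodup) (h' : ∀ j, j ∈ l) :
    (sysList F l) ≃ ∀ j, (F j) :=
  (Equiv.ofBijective (fun g => sysMk g l)
    ⟨fun _ _ hg => funext fun j => sysMk_eq_iff.1 hg j (h' j), exists_sysMk h⟩).symm

/-- The componentwise map. -/
def sysMap (φ : ∀ j, (F j) → (F' j)) :
    (l : List ι) → (sysList F l) → (sysList F' l)
  | [], _ => ()
  | j :: l, z => (φ j z.1, sysMap φ l z.2)

theorem sysMap_mk (φ : ∀ j, (F j) → (F' j)) (g : ∀ j, (F j)) :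
    ∀ l : List ι, sysMap φ l (sysMk g l) = sysMk (fun j => φ j (g j)) l
  | [] => rfl
  | _ :: l => Prod.ext rfl (sysMap_mk φ g l)

/-- The components satisfy the predicates. -/
def SysAll (p : ∀ j, (F j) → Prop) : (l : List ι) → (sysList F l) → Prop
  | [], _ => True
  | j :: l, z => p j z.1 ∧ SysAll p l z.2

theorem sysAll_mk (p : ∀ j, (F j) → Prop) (g : ∀ j, (F j)) :
    ∀ l : List ι, SysAll p l (sysMk g l) ↔ ∀ j ∈ l, p j (g j)
  | [] => by simp [SysAll]
  | j :: l => by simp [SysAll, sysMk, sysAll_mk p g l]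

/-- The joint system of pairs. -/
def sysZip : (l : List ι) → (sysList (fun j => F j ⊠ G j) l) ≃
    (sysList F l) × (sysList G l)
  | [] => ⟨fun _ => ((), ()), fun _ => (), fun _ => rfl, fun _ => rfl⟩
  | j :: l => ((Equiv.refl ((F j) × (G j))).prodCongr (sysZip l)).trans
      (prodProdProdComm _ _ _ _)

theorem sysMap_zip_symm (φ : ∀ j, (F j) → (F j)) :
    ∀ (l : List ι) (z : (sysList F l)) (w : (sysList G l)),
    sysMap (F := fun j => F j ⊠ G j) (F' := fun j => F j ⊠ G j) (fun j p => (φ j p.1, p.2)) l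
      ((sysZip l).symm (z, w)) = (sysZip l).symm (sysMap φ l z, w)
  | [], _, _ => rfl
  | _ :: l, z, w => Prod.ext rfl (sysMap_zip_symm φ l z.2 w.2)

theorem sysAll_zip_symm (p : ∀ j, (F j) → Prop) :
    ∀ (l : List ι) (z : (sysList F l)) (w : (sysList G l)),
    SysAll (F := fun j => F j ⊠ G j) (fun j q => p j q.1) l ((sysZip l).symm (z, w))
      ↔ SysAll p l z
  | [], _, _ => Iff.rfl
  | _ :: l, z, w => and_congr Iff.rfl (sysAll_zip_symm p l z.2 w.2)

theorem envMap_ptrace : ∀ l : List ι,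
    envMap (Z := fun j => F j ⊠ G j) (Z' := F) (fun _ => ptrace) l
      = ptrace ∘ₗ relabel (X := sysList (fun j => F j ⊠ G j) l)
        (Y := sysList F l ⊠ sysList G l) (sysZip l)
  | [] => by
    refine LinearMap.ext fun M => Matrix.ext fun p q => ?_
    change M p q = ∑ w : Unit, M () ()
    simp
  | j :: l => by
    rw [envMap, envMap_ptrace l]
    refine LinearMap.ext fun M => Matrix.ext fun p q => ?_
    change ∑ z : (sysList G l), ∑ w : (G j),
      M ((p.1, w), (sysZip l).symm (p.2, z)) ((q.1, w), (sysZip l).symm (q.2, z))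
      = ∑ w : (G j) × (sysList G l),
      M ((p.1, w.1), (sysZip l).symm (p.2, w.2)) ((q.1, w.1), (sysZip l).symm (q.2, w.2))
    rw [Fintype.sum_prod_type_right]

/-- The tensor product of matrices between the systems along a list. -/
def envMat (C : ∀ j, Matrix (F' j) (F j) ℂ) :
    (l : List ι) → Matrix (sysList F' l) (sysList F l) ℂ
  | [] => (1 : Op QSys.unit)
  | j :: l => C j ⊗ₖ envMat C l

theorem envMap_conj (C : ∀ j, Matrix (F' j) (F j) ℂ) :
    ∀ l : List ι, envMap (fun j => conj (C j)) l = conj (envMat C l)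
  | [] => conj_one.symm
  | j :: l => by rw [envMap, envMap_conj C l, envMat, tensor_conj]

theorem isContr_envMat {C : ∀ j, Matrix (F' j) (F j) ℂ}
    (h : ∀ j, IsContr (C j)) : ∀ l : List ι, IsContr (envMat C l)
  | [] => IsContr.one
  | j :: l => (h j).kron (isContr_envMat h l)

open Classical in
theorem envMat_ite (p : ∀ j, (F' j) → Prop) (φ : ∀ j, (F' j) → (F j)) :
    ∀ (l : List ι) (z : (sysList F' l)) (z' : (sysList F l)),
    envMat (fun j => Matrix.of fun a b => if p j a ∧ b = φ j a then (1 : ℂ) else 0) l z z'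
      = if SysAll p l z ∧ z' = sysMap φ l z then 1 else 0
  | [], _, _ => by simp [envMat, SysAll, sysMap]
  | j :: l, z, z' => by
    rw [envMat, kroneckerMap_apply, envMat_ite p φ l z.2 z'.2]
    simp only [SysAll, sysMap, of_apply, Prod.ext_iff]
    by_cases h1 : p j z.1 <;> by_cases h2 : z'.1 = φ j z.1 <;> by_cases h3 : SysAll p l z.2 <;>
      simp [h1, h2, h3]

end SysList

/-! ### Traces of runs -/

section RunTrace

variable {ι : Type} {N : ι → Resource} {L : Type} {E : ∀ j, ExtMap L (N j)}

theorem IsChannel.tracePreserving_of_ptrace {X Y Z : QSys} {Φ : SuperOp X Y} (h : IsChannel Φ)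
    {Ψ : SuperOp X (Y ⊠ Z)} (h' : ptrace ∘ₗ Ψ = Φ) : TracePreserving Ψ := fun ρ => by
  rw [← trace_ptrace, ← h.tracePreserving ρ, ← h']
  rfl

theorem Layers.trace_run {lab : L} :
    ∀ {l : List ι} {M M' : QSys} (ly : Layers N l M M')
    (_ : ∀ j ∈ l, ptrace ∘ₗ (E j).map lab = (N j).chan) (ρ : Op (M ⊠ srcSys N l)),
    (ly.run E lab ρ).trace = ρ.trace
  | _, _, _, .nil M, _, ρ => isConj_append_one.isChannel.tracePreserving ρ
  | _, _, _, .cons j (l := l) aux V hV rest, h, ρ => by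
    rw [Layers.run]
    simp only [comp_apply]
    refine (trace_relabel _ _).trans ?_
    rw [trace_ext, Layers.trace_run rest (fun j hj => h j (by simp [hj])), trace_ptrace]
    refine (trace_relabel _ _).trans ?_
    rw [trace_ext, (N j).isChannel.tracePreserving_of_ptrace (h j (by simp)), trace_ptrace]
    exact (isConj_encodeStep j l aux hV).isChannel.tracePreserving ρ

theorem Layers.sum_trace_run_le {α : Type} [Fintype α] {lab : α → L} {i : ι} {η c : ℝ}
    (h : ∀ j, j ≠ i → ∀ a, ptrace ∘ₗ (E j).map (lab a) = (N j).chan)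
    (hi : ∀ σ : Op (N i).In, ∑ a, ‖((E i).map (lab a) σ).trace - c‖
      ≤ traceNorm (ptraceLeft (ptrace σ) - (N i).test)) :
    ∀ {l : List ι} {M M' : QSys} (ly : Layers N l M M') (_ : l.Nodup) (_ : i ∈ l)
    (ρ : Op (M ⊠ srcSys N l)) (_ : ly.Valid η ρ),
    ∑ a, ‖(ly.run E (lab a) ρ).trace - c‖ ≤ η
  | _, _, _, .nil M, _, hi, _, _ => absurd hi List.not_mem_nil
  | _, _, _, .cons (M := M) (M' := M') j (l := l) aux V hV rest, hn, hil, ρ, hv => by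
    have hj : ∀ a, ∃ M₁, ((Layers.cons j aux V hV rest).run E (lab a) ρ).trace
        = (rest.run E (lab a) M₁).trace ∧
          M₁ = ptrace (relabel
          (X := (((N j).Aout ⊠ (N j).Bout) ⊠ (E j).Z) ⊠ (aux ⊠ srcSys N l))
          (Y := (((N j).Aout ⊠ aux) ⊠ srcSys N l) ⊠ ((N j).Bout ⊠ (E j).Z))
          ⟨fun p => (((p.1.1.1, p.2.1), p.2.2), (p.1.1.2, p.1.2)),
           fun q => (((q.1.1.1, q.2.1), q.2.2), (q.1.1.2, q.1.2)), fun _ => rfl, fun _ => rfl⟩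
          (ext ((E j).map (lab a)) (aux ⊠ srcSys N l) (encodeStep j l aux V ρ))) := by
      refine fun a => ⟨_, ?_, rfl⟩
      rw [Layers.run]
      simp only [comp_apply]
      refine (trace_relabel _ _).trans ?_
      rw [trace_ext]
    by_cases hji : j = i
    · subst hji
      refine (sum_le_sum fun a _ => le_of_eq ?_).trans
        ((hi (ptrace (encodeStep j l aux V ρ))).trans hv.1)
      obtain ⟨M₁, h1, h2⟩ := hj a
      rw [h1, Layers.trace_run rest, h2, trace_ptrace]
      · congr 2
        refine (trace_relabel _ _).trans ?_
        rw [trace_ext]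
      · refine fun j' hj' => h j' ?_ a
        rintro rfl
        exact (List.nodup_cons.1 hn).1 hj'
    · have hil' : i ∈ l := (List.mem_cons.1 hil).resolve_left (Ne.symm hji)
      refine (sum_le_sum fun a _ => le_of_eq ?_).trans
        (Layers.sum_trace_run_le h hi rest (List.nodup_cons.1 hn).2 hil' _ hv.2)
      obtain ⟨M₁, h1, h2⟩ := hj a
      rw [h1, h2]
      congr 4
      have h3 := h j hji a
      rw [← h3, ext_comp]
      refine Matrix.ext fun p q => ?_
      change ∑ z : (N j).Bout × (E j).Z, _ = ∑ b, ∑ z, _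
      rw [sum_prod_type]
      rfl

end RunTrace

/-! ### The isometrically extended protocol -/

section Pipe

variable {ι : Type} {A M₀ M₁ S S' O B T' F F₀ F₁ R' Z Z' Y Y' : QSys} {ρ : Op S} {ρ' : Op S'}

/-- Alice's first operation, and the unused sources. -/
def prepare (v₀ : SuperOp A (M₀ ⊠ F₀)) (c : SourceSplit ρ ρ') (ζ : Op (c.T ⊠ R')) :
    SuperOp (A ⊠ S') ((M₀ ⊠ S) ⊠ (F₀ ⊠ R')) :=
  relabel (X := ((M₀ ⊠ F₀) ⊠ S') ⊠ (c.T ⊠ R')) (Y := (M₀ ⊠ S) ⊠ (F₀ ⊠ R'))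
    { toFun := fun p => ((p.1.1.1, c.e (p.1.2, p.2.1)), (p.1.1.2, p.2.2))
      invFun := fun q => (((q.1.1, q.2.1), (c.e.symm q.1.2).1), ((c.e.symm q.1.2).2, q.2.2))
      left_inv := fun p => by simp
      right_inv := fun q => by simp } ∘ₗ append ζ ∘ₗ ext v₀ S'

theorem prepare_env {F₀' : QSys} (Θ : SuperOp F₀ F₀') (v₀ : SuperOp A (M₀ ⊠ F₀))
    (c : SourceSplit ρ ρ') (ζ : Op (c.T ⊠ R')) :
    prepare (extL Θ M₀ ∘ₗ v₀) c ζ = extL (ext Θ R') (M₀ ⊠ S) ∘ₗ prepare v₀ c ζ := by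
  refine LinearMap.ext fun M => Matrix.ext fun p q => ?_
  let X : Op ((M₀ ⊠ F₀) ⊠ S') := ext v₀ S' M
  let k := ζ ((c.e.symm p.1.2).2, p.2.2) ((c.e.symm q.1.2).2, q.2.2)
  change Θ (Matrix.of fun f f' => X ((p.1.1, f), (c.e.symm p.1.2).1)
      ((q.1.1, f'), (c.e.symm q.1.2).1)) p.2.1 q.2.1 * k
    = Θ (Matrix.of fun f f' => X ((p.1.1, f), (c.e.symm p.1.2).1)
      ((q.1.1, f'), (c.e.symm q.1.2).1) * k) p.2.1 q.2.1
  have : (Matrix.of fun f f' => X ((p.1.1, f), (c.e.symm p.1.2).1)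
      ((q.1.1, f'), (c.e.symm q.1.2).1) * k : Op F₀)
    = k • (Matrix.of fun f f' => X ((p.1.1, f), (c.e.symm p.1.2).1)
      ((q.1.1, f'), (c.e.symm q.1.2).1)) := by
    ext f f'; exact mul_comm _ _
  rw [this, map_smul, Matrix.smul_apply, smul_eq_mul, mul_comm]

theorem ptrace_prepare {v₀ : SuperOp A (M₀ ⊠ F₀)} {E₀ : SuperOp A M₀} (h : ptrace ∘ₗ v₀ = E₀)
    {c : SourceSplit ρ ρ'} {ζ : Op (c.T ⊠ R')} (hζ : ptrace ζ = c.σ) :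
    ptrace ∘ₗ prepare v₀ c ζ = tensor E₀ c.embed := by
  refine LinearMap.ext fun M => Matrix.ext fun p q => ?_
  rw [tensor_eq, ← h, ext_comp]
  let X : Op ((M₀ ⊠ F₀) ⊠ S') := ext v₀ S' M
  let s := c.e.symm p.2
  let s' := c.e.symm q.2
  change ∑ w : F₀ × R', X ((p.1, w.1), s.1) ((q.1, w.1), s'.1)
      * ζ (s.2, w.2) (s'.2, w.2)
    = (∑ f, X ((p.1, f), s.1) ((q.1, f), s'.1)) * c.σ s.2 s'.2
  rw [← hζ, sum_prod_type]
  change _ = _ * ∑ r, ζ (s.2, r) (s'.2, r)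
  rw [Finset.sum_mul_sum]

/-- The protocol with all systems kept, before a final rearrangement of the systems. -/
def pipe (run : SuperOp (M₀ ⊠ S) ((M₁ ⊠ B) ⊠ Z)) (v₁ : SuperOp M₁ Y) (vB : SuperOp B Y')
    {X : QSys} (prep : SuperOp X ((M₀ ⊠ S) ⊠ F)) : SuperOp X (((Y ⊠ Y') ⊠ Z) ⊠ F) :=
  ext (ext (tensor v₁ vB) Z) F ∘ₗ ext run F ∘ₗ prep

theorem pipe_env {X Y₁ Y₁' F' : QSys} (run : SuperOp (M₀ ⊠ S) ((M₁ ⊠ B) ⊠ Z)) (v₁ : SuperOp M₁ Y)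
    (vB : SuperOp B Y') (prep : SuperOp X ((M₀ ⊠ S) ⊠ F)) (Θ : SuperOp Z Z')
    (Ψ₁ : SuperOp Y Y₁) (Ψ : SuperOp Y' Y₁') (Θ' : SuperOp F F') :
    pipe (extL Θ (M₁ ⊠ B) ∘ₗ run) (Ψ₁ ∘ₗ v₁) (Ψ ∘ₗ vB) (extL Θ' (M₀ ⊠ S) ∘ₗ prep)
      = tensor (tensor (tensor Ψ₁ Ψ) Θ) Θ' ∘ₗ pipe run v₁ vB prep := by
  rw [pipe, tensor_comp, ext_comp, ext_comp, ext_comp, tensor_eq (tensor (tensor Ψ₁ Ψ) Θ) Θ']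
  have h1 := ext_comp_extL run Θ'
  have h2 := ext_comp_extL (tensor v₁ vB) Θ
  rw [tensor_eq (tensor Ψ₁ Ψ) Θ, ext_comp, pipe]
  have h3 := ext_comp_extL (extL Θ (Y₁ ⊠ Y₁')) Θ'
  have h4 := ext_comp_extL (ext (tensor Ψ₁ Ψ) Z) Θ'
  have h5 := ext_comp_extL (ext (tensor v₁ vB) Z) Θ'
  have h6 : ext (ext (tensor Ψ₁ Ψ) Z') F' ∘ₗ ext (ext (tensor v₁ vB) Z') F' ∘ₗ
      ext (extL Θ (M₁ ⊠ B)) F' = ext (extL Θ (Y₁ ⊠ Y₁')) F' ∘ₗ ext (ext (tensor Ψ₁ Ψ) Z) F' ∘ₗ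
      ext (ext (tensor v₁ vB) Z) F' := by
    rw [← ext_comp, ← ext_comp, ← ext_comp, ← ext_comp, h2]
    congr 1
    rw [← comp_assoc, ← comp_assoc, ext_comp_extL]
  calc _ = (ext (ext (tensor Ψ₁ Ψ) Z') F' ∘ₗ ext (ext (tensor v₁ vB) Z') F' ∘ₗ
      ext (extL Θ (M₁ ⊠ B)) F') ∘ₗ ext run F' ∘ₗ extL Θ' (M₀ ⊠ S) ∘ₗ prep := by
        simp only [comp_assoc]
    _ = ext (extL Θ (Y₁ ⊠ Y₁')) F' ∘ₗ ext (ext (tensor Ψ₁ Ψ) Z) F' ∘ₗ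
      ext (ext (tensor v₁ vB) Z) F' ∘ₗ (ext run F' ∘ₗ extL Θ' (M₀ ⊠ S)) ∘ₗ prep := by
        rw [h6]; simp only [comp_assoc]
    _ = ext (extL Θ (Y₁ ⊠ Y₁')) F' ∘ₗ ext (ext (tensor Ψ₁ Ψ) Z) F' ∘ₗ
      (ext (ext (tensor v₁ vB) Z) F' ∘ₗ extL Θ' _) ∘ₗ ext run F ∘ₗ prep := by
        rw [h1]; simp only [comp_assoc]
    _ = ext (extL Θ (Y₁ ⊠ Y₁')) F' ∘ₗ (ext (ext (tensor Ψ₁ Ψ) Z) F' ∘ₗ extL Θ' _) ∘ₗ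
      ext (ext (tensor v₁ vB) Z) F ∘ₗ ext run F ∘ₗ prep := by
        rw [h5]; simp only [comp_assoc]
    _ = (ext (extL Θ (Y₁ ⊠ Y₁')) F' ∘ₗ extL Θ' _) ∘ₗ ext (ext (tensor Ψ₁ Ψ) Z) F ∘ₗ
      ext (ext (tensor v₁ vB) Z) F ∘ₗ ext run F ∘ₗ prep := by
        rw [h4]; simp only [comp_assoc]
    _ = _ := by
        rw [h3]; simp only [comp_assoc]

theorem trace_pipe {X : QSys} {run : SuperOp (M₀ ⊠ S) ((M₁ ⊠ B) ⊠ Z)} {v₁ : SuperOp M₁ Y}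
    {vB : SuperOp B Y'} (h₁ : IsChannel v₁) (hB : IsChannel vB)
    (prep : SuperOp X ((M₀ ⊠ S) ⊠ F)) (σ : Op X) :
    (pipe run v₁ vB prep σ).trace = (run (ptrace (prep σ))).trace := by
  rw [← trace_ext]
  exact (((h₁.tensor hB).ext Z).ext F).tracePreserving _

end Pipe

/-! ### Classical channels -/

section Classical

/-- A classical noiseless channel with a maximally mixed test state: inputs are absent or trivial
but for the test system, and the input `x` is mapped to `out x`. -/
structure CbitLike (r : Resource) where
  out : r.In → r.Out
  chan_eq : r.chan = ∑ x, conj (X := r.In) (Y := r.Out) (Matrix.single (out x) x (1 : ℂ))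
  abs : Subsingleton r.Aabs
  src : Subsingleton r.S
  test : r.test = (Fintype.card r.Arel : ℂ)⁻¹ • (1 : Op r.Arel)

variable {X Y : QSys}

theorem conj_single_matrix (y : Y) (x : X) (ρ : Op X) :
    conj (Matrix.single y x (1 : ℂ)) ρ = ρ x x • Matrix.single y y 1 := by
  rw [conj_apply, Matrix.conjTranspose_single, star_one]
  ext a b
  rw [Matrix.mul_assoc, Matrix.smul_apply]
  by_cases ha : a = y
  · subst ha
    by_cases hb : b = a
    · subst hb; simp
    · rw [Matrix.single_mul_apply_same, Matrix.mul_single_apply_of_ne _ _ _ _ _ hb]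
      simp [Ne.symm hb]
  · rw [Matrix.single_mul_apply_of_ne _ _ _ _ _ ha]
    simp [Ne.symm ha]

theorem CbitLike.chan_single {r : Resource} (h : CbitLike r) (x : r.In) :
    r.chan ∘ₗ conj (X := r.In) (Y := r.In) (Matrix.single x x (1 : ℂ))
      = conj (X := r.In) (Y := r.Out) (Matrix.single (h.out x) x (1 : ℂ)) := by
  rw [h.chan_eq]
  refine LinearMap.ext fun ρ => ?_
  rw [comp_apply, LinearMap.sum_apply, sum_eq_single x]
  · rw [conj_single_matrix, conj_single_matrix, conj_single_matrix]; simp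
  · intro b _ hb
    rw [conj_single_matrix, conj_single_matrix]
    simp [hb.symm]
  · simp

theorem one_kron_single_mul_single {A B X : QSys} (y : B) (p : (A ⊠ B))
    (x : X) :
    ((1 : Op A) ⊗ₖ Matrix.single y y (1 : ℂ) : Op (A ⊠ B)) * Matrix.single p x (1 : ℂ)
      = if p.2 = y then Matrix.single p x (1 : ℂ) else 0 := by
  obtain ⟨a, b⟩ := p
  ext ⟨a', b'⟩ x'
  rw [mul_apply, sum_eq_single (a, b)]
  · rw [kroneckerMap_apply, one_apply, single_apply, single_apply]
    by_cases h : b = y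
    · subst h
      rw [if_pos rfl, single_apply]
      rcases eq_or_ne a a' with rfl | h1
      · by_cases h2 : b = b' <;> simp [h2]
      · simp [h1, h1.symm]
    · simp [h, Ne.symm h]
  · intro z _ hz
    rw [single_apply, if_neg (fun h => hz h.1.symm), mul_zero]
  · simp

theorem CbitLike.branch_map {r : Resource} (h : CbitLike r) (x : r.In)
    (y : r.Bout) : (ExtMap.branch r).map (x, y)
      = if (h.out x).2 = y then
        append 1 ∘ₗ conj (X := r.In) (Y := r.Out) (Matrix.single (h.out x) x (1 : ℂ)) else 0 := by
  change append 1 ∘ₗ conj (X := r.Out) (Y := r.Out) _ ∘ₗ r.chan ∘ₗ conj _ = _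
  rw [h.chan_single, conj_comp, one_kron_single_mul_single]
  split_ifs
  · rfl
  · refine LinearMap.ext fun ρ => ?_
    rw [comp_apply, conj_apply, Matrix.zero_mul, Matrix.zero_mul, map_zero]
    rfl

end Classical

section CqOp

variable {X Q : QSys}

theorem sum_traceNorm_le_cqOp (τ : X → Op Q) :
    ∑ x, traceNorm (τ x) ≤ traceNorm (cqOp τ) := by
  choose O hO hτ using fun x => exists_trace_mul_eq (τ x)
  have hc : IsContr (cqOp O) := by
    intro v
    have h1 : ∀ w : (X ⊠ Q) → ℂ, nsq w = ∑ x, nsq fun q => w (x, q) := fun w => by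
      simp only [nsq, sum_prod_type]
    have h2 : ∀ x, (fun q => (cqOp O *ᵥ v) (x, q)) = O x *ᵥ fun q => v (x, q) := fun x => by
      ext q
      simp only [Matrix.mulVec, dotProduct, sum_prod_type, cqOp, of_apply]
      rw [sum_eq_single x]
      · simp
      · intro b _ hb; simp [hb.symm]
      · simp
    rw [h1, h1]
    exact sum_le_sum fun x _ => by rw [h2]; exact hO x _
  have h3 : (cqOp O * cqOp τ).trace = ((∑ x, traceNorm (τ x) : ℝ) : ℂ) := by
    push_cast
    rw [sum_congr rfl fun x _ => (hτ x).symm]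
    simp only [Matrix.trace, Matrix.diag, mul_apply, sum_prod_type, cqOp,
      of_apply]
    refine sum_congr rfl fun x _ => sum_congr rfl fun q _ => ?_
    rw [sum_eq_single x]
    · simp
    · intro b _ hb; simp [hb.symm]
    · simp
  have h4 := norm_trace_mul_le hc (cqOp τ)
  rw [h3, Complex.norm_real] at h4
  exact (le_abs_self _).trans h4

theorem cqOp_sub_marginals (σ : X → Op Q) :
    cqOp σ - ptrace (cqOp σ) ⊗ₖ ptraceLeft (cqOp σ)
      = cqOp fun x => σ x - (σ x).trace • ∑ y, σ y := by
  ext ⟨x, q⟩ ⟨x', q'⟩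
  have h1 : ptrace (cqOp σ) x x' = if x = x' then (σ x).trace else 0 := by
    change ∑ q, (if x = x' then σ x q q else 0) = _
    split_ifs <;> simp [Matrix.trace]
  have h2 : ptraceLeft (cqOp σ) q q' = (∑ y, σ y) q q' := by
    change ∑ y, (if y = y then σ y q q' else 0) = _
    simp [Matrix.sum_apply]
  rw [Matrix.sub_apply, kroneckerMap_apply, h1, h2]
  change (if x = x' then σ x q q' else 0) - _
    = if x = x' then (σ x - (σ x).trace • ∑ y, σ y) q q' else 0
  split_ifs <;> simp

end CqOp

/-! ### Decoupled classical communication -/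

section Independence

variable {α : Type} [Fintype α] {Q Q' : QSys}

theorem sum_traceNorm_sub_average_le {Ω : SuperOp Q Q'} (hΩ : ∀ M, traceNorm (Ω M) ≤ traceNorm M)
    (σ : α → Op Q) (v : α → Q' → ℂ) (h : ∀ a, rankOne (v a) = Ω (σ a))
    (hv : ∑ a, nsq (v a) = 1) {ε η : ℝ}
    (hε : ∑ a, traceNorm (σ a - (σ a).trace • ∑ b, σ b) ≤ ε)
    (hη : ∑ a, |nsq (v a) - (Fintype.card α : ℝ)⁻¹| ≤ η) :
    ∑ a, traceNorm (rankOne (v a) - (Fintype.card α : ℂ)⁻¹ • ∑ b, rankOne (v b)) ≤ 2 * ε + η := by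
  set T := ∑ b, rankOne (v b) with hT
  have hTΩ : T = Ω (∑ b, σ b) := by rw [hT, map_sum]; simp only [h]
  have h1 : ∑ a, traceNorm (rankOne (v a) - (σ a).trace • T) ≤ ε := by
    refine (sum_le_sum fun a _ => ?_).trans hε
    rw [h, hTΩ, ← map_smul, ← map_sub]
    exact hΩ _
  have hT1 : T.trace = 1 := by
    rw [hT, Matrix.trace_sum]
    simp only [trace_rankOne]
    exact_mod_cast hv
  have hTn : traceNorm T ≤ 1 := by
    rw [← hv]
    exact (traceNorm_sum_le _ _).trans (sum_le_sum fun a _ => traceNorm_rankOne_le _)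
  have h2 : ∑ a, ‖((nsq (v a) : ℝ) : ℂ) - (σ a).trace‖ ≤ ε := by
    refine (sum_le_sum fun a _ => ?_).trans h1
    have := norm_trace_le (rankOne (v a) - (σ a).trace • T)
    rwa [Matrix.trace_sub, trace_smul, hT1, trace_rankOne, smul_eq_mul, mul_one] at this
  have h3 : ∀ a, traceNorm (rankOne (v a) - (Fintype.card α : ℂ)⁻¹ • T)
      ≤ traceNorm (rankOne (v a) - (σ a).trace • T)
        + (‖((nsq (v a) : ℝ) : ℂ) - (σ a).trace‖ + |nsq (v a) - (Fintype.card α : ℝ)⁻¹|) := by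
    intro a
    refine (traceNorm_sub_le _ ((σ a).trace • T) _).trans (add_le_add le_rfl ?_)
    rw [← sub_smul]
    refine (traceNorm_smul_le _ _).trans ?_
    have h4 : ‖(σ a).trace - (Fintype.card α : ℂ)⁻¹‖
        ≤ ‖((nsq (v a) : ℝ) : ℂ) - (σ a).trace‖ + |nsq (v a) - (Fintype.card α : ℝ)⁻¹| := by
      have h5 : |nsq (v a) - (Fintype.card α : ℝ)⁻¹|
          = ‖((nsq (v a) : ℝ) : ℂ) - (Fintype.card α : ℂ)⁻¹‖ := by
        rw [← Real.norm_eq_abs, ← Complex.norm_real]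
        push_cast; rfl
      rw [h5, norm_sub_rev ((nsq (v a) : ℝ) : ℂ)]
      exact norm_sub_le_norm_sub_add_norm_sub _ _ _
    calc _ ≤ ‖(σ a).trace - (Fintype.card α : ℂ)⁻¹‖ * 1 := by gcongr
      _ ≤ _ := by rw [mul_one]; exact h4
  refine (sum_le_sum fun a _ => h3 a).trans ?_
  rw [sum_add_distrib, sum_add_distrib]
  linarith

end Independence

section Swap

variable {ι : Type} [Fintype ι] [DecidableEq ι] {K : ι → QSys} {O B T' E W I R : QSys}

theorem sum_pi_update (i : ι) (b : (K i)) (g : (QSys.pi K) → ℝ) :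
    ∑ k : (QSys.pi K), (if k i = b then ∑ a, g (Function.update k i a) else 0)
      = ∑ k, g k := by
  let e := Equiv.piSplitAt i fun j => (K j)
  have he : ∀ p a, Function.update (e.symm p) i a = e.symm (a, p.2) := by
    intro p a
    ext j
    by_cases h : j = i
    · subst h; simp [e]
    · simp [e, h]
  have he' : ∀ p, e.symm p i = p.1 := fun p => by simp [e]
  rw [← Equiv.sum_comp e.symm, ← Equiv.sum_comp e.symm g, Fintype.sum_prod_type_right,
    Fintype.sum_prod_type_right]
  refine sum_congr rfl fun r _ => ?_
  simp only [he', he]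
  simp

/-- The amplitudes in which the copied value at `i` is `a`, after the operator `u` on Bob's
environment; this value is then erased. -/
def pinned (i : ι) (b : (K i)) (V : Matrix (T' ⊠ E) B ℂ)
    (A : Matrix (((O ⊠ B) ⊠ QSys.pi K) ⊠ W) I ℂ) (u : Op E)
    (ψ : Matrix I R ℂ) (a : (K i)) :
    Matrix (QSys.pi K ⊠ (E ⊠ ((O ⊠ T') ⊠ W))) R ℂ :=
  Matrix.of fun p r => if p.1 i = b then
    (u * decoded V A ψ (Function.update p.1 i a)) p.2.1 (p.2.2, r) else 0

theorem pinned_mul (i : ι) (b : (K i)) (V : Matrix (T' ⊠ E) B ℂ)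
    (A : Matrix (((O ⊠ B) ⊠ QSys.pi K) ⊠ W) I ℂ) (u : Op E)
    (ψ : Matrix I R ℂ) (a : (K i)) :
    pinned i b V A u (1 : Op I) a * ψ = pinned i b V A u ψ a := by
  ext p r
  rw [mul_apply]
  simp only [pinned, of_apply]
  split_ifs with h
  · exact congrFun (congrFun (decoded_eq_sum V A ψ u (Function.update p.1 i a)) p.2.1) (p.2.2, r)
  · simp

theorem nsq_comb_pinned (i : ι) (b : (K i)) (V : Matrix (T' ⊠ E) B ℂ)
    (A : Matrix (((O ⊠ B) ⊠ QSys.pi K) ⊠ W) I ℂ) (u u' : Op E)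
    (ψ : Matrix I R ℂ) (a a' : (K i)) (c c' : ℂ) :
    nsq (c • vec (pinned i b V A u ψ a) - c' • vec (pinned i b V A u' ψ a'))
      = ∑ k : (QSys.pi K), if k i = b then
        nsq (vec ((c • u) * decoded V A ψ (Function.update k i a)
          - (c' • u') * decoded V A ψ (Function.update k i a'))) else 0 := by
  simp only [nsq]
  rw [sum_prod_type, sum_prod_type]
  refine sum_congr rfl fun k _ => ?_
  simp only [Pi.sub_apply, Pi.smul_apply, vec, pinned, of_apply]
  split_ifs with h
  · rw [sum_prod_type, sum_prod_type]
    refine sum_congr rfl fun e _ => ?_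
    rw [← Fintype.sum_prod_type']
    refine sum_congr rfl fun q _ => ?_
    rw [Matrix.sub_apply, Matrix.smul_mul, Matrix.smul_mul]
    rfl
  · simp

theorem sum_nsq_swap {V : Matrix (T' ⊠ E) B ℂ}
    {A : Matrix (((O ⊠ B) ⊠ QSys.pi K) ⊠ W) I ℂ} (i : ι) (b : (K i))
    {U : (K i) → Op E} (hU : ∀ a, (U a)ᴴ * U a = 1) {ω : (K i) → ℂ}
    (hω : ∀ a, ‖ω a‖ = 1) (ψ : Matrix I R ℂ) {c : ℝ}
    (h : ∑ a, ∑ a', nsq (ω a • vec (pinned i b V A (U a) ψ a)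
      - ω a' • vec (pinned i b V A (U a') ψ a')) ≤ c) :
    (∀ a, (ω a • U a)ᴴ * (ω a • U a) = 1) ∧
    ∑ k : (QSys.pi K), ∑ a, nsq (vec ((ω a • U a)ᴴ * (ω (k i) • U (k i)) * decoded V A ψ k
      - decoded V A ψ (Function.update k i a))) ≤ c := by
  have hU' : ∀ a, (ω a • U a)ᴴ * (ω a • U a) = 1 := by
    intro a
    have h1 : star (ω a) * ω a = 1 := by
      have := Complex.conj_mul' (ω a)
      rw [hω] at this
      simpa using this
    rw [Matrix.conjTranspose_smul, Matrix.smul_mul, Matrix.mul_smul, smul_smul, hU, h1, one_smul]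
  refine ⟨hU', le_trans (le_of_eq ?_) h⟩
  let f : (QSys.pi K) → (K i) → (K i) → ℝ := fun k a a' =>
    nsq (vec ((ω a • U a) * decoded V A ψ (Function.update k i a)
          - (ω a' • U a') * decoded V A ψ (Function.update k i a')))
  have h2 : ∀ k : (QSys.pi K), ∀ a, nsq (vec ((ω a • U a)ᴴ * (ω (k i) • U (k i)) *
      decoded V A ψ k - decoded V A ψ (Function.update k i a))) = f k (k i) a := by
    intro k a
    have h3 : ((ω a • U a)ᴴ)ᴴ * (ω a • U a)ᴴ = 1 := by
      rw [Matrix.conjTranspose_conjTranspose]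
      exact mul_eq_one_comm.1 (hU' a)
    have h4 := nsq_vec_mul_of_isometry h3 ((ω (k i) • U (k i)) *
      decoded V A ψ (Function.update k i (k i)) - (ω a • U a) *
      decoded V A ψ (Function.update k i a))
    refine (congrArg (fun z => nsq (vec z)) ?_).trans h4
    rw [Matrix.mul_sub, ← Matrix.mul_assoc, ← Matrix.mul_assoc, hU', Matrix.one_mul,
      Function.update_eq_self]
  simp only [h2]
  rw [← sum_pi_update i b]
  have h5 : ∀ a, (∑ a', ∑ k : (QSys.pi K), if k i = b then f k a a' else 0)
      = ∑ k : (QSys.pi K), if k i = b then ∑ a', f k a a' else 0 := by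
    intro a
    rw [sum_comm]
    refine sum_congr rfl fun k _ => ?_
    split_ifs <;> simp
  have h6 : ∀ a a', nsq (ω a • vec (pinned i b V A (U a) ψ a)
      - ω a' • vec (pinned i b V A (U a') ψ a'))
      = ∑ k : (QSys.pi K), if k i = b then f k a a' else 0 := fun a a' =>
    nsq_comb_pinned i b V A (U a) (U a') ψ a a' (ω a) (ω a')
  simp only [h6]
  simp only [h5]
  rw [sum_comm]
  refine sum_congr rfl fun k _ => ?_
  split_ifs
  · refine sum_congr rfl fun a _ => sum_congr rfl fun a' _ => ?_
    simp [f]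
  · simp

theorem sum_nsq_pinned {V : Matrix (T' ⊠ E) B ℂ} (hV : Vᴴ * V = 1)
    {A : Matrix (((O ⊠ B) ⊠ QSys.pi K) ⊠ W) I ℂ} (hA : Aᴴ * A = 1)
    (i : ι) (b : (K i))
    {U : (K i) → Op E} (hU : ∀ a, (U a)ᴴ * U a = 1) (ψ : Matrix I R ℂ) :
    ∑ a, nsq (vec (pinned i b V A (U a) ψ a)) = nsq (vec ψ) := by
  have h1 : ∀ a, nsq (vec (pinned i b V A (U a) ψ a)) = ∑ k : (QSys.pi K),
      if k i = b then nsq (vec (decoded V A ψ (Function.update k i a))) else 0 := by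
    intro a
    have := nsq_comb_pinned i b V A (U a) (U a) ψ a a 1 0
    simp only [one_smul, zero_smul, sub_zero, Matrix.zero_mul] at this
    rw [this]
    refine sum_congr rfl fun k _ => ?_
    rw [nsq_vec_mul_of_isometry (hU a)]
  simp only [h1]
  rw [sum_comm, ← sum_nsq_decoded hV hA ψ,
    ← sum_pi_update i b fun k => nsq (vec (decoded V A ψ k))]
  refine sum_congr rfl fun k _ => ?_
  split_ifs <;> simp

end Swap

section Diag

variable {X Y Z W : QSys}

theorem exists_norm_eq_mul (z : ℂ) : ∃ θ : ℂ, ‖θ‖ ≤ 1 ∧ θ * z = ((‖z‖ : ℝ) : ℂ) := by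
  by_cases hz : z = 0
  · exact ⟨0, by simp, by simp [hz]⟩
  · have hn : ((‖z‖ : ℝ) : ℂ) ≠ 0 := by exact_mod_cast norm_ne_zero_iff.2 hz
    refine ⟨star z / ((‖z‖ : ℝ) : ℂ), ?_, ?_⟩
    · rw [norm_div, norm_star, Complex.norm_real, norm_norm]
      exact div_self_le_one _
    · rw [div_mul_eq_mul_div, div_eq_iff hn]
      have := Complex.conj_mul' z
      rw [← sq]
      exact this

theorem sum_norm_diag_le (M : Op X) : ∑ x, ‖M x x‖ ≤ traceNorm M := by
  choose θ h1 h2 using fun x => exists_norm_eq_mul (M x x)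
  have hc : IsContr (Matrix.diagonal θ) := by
    intro v
    refine sum_le_sum fun x _ => ?_
    rw [Matrix.mulVec_diagonal, norm_mul, mul_pow]
    exact mul_le_of_le_one_left (sq_nonneg _) (pow_le_one₀ (norm_nonneg _) (h1 x))
  have h3 := norm_trace_mul_le hc M
  have h4 : (Matrix.diagonal θ * M).trace = ((∑ x, ‖M x x‖ : ℝ) : ℂ) := by
    push_cast
    refine sum_congr rfl fun x _ => ?_
    rw [Matrix.diag_apply, Matrix.diagonal_mul, h2]
  rw [h4, Complex.norm_real] at h3
  exact (le_abs_self _).trans h3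

theorem relabel_conj_apply (e : Y ≃ Z) (M : Matrix Y X ℂ) :
    relabel e ∘ₗ conj M = conj (X := X) (Y := Z) (Matrix.of fun z x => M (e.symm z) x) := rfl

theorem traceNorm_relabel_le (e : X ≃ Y) (M : Op X) :
    traceNorm (relabel e M) ≤ traceNorm M :=
  traceNorm_channel_le (isChannel_relabel e) M

end Diag

/-! ### Copying the inputs of classical channels -/

/-- An isometric extension whose environment is divided in a register to be kept and a rest. -/
structure CopyDil (r : Resource) where
  K : QSys
  W : QSys
  V : Matrix (r.Out ⊠ (K ⊠ W)) r.In ℂ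
  isometry : Vᴴ * V = 1
  dilates : ∀ ρ, ptrace (conj V ρ) = r.chan ρ

namespace CopyDil

variable {r : Resource} (c : CopyDil r)

/-- The isometric extension. -/
def full : ExtMap Unit r := ⟨c.K ⊠ c.W, fun _ => conj c.V⟩

/-- The resource together with the register that is kept. -/
def kept : ExtMap Unit r := ⟨c.K, fun _ => extL ptrace r.Out ∘ₗ conj c.V⟩

/-- The kept register is a copy of the input of a classical channel. -/
def IsCopy (h : CbitLike r) : Prop :=
  ∃ (f : r.In ≃ c.K) (w : c.W),
    c.V = basisMap (Y := r.Out ⊠ (c.K ⊠ c.W)) fun x => (h.out x, (f x, w))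

end CopyDil

section Hat

variable {ι : Type} [DecidableEq ι] {K W : ι → QSys}

open Classical in
/-- The operator `|b⟩⟨a|` on the register `i`. -/
def hatMat (i : ι) (b a : (K i)) (j : ι) : Op (K j ⊠ W j) :=
  Matrix.of fun p q => if Function.update (β := fun j => (K j) → Prop)
      (fun _ _ => True) i (fun k => k = b) j p.1 ∧
    q = (Function.update (β := fun j => (K j) → (K j))
      (fun _ k => k) i (fun _ => a) j p.1, p.2) then 1 else 0

theorem hatMat_of_ne {i : ι} (b a : (K i)) {j : ι} (h : j ≠ i) :
    hatMat (W := W) i b a j = 1 := by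
  ext p q
  simp only [hatMat, of_apply, Function.update_of_ne h, true_and, one_apply]
  simp [eq_comm]

theorem hatMat_self {i : ι} (b a : (K i)) (p q : (K i ⊠ W i)) :
    hatMat (W := W) i b a i p q = if p.1 = b ∧ q = (a, p.2) then 1 else 0 := by
  simp [hatMat]

theorem hatMat_mul_basisMap {i : ι} {I O : QSys} (b a : (K i))
    (f : I ≃ (K i)) (out : I → O) (w : (W i)) :
    ((1 : Op O) ⊗ₖ hatMat (W := W) i b a i : Op (O ⊠ (K i ⊠ W i))) *
      basisMap (Y := O ⊠ (K i ⊠ W i)) (fun x => (out x, (f x, w)))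
      = Matrix.single (out (f.symm a), (b, w)) (f.symm a) 1 := by
  ext ⟨o, k, v⟩ x
  rw [mul_apply, sum_eq_single (out x, (f x, w))]
  · rw [basisMap_apply, if_pos rfl, mul_one, kroneckerMap_apply, hatMat_self,
      one_apply, single_apply]
    by_cases hx : f.symm a = x
    · subst hx
      simp only [Equiv.apply_symm_apply, Prod.mk.injEq, true_and, and_true]
      have e1 : (o = out (f.symm a)) ↔ (out (f.symm a) = o) := eq_comm
      have e2 : k = b ↔ b = k := eq_comm
      simp only [e1, e2]
      by_cases h1 : out (f.symm a) = o <;> by_cases h2 : b = k <;> by_cases h3 : w = v <;>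
        simp [h1, h2, h3]
    · have : f x ≠ a := fun h => hx (by rw [← h, Equiv.symm_apply_apply])
      simp [hx, this]
  · intro z _ hz
    rw [basisMap_apply, if_neg (Ne.symm hz), mul_zero]
  · simp

end Hat

section Arrange

variable {ι : Type} [DecidableEq ι] {K W : ι → QSys} {l : List ι} {O B F G E T' : QSys}

/-- The kept registers, Alice's output and Bob's system are put in front. -/
def arrange (h : l.Nodup) (h' : ∀ j, j ∈ l) :
    ((((O ⊠ F) ⊠ B) ⊠ sysList (fun j => K j ⊠ W j) l) ⊠ G)
      ≃ ((O × B) × (∀ j, (K j))) × ((sysList W l ⊠ (F ⊠ G))) where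
  toFun p := (((p.1.1.1.1, p.1.1.2), sysPi h h' (sysZip l p.1.2).1),
    ((sysZip l p.1.2).2, (p.1.1.1.2, p.2)))
  invFun q := ((((q.1.1.1, q.2.2.1), q.1.1.2), (sysZip l).symm ((sysPi h h').symm q.1.2, q.2.1)),
    q.2.2.2)
  left_inv p := by simp
  right_inv q := by simp

/-- The kept registers are put in front, followed by Bob's environment. -/
def arrangeDecoded (h : l.Nodup) (h' : ∀ j, j ∈ l) :
    ((((O ⊠ F) ⊠ (T' ⊠ E)) ⊠ sysList (fun j => K j ⊠ W j) l) ⊠ G)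
      ≃ (∀ j, (K j)) × (E × ((O ⊠ T') ⊠ (sysList W l ⊠ (F ⊠ G)))) where
  toFun p := (sysPi h h' (sysZip l p.1.2).1, (p.1.1.2.2, ((p.1.1.1.1, p.1.1.2.1),
    ((sysZip l p.1.2).2, (p.1.1.1.2, p.2)))))
  invFun q := ((((q.2.2.1.1, q.2.2.2.2.1), (q.2.2.1.2, q.2.1)),
    (sysZip l).symm ((sysPi h h').symm q.1, q.2.2.2.1)), q.2.2.2.2.2)
  left_inv p := by simp
  right_inv q := by simp

variable [Fintype ι]

theorem mul_decoded {K I W R : QSys} (V : Matrix (T' ⊠ E) B ℂ) (u : Op E)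
    (A : Matrix (((O ⊠ B) ⊠ K) ⊠ W) I ℂ) (ψ : Matrix I R ℂ)
    (k : K) : u * decoded V A ψ k
      = decoded (((1 : Op T') ⊗ₖ u : Op (T' ⊠ E)) * V) A ψ k := by
  ext e q
  rw [mul_apply]
  change ∑ e', u e e' * ∑ b, V (q.1.1.2, e') b * (A * ψ) (((q.1.1.1, b), k), q.1.2) q.2
    = ∑ b, (((1 : Op T') ⊗ₖ u : Op (T' ⊠ E)) * V) (q.1.1.2, e) b * _
  simp only [mul_sum]
  rw [sum_comm]
  refine sum_congr rfl fun b _ => ?_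
  rw [one_kron_mul_apply, sum_mul]
  exact sum_congr rfl fun e' _ => (mul_assoc _ _ _).symm

theorem kron_mul_apply {X Y Y' Z Z' G I : QSys} (B : Matrix Y' Y ℂ)
    (H : Matrix Z' Z ℂ) (A : Matrix (((X ⊠ Y) ⊠ Z) ⊠ G) I ℂ)
    (x : X) (y : Y') (z : Z') (g : G) (i : I) :
    ((((((1 : Op X) ⊗ₖ B : Matrix (X ⊠ Y') (X ⊠ Y) ℂ) ⊗ₖ H :
      Matrix ((X ⊠ Y') ⊠ Z') ((X ⊠ Y) ⊠ Z) ℂ) ⊗ₖ (1 : Op G) :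
      Matrix (((X ⊠ Y') ⊠ Z') ⊠ G) (((X ⊠ Y) ⊠ Z) ⊠ G) ℂ)) * A)
      (((x, y), z), g) i = ∑ b, B y b * ∑ z', H z z' * A (((x, b), z'), g) i := by
  rw [mul_apply]
  simp only [sum_prod_type, kroneckerMap_apply]
  rw [sum_eq_single x]
  · refine sum_congr rfl fun b _ => ?_
    rw [mul_sum]
    refine sum_congr rfl fun z' _ => ?_
    rw [sum_eq_single g]
    · simp [mul_assoc]
    · intro g' _ hg; simp [Ne.symm hg]
    · simp
  · intro x' _ hx; simp [one_apply, Ne.symm hx]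
  · simp

open Classical in
theorem pinned_eq_arrange (h : l.Nodup) (h' : ∀ j, j ∈ l) {I : QSys} (i : ι) (b a : (K i))
    (V : Matrix (T' ⊠ E) B ℂ) (u : Op E)
    (A : Matrix ((((O ⊠ F) ⊠ B) ⊠ sysList (fun j => K j ⊠ W j) l) ⊠ G) I ℂ) :
    pinned i b V (W := sysList W l ⊠ (F ⊠ G)) (Matrix.of fun p => A ((arrange h h').symm p)) u
      (1 : Op I) a
    = Matrix.of fun p => (((((((1 : Op (O ⊠ F)) ⊗ₖ (((1 : Op T') ⊗ₖ u : Op (T' ⊠ E)) * V) :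
        Matrix ((O ⊠ F) ⊠ (T' ⊠ E)) ((O ⊠ F) ⊠ B) ℂ) ⊗ₖ
        envMat (hatMat (W := W) i b a) l :
      Matrix (((O ⊠ F) ⊠ (T' ⊠ E)) ⊠ sysList (fun j => K j ⊠ W j) l)
        (((O ⊠ F) ⊠ B) ⊠ sysList (fun j => K j ⊠ W j) l) ℂ) ⊗ₖ (1 : Op G) :
      Matrix ((((O ⊠ F) ⊠ (T' ⊠ E)) ⊠ sysList (fun j => K j ⊠ W j) l) ⊠ G)
        ((((O ⊠ F) ⊠ B) ⊠ sysList (fun j => K j ⊠ W j) l) ⊠ G) ℂ)) * A)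
        ((arrangeDecoded h h').symm p)) := by
  refine Matrix.ext fun ⟨k, e, ⟨o, t⟩, w, fr, g⟩ x => ?_
  rw [pinned, of_apply, of_apply, mul_decoded]
  refine Eq.trans ?_ (kron_mul_apply _ _ _ _ _ _ _ _).symm
  have h1 : ∀ z', envMat (hatMat (W := W) i b a) l ((sysZip l).symm (sysMk k l, w)) z'
      = if k i = b ∧ z' = (sysZip l).symm (sysMk (Function.update k i a) l, w) then 1 else 0 := by
    intro z'
    have h2 := envMat_ite (F := fun j => K j ⊠ W j) (F' := fun j => K j ⊠ W j)
      (fun j p => Function.update (β := fun j => (K j) → Prop)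
        (fun _ _ => True) i (fun k => k = b) j p.1)
      (fun j p => (Function.update (β := fun j => (K j) → (K j))
        (fun _ k => k) i (fun _ => a) j p.1, p.2)) l ((sysZip l).symm (sysMk k l, w)) z'
    refine h2.trans ?_
    rw [sysAll_zip_symm (fun j => Function.update (β := fun j => (K j) → Prop)
        (fun _ _ => True) i (fun k => k = b) j), sysMap_zip_symm
        (fun j => Function.update (β := fun j => (K j) → (K j))
        (fun _ k => k) i (fun _ => a) j), sysMap_mk, sysAll_mk]
    have h3 : (∀ j ∈ l, Function.update (β := fun j => (K j) → Prop)
        (fun _ _ => True) i (fun k => k = b) j (k j)) ↔ k i = b := by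
      constructor
      · intro hh; simpa using hh i (h' i)
      · intro hb j _
        by_cases hj : j = i
        · subst hj; simpa using hb
        · simp [Function.update_of_ne hj]
    have h4 : (fun j => Function.update (β := fun j => (K j) → (K j))
        (fun _ k => k) i (fun _ => a) j (k j)) = Function.update k i a := by
      ext j
      by_cases hj : j = i
      · subst hj; simp
      · simp [Function.update_of_ne hj]
    rw [h4]
    simp only [h3]
  change _ = ∑ β, _ * ∑ z', envMat (hatMat (W := W) i b a) l
    ((sysZip l).symm (sysMk k l, w)) z' * _
  simp only [h1]
  by_cases hk : k i = b
  · simp only [hk, true_and, if_true, ite_mul, one_mul, zero_mul, Finset.sum_ite_eq',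
      Finset.mem_univ]
    change ∑ β, _ * ((Matrix.of fun p => A ((arrange h h').symm p)) * (1 : Op I)) _ _ = _
    rw [Matrix.mul_one]
    rfl
  · simp [hk]

end Arrange

section Corrections

variable {ι : Type} [DecidableEq ι] {N : ι → Resource} {T : Resource}

theorem conj_iso_dilates {X Y E E' : QSys} {Φ : SuperOp X Y} {V : Matrix (Y ⊠ E) X ℂ}
    (h : ∀ ρ, ptrace (conj V ρ) = Φ ρ) {J : Matrix E' E ℂ} (hJ : Jᴴ * J = 1)
    (ρ : Op X) : ptrace (conj (((1 : Op Y) ⊗ₖ J : Matrix (Y ⊠ E') (Y ⊠ E) ℂ) * V) ρ)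
      = Φ ρ := by
  rw [← h, ← conj_comp V, ← extL_conj, comp_apply]
  exact ptrace_extL (isChannel_conj J hJ).tracePreserving _

theorem extL_conj_comp {X Y E E' : QSys} (J : Matrix E' E ℂ)
    (V : Matrix (Y ⊠ E) X ℂ) : extL (conj J) Y ∘ₗ conj V
      = conj (((1 : Op Y) ⊗ₖ J : Matrix (Y ⊠ E') (Y ⊠ E) ℂ) * V) := by
  rw [extL_conj, conj_comp]

/-- The family of isometrically extended resources, with the kept register of `i` pinned. -/
def hatMaps (c : ∀ j, CopyDil (N j)) (i : ι) (b : (c i).K) :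
    ∀ j, ExtMap (c i).K (N j) := fun j =>
  ⟨(c j).K ⊠ (c j).W, fun a =>
    extL (conj (hatMat (K := fun j => (c j).K) (W := fun j => (c j).W) i b a j)) (N j).Out
      ∘ₗ conj (c j).V⟩

theorem hatMaps_of_ne (c : ∀ j, CopyDil (N j)) {i : ι} (b a : (c i).K) {j : ι}
    (h : j ≠ i) : (hatMaps c i b j).map a = conj (c j).V := by
  change extL (conj (hatMat (K := fun j => (c j).K) (W := fun j => (c j).W) i b a j)) _ ∘ₗ _ = _
  rw [hatMat_of_ne (K := fun j => (c j).K) (W := fun j => (c j).W) b a h, conj_one, extL_id]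
  rfl

theorem hatMaps_self (c : ∀ j, CopyDil (N j)) {i : ι} {h : CbitLike (N i)}
    {f : (N i).In ≃ (c i).K} {w : (c i).W}
    (hV : (c i).V = basisMap (Y := (N i).Out ⊠ ((c i).K ⊠ (c i).W)) fun x => (h.out x, (f x, w)))
    (b a : (c i).K) : (hatMaps c i b i).map a
      = conj (X := (N i).In) (Y := (N i).Out ⊠ ((c i).K ⊠ (c i).W))
        (Matrix.single (h.out (f.symm a), (b, w)) (f.symm a) 1) := by
  change extL (conj (hatMat (K := fun j => (c j).K) (W := fun j => (c j).W) i b a i)) _ ∘ₗ _ = _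
  rw [extL_conj_comp, hV]
  exact congrArg conj (hatMat_mul_basisMap (K := fun j => (c j).K) (W := fun j => (c j).W)
    b a f h.out w)

theorem run_hatMaps (c : ∀ j, CopyDil (N j)) (i : ι) (b a : (c i).K) {l : List ι}
    {M M' : QSys} (ly : Layers N l M M') : ly.run (hatMaps c i b) a
      = extL (conj (envMat (hatMat (K := fun j => (c j).K) (W := fun j => (c j).W) i b a) l))
        (M' ⊠ bobSys N l) ∘ₗ ly.run (fun j => (c j).full) () := by
  rw [← envMap_conj]
  exact ly.run_env (E := fun j => (c j).full) (E' := hatMaps c i b) fun j => rfl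

theorem sum_trace_hatMaps_le (c : ∀ j, CopyDil (N j)) {i : ι} {h : CbitLike (N i)}
    {f : (N i).In ≃ (c i).K} {w : (c i).W}
    (hV : (c i).V = basisMap (Y := (N i).Out ⊠ ((c i).K ⊠ (c i).W)) fun x => (h.out x, (f x, w)))
    (b : (c i).K) {η : ℝ} {l : List ι} {M M' : QSys} (ly : Layers N l M M')
    (hl : l.Nodup) (hi : i ∈ l) (ρ : Op (M ⊠ srcSys N l)) (hρ : ly.Valid η ρ) :
    ∑ a, ‖(ly.run (hatMaps c i b) a ρ).trace - (Fintype.card (c i).K : ℂ)⁻¹‖ ≤ η := by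
  have := Layers.sum_trace_run_le (E := hatMaps c i b) (lab := fun a => a) (i := i)
    (c := (Fintype.card (c i).K : ℝ)⁻¹) (η := η) (fun j hj a => ?_) (fun σ => ?_) ly hl hi
    ρ hρ
  · simpa using this
  · exact (congrArg (fun Φ : SuperOp (N j).In ((N j).Out ⊠ ((c j).K ⊠ (c j).W)) => ptrace ∘ₗ Φ)
      (hatMaps_of_ne c b a hj)).trans (LinearMap.ext (c j).dilates)
  · have := h.abs
    have := h.src
    let α₀ : (N i).Aabs := Classical.arbitrary _
    let s₀ : (N i).S := Classical.arbitrary _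
    let g : (N i).Arel ≃ (N i).In :=
      ⟨fun u => ((α₀, u), s₀), fun x => x.1.2, fun _ => rfl, fun x =>
        Prod.ext (Prod.ext (Subsingleton.elim _ _) rfl) (Subsingleton.elim _ _)⟩
    have hcard : Fintype.card (c i).K = Fintype.card (N i).Arel :=
      (Fintype.card_congr (g.trans f)).symm
    have h1 : ∀ a, ((hatMaps c i b i).map a σ).trace = σ (f.symm a) (f.symm a) := by
      intro a
      refine (congrArg (fun Φ : SuperOp (N i).In ((N i).Out ⊠ ((c i).K ⊠ (c i).W)) =>
        (Φ σ).trace) (hatMaps_self c hV b a)).trans ?_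
      rw [conj_single_matrix, trace_smul]
      simp
    have h2 : ∀ u, (ptraceLeft (ptrace σ) - (N i).test) u u
        = σ (g u) (g u) - (Fintype.card (N i).Arel : ℂ)⁻¹ := by
      intro u
      rw [Matrix.sub_apply, h.test, Matrix.smul_apply, Matrix.one_apply_eq, smul_eq_mul, mul_one]
      congr 1
      change ∑ α, ∑ s, σ ((α, u), s) ((α, u), s) = _
      rw [Fintype.sum_eq_single α₀ fun x hx => absurd (Subsingleton.elim _ _) hx,
        Fintype.sum_eq_single s₀ fun x hx => absurd (Subsingleton.elim _ _) hx]
      rfl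
    refine le_trans (le_of_eq ?_) (sum_norm_diag_le _)
    rw [← Equiv.sum_comp (g.trans f)]
    refine sum_congr rfl fun u _ => ?_
    rw [h1, h2, hcard]
    simp

theorem conj_single_eq_extL {I O Z : QSys} (o : O) (z : Z) (x : I) :
    conj (X := I) (Y := O ⊠ Z) (Matrix.single (o, z) x 1)
      = extL (conj (X := QSys.unit) (Y := Z) (Matrix.of fun p _ => if p = z then (1 : ℂ) else 0)) O
        ∘ₗ append 1 ∘ₗ conj (X := I) (Y := O) (Matrix.single o x 1) := by
  refine LinearMap.ext fun ρ => ?_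
  rw [comp_apply, comp_apply, conj_single_matrix, conj_single_matrix,
    map_smul, map_smul]
  congr 1
  refine Eq.trans ?_ (extL_kron _ _ _).symm
  have h1 : conj (X := QSys.unit) (Y := Z)
      (Matrix.of fun p _ => if p = z then (1 : ℂ) else 0) 1 = Matrix.single z z 1 := by
    rw [conj_apply, Matrix.mul_one]
    ext p q
    rw [mul_apply, Fintype.sum_unique]
    simp only [of_apply, conjTranspose_apply, single_apply]
    have e1 : p = z ↔ z = p := eq_comm
    have e2 : q = z ↔ z = q := eq_comm
    simp only [e1, e2]
    by_cases h1 : z = p <;> by_cases h2 : z = q <;> simp [h1, h2]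
  rw [h1, single_kronecker_single, one_mul]

theorem exists_hat_env (c : ∀ j, CopyDil (N j)) {i : ι} {h : CbitLike (N i)}
    {f : (N i).In ≃ (c i).K} {w : (c i).W}
    (hV : (c i).V = basisMap (Y := (N i).Out ⊠ ((c i).K ⊠ (c i).W)) fun x => (h.out x, (f x, w)))
    (b : (c i).K) (dil : ∀ j, Dilation Unit (N j).chan) (j : ι)
    (e : ExtMap ((N i).In × (N i).Bout) (N j))
    (he : e = Protocol.cohMaps i dil j) :
    ∃ D : Matrix ((c j).K ⊠ (c j).W) e.Z ℂ, IsContr D ∧ ∀ a,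
      (hatMaps c i b j).map a
        = extL (conj D) (N j).Out ∘ₗ e.map (f.symm a, (h.out (f.symm a)).2) := by
  by_cases hj : j = i
  · subst hj
    have he' : e = ExtMap.branch (N j) := he.trans (Function.update_self ..)
    subst he'
    refine ⟨Matrix.of fun p _ => if p = (b, w) then 1 else 0, IsContr.of_isometry ?_, fun a => ?_⟩
    · ext x y
      obtain rfl : x = y := Subsingleton.elim (α := Unit) _ _
      rw [mul_apply, sum_eq_single (b, w)]
      · simp
      · intro z _ hz; simp [hz]
      · simp
    · refine (hatMaps_self c hV b a).trans (Eq.trans ?_ (congrArg (fun Φ :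
        SuperOp (N j).In ((N j).Out ⊠ QSys.unit) => extL (conj (Y := (c j).K ⊠ (c j).W)
          (Matrix.of fun p _ => if p = (b, w) then (1 : ℂ) else 0)) (N j).Out ∘ₗ Φ)
        ((h.branch_map _ _).trans (if_pos rfl))).symm)
      exact conj_single_eq_extL (I := (N j).In) (O := (N j).Out) (Z := (c j).K ⊠ (c j).W)
        (h.out (f.symm a)) (b, w) (f.symm a)
  · have he' : e = ExtMap.dilated (dil j) := he.trans (Function.update_of_ne hj ..)
    subst he'
    obtain ⟨D, hD, hD'⟩ := exists_contr_of_dilates ((dil j).dilates ()) (c j).dilates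
    refine ⟨D, hD, fun a => ?_⟩
    refine (hatMaps_of_ne c b a hj).trans ?_
    rw [← hD']
    exact (extL_conj_comp _ _).symm

end Corrections

section Abstract

variable {ι : Type} [Fintype ι] [DecidableEq ι] {K W : ι → QSys} {T : Resource}
  {O B T' E W' : QSys}

theorem exists_corrections_of_near_uniform {V : Matrix (T' ⊠ E) B ℂ}
    (hV : Vᴴ * V = 1) {A : Matrix (((O ⊠ B) ⊠ QSys.pi K) ⊠ W') T.In ℂ}
    (hA : Aᴴ * A = 1) (i : ι) (b : (K i))
    {U : (K i) → Op E} (hU : ∀ a, (U a)ᴴ * U a = 1) {ε : ℝ}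
    (hF : ∀ (R : QSys) (ψ : Matrix T.In R ℂ), T.IsExtension (pureOp ψ) →
      ∑ a, nsq (vec (pinned i b V A (U a) ψ a)) = 1 →
      ∑ a, traceNorm (pureOp (pinned i b V A (U a) ψ a) - (Fintype.card (K i) : ℂ)⁻¹ •
        ∑ b', pureOp (pinned i b V A (U b') ψ b')) ≤ ε) :
    ∃ U : (K i) → Op E, (∀ a, (U a)ᴴ * U a = 1) ∧
      ∀ (R : QSys) (ψ : Matrix T.In R ℂ), T.IsExtension (pureOp ψ) →
        ∑ k, ∑ a, nsq (vec ((U a)ᴴ * U (k i) * decoded V A ψ k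
          - decoded V A ψ (Function.update k i a))) ≤ Fintype.card (K i) * (128 * ε) := by
  have hn : ∀ (R : QSys) (ψ : Matrix T.In R ℂ), T.IsExtension (pureOp ψ) →
      ∑ a, nsq (vec (pinned i b V A (U a) ψ a)) = 1 := by
    intro R ψ hψ
    rw [sum_nsq_pinned hV hA i b hU ψ]
    have := nsq_vec_eq_trace ψ
    rw [hψ.1.2] at this
    exact_mod_cast this
  have e : ∀ (R : QSys) (ψ : Matrix T.In R ℂ),
      (fun a => pinned i b V A (U a) (1 : Op T.In) a * ψ) = fun a => pinned i b V A (U a) ψ a :=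
    fun R ψ => funext fun a => pinned_mul i b V A (U a) ψ a
  obtain ⟨R₀, ψ₀, hψ₀⟩ := exists_pure_extension T
  obtain ⟨ω, hω, hωF⟩ := exists_phases (fun R ψ => T.IsExtension (pureOp ψ))
    (fun R₀ R₁ ψ₀ ψ₁ h₀ h₁ => isExtension_superpose h₀ h₁) hψ₀
    (fun a => pinned i b V A (U a) (1 : Op T.In) a)
    (fun R ψ hψ => (congrArg (fun f : (K i) → Matrix _ R ℂ =>
      ∑ a, nsq (vec (X := QSys.pi K ⊠ (E ⊠ ((O ⊠ T') ⊠ W'))) (f a))) (e R ψ)).trans (hn R ψ hψ))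
    (fun R ψ hψ => (congrArg (fun f : (K i) → Matrix _ R ℂ =>
      ∑ a, traceNorm (pureOp (X := QSys.pi K ⊠ (E ⊠ ((O ⊠ T') ⊠ W'))) (f a) -
        (Fintype.card (K i) : ℂ)⁻¹ • ∑ b', pureOp (f b'))) (e R ψ)).trans_le
        (hF R ψ hψ (hn R ψ hψ)))
  have hω' : ∀ (R : QSys) (ψ : Matrix T.In R ℂ), T.IsExtension (pureOp ψ) →
      ∑ a, ∑ a', nsq (ω a • vec (pinned i b V A (U a) ψ a)
        - ω a' • vec (pinned i b V A (U a') ψ a')) ≤ Fintype.card (K i) * (128 * ε) :=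
    fun R ψ hψ => (congrArg (fun f : (K i) → Matrix _ R ℂ =>
      ∑ a, ∑ a', nsq (ω a • vec (X := QSys.pi K ⊠ (E ⊠ ((O ⊠ T') ⊠ W'))) (f a) -
        ω a' • vec (f a'))) (e R ψ)).symm.trans_le (hωF R ψ hψ)
  exact ⟨fun a => ω a • U a, (sum_nsq_swap i b hU hω ψ₀ (hω' R₀ ψ₀ hψ₀)).1,
    fun R ψ hψ => (sum_nsq_swap i b hU hω ψ (hω' R ψ hψ)).2⟩

variable {l : List ι} {M₀ M₁ S F G I : QSys}

theorem conj_pinned_eq (h : l.Nodup) (h' : ∀ j, j ∈ l)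
    {A : Matrix ((((O ⊠ F) ⊠ B) ⊠ sysList (fun j => K j ⊠ W j) l) ⊠ G) I ℂ}
    {run : SuperOp (M₀ ⊠ S) ((M₁ ⊠ B) ⊠ sysList (fun j => K j ⊠ W j) l)}
    {v₁ : SuperOp M₁ (O ⊠ F)} {prep : SuperOp I ((M₀ ⊠ S) ⊠ G)}
    (hA : conj A = pipe run v₁ LinearMap.id prep) (i : ι) (b a : (K i))
    (V : Matrix (T' ⊠ E) B ℂ) (u : Op E) :
    conj (pinned i b V (W := sysList W l ⊠ (F ⊠ G)) (Matrix.of fun p => A ((arrange h h').symm p))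
      u (1 : Op I) a)
    = relabel (Y := QSys.pi K ⊠ (E ⊠ ((O ⊠ T') ⊠ (sysList W l ⊠ (F ⊠ G))))) (arrangeDecoded h h')
      ∘ₗ pipe (extL (conj (envMat (hatMat (W := W) i b a) l)) (M₁ ⊠ B) ∘ₗ run) v₁
        (conj (Y := T' ⊠ E) (((1 : Op T') ⊗ₖ u : Op (T' ⊠ E)) * V)) prep := by
  have h1 := pipe_env run v₁ LinearMap.id prep (conj (envMat (hatMat (W := W) i b a) l))
    LinearMap.id (conj (Y := T' ⊠ E) (((1 : Op T') ⊗ₖ u : Op (T' ⊠ E)) * V)) LinearMap.id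
  rw [extL_id, LinearMap.id_comp, LinearMap.id_comp, LinearMap.comp_id, ← hA, ← conj_one,
    ← conj_one (X := G), tensor_conj, tensor_conj, tensor_conj, conj_comp] at h1
  rw [h1, relabel_conj_apply, pinned_eq_arrange h h']

theorem sum_pinned_le (h : l.Nodup) (h' : ∀ j, j ∈ l)
    {A : Matrix ((((O ⊠ F) ⊠ B) ⊠ sysList (fun j => K j ⊠ W j) l) ⊠ G) T.In ℂ}
    {i : ι} {b : (K i)} {V : Matrix (T' ⊠ E) B ℂ}
    {U : (K i) → Op E} {Q : QSys}
    {Φ : (K i) → SuperOp T.In Q}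
    {C : Matrix ((((O ⊠ F) ⊠ (T' ⊠ E)) ⊠ sysList (fun j => K j ⊠ W j) l) ⊠ G) Q ℂ}
    (hC : IsContr C)
    (hΦ : ∀ a, conj (pinned i b V (W := sysList W l ⊠ (F ⊠ G))
      (Matrix.of fun p => A ((arrange h h').symm p)) (U a) (1 : Op T.In) a)
      = relabel (Y := QSys.pi K ⊠ (E ⊠ ((O ⊠ T') ⊠ (sysList W l ⊠ (F ⊠ G))))) (arrangeDecoded h h')
      ∘ₗ conj C ∘ₗ Φ a) {R : QSys} (ψ : Matrix T.In R ℂ)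
    (hn : ∑ a, nsq (vec (pinned i b V (W := sysList W l ⊠ (F ⊠ G))
      (Matrix.of fun p => A ((arrange h h').symm p)) (U a) ψ a)) = 1) {ε η : ℝ}
    (hε : ∑ a, traceNorm (ext (Φ a) R (pureOp ψ) - (ext (Φ a) R (pureOp ψ)).trace •
      ∑ b, ext (Φ b) R (pureOp ψ)) ≤ ε)
    (hη : ∑ a, ‖((conj C ∘ₗ Φ a) (ptrace (pureOp ψ))).trace - (Fintype.card (K i) : ℂ)⁻¹‖
      ≤ η) :
    ∑ a, traceNorm (pureOp (pinned i b V (W := sysList W l ⊠ (F ⊠ G))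
      (Matrix.of fun p => A ((arrange h h').symm p)) (U a) ψ a)
      - (Fintype.card (K i) : ℂ)⁻¹ •
        ∑ b', pureOp (pinned i b V (W := sysList W l ⊠ (F ⊠ G))
      (Matrix.of fun p => A ((arrange h h').symm p)) (U b') ψ b')) ≤ 2 * ε + η := by
  have h1 : ∀ a, pureOp (pinned i b V (W := sysList W l ⊠ (F ⊠ G))
      (Matrix.of fun p => A ((arrange h h').symm p)) (U a) ψ a)
      = ext (relabel (Y := QSys.pi K ⊠ (E ⊠ ((O ⊠ T') ⊠ (sysList W l ⊠ (F ⊠ G)))))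
        (arrangeDecoded h h')) R (ext (conj C) R (ext (Φ a) R (pureOp ψ))) := by
    intro a
    rw [← pinned_mul, ← ext_conj_pureOp, hΦ, ext_comp, ext_comp]
    rfl
  refine sum_traceNorm_sub_average_le (Ω := ext (relabel
      (Y := QSys.pi K ⊠ (E ⊠ ((O ⊠ T') ⊠ (sysList W l ⊠ (F ⊠ G)))))
        (arrangeDecoded h h')) R ∘ₗ ext (conj C) R) (fun M => ?_)
    (fun a => ext (Φ a) R (pureOp ψ)) _ h1 hn hε ?_
  · refine (traceNorm_channel_le ((isChannel_relabel _).ext R) _).trans ?_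
    rw [ext_conj]
    exact traceNorm_conj_le (hC.kron_one _) _
  · refine (sum_le_sum fun a _ => le_of_eq ?_).trans hη
    rw [← Real.norm_eq_abs, ← Complex.norm_real]
    push_cast
    rw [nsq_vec_eq_trace, h1]
    congr 2
    rw [trace_ext]
    refine (trace_relabel _ _).trans ?_
    rw [ptrace_ext, ptrace_ext]
    rfl

end Abstract

section Corrections

variable {ι : Type} [DecidableEq ι] {N : ι → Resource} {T : Resource}

/-- The environment systems are grouped together. -/
def regroup (Q F R R' : QSys) : ((Q ⊠ (F ⊠ R')) ⊠ R) ≃ (Q ⊠ (F ⊠ (R ⊠ R'))) where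
  toFun p := (p.1.1, (p.1.2.1, (p.2, p.1.2.2)))
  invFun q := ((q.1, (q.2.1, q.2.2.2)), q.2.2.1)
  left_inv _ := rfl
  right_inv _ := rfl

/-- The branch of a protocol, as a map on the input system. -/
abbrev Protocol.branchMap (P : Protocol N T) (i : ι) (dil : ∀ j, Dilation Unit (N j).chan)
    (d₀ : Dilation Unit P.E₀) (d₁ : Dilation Unit P.E₁) (dB : Dilation (N i).Bout P.D)
    {R' : QSys} (ζ : Op (P.split.T ⊠ R')) (xy : (N i).In × (N i).Bout) :
    SuperOp T.In ((((T.Aout ⊠ d₁.Env) ⊠ (T.Bout ⊠ dB.Env)) ⊠ envSys (Protocol.cohMaps i dil) P.order)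
      ⊠ (d₀.Env ⊠ R')) :=
  pipe (P.layers.run (Protocol.cohMaps i dil) xy)
        (conj (Y := T.Aout ⊠ d₁.Env) (d₁.V ())) (conj (Y := T.Bout ⊠ dB.Env) (dB.V xy.2))
        (prepare (conj (Y := P.M₀ ⊠ d₀.Env) (d₀.V ())) P.split ζ)

theorem Protocol.branchState_eq (P : Protocol N T) (i : ι) (dil : ∀ j, Dilation Unit (N j).chan)
    (d₀ : Dilation Unit P.E₀) (d₁ : Dilation Unit P.E₁) (dB : Dilation (N i).Bout P.D)
    {R R' : QSys} (ξ : Op (T.In ⊠ R)) (ζ : Op (P.split.T ⊠ R'))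
    (x : (N i).In) (y : (N i).Bout) :
    P.branchState i dil d₀ d₁ dB ξ ζ x y = relabel (regroup _ d₀.Env R R')
      (ext (P.branchMap i dil d₀ d₁ dB ζ (x, y)) R ξ) := rfl

theorem Layers.run_zero {L : Type} {E : ∀ j, ExtMap L (N j)} {lab : L} {i : ι}
    (h : (E i).map lab = 0) : ∀ {l : List ι} {M M' : QSys} (ly : Layers N l M M') (_ : i ∈ l),
    ly.run E lab = 0
  | _, _, _, .nil M, hi => absurd hi List.not_mem_nil
  | _, _, _, .cons j (l := l) aux V hV rest, hi => by
    have hz : ∀ {X Y W : QSys}, ext (0 : SuperOp X Y) W = 0 := fun {X Y W} =>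
      LinearMap.ext fun M => Matrix.ext fun p q => rfl
    rw [Layers.run]
    by_cases hji : j = i
    · subst hji
      rw [h, hz, LinearMap.zero_comp, LinearMap.comp_zero, LinearMap.comp_zero, LinearMap.comp_zero]
    · rw [Layers.run_zero h rest ((List.mem_cons.1 hi).resolve_left (Ne.symm hji)), hz,
        LinearMap.zero_comp, LinearMap.comp_zero]

theorem Protocol.branchState_of_ne (P : Protocol N T) {i : ι} (h : CbitLike (N i))
    (dil : ∀ j, Dilation Unit (N j).chan)
    (d₀ : Dilation Unit P.E₀) (d₁ : Dilation Unit P.E₁) (dB : Dilation (N i).Bout P.D)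
    {R R' : QSys} (ξ : Op (T.In ⊠ R)) (ζ : Op (P.split.T ⊠ R'))
    {x : (N i).In} {y : (N i).Bout} (hy : (h.out x).2 ≠ y) :
    P.branchState i dil d₀ d₁ dB ξ ζ x y = 0 := by
  have h0 : ∀ e : ExtMap ((N i).In × (N i).Bout) (N i), e = ExtMap.branch (N i) →
      e.map (x, y) = 0 := by
    rintro _ rfl
    exact (h.branch_map x y).trans (if_neg hy)
  have h1 : P.layers.run (Protocol.cohMaps i dil) (x, y) = 0 :=
    P.layers.run_zero (h0 _ (Function.update_self ..)) (P.complete i)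
  rw [P.branchState_eq, Protocol.branchMap, h1, pipe]
  have hz : ∀ {X Y W : QSys}, ext (0 : SuperOp X Y) W = 0 := fun {X Y W} =>
    LinearMap.ext fun M => Matrix.ext fun p q => rfl
  rw [hz, LinearMap.zero_comp, LinearMap.comp_zero, hz, LinearMap.zero_apply, map_zero]

theorem traceNorm_indep_relabel {α : Type} [Fintype α] {X Y : QSys} (e : X ≃ Y)
    (σ : α → Op X) (a : α) : traceNorm (σ a - (σ a).trace • ∑ b, σ b)
      ≤ traceNorm (relabel e (σ a) - (relabel e (σ a)).trace • ∑ b, relabel e (σ b)) := by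
  refine le_trans (le_of_eq ?_) (traceNorm_relabel_le e.symm _)
  rw [map_sub, map_smul, map_sum]
  simp only [relabel_symm_relabel]
  rw [trace_relabel]

theorem Protocol.sum_branch_le (P : Protocol N T) {i : ι} (h : CbitLike (N i))
    {dil : ∀ j, Dilation Unit (N j).chan}
    {d₀ : Dilation Unit P.E₀} {d₁ : Dilation Unit P.E₁} {dB : Dilation (N i).Bout P.D}
    {R R' : QSys} {ξ : Op (T.In ⊠ R)} {ζ : Op (P.split.T ⊠ R')} {ε : ℝ}
    (hdec : ∀ σ, σ = cqOp (X := (N i).In) (fun x => ∑ y, P.branchState i dil d₀ d₁ dB ξ ζ x y) →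
        traceNorm (σ - ptrace σ ⊗ₖ ptraceLeft σ) ≤ ε) :
    ∑ x, traceNorm (ext (P.branchMap i dil d₀ d₁ dB ζ (x, (h.out x).2)) R ξ -
      (ext (P.branchMap i dil d₀ d₁ dB ζ (x, (h.out x).2)) R ξ).trace •
        ∑ x', ext (P.branchMap i dil d₀ d₁ dB ζ (x', (h.out x').2)) R ξ) ≤ ε := by
  have h1 : ∀ x, ∑ y, P.branchState i dil d₀ d₁ dB ξ ζ x y
      = relabel (regroup _ d₀.Env R R')
      (ext (P.branchMap i dil d₀ d₁ dB ζ (x, (h.out x).2)) R ξ) := by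
    intro x
    rw [sum_eq_single (h.out x).2, P.branchState_eq]
    · intro y _ hy
      exact P.branchState_of_ne h dil d₀ d₁ dB ξ ζ hy.symm
    · simp
  have h2 := hdec _ rfl
  rw [funext h1, cqOp_sub_marginals] at h2
  refine le_trans (sum_le_sum fun x _ => ?_) ((sum_traceNorm_le_cqOp _).trans h2)
  exact traceNorm_indep_relabel (regroup _ d₀.Env R R')
    (fun x => ext (P.branchMap i dil d₀ d₁ dB ζ (x, (h.out x).2)) R ξ) x

theorem Protocol.exists_corrections [Fintype ι] {P : Protocol N T} (K W : ι → QSys)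
    {c : ∀ j, CopyDil (N j)} (hK : K = fun j => (c j).K) (hW : W = fun j => (c j).W)
    {d₀ : Dilation Unit P.E₀} {d₁ : Dilation Unit P.E₁}
    {R' E : QSys} {s : Matrix P.split.T R' ℂ} (hs : ptrace (pureOp s) = P.split.σ)
    (hs' : IsState (pureOp s))
    {run : SuperOp (P.M₀ ⊠ srcSys N P.order) ((P.M₁ ⊠ bobSys N P.order) ⊠
      sysList (fun j => K j ⊠ W j) P.order)}
    (hrun : HEq run (P.layers.run (fun j => (c j).full) ()))
    {A : Matrix ((((T.Aout ⊠ d₁.Env) ⊠ bobSys N P.order) ⊠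
      sysList (fun j => K j ⊠ W j) P.order) ⊠ (d₀.Env ⊠ R')) T.In ℂ}
    {A' : Matrix (((T.Aout ⊠ bobSys N P.order) ⊠ QSys.pi K) ⊠ (sysList W P.order ⊠
      (d₁.Env ⊠ (d₀.Env ⊠ R')))) T.In ℂ}
    (hA' : A' = Matrix.of fun p => A ((arrange P.nodup P.complete).symm p))
    (hAi : A'ᴴ * A' = 1)
    (hA : conj A = pipe run
      (conj (Y := T.Aout ⊠ d₁.Env) (d₁.V ())) LinearMap.id
      (prepare (conj (Y := P.M₀ ⊠ d₀.Env) (d₀.V ())) P.split (pureOp s)))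
    {V₀ : Matrix (T.Bout ⊠ E) (bobSys N P.order) ℂ} (hV₀ : V₀ᴴ * V₀ = 1)
    (hV₀' : ∀ ρ, ptrace (conj V₀ ρ) = P.D ρ)
    {i : ι} {h : CbitLike (N i)} (hc : (c i).IsCopy h) {ε η : ℝ} (hη : P.Valid η)
    {dil : ∀ j, Dilation Unit (N j).chan} {d₀' : Dilation Unit P.E₀} {d₁' : Dilation Unit P.E₁}
    {dB : Dilation (N i).Bout P.D}
    (hdec : ∀ (R R' : QSys) (ξ : Op (T.In ⊠ R)) (ζ : Op (P.split.T ⊠ R')),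
      T.IsExtension ξ → IsState ζ → ptrace ζ = P.split.σ →
      ∀ σ, σ = cqOp (X := (N i).In) (fun x => ∑ y, P.branchState i dil d₀' d₁' dB ξ ζ x y) →
        traceNorm (σ - ptrace σ ⊗ₖ ptraceLeft σ) ≤ ε)
    {J : Matrix E dB.Env ℂ} (hJ : Jᴴ * J = 1) :
    ∃ U : (K i) → Op E, (∀ a, (U a)ᴴ * U a = 1) ∧
      ∀ (R : QSys) (ψ : Matrix T.In R ℂ), T.IsExtension (pureOp ψ) →
        ∑ k, ∑ a, nsq (vec ((U a)ᴴ * U (k i) * decoded V₀ A' ψ k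
          - decoded V₀ A' ψ (Function.update k i a)))
        ≤ Fintype.card (K i) * (128 * (2 * ε + η)) := by
  subst hK hW
  obtain rfl := eq_of_heq hrun
  obtain ⟨f, w, hV⟩ := hc
  let y : (c i).K → (N i).Bout := fun a => (h.out (f.symm a)).2
  let b : (c i).K := Classical.arbitrary _
  choose U hU hUV using fun a => exists_unitary_of_dilates hV₀'
    (conj_iso_dilates (dB.dilates (y a)) hJ)
  obtain ⟨C₀, hC₀, hC₀'⟩ := exists_contr_of_dilates (d₀'.dilates ()) (d₀.dilates ())
  obtain ⟨C₁, hC₁, hC₁'⟩ := exists_contr_of_dilates (d₁'.dilates ()) (d₁.dilates ())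
  choose Dj hDj hDj' using fun j => exists_hat_env c hV b dil j _ rfl
  obtain ⟨C, hC, hC'⟩ : ∃ C : Matrix _ _ ℂ, IsContr C ∧
      tensor (tensor (tensor (extL (conj C₁) T.Aout) (extL (conj J) T.Bout))
          (conj (envMat Dj P.order))) (ext (conj C₀) R') = conj C := by
    rw [extL_conj, extL_conj, ext_conj, tensor_conj, tensor_conj, tensor_conj]
    exact ⟨_, ((((hC₁.one_kron _).kron ((IsContr.of_isometry hJ).one_kron _)).kron
      (isContr_envMat hDj _)).kron (hC₀.kron_one _)), rfl⟩
  subst hA'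
  refine exists_corrections_of_near_uniform (K := fun j => (c j).K) hV₀ hAi i b hU ?_
  intro R ψ hψ hn
  have hpipe : ∀ a, pipe (extL (conj (envMat (hatMat (K := fun j => (c j).K)
        (W := fun j => (c j).W) i b a) P.order)) (P.M₁ ⊠ bobSys N P.order)
          ∘ₗ P.layers.run (fun j => (c j).full) ())
        (conj (Y := T.Aout ⊠ d₁.Env) (d₁.V ()))
        (conj (Y := T.Bout ⊠ E) (((1 : Op T.Bout) ⊗ₖ U a : Op (T.Bout ⊠ E)) * V₀))
        (prepare (conj (Y := P.M₀ ⊠ d₀.Env) (d₀.V ())) P.split (pureOp s))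
      = conj C ∘ₗ P.branchMap i dil d₀' d₁' dB (pureOp s) (f.symm a, y a) := by
    intro a
    have hr : P.layers.run (hatMaps c i b) a = extL (conj (envMat Dj P.order)) _ ∘ₗ
        P.layers.run (Protocol.cohMaps i dil) (f.symm a, y a) := by
      rw [← envMap_conj]
      exact P.layers.run_env fun j => hDj' j a
    have h1 := (extL_conj_comp C₁ (d₁'.V ())).trans (congrArg conj hC₁')
    have h0 := (extL_conj_comp C₀ (d₀'.V ())).trans (congrArg conj hC₀')
    have hB := (extL_conj_comp J (dB.V (y a))).trans (congrArg conj (hUV a).symm)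
    refine (congrArg (fun r => pipe r _ _ _) ((run_hatMaps c i b a P.layers).symm.trans hr)).trans ?_
    rw [← h1, ← h0, ← hB, prepare_env, pipe_env, hC']
  refine sum_pinned_le (K := fun j => (c j).K) (W := fun j => (c j).W) P.nodup P.complete hC
    (Φ := fun a => P.branchMap i dil d₀' d₁' dB (pureOp s) (f.symm a, y a)) (fun a => ?_) ψ hn ?_ ?_
  · rw [← hpipe]
    exact conj_pinned_eq (K := fun j => (c j).K) (W := fun j => (c j).W) P.nodup P.complete hA i b a
      V₀ (U a)
  · refine le_trans (le_of_eq ?_) (P.sum_branch_le h (hdec R R' (pureOp ψ) (pureOp s) hψ hs' hs))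
    rw [← Equiv.sum_comp f.symm, ← Equiv.sum_comp f.symm]
  · refine le_trans (le_of_eq (sum_congr rfl fun a _ => ?_)) (sum_trace_hatMaps_le c hV b
      P.layers P.nodup (P.complete i) _ (hη R (pureOp ψ) hψ))
    rw [← hpipe]
    refine (congrArg (fun z : ℂ => ‖z - _‖) ((trace_pipe (isChannel_conj _ (d₁.isometry ()))
      (isChannel_conj _ ?_) _ _).trans ?_))
    · rw [conjTranspose_mul, Matrix.mul_assoc, ← Matrix.mul_assoc _ _ V₀,
        conjTranspose_kronecker, ← mul_kronecker_mul, hU]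
      simp [hV₀]
    · refine congrArg Matrix.trace (congrArg₂ (fun Φ M => Φ M) (run_hatMaps c i b a P.layers).symm ?_)
      exact LinearMap.congr_fun (ptrace_prepare (LinearMap.ext (d₀.dilates ())) hs) _

end Corrections

section Block

theorem isConj_append_pureOp {X W R : QSys} {s : Matrix W R ℂ}
    (hs : nsq (vec s) = 1) :
    IsConj (append (W := W ⊠ R) (pureOp s) : SuperOp X (X ⊠ (W ⊠ R))) := by
  refine ⟨Matrix.of fun p x => if p.1 = x then vec s p.2 else 0, ?_, ?_⟩
  · ext x x'
    rw [mul_apply]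
    simp only [conjTranspose_apply, of_apply]
    rw [sum_prod_type (f := fun p : X × (W × R) =>
      star (if p.1 = x then vec s p.2 else 0) * if p.1 = x' then vec s p.2 else 0),
      sum_eq_single x]
    · by_cases h : x = x'
      · subst h
        simp only [if_true, Matrix.one_apply_eq]
        have h1 : ((nsq (vec s) : ℝ) : ℂ) = ∑ p, star (vec s p) * vec s p := nsq_eq_dotProduct _
        rw [hs] at h1
        rw [← h1]; simp
      · simp [h]
    · intro b _ hb; simp [hb]
    · simp
  · refine superOp_ext fun x x' => ?_
    ext p q
    rw [conj_single_apply]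
    change Matrix.single x x' (1 : ℂ) p.1 q.1 * (vec s p.2 * star (vec s q.2))
      = (if p.1 = x then vec s p.2 else 0) * star (if q.1 = x' then vec s q.2 else 0)
    rw [single_apply]
    have e1 : x = p.1 ↔ p.1 = x := eq_comm
    have e2 : x' = q.1 ↔ q.1 = x' := eq_comm
    simp only [e1, e2]
    by_cases h1 : p.1 = x <;> by_cases h2 : q.1 = x' <;> simp [h1, h2]

theorem CbitLike.dilates {r : Resource} (h : CbitLike r) (ρ : Op r.In) :
    ptrace (conj (X := r.In) (Y := r.Out ⊠ (r.In ⊠ QSys.unit))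
      (basisMap (X := r.In) (Y := r.Out ⊠ (r.In ⊠ QSys.unit)) fun x => (h.out x, (x, ()))) ρ)
      = r.chan ρ := by
  suffices ptrace ∘ₗ push (X := r.In) (Y := r.Out ⊠ (r.In ⊠ QSys.unit))
      (fun x => (h.out x, (x, ()))) = r.chan from LinearMap.congr_fun this ρ
  refine superOp_ext fun x x' => ?_
  rw [comp_apply, push_single, h.chan_eq, LinearMap.sum_apply, sum_eq_single x]
  · rw [conj_single_matrix]
    have h1 : (Matrix.single (h.out x, (x, ())) (h.out x', (x', ())) (1 : ℂ) :
        Op (r.Out ⊠ (r.In ⊠ QSys.unit))) = (Matrix.single (h.out x) (h.out x') (1 : ℂ) : Op r.Out) ⊗ₖ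
          (Matrix.single (x, ()) (x', ()) (1 : ℂ) : Op (r.In ⊠ QSys.unit)) := by
      rw [single_kronecker_single, one_mul]
    rw [h1, ptrace_kron]
    by_cases hx : x = x'
    · subst hx; simp
    · have h2 : (Matrix.single (x, ()) (x', ()) (1 : ℂ) : Op (r.In ⊠ QSys.unit)).trace = 0 :=
        Matrix.trace_single_eq_of_ne _ _ _ fun h => hx (congrArg Prod.fst h)
      rw [h2, single_apply, if_neg (fun h => hx h.2.symm), zero_smul, zero_smul]
  · intro z _ hz
    rw [conj_single_matrix, single_apply, if_neg (fun h => hz h.1.symm), zero_smul]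
  · simp

/-- A register is kept for the classical channels only. -/
def CopyDil.ofOption {r : Resource} : Option (CbitLike r) → CopyDil r
  | some h => ⟨r.In, QSys.unit, basisMap (X := r.In) (Y := r.Out ⊠ (r.In ⊠ QSys.unit))
      fun x => (h.out x, (x, ())), basisMap_isometry fun _ _ h => congrArg (fun p => p.2.1) h,
      h.dilates⟩
  | none =>
    have d : Dilation Unit r.chan := Classical.choice (exists_dilation r.isChannel)
    ⟨QSys.unit, d.Env, Matrix.of fun p x => d.V () (p.1, p.2.2) x, by
      rw [← d.isometry ()]
      ext x x'
      rw [mul_apply, mul_apply]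
      change ∑ p : r.Out × (Unit × d.Env), star (d.V () (p.1, p.2.2) x) *
          d.V () (p.1, p.2.2) x'
        = ∑ p : r.Out × d.Env, star (d.V () p x) * d.V () p x'
      exact Fintype.sum_equiv ((Equiv.refl r.Out).prodCongr (punitProd d.Env))
        _ _ fun _ => rfl, fun ρ => by
      rw [← d.dilates ()]
      ext o o'
      change ∑ w : Unit × d.Env, conj (d.V ()) ρ (o, w.2) (o', w.2)
        = ∑ w, conj (d.V ()) ρ (o, w) (o', w)
      exact Fintype.sum_equiv (punitProd d.Env) _ _ fun _ => rfl⟩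

/-- The protocol with the kept registers. -/
def Layers.keptRun {ι : Type} {N : ι → Resource} {l : List ι} {M M' : QSys} (ly : Layers N l M M')
    (c : ∀ j, CopyDil (N j)) :
    SuperOp (M ⊠ srcSys N l) ((M' ⊠ bobSys N l) ⊠ sysList (fun j => (c j).K) l) :=
  ly.run (fun j => (c j).kept) ()

/-- The isometrically extended protocol. -/
def Layers.fullRun {ι : Type} {N : ι → Resource} {l : List ι} {M M' : QSys} (ly : Layers N l M M')
    (c : ∀ j, CopyDil (N j)) :
    SuperOp (M ⊠ srcSys N l) ((M' ⊠ bobSys N l) ⊠ sysList (fun j => (c j).K ⊠ (c j).W) l) :=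
  ly.run (fun j => (c j).full) ()

theorem Layers.keptRun_eq {ι : Type} {N : ι → Resource} {l : List ι} (c : ∀ j, CopyDil (N j))
    {M M' : QSys} (ly : Layers N l M M') :
    ly.keptRun c = extL (envMap (Z := fun j => (c j).K ⊠ (c j).W)
      (Z' := fun j => (c j).K) (fun _ => ptrace) l) (M' ⊠ bobSys N l) ∘ₗ ly.fullRun c :=
  ly.run_env (E := fun j => (c j).full) (E' := fun j => (c j).kept) fun _ => rfl

theorem Layers.ptrace_keptRun {ι : Type} {N : ι → Resource} {l : List ι} (c : ∀ j, CopyDil (N j))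
    {M M' : QSys} (ly : Layers N l M M') :
    ptrace ∘ₗ ly.keptRun c = ptrace ∘ₗ ly.run (fun j => ExtMap.plain (N j)) () := by
  refine ly.ptrace_run (E := fun j => (c j).kept) fun j => LinearMap.ext fun ρ => ?_
  rw [← (c j).dilates ρ]
  refine Matrix.ext fun p q => ?_
  change ∑ k, ∑ w, conj (c j).V ρ (p, (k, w)) (q, (k, w))
    = ∑ z : (c j).K × (c j).W, conj (c j).V ρ (p, z) (q, z)
  rw [sum_prod_type]

variable {ι : Type} [Fintype ι] [DecidableEq ι] {K W : ι → QSys} {l : List ι} {O B F G : QSys}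

theorem ptrace_arrange (h : l.Nodup) (h' : ∀ j, j ∈ l) :
    ptrace ∘ₗ relabel (X := (((O ⊠ F) ⊠ B) ⊠ sysList (fun j => K j ⊠ W j) l) ⊠ G)
      (Y := ((O ⊠ B) ⊠ QSys.pi K) ⊠ (sysList W l ⊠ (F ⊠ G))) (arrange h h')
    = extL (relabel (Y := QSys.pi K) (sysPi h h')) (O ⊠ B) ∘ₗ
      extL (envMap (Z := fun j => K j ⊠ W j) (Z' := K) (fun _ => ptrace) l) (O ⊠ B) ∘ₗ
      ext (ext ptrace B) (sysList (fun j => K j ⊠ W j) l) ∘ₗ ptrace := by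
  rw [envMap_ptrace]
  refine LinearMap.ext fun M => Matrix.ext fun p q => ?_
  change ∑ w : (sysList W l) × (F × G),
      M ((((p.1.1, w.2.1), p.1.2), (sysZip l).symm ((sysPi h h').symm p.2, w.1)), w.2.2)
        ((((q.1.1, w.2.1), q.1.2), (sysZip l).symm ((sysPi h h').symm q.2, w.1)), w.2.2)
    = ∑ w : (sysList W l), ∑ f : F, ∑ g : G,
      M ((((p.1.1, f), p.1.2), (sysZip l).symm ((sysPi h h').symm p.2, w)), g)
        ((((q.1.1, f), q.1.2), (sysZip l).symm ((sysPi h h').symm q.2, w)), g)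
  rw [sum_prod_type]
  refine sum_congr rfl fun w _ => ?_
  rw [sum_prod_type]

variable {N : ι → Resource} {T : Resource}

/-- Alice's final operation, and the registers in the form of a family. -/
def keptPipe {X M₁ : QSys} (h : l.Nodup) (h' : ∀ j, j ∈ l) (E₁ : SuperOp M₁ O)
    (run : SuperOp X ((M₁ ⊠ B) ⊠ sysList K l)) : SuperOp X ((O ⊠ B) ⊠ QSys.pi K) :=
  extL (relabel (Y := QSys.pi K) (sysPi h h')) (O ⊠ B) ∘ₗ ext (ext E₁ B) (sysList K l) ∘ₗ run

theorem extL_ptrace_keptPipe {X M₁ B' : QSys} (h : l.Nodup) (h' : ∀ j, j ∈ l) (E₁ : SuperOp M₁ O)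
    (D : SuperOp B B') (run : SuperOp X ((M₁ ⊠ B) ⊠ sysList K l)) :
    extL D O ∘ₗ ptrace ∘ₗ keptPipe h h' E₁ run = tensor E₁ D ∘ₗ ptrace ∘ₗ run := by
  refine LinearMap.ext fun ρ => ?_
  rw [tensor_eq]
  simp only [comp_apply, keptPipe]
  rw [ptrace_extL (isChannel_relabel _).tracePreserving, ptrace_ext]

theorem ptrace_arrange_pipe {X M₀ M₁ S F₀ R' : QSys} (h : l.Nodup) (h' : ∀ j, j ∈ l)
    (v₁ : SuperOp M₁ (O ⊠ F)) (run : SuperOp (M₀ ⊠ S) ((M₁ ⊠ B) ⊠ sysList (fun j => K j ⊠ W j) l))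
    (prep : SuperOp X ((M₀ ⊠ S) ⊠ (F₀ ⊠ R'))) :
    ptrace ∘ₗ relabel (Y := ((O ⊠ B) ⊠ QSys.pi K) ⊠ (sysList W l ⊠ (F ⊠ (F₀ ⊠ R'))))
      (arrange h h') ∘ₗ pipe run v₁ LinearMap.id prep
    = keptPipe h h' (ptrace ∘ₗ v₁) (extL (envMap (Z := fun j => K j ⊠ W j) (Z' := K)
        (fun _ => ptrace) l) (M₁ ⊠ B) ∘ₗ run ∘ₗ ptrace ∘ₗ prep) := by
  rw [← comp_assoc, ptrace_arrange, keptPipe, ext_comp, ext_comp]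
  have h3 := ext_comp_extL (ext (ptrace : SuperOp (O ⊠ F) O) B)
    (envMap (Z := fun j => K j ⊠ W j) (Z' := K) (fun _ => ptrace) l)
  have h4 := ext_comp_extL (ext v₁ B)
    (envMap (Z := fun j => K j ⊠ W j) (Z' := K) (fun _ => ptrace) l)
  refine LinearMap.ext fun ρ => ?_
  have h5 := LinearMap.congr_fun h4 (run (ptrace (prep ρ)))
  have h6 := LinearMap.congr_fun h3 (ext (ext v₁ B) _ (run (ptrace (prep ρ))))
  simp only [comp_apply] at h5 h6
  simp only [comp_apply, pipe]
  rw [ptrace_ext, ptrace_ext, tensor_id_right, h5, h6]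

/-- Alice's and Bob's outputs and the kept registers, before Bob's decoding. -/
def Protocol.keptMap (P : Protocol N T) (c : ∀ j, CopyDil (N j)) :
    SuperOp T.In ((T.Aout ⊠ bobSys N P.order) ⊠ QSys.pi fun j => (c j).K) :=
  keptPipe (K := fun j => (c j).K) P.nodup P.complete P.E₁
    (P.layers.keptRun c ∘ₗ tensor P.E₀ P.split.embed)

theorem Protocol.extL_D_ptrace_keptMap (P : Protocol N T) (c : ∀ j, CopyDil (N j)) :
    extL P.D T.Aout ∘ₗ ptrace ∘ₗ P.keptMap c = P.chan := by
  rw [Protocol.keptMap, extL_ptrace_keptPipe]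
  exact LinearMap.ext fun ρ => congrArg (tensor P.E₁ P.D)
    (LinearMap.congr_fun (P.layers.ptrace_keptRun c) (tensor P.E₀ P.split.embed ρ))

theorem Protocol.ptrace_arrange_pipe (P : Protocol N T) (c : ∀ j, CopyDil (N j))
    (d₀ : Dilation Unit P.E₀) (d₁ : Dilation Unit P.E₁) {R' : QSys} {ζ : Op (P.split.T ⊠ R')}
    (hζ : ptrace ζ = P.split.σ) :
    ptrace ∘ₗ relabel
      (Y := ((T.Aout ⊠ bobSys N P.order) ⊠ QSys.pi fun j => (c j).K) ⊠
        (sysList (fun j => (c j).W) P.order ⊠ (d₁.Env ⊠ (d₀.Env ⊠ R'))))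
      (arrange (K := fun j => (c j).K) (W := fun j => (c j).W) P.nodup P.complete) ∘ₗ
      pipe (P.layers.fullRun c) (conj (Y := T.Aout ⊠ d₁.Env) (d₁.V ())) LinearMap.id
      (prepare (conj (Y := P.M₀ ⊠ d₀.Env) (d₀.V ())) P.split ζ) = P.keptMap c := by
  have h1 : ptrace ∘ₗ conj (Y := T.Aout ⊠ d₁.Env) (d₁.V ()) = P.E₁ :=
    LinearMap.ext (d₁.dilates ())
  have h2 := ptrace_prepare (LinearMap.ext (d₀.dilates ())) hζ
  refine (QShannon.ptrace_arrange_pipe (K := fun j => (c j).K) (W := fun j => (c j).W) P.nodup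
    P.complete _ (P.layers.fullRun c) _).trans ?_
  rw [h1, h2, Protocol.keptMap, P.layers.keptRun_eq, comp_assoc]

end Block

section Block

variable {ι : Type} [DecidableEq ι] {N : ι → Resource} {T : Resource}

theorem CopyDil.isCopy_ofOption {r : Resource} (h : CbitLike r) :
    (CopyDil.ofOption (some h)).IsCopy h :=
  ⟨Equiv.refl _, (), rfl⟩

theorem isConj_prepare_conj {A M₀ S S' F₀ R' : QSys} {ρ : Op S} {ρ' : Op S'}
    {V : Matrix (M₀ ⊠ F₀) A ℂ} (hV : Vᴴ * V = 1) (c : SourceSplit ρ ρ')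
    {s : Matrix c.T R' ℂ} (hs : nsq (vec s) = 1) :
    IsConj (prepare (conj (Y := M₀ ⊠ F₀) V) c (pureOp s)) :=
  (isConj_relabel _).comp ((isConj_append_pureOp hs).comp (IsConj.ext ⟨V, hV, rfl⟩ _))

theorem isConj_pipe {X M₀ M₁ S B Z Y Y' F : QSys} {run : SuperOp (M₀ ⊠ S) ((M₁ ⊠ B) ⊠ Z)}
    {v₁ : SuperOp M₁ Y} {vB : SuperOp B Y'} {prep : SuperOp X ((M₀ ⊠ S) ⊠ F)} (hr : IsConj run)
    (h₁ : IsConj v₁) (hB : IsConj vB) (hp : IsConj prep) : IsConj (pipe run v₁ vB prep) :=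
  (((h₁.tensor hB).ext Z).ext F).comp ((hr.ext F).comp hp)

/-- Any correction operators with a common environment are moved to a common larger space. -/
theorem exists_common_env [Fintype ι] {B Y : QSys} {D : SuperOp B Y} (hD : IsChannel D)
    (F : ι → QSys) : ∃ (E : QSys) (V : Matrix (Y ⊠ E) B ℂ)
      (J : ∀ j, Matrix E (F j) ℂ),
      Vᴴ * V = 1 ∧ (∀ ρ, ptrace (conj V ρ) = D ρ) ∧ ∀ j, (J j)ᴴ * J j = 1 := by
  obtain ⟨d⟩ := exists_dilation hD
  let E : QSys := ⟨d.Env ⊕ Σ j, (F j)⟩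
  let J₀ : Matrix E d.Env ℂ := basisMap (Y := E) Sum.inl
  have hJ₀ : J₀ᴴ * J₀ = 1 := basisMap_isometry Sum.inl_injective
  refine ⟨E, ((1 : Op Y) ⊗ₖ J₀ : Matrix (Y ⊠ E) (Y ⊠ d.Env) ℂ) * d.V (),
    fun j => basisMap (Y := E) fun x => Sum.inr ⟨j, x⟩, ?_, conj_iso_dilates (d.dilates ()) hJ₀,
    fun j => basisMap_isometry fun a b h => by simpa [E] using h⟩
  rw [conjTranspose_mul, Matrix.mul_assoc, ← Matrix.mul_assoc _ _ (d.V ()),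
    conjTranspose_kronecker, ← mul_kronecker_mul, hJ₀]
  simp [d.isometry ()]

theorem isometry_rows {X Y Z : QSys} {A : Matrix Y X ℂ} (hA : Aᴴ * A = 1)
    (e : Y ≃ Z) :
    (Matrix.of fun p => A (e.symm p))ᴴ * (Matrix.of fun p => A (e.symm p)) = 1 := by
  rw [← hA]
  ext x x'
  rw [mul_apply, mul_apply]
  exact Equiv.sum_comp e.symm fun y => star (A y x) * A y x'

/-- A space for the corrections of all classical channels. -/
theorem Protocol.exists_all_corrections [Fintype ι] (P : Protocol N T) (c : ∀ j, CopyDil (N j))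
    (o : ∀ j, Option (CbitLike (N j))) (hcK : ∀ j, o j = none → Subsingleton (c j).K)
    (hcopy : ∀ j h, o j = some h → (c j).IsCopy h)
    {d₀ : Dilation Unit P.E₀} {d₁ : Dilation Unit P.E₁}
    {R' : QSys} {s : Matrix P.split.T R' ℂ} (hs : ptrace (pureOp s) = P.split.σ)
    (hs' : IsState (pureOp s))
    {A : Matrix ((((T.Aout ⊠ d₁.Env) ⊠ bobSys N P.order) ⊠
      sysList (fun j => (c j).K ⊠ (c j).W) P.order) ⊠ (d₀.Env ⊠ R')) T.In ℂ}
    (hAi : Aᴴ * A = 1)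
    (hA : pipe (P.layers.fullRun c)
      (conj (Y := T.Aout ⊠ d₁.Env) (d₁.V ())) LinearMap.id
      (prepare (conj (Y := P.M₀ ⊠ d₀.Env) (d₀.V ())) P.split (pureOp s)) = conj A)
    {ε η : ℝ} (hε : 0 ≤ ε) (hη' : 0 ≤ η) (hη : P.Valid η)
    (hdec : ∀ j h, o j = some h → P.CohDecoupled j ε) :
    ∃ (A' : Matrix (((T.Aout ⊠ bobSys N P.order) ⊠ QSys.pi fun j => (c j).K) ⊠
        (sysList (fun j => (c j).W) P.order ⊠ (d₁.Env ⊠ (d₀.Env ⊠ R')))) T.In ℂ)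
      (E : QSys) (V : Matrix (T.Bout ⊠ E) (bobSys N P.order) ℂ)
      (U : ∀ j, (c j).K → Op E), A'ᴴ * A' = 1 ∧
      conj A' = relabel (arrange (K := fun j => (c j).K) (W := fun j => (c j).W)
        P.nodup P.complete) ∘ₗ conj A ∧ Vᴴ * V = 1 ∧ (∀ ρ, ptrace (conj V ρ) = P.D ρ) ∧
      (∀ j a, (U j a)ᴴ * U j a = 1) ∧
      ∀ (R : QSys) (ψ : Matrix T.In R ℂ), T.IsExtension (pureOp ψ) →
        ∀ j, ∑ k, ∑ a, nsq (vec ((U j a)ᴴ * U j (k j) * decoded V A' ψ k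
          - decoded V A' ψ (Function.update k j a)))
        ≤ Fintype.card (c j).K * (128 * (2 * ε + η)) := by
  have hF : ∀ j, ∃ F : QSys, ∀ h, o j = some h →
      ∃ (dil : ∀ j, Dilation Unit (N j).chan) (d₀' : Dilation Unit P.E₀)
        (d₁' : Dilation Unit P.E₁) (dB : Dilation (N j).Bout P.D), dB.Env = F ∧
      ∀ (R R' : QSys) (ξ : Op (T.In ⊠ R)) (ζ : Op (P.split.T ⊠ R')),
      T.IsExtension ξ → IsState ζ → ptrace ζ = P.split.σ →
      ∀ σ, σ = cqOp (X := (N j).In) (fun x => ∑ y, P.branchState j dil d₀' d₁' dB ξ ζ x y) →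
        traceNorm (σ - ptrace σ ⊗ₖ ptraceLeft σ) ≤ ε := by
    intro j
    rcases hj : o j with _ | h
    · exact ⟨QSys.unit, fun h hh => by simp at hh⟩
    · obtain ⟨dil, d₀', d₁', dB, hd⟩ := hdec j h hj
      exact ⟨dB.Env, fun h' _ => ⟨dil, d₀', d₁', dB, rfl, hd⟩⟩
  choose F hF using hF
  obtain ⟨E, V, J, hV, hVD, hJ⟩ := exists_common_env P.isChannel_D F
  obtain ⟨A', hA'⟩ : ∃ A' : Matrix (((T.Aout ⊠ bobSys N P.order) ⊠ QSys.pi fun j => (c j).K) ⊠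
        (sysList (fun j => (c j).W) P.order ⊠ (d₁.Env ⊠ (d₀.Env ⊠ R')))) T.In ℂ,
      A' = Matrix.of fun p => A ((arrange (K := fun j => (c j).K) (W := fun j => (c j).W)
            P.nodup P.complete).symm p) := ⟨_, rfl⟩
  have hAi' : A'ᴴ * A' = 1 := by rw [hA']; exact isometry_rows hAi _
  have hU : ∀ j, ∃ U : (c j).K → Op E, (∀ a, (U a)ᴴ * U a = 1) ∧
      ∀ (R : QSys) (ψ : Matrix T.In R ℂ), T.IsExtension (pureOp ψ) →
        ∑ k, ∑ a, nsq (vec ((U a)ᴴ * U (k j) * decoded V A' ψ k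
          - decoded V A' ψ (Function.update k j a)))
        ≤ Fintype.card (c j).K * (128 * (2 * ε + η)) := by
    intro j
    rcases hj : o j with _ | h
    · refine ⟨fun _ => 1, fun a => by simp, fun R ψ _ => ?_⟩
      refine (le_of_eq ?_).trans (by positivity : (0 : ℝ) ≤ _)
      refine sum_eq_zero fun k _ => sum_eq_zero fun a _ => ?_
      rw [(hcK j hj).elim a (k j), Function.update_eq_self]
      simp [nsq, vec]
    · obtain ⟨dil, d₀', d₁', dB, hE, hd⟩ := hF j h hj
      obtain ⟨J', hJ'⟩ : ∃ J' : Matrix E dB.Env ℂ, J'ᴴ * J' = 1 := by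
        rw [hE]; exact ⟨J j, hJ j⟩
      exact Protocol.exists_corrections (P := P) (fun j => (c j).K) (fun j => (c j).W) (c := c)
        rfl rfl hs hs' (run := P.layers.fullRun c) HEq.rfl hA' hAi' hA.symm hV hVD
        (hcopy j h hj) hη hd hJ'
  choose U hU hUs using hU
  exact ⟨A', E, V, U, hAi', hA' ▸ (relabel_conj_apply _ _).symm, hV, hVD, hU,
    fun R ψ hψ j => hUs j R ψ hψ⟩

theorem Protocol.coherent_block [Fintype ι] (P : Protocol N T) (o : ∀ j, Option (CbitLike (N j)))
    {ε η : ℝ} (hε : 0 ≤ ε) (hη' : 0 ≤ η) (hη : P.Valid η)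
    (hdec : ∀ j h, o j = some h → P.CohDecoupled j ε) {t : ℝ} (ht : 0 < t) :
    ∃ Dn : SuperOp (bobSys N P.order ⊠ QSys.pi fun j => (CopyDil.ofOption (o j)).K)
      (T.Bout ⊠ QSys.pi fun j => (CopyDil.ofOption (o j)).K), IsChannel Dn ∧
      Near T (2 * t + 2 * (2 ^ Fintype.card ι - 1) * (128 * (2 * ε + η)) / (2 * t))
        (extL Dn (T.Aout ⊠ QSys.pi fun j => (CopyDil.ofOption (o j)).K) ∘ₗ
          spread T.Aout (bobSys N P.order) (QSys.pi fun j => (CopyDil.ofOption (o j)).K) ∘ₗ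
          P.keptMap fun j => CopyDil.ofOption (o j))
        (entangle T.Aout T.Bout (QSys.pi fun j => (CopyDil.ofOption (o j)).K) ∘ₗ P.chan) := by
  obtain ⟨d₀⟩ := exists_dilation P.isChannel_E₀
  obtain ⟨d₁⟩ := exists_dilation P.isChannel_E₁
  obtain ⟨s, hs⟩ := exists_sqrt P.split.isState.1
  have hs1 : ptrace (pureOp s) = P.split.σ := hs.symm
  have hs2 : IsState (pureOp s) :=
    ⟨posSemidef_rankOne _, by rw [← trace_ptrace, hs1]; exact P.split.isState.2⟩
  have hs3 : nsq (vec s) = 1 := by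
    have := hs2.2
    rw [pureOp, trace_rankOne] at this
    exact_mod_cast this
  set c : ∀ j, CopyDil (N j) := fun j => CopyDil.ofOption (o j) with hc
  have hrun : IsConj (P.layers.fullRun c) :=
    P.layers.isConj_run (E := fun j => (c j).full) fun j => ⟨(c j).V, (c j).isometry, rfl⟩
  obtain ⟨A, hA, hA'⟩ := isConj_pipe hrun (vB := LinearMap.id)
    (⟨_, d₁.isometry (), rfl⟩ : IsConj (conj (Y := T.Aout ⊠ d₁.Env) (d₁.V ()))) isConj_id
    (isConj_prepare_conj (d₀.isometry ()) P.split hs3)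
  have hcK : ∀ j, o j = none → Subsingleton (c j).K := by
    intro j hj
    simp only [hc, hj]
    exact inferInstanceAs (Subsingleton Unit)
  have hcopy : ∀ j h, o j = some h → (c j).IsCopy h := by
    intro j h hj
    simp only [hc, hj]
    exact CopyDil.isCopy_ofOption h
  obtain ⟨A', E, V, U, hA'i, hA'A, hV, hVD, hU, hs⟩ := P.exists_all_corrections c o hcK hcopy hs1 hs2
    hA hA' hε hη' hη hdec
  have hkept : ∀ ρ, ptrace (conj A' ρ) = P.keptMap c ρ := fun ρ => by
    rw [hA'A, ← hA', ← P.ptrace_arrange_pipe c d₀ d₁ hs1]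
    rfl
  refine ⟨coherentDecoder V U, isChannel_coherentDecoder hV hU, ?_⟩
  have := coherent_decoding hA'i hkept hV hVD hU ht hs
  rwa [P.extL_D_ptrace_keptMap c] at this

end Block

/-! ### Programs: partial protocols -/

section SeqMap

variable {M S S₁ S₂ A A₁ A₂ B B₁ B₂ W W' X Y : QSys}

/-- The input of the first of two consecutive maps. -/
def seqFirst (ρ : Op ((M ⊠ W) ⊠ (S₁ ⊠ S₂))) : Op (M ⊠ S₁) :=
  ptrace (relabel (X := (M ⊠ W) ⊠ (S₁ ⊠ S₂)) (Y := (M ⊠ S₁) ⊠ (W ⊠ S₂))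
    (prodProdProdComm _ _ _ _) ρ)

/-- The state between two consecutive maps. -/
def seqMidMap (G : SuperOp (M ⊠ S₁) (A₁ ⊠ B₁)) :
    SuperOp ((M ⊠ W) ⊠ (S₁ ⊠ S₂)) (((A₁ ⊠ W) ⊠ S₂) ⊠ B₁) :=
  relabel (X := (A₁ ⊠ B₁) ⊠ (W ⊠ S₂)) (Y := ((A₁ ⊠ W) ⊠ S₂) ⊠ B₁)
      ⟨fun p => (((p.1.1, p.2.1), p.2.2), p.1.2),
       fun q => ((q.1.1.1, q.2), (q.1.1.2, q.1.2)), fun _ => rfl, fun _ => rfl⟩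
    ∘ₗ ext G (W ⊠ S₂) ∘ₗ relabel (X := (M ⊠ W) ⊠ (S₁ ⊠ S₂)) (Y := (M ⊠ S₁) ⊠ (W ⊠ S₂))
    (prodProdProdComm _ _ _ _)

/-- The input of the second of two consecutive maps. -/
def seqMid (G : SuperOp (M ⊠ S₁) (A₁ ⊠ B₁)) (ρ : Op ((M ⊠ W) ⊠ (S₁ ⊠ S₂))) :
    Op ((A₁ ⊠ W) ⊠ S₂) := ptrace (seqMidMap G ρ)

/-- Two consecutive maps; `W` is idle during the first one. -/
def seqMap (G : SuperOp (M ⊠ S₁) (A₁ ⊠ B₁)) (F : SuperOp ((A₁ ⊠ W) ⊠ S₂) (A ⊠ B₂)) :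
    SuperOp ((M ⊠ W) ⊠ (S₁ ⊠ S₂)) (A ⊠ (B₁ ⊠ B₂)) :=
  relabel (X := (A ⊠ B₂) ⊠ B₁) (Y := A ⊠ (B₁ ⊠ B₂))
      ⟨fun p => (p.1.1, (p.2, p.1.2)), fun q => ((q.1, q.2.2), q.2.1), fun _ => rfl, fun _ => rfl⟩
    ∘ₗ ext F B₁ ∘ₗ seqMidMap G

theorem seqMap_post (G : SuperOp (M ⊠ S₁) (A₁ ⊠ B₁)) (F : SuperOp ((A₁ ⊠ W) ⊠ S₂) (A ⊠ B₂))
    (Φ : SuperOp A A₂) (Ψ : SuperOp B₂ B) :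
    seqMap G (tensor Φ Ψ ∘ₗ F) = tensor Φ (extL Ψ B₁) ∘ₗ seqMap G F := rfl

theorem seqMap_ext (G : SuperOp (M ⊠ S₁) (A₁ ⊠ B₁)) (F : SuperOp ((A₁ ⊠ W) ⊠ S₂) (A ⊠ B₂))
    (C : SuperOp X M) : seqMap (G ∘ₗ ext C S₁) F
      = seqMap G F ∘ₗ ext (ext C W) (S₁ ⊠ S₂) := rfl

theorem seqMidMap_extL (G : SuperOp (M ⊠ S₁) (A₁ ⊠ B₁)) (E : SuperOp X S₂) :
    seqMidMap (W := W) G ∘ₗ extL (extL E S₁) (M ⊠ W)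
      = ext (extL E (A₁ ⊠ W)) B₁ ∘ₗ seqMidMap G := by
  have h := ext_comp_extL G (extL E W)
  refine LinearMap.ext fun ρ => ?_
  have h1 := LinearMap.congr_fun h (relabel (X := (M ⊠ W) ⊠ (S₁ ⊠ X))
    (Y := (M ⊠ S₁) ⊠ (W ⊠ X)) (prodProdProdComm _ _ _ _) ρ)
  exact congrArg (relabel (X := (A₁ ⊠ B₁) ⊠ (W ⊠ S₂)) (Y := ((A₁ ⊠ W) ⊠ S₂) ⊠ B₁)
      ⟨fun p => (((p.1.1, p.2.1), p.2.2), p.1.2),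
       fun q => ((q.1.1.1, q.2), (q.1.1.2, q.1.2)), fun _ => rfl, fun _ => rfl⟩) h1

theorem seqMap_extL (G : SuperOp (M ⊠ S₁) (A₁ ⊠ B₁)) (F : SuperOp ((A₁ ⊠ W) ⊠ S₂) (A ⊠ B₂))
    (E : SuperOp X S₂) : seqMap G (F ∘ₗ extL E (A₁ ⊠ W))
      = seqMap G F ∘ₗ extL (extL E S₁) (M ⊠ W) := by
  rw [seqMap, seqMap, comp_assoc, comp_assoc, seqMidMap_extL]
  rfl

theorem seqMid_extL (G : SuperOp (M ⊠ S₁) (A₁ ⊠ B₁)) (E : SuperOp X S₂)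
    (ρ : Op ((M ⊠ W) ⊠ (S₁ ⊠ X))) :
    seqMid G (extL (extL E S₁) (M ⊠ W) ρ) = extL E (A₁ ⊠ W) (seqMid G ρ) := by
  rw [seqMid, ← comp_apply (seqMidMap G), seqMidMap_extL, comp_apply,
    ptrace_ext, seqMid]

theorem TracePreserving.extL {E : SuperOp X Y} (hE : TracePreserving E) (W : QSys) :
    TracePreserving (extL E W) := fun M => by
  rw [← trace_ptraceLeft, ptraceLeft_extL, hE, trace_ptraceLeft]

theorem seqFirst_extL {E : SuperOp X S₂} (hE : TracePreserving E) (ρ : Op ((M ⊠ W) ⊠ (S₁ ⊠ X))) :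
    seqFirst (extL (extL E S₁) (M ⊠ W) ρ) = seqFirst ρ :=
  ptrace_extL (hE.extL W) (relabel (X := (M ⊠ W) ⊠ (S₁ ⊠ X)) (Y := (M ⊠ S₁) ⊠ (W ⊠ X))
    (prodProdProdComm _ _ _ _) ρ)

/-- Sequential composition is associative, up to the arrangement of the systems. -/
theorem seqMap_assoc (G : SuperOp (M ⊠ S) (A₁ ⊠ B₁)) (H : SuperOp ((A₁ ⊠ W) ⊠ S₁) (A₂ ⊠ B₂))
    (F : SuperOp ((A₂ ⊠ W') ⊠ S₂) (A ⊠ B)) :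
    seqMap (seqMap G H) F = extL (relabel (X := B₁ ⊠ (B₂ ⊠ B)) (Y := (B₁ ⊠ B₂) ⊠ B)
        (prodAssoc _ _ _).symm) A ∘ₗ
      seqMap G (seqMap H F ∘ₗ ext (relabel (X := A₁ ⊠ (W ⊠ W')) (Y := (A₁ ⊠ W) ⊠ W')
        (prodAssoc _ _ _).symm) (S₁ ⊠ S₂)) ∘ₗ
      extL (relabel (X := (S ⊠ S₁) ⊠ S₂) (Y := S ⊠ (S₁ ⊠ S₂)) (prodAssoc _ _ _))
        (M ⊠ (W ⊠ W')) ∘ₗ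
      ext (relabel (X := (M ⊠ W) ⊠ W') (Y := M ⊠ (W ⊠ W')) (prodAssoc _ _ _))
        ((S ⊠ S₁) ⊠ S₂) := rfl

end SeqMap

section Split

variable {S S' S'' Z Z' : QSys}

/-- `E` appends the state of the remaining factor, `ρ'` being a restriction of `ρ`. -/
def IsSplit (ρ : Op S) (ρ' : Op S') (E : SuperOp S' S) : Prop :=
  ∃ c : SourceSplit ρ ρ', c.embed = E

theorem isSplit_relabel (e : S' ≃ S) {ρ : Op S} {ρ' : Op S'}
    (h : relabel e ρ' = ρ) : IsSplit ρ ρ' (relabel e) := by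
  refine ⟨⟨QSys.unit, 1, isState_unit, (prodPUnit _).trans e, ?_⟩, ?_⟩
  · rw [← h]
    ext a b
    simp [relabel_apply]
  · refine LinearMap.ext fun M => ?_
    ext a b
    change M _ _ * (1 : Op QSys.unit) _ _ = M _ _
    simp

theorem IsSplit.apply {ρ : Op S} {ρ' : Op S'} {E : SuperOp S' S} (h : IsSplit ρ ρ' E) :
    E ρ' = ρ := by
  obtain ⟨c, rfl⟩ := h
  exact c.eq

theorem IsSplit.isChannel {ρ : Op S} {ρ' : Op S'} {E : SuperOp S' S} (h : IsSplit ρ ρ' E) :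
    IsChannel E := by
  obtain ⟨c, rfl⟩ := h
  exact (isChannel_relabel _).comp (isChannel_append c.isState)

theorem IsSplit.comp {ρ : Op S} {ρ' : Op S'} {ρ'' : Op S''} {E : SuperOp S' S}
    {E' : SuperOp S'' S'} (h : IsSplit ρ ρ' E) (h' : IsSplit ρ' ρ'' E') :
    IsSplit ρ ρ'' (E ∘ₗ E') := by
  have h0 := h.apply
  have h0' := h'.apply
  obtain ⟨c, rfl⟩ := h
  obtain ⟨c', rfl⟩ := h'
  have h1 : (relabel (X := S'' ⊠ (c'.T ⊠ c.T)) (Y := S) ((prodAssoc _ _ _).symm.trans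
      ((c'.e.prodCongr (Equiv.refl _)).trans c.e)) ∘ₗ append (c'.σ ⊗ₖ c.σ : Op (c'.T ⊠ c.T)) :
      SuperOp S'' S) = c.embed ∘ₗ c'.embed := by
    refine LinearMap.ext fun M => ?_
    ext a b
    exact (mul_assoc _ _ _).symm
  refine ⟨⟨c'.T ⊠ c.T, c'.σ ⊗ₖ c.σ, c'.isState.kron c.isState, (prodAssoc _ _ _).symm.trans
      ((c'.e.prodCongr (Equiv.refl _)).trans c.e), ?_⟩, h1⟩
  have := LinearMap.congr_fun h1 ρ''
  simp only [comp_apply, h0, h0'] at this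
  exact this

theorem IsSplit.tensor {ρ : Op S} {ρ' : Op S'} {E : SuperOp S' S} {σ : Op Z} {σ' : Op Z'}
    {F : SuperOp Z' Z} (h : IsSplit ρ ρ' E) (h' : IsSplit σ σ' F) :
    IsSplit (S := S ⊠ Z) (S' := S' ⊠ Z') (ρ ⊗ₖ σ) (ρ' ⊗ₖ σ') (QShannon.tensor E F) := by
  have h0 := h.apply
  have h0' := h'.apply
  obtain ⟨c, rfl⟩ := h
  obtain ⟨c', rfl⟩ := h'
  have h1 : (relabel (X := (S' ⊠ Z') ⊠ (c.T ⊠ c'.T)) (Y := S ⊠ Z)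
      ((prodProdProdComm _ _ _ _).trans (c.e.prodCongr c'.e)) ∘ₗ
      append (c.σ ⊗ₖ c'.σ : Op (c.T ⊠ c'.T)) :
      SuperOp (S' ⊠ Z') (S ⊠ Z)) = QShannon.tensor c.embed c'.embed := by
    refine LinearMap.ext fun M => ?_
    ext a b
    exact (mul_assoc _ _ _).symm
  refine ⟨⟨c.T ⊠ c'.T, c.σ ⊗ₖ c'.σ, c.isState.kron c'.isState,
    (prodProdProdComm _ _ _ _).trans (c.e.prodCongr c'.e), ?_⟩, h1⟩
  have := LinearMap.congr_fun h1 (ρ' ⊗ₖ σ')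
  rw [tensor_kron, h0, h0'] at this
  exact this

theorem isSplit_refl (ρ : Op S) : IsSplit ρ ρ LinearMap.id :=
  isSplit_relabel (Equiv.refl _) rfl

/-- A source that is not used at all. -/
theorem isSplit_unit {ρ : Op S} (h : IsState ρ) :
    IsSplit ρ (1 : Op QSys.unit) (relabel (X := QSys.unit ⊠ S) (Y := S) (punitProd _) ∘ₗ
      append ρ) := by
  refine ⟨⟨S, ρ, h, punitProd _, ?_⟩, rfl⟩
  ext a b
  simp [relabel_apply]

end Split

section Impl

variable {ι : Type} {N : ι → Resource}

/-- The channel of the encoding layers with the resources. -/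
def Layers.out {l : List ι} {M M' : QSys} (ly : Layers N l M M') :
    SuperOp (M ⊠ srcSys N l) (M' ⊠ bobSys N l) :=
  ptrace ∘ₗ ly.run (fun j => ExtMap.plain (N j)) ()

theorem Layers.out_nil (M : QSys) : (Layers.nil (N := N) M).out = LinearMap.id := by
  refine LinearMap.ext fun ρ => ?_
  change ptrace (ρ ⊗ₖ (1 : Op QSys.unit)) = ρ
  rw [ptrace_kron]
  simp [Matrix.trace]

theorem Layers.out_cons {M M' : QSys} (j : ι) {l : List ι} (aux : QSys)
    (V : Matrix ((N j).Alice ⊠ aux) M ℂ) (hV : Vᴴ * V = 1)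
    (rest : Layers N l ((N j).Aout ⊠ aux) M') :
    (Layers.cons j aux V hV rest).out = seqMap (N j).chan rest.out ∘ₗ
      ext (conj (Y := (N j).Alice ⊠ aux) V) ((N j).S ⊠ srcSys N l) := by
  refine LinearMap.ext fun ρ => Matrix.ext fun p q => ?_
  let r := rest.run (fun j => ExtMap.plain (N j)) ()
  let X := ext (N j).chan (aux ⊠ srcSys N l) (encodeStep j l aux V ρ)
  change ∑ z : Unit × (envSys (fun j => ExtMap.plain (N j)) l),
      r (Matrix.of fun x x' => X ((x.1.1, p.2.1), (x.1.2, x.2)) ((x'.1.1, q.2.1), (x'.1.2, x'.2))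
        * (1 : Op QSys.unit) z.1 z.1) ((p.1, p.2.2), z.2) ((q.1, q.2.2), z.2)
    = ∑ z, r (Matrix.of fun x x' => X ((x.1.1, p.2.1), (x.1.2, x.2))
        ((x'.1.1, q.2.1), (x'.1.2, x'.2))) ((p.1, p.2.2), z) ((q.1, q.2.2), z)
  refine Fintype.sum_equiv (punitProd _) _ _ fun z => ?_
  simp only [Matrix.one_apply_eq, mul_one]
  rfl

theorem Layers.valid_cons {M M' : QSys} {η : ℝ} (j : ι) {l : List ι} (aux : QSys)
    (V : Matrix ((N j).Alice ⊠ aux) M ℂ) (hV : Vᴴ * V = 1)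
    (rest : Layers N l ((N j).Aout ⊠ aux) M') (ρ : Op (M ⊠ srcSys N (j :: l))) :
    (Layers.cons j aux V hV rest).Valid η ρ ↔
      traceNorm (ptraceLeft (ptrace (seqFirst (ext (conj (Y := (N j).Alice ⊠ aux) V)
        ((N j).S ⊠ srcSys N l) ρ))) - (N j).test) ≤ η ∧
      rest.Valid η (seqMid (N j).chan (ext (conj (Y := (N j).Alice ⊠ aux) V)
        ((N j).S ⊠ srcSys N l) ρ)) := Iff.rfl

variable {η : ℝ} {l l₁ l₂ : List ι} {M M₁ S S' S₁ S₂ A A' A₁ B B' B₁ B₂ W : QSys}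

/-- The map `F` from Alice's memory and sources in the state `σ` to Alice's memory and Bob is
implemented by a protocol on the listed resources, `η`-valid on the states `ρ` with `Vd ρ`. -/
def Impl (N : ι → Resource) (η : ℝ) (l : List ι) (σ : Op S) (F : SuperOp (M ⊠ S) (A ⊠ B))
    (Vd : Op (M ⊠ S) → Prop) : Prop :=
  ∃ (M' : QSys) (ly : Layers N l M M') (Φ : SuperOp M' A) (Ψ : SuperOp (bobSys N l) B)
    (E : SuperOp S (srcSys N l)), IsChannel Φ ∧ IsChannel Ψ ∧ IsSplit (srcState N l) σ E ∧
    F = tensor Φ Ψ ∘ₗ ly.out ∘ₗ extL E M ∧ ∀ ρ, Vd ρ → ly.Valid η (extL E M ρ)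

theorem Impl.mono {σ : Op S} {F : SuperOp (M ⊠ S) (A ⊠ B)} {Vd Vd' : Op (M ⊠ S) → Prop}
    (h : Impl N η l σ F Vd) (hV : ∀ ρ, Vd' ρ → Vd ρ) : Impl N η l σ F Vd' := by
  obtain ⟨M', ly, Φ, Ψ, E, h1, h2, h3, h4, h5⟩ := h
  exact ⟨M', ly, Φ, Ψ, E, h1, h2, h3, h4, fun ρ hρ => h5 ρ (hV ρ hρ)⟩

theorem Impl.nil {Φ : SuperOp M A} (h : IsChannel Φ) (Vd : Op (M ⊠ QSys.unit) → Prop) :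
    Impl N η [] (1 : Op QSys.unit) (ext Φ QSys.unit) Vd :=
  ⟨M, .nil M, Φ, LinearMap.id, LinearMap.id, h, isChannel_id, isSplit_refl _, by
    rw [Layers.out_nil, tensor_id_right]; rfl, fun _ _ => _root_.trivial⟩

theorem Impl.post {σ : Op S} {F : SuperOp (M ⊠ S) (A ⊠ B)} {Vd : Op (M ⊠ S) → Prop}
    (h : Impl N η l σ F Vd) {Φ : SuperOp A A'} {Ψ : SuperOp B B'} (hΦ : IsChannel Φ)
    (hΨ : IsChannel Ψ) : Impl N η l σ (tensor Φ Ψ ∘ₗ F) Vd := by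
  obtain ⟨M', ly, Φ', Ψ', E, h1, h2, h3, rfl, h5⟩ := h
  exact ⟨M', ly, Φ ∘ₗ Φ', Ψ ∘ₗ Ψ', E, hΦ.comp h1, hΨ.comp h2, h3, by
    rw [← comp_assoc, ← tensor_comp], h5⟩

theorem Impl.source {σ : Op S} {σ' : Op S'} {F : SuperOp (M ⊠ S) (A ⊠ B)} {Vd : Op (M ⊠ S) → Prop}
    (h : Impl N η l σ F Vd) {E : SuperOp S' S} (hE : IsSplit σ σ' E) :
    Impl N η l σ' (F ∘ₗ extL E M) fun ρ => Vd (extL E M ρ) := by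
  obtain ⟨M', ly, Φ, Ψ, E', h1, h2, h3, rfl, h5⟩ := h
  exact ⟨M', ly, Φ, Ψ, E' ∘ₗ E, h1, h2, h3.comp hE, rfl, fun ρ hρ => h5 _ hρ⟩

theorem Impl.pre_iso {σ : Op S} {F : SuperOp (M ⊠ S) (A ⊠ B)} {Vd : Op (M ⊠ S) → Prop}
    (h : Impl N η l σ F Vd) {C : SuperOp M₁ M} (hC : IsConj C) :
    Impl N η l σ (F ∘ₗ ext C S) fun ρ => Vd (ext C S ρ) := by
  obtain ⟨M', ly, Φ, Ψ, E, h1, h2, h3, rfl, h5⟩ := h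
  obtain ⟨V, hV, rfl⟩ := hC
  have hcomm := ext_comp_extL (conj V) E
  cases ly with
  | nil =>
    refine ⟨M₁, .nil M₁, Φ ∘ₗ conj V, Ψ, E, h1.comp (isChannel_conj V hV), h2, h3, ?_,
      fun _ _ => _root_.trivial⟩
    rw [Layers.out_nil, Layers.out_nil, LinearMap.id_comp, LinearMap.id_comp, tensor_eq, tensor_eq,
      ext_comp, comp_assoc, ← hcomm]
    rfl
  | cons j aux V' hV' rest =>
    have hV'' : (V' * V)ᴴ * (V' * V) = 1 := by
      rw [conjTranspose_mul, Matrix.mul_assoc, ← Matrix.mul_assoc _ V' V, hV',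
        Matrix.one_mul, hV]
    have e := conj_comp V V'
    refine ⟨M', .cons j aux (V' * V) hV'' rest, Φ, Ψ, E, h1, h2, h3, ?_, fun ρ hρ => ?_⟩
    · rw [Layers.out_cons, Layers.out_cons, ← e, ext_comp]
      simp only [comp_assoc]
      rw [hcomm]
    · have := h5 _ hρ
      rw [Layers.valid_cons] at this ⊢
      rw [← e, ext_comp]
      have e2 := LinearMap.congr_fun hcomm ρ
      simp only [comp_apply] at e2 ⊢
      rw [← e2] at this
      exact this

theorem Impl.use {σ : Op S} {j : ι} {r : Resource} (hj : N j = r)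
    {F : SuperOp ((r.Aout ⊠ W) ⊠ S) (A ⊠ B)} {Vd : Op ((r.Aout ⊠ W) ⊠ S) → Prop}
    (h : Impl N η l σ F Vd) :
    Impl N η (j :: l) (S := r.S ⊠ S) (r.source ⊗ₖ σ) (seqMap r.chan F) fun ρ =>
      traceNorm (ptraceLeft (ptrace (seqFirst ρ)) - r.test) ≤ η ∧ Vd (seqMid r.chan ρ) := by
  subst hj
  obtain ⟨M', ly, Φ, Ψ, E, h1, h2, h3, rfl, h5⟩ := h
  refine ⟨M', .cons j W 1 (by simp) ly, Φ, extL Ψ (N j).Bout, extL E (N j).S, h1, h2.extL _,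
    (isSplit_refl _).tensor h3, ?_, fun ρ hρ => ?_⟩
  · rw [Layers.out_cons, conj_one, ext_id, LinearMap.comp_id, seqMap_post]
    rw [seqMap_extL]
  · rw [Layers.valid_cons, conj_one, ext_id, LinearMap.id_apply]
    rw [seqFirst_extL h3.isChannel.tracePreserving, seqMid_extL]
    exact ⟨hρ.1, h5 _ hρ.2⟩

end Impl

section Seq

variable {M S S₁ S₂ A A₁ A₂ B B₁ B₂ W W' X Y : QSys}

theorem ptrace_ptrace_comm (Z : Op ((X ⊠ Y) ⊠ W)) : ptrace (ptrace Z) =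
    ptrace (ptrace (relabel (X := (X ⊠ Y) ⊠ W) (Y := (X ⊠ W) ⊠ Y)
      ⟨fun p => ((p.1.1, p.2), p.1.2), fun p => ((p.1.1, p.2), p.1.2), fun _ => rfl, fun _ => rfl⟩ Z)) := by
  refine Matrix.ext fun p q => ?_
  change ∑ y, ∑ w, Z ((p, y), w) ((q, y), w) = ∑ w, ∑ y, Z ((p, y), w) ((q, y), w)
  exact sum_comm

theorem ptrace_unit (Z : Op (X ⊠ QSys.unit)) :
    ptrace Z = relabel (Y := X) (prodPUnit _) Z := by
  refine Matrix.ext fun p q => ?_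
  change ∑ w : Unit, Z (p, w) (q, w) = _
  rw [Fintype.sum_unique]
  rfl

theorem ptrace_ptrace (Z : Op ((X ⊠ Y) ⊠ W)) : ptrace (ptrace Z) =
    ptrace (relabel (X := (X ⊠ Y) ⊠ W) (Y := X ⊠ (W ⊠ Y))
      ⟨fun p => (p.1.1, (p.2, p.1.2)), fun q => ((q.1, q.2.2), q.2.1), fun _ => rfl, fun _ => rfl⟩ Z) := by
  refine Matrix.ext fun p q => ?_
  change ∑ y, ∑ w, Z ((p, y), w) ((q, y), w)
    = ∑ z : W × Y, Z ((p, z.2), z.1) ((q, z.2), z.1)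
  rw [Fintype.sum_prod_type_right]

/-- The arrangement of systems for the sequential composition of three maps. -/
def seqAssoc (σ : Op (((M ⊠ W) ⊠ W') ⊠ ((S ⊠ S₁) ⊠ S₂))) :
    Op ((M ⊠ (W ⊠ W')) ⊠ (S ⊠ (S₁ ⊠ S₂))) :=
  extL (relabel (X := (S ⊠ S₁) ⊠ S₂) (Y := S ⊠ (S₁ ⊠ S₂)) (prodAssoc _ _ _))
    (M ⊠ (W ⊠ W')) (ext (relabel (X := (M ⊠ W) ⊠ W') (Y := M ⊠ (W ⊠ W'))
      (prodAssoc _ _ _)) ((S ⊠ S₁) ⊠ S₂) σ)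

theorem seqFirst_seqAssoc (σ : Op (((M ⊠ W) ⊠ W') ⊠ ((S ⊠ S₁) ⊠ S₂))) :
    seqFirst (seqAssoc σ) = seqFirst (seqFirst σ) := by
  refine Matrix.ext fun p q => ?_
  change ∑ z : (W × W') × (S₁ × S₂),
      σ (((p.1, z.1.1), z.1.2), ((p.2, z.2.1), z.2.2)) (((q.1, z.1.1), z.1.2), ((q.2, z.2.1), z.2.2))
    = ∑ u : W × S₁, ∑ v : W' × S₂,
      σ (((p.1, u.1), v.1), ((p.2, u.2), v.2)) (((q.1, u.1), v.1), ((q.2, u.2), v.2))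
  rw [← Fintype.sum_prod_type']
  exact Fintype.sum_equiv (prodProdProdComm _ _ _ _) _ _ fun _ => rfl

theorem seqFirst_seqMid (G : SuperOp (M ⊠ S) (A₁ ⊠ B₁))
    (σ : Op (((M ⊠ W) ⊠ W') ⊠ ((S ⊠ S₁) ⊠ S₂))) :
    seqFirst (ext (relabel (X := A₁ ⊠ (W ⊠ W')) (Y := (A₁ ⊠ W) ⊠ W')
        (prodAssoc _ _ _).symm) (S₁ ⊠ S₂) (seqMid G (seqAssoc σ)))
      = seqMid G (seqFirst σ) := by
  refine Eq.trans ?_ (congrArg ptrace (ptrace_ext (seqMidMap (W := W) (S₂ := S₁) G)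
    (relabel (X := ((M ⊠ W) ⊠ W') ⊠ ((S ⊠ S₁) ⊠ S₂)) (Y := ((M ⊠ W) ⊠ (S ⊠ S₁)) ⊠ (W' ⊠ S₂))
      (prodProdProdComm _ _ _ _) σ)))
  exact ptrace_ptrace_comm (X := (A₁ ⊠ W) ⊠ S₁) (Y := W' ⊠ S₂) (W := B₁)
    (relabel (X := (((A₁ ⊠ (W ⊠ W')) ⊠ (S₁ ⊠ S₂)) ⊠ B₁))
      (Y := ((((A₁ ⊠ W) ⊠ S₁) ⊠ (W' ⊠ S₂)) ⊠ B₁))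
      ⟨fun p => ((((p.1.1.1, p.1.1.2.1), p.1.2.1), (p.1.1.2.2, p.1.2.2)), p.2),
       fun p => (((p.1.1.1.1, (p.1.1.1.2, p.1.2.1)), (p.1.1.2, p.1.2.2)), p.2),
       fun _ => rfl, fun _ => rfl⟩ (seqMidMap G (seqAssoc σ)))

theorem seqMid_seqMid (G : SuperOp (M ⊠ S) (A₁ ⊠ B₁)) (H : SuperOp ((A₁ ⊠ W) ⊠ S₁) (A₂ ⊠ B₂))
    (σ : Op (((M ⊠ W) ⊠ W') ⊠ ((S ⊠ S₁) ⊠ S₂))) :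
    seqMid H (ext (relabel (X := A₁ ⊠ (W ⊠ W')) (Y := (A₁ ⊠ W) ⊠ W')
        (prodAssoc _ _ _).symm) (S₁ ⊠ S₂) (seqMid G (seqAssoc σ)))
      = seqMid (seqMap G H) σ := by
  have h := ptrace_ext (seqMidMap (W := W') (S₂ := S₂) H ∘ₗ ext (relabel (X := A₁ ⊠ (W ⊠ W'))
    (Y := (A₁ ⊠ W) ⊠ W') (prodAssoc _ _ _).symm) (S₁ ⊠ S₂)) (seqMidMap G (seqAssoc σ))
  exact (congrArg ptrace h.symm).trans (ptrace_ptrace _)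

theorem relabel_assoc_kron (a : Op S) (b : Op S₁) (c : Op S₂) :
    relabel (X := (S ⊠ S₁) ⊠ S₂) (Y := S ⊠ (S₁ ⊠ S₂)) (prodAssoc _ _ _)
      ((a ⊗ₖ b : Op (S ⊠ S₁)) ⊗ₖ c) = (a ⊗ₖ (b ⊗ₖ c : Op (S₁ ⊠ S₂))) :=
  Matrix.ext fun _ _ => mul_assoc _ _ _

theorem relabel_punitProd_kron (a : Op S) :
    relabel (X := QSys.unit ⊠ S) (Y := S) (punitProd _) ((1 : Op QSys.unit) ⊗ₖ a) = a :=
  Matrix.ext fun _ _ => one_mul _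

variable {ι : Type} {N : ι → Resource} {η : ℝ}

theorem Impl.congr {l : List ι} {σ : Op S} {F F' : SuperOp (M ⊠ S) (A ⊠ B)}
    {Vd Vd' : Op (M ⊠ S) → Prop}
    (h : Impl N η l σ F Vd) (hF : F' = F) (hV : ∀ ρ, Vd' ρ → Vd ρ) : Impl N η l σ F' Vd' := by
  subst hF
  exact h.mono hV

theorem Layers.impl_seq {l₂ : List ι} {σ₂ : Op S₂} :
    ∀ {l₁ : List ι} {M M' W : QSys} (ly : Layers N l₁ M M') {F : SuperOp ((M' ⊠ W) ⊠ S₂) (A ⊠ B)}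
      {Vd : Op ((M' ⊠ W) ⊠ S₂) → Prop}, Impl N η l₂ σ₂ F Vd →
      Impl N η (l₁ ++ l₂) (S := srcSys N l₁ ⊠ S₂) (srcState N l₁ ⊗ₖ σ₂) (seqMap ly.out F)
        fun ρ => ly.Valid η (seqFirst ρ) ∧ Vd (seqMid ly.out ρ)
  | _, M, _, W, .nil _, F, Vd, h => by
    have h1 := (h.source (isSplit_relabel (S' := QSys.unit ⊠ S₂) (S := S₂) (punitProd _)
      (relabel_punitProd_kron σ₂))).post isChannel_id
      (isChannel_relabel (X := B) (Y := QSys.unit ⊠ B) (punitProd B).symm)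
    refine h1.congr ?_ fun ρ hρ => ?_
    · rw [Layers.out_nil]; rfl
    · have := hρ.2
      rw [Layers.out_nil] at this
      convert this using 1
      exact (ptrace_unit (seqMidMap (S₁ := QSys.unit) (B₁ := QSys.unit) (A₁ := M) (W := W) (S₂ := S₂)
        LinearMap.id ρ)).symm
  | _, M, M', W, .cons j (l := l) aux V hV rest, F, Vd, h => by
    have h1 := (Layers.impl_seq rest h).pre_iso (isConj_relabel (X := (N j).Aout ⊠ (aux ⊠ W))
      (Y := ((N j).Aout ⊠ aux) ⊠ W) (prodAssoc _ _ _).symm)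
    have h2 := (Impl.use rfl h1).source (isSplit_relabel
      (S' := ((N j).S ⊠ srcSys N l) ⊠ S₂) (S := (N j).S ⊠ (srcSys N l ⊠ S₂)) (prodAssoc _ _ _)
      (relabel_assoc_kron (N j).source (srcState N l) σ₂))
    have h3 := (h2.pre_iso ((isConj_relabel (X := ((N j).Alice ⊠ aux) ⊠ W)
      (Y := (N j).Alice ⊠ (aux ⊠ W)) (prodAssoc _ _ _)).comp
      (IsConj.ext ⟨V, hV, rfl⟩ W))).post isChannel_id (isChannel_relabel
        (X := (N j).Bout ⊠ (bobSys N l ⊠ B)) (Y := ((N j).Bout ⊠ bobSys N l) ⊠ B)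
        (prodAssoc _ _ _).symm)
    refine h3.congr ?_ fun ρ hρ => ?_
    · rw [Layers.out_cons, seqMap_ext, seqMap_assoc, ext_comp, tensor_id_left]
      simp only [comp_assoc]
    · let σ := ext (ext (conj (Y := (N j).Alice ⊠ aux) V) W) (((N j).S ⊠ srcSys N l) ⊠ S₂) ρ
      have e1 : ext (conj (Y := (N j).Alice ⊠ aux) V) ((N j).S ⊠ srcSys N l) (seqFirst ρ)
        = seqFirst σ := (ptrace_ext _ _).symm
      obtain ⟨hρ1, hρ2⟩ := hρ
      rw [Layers.valid_cons, e1] at hρ1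
      rw [Layers.out_cons] at hρ2
      refine ⟨?_, ?_, ?_⟩
      · have := hρ1.1
        rwa [← seqFirst_seqAssoc] at this
      · have := hρ1.2
        rwa [← seqFirst_seqMid] at this
      · have := (congrArg Vd (seqMid_seqMid (N j).chan rest.out σ)).mpr hρ2
        exact this

end Seq

section Rules

variable {M S S' S₁ S₂ A A' A₁ A₂ B B₁ B₂ M₁ M₂ W X Y : QSys} {ι : Type} {N : ι → Resource} {η : ℝ}
  {l l₁ l₂ : List ι}

theorem Layers.isChannel_out {M' : QSys} (ly : Layers N l M M') : IsChannel ly.out :=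
  isChannel_ptrace.comp (ly.isChannel_run fun j =>
    (isConj_append_one.isChannel).comp (N j).isChannel)

theorem Impl.isChannel {σ : Op S} {F : SuperOp (M ⊠ S) (A ⊠ B)} {Vd : Op (M ⊠ S) → Prop}
    (h : Impl N η l σ F Vd) : IsChannel F := by
  obtain ⟨M', ly, Φ, Ψ, E, h1, h2, h3, rfl, h5⟩ := h
  exact (h1.tensor h2).comp (ly.isChannel_out.comp (h3.isChannel.extL _))

theorem seqFirst_source (E : SuperOp X S₁) (ρ : Op ((M ⊠ W) ⊠ (X ⊠ S₂))) :
    seqFirst (extL (ext E S₂) (M ⊠ W) ρ) = extL E M (seqFirst ρ) :=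
  ptrace_ext (extL E M) (relabel (X := (M ⊠ W) ⊠ (X ⊠ S₂)) (Y := (M ⊠ X) ⊠ (W ⊠ S₂))
    (prodProdProdComm _ _ _ _) ρ)

theorem seqMidMap_comp (G : SuperOp (M ⊠ S₁) (A ⊠ B)) (Φ : SuperOp A A₁) (Ψ : SuperOp B B₁)
    (E : SuperOp X S₁) :
    seqMidMap (W := W) (S₂ := S₂) (tensor Φ Ψ ∘ₗ G ∘ₗ extL E M)
      = tensor (ext (ext Φ W) S₂) Ψ ∘ₗ seqMidMap G ∘ₗ extL (ext E S₂) (M ⊠ W) := rfl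

theorem seqMap_comp (G : SuperOp (M ⊠ S₁) (A ⊠ B)) (Φ : SuperOp A A₁) (Ψ : SuperOp B B₁)
    (E : SuperOp X S₁) (F : SuperOp ((A₁ ⊠ W) ⊠ S₂) (A₂ ⊠ B₂)) :
    seqMap (tensor Φ Ψ ∘ₗ G ∘ₗ extL E M) F
      = extL (ext Ψ B₂) A₂ ∘ₗ seqMap G (F ∘ₗ ext (ext Φ W) S₂) ∘ₗ extL (ext E S₂) (M ⊠ W) := by
  rw [seqMap, seqMidMap_comp, tensor_eq]
  have h := ext_comp_extL F Ψ
  refine LinearMap.ext fun ρ => ?_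
  have h1 := LinearMap.congr_fun h (ext (ext (ext Φ W) S₂) B
    (seqMidMap G (extL (ext E S₂) (M ⊠ W) ρ)))
  exact congrArg (relabel (X := (A₂ ⊠ B₂) ⊠ B₁) (Y := A₂ ⊠ (B₁ ⊠ B₂))
      ⟨fun p => (p.1.1, (p.2, p.1.2)), fun q => ((q.1, q.2.2), q.2.1), fun _ => rfl, fun _ => rfl⟩) h1

theorem seqMid_comp (G : SuperOp (M ⊠ S₁) (A ⊠ B)) (Φ : SuperOp A A₁) {Ψ : SuperOp B B₁}
    (hΨ : IsChannel Ψ) (E : SuperOp X S₁) (ρ : Op ((M ⊠ W) ⊠ (X ⊠ S₂))) :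
    seqMid (tensor Φ Ψ ∘ₗ G ∘ₗ extL E M) ρ
      = ext (ext Φ W) S₂ (seqMid G (extL (ext E S₂) (M ⊠ W) ρ)) := by
  rw [seqMid, seqMidMap_comp, tensor_eq, comp_apply, comp_apply,
    ptrace_extL hΨ.tracePreserving, ptrace_ext]
  rfl

/-- A map with an idle system of Alice. -/
def idleMap (F : SuperOp (M ⊠ S) (A ⊠ B)) (W : QSys) : SuperOp ((M ⊠ W) ⊠ S) ((A ⊠ W) ⊠ B) :=
  relabel (X := (A ⊠ B) ⊠ W) (Y := (A ⊠ W) ⊠ B)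
      ⟨fun p => ((p.1.1, p.2), p.1.2), fun p => ((p.1.1, p.2), p.1.2), fun _ => rfl, fun _ => rfl⟩ ∘ₗ ext F W ∘ₗ
    relabel (X := (M ⊠ W) ⊠ S) (Y := (M ⊠ S) ⊠ W)
      ⟨fun p => ((p.1.1, p.2), p.1.2), fun p => ((p.1.1, p.2), p.1.2), fun _ => rfl, fun _ => rfl⟩

/-- The state without the idle system. -/
def idleState (ρ : Op ((M ⊠ W) ⊠ S)) : Op (M ⊠ S) := ext ptrace S ρ

theorem discard_idle (F : SuperOp (M ⊠ S) (A ⊠ B)) :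
    ext ptrace B ∘ₗ idleMap F W = F ∘ₗ ext ptrace S := by
  refine LinearMap.ext fun ρ => ?_
  exact ptrace_ext F (relabel (X := (M ⊠ W) ⊠ S) (Y := (M ⊠ S) ⊠ W)
      ⟨fun p => ((p.1.1, p.2), p.1.2), fun p => ((p.1.1, p.2), p.1.2), fun _ => rfl, fun _ => rfl⟩ ρ)

theorem Impl.idle {σ : Op S} {F : SuperOp (M ⊠ S) (A ⊠ B)} {Vd : Op (M ⊠ S) → Prop}
    (h : Impl N η l σ F Vd) (W : QSys) :
    Impl N η l σ (idleMap F W) fun ρ => Vd (idleState ρ) := by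
  obtain ⟨M', ly, Φ, Ψ, E, h1, h2, h3, rfl, h5⟩ := h
  have h6 := ((ly.impl_seq (Impl.nil (N := N) (η := η) (isChannel_id (X := M' ⊠ W))
    fun _ => True)).source ((isSplit_relabel (S' := srcSys N l) (S := srcSys N l ⊠ QSys.unit)
      (prodPUnit _).symm (by
        refine Matrix.ext fun p q => ?_
        exact (mul_one _).symm)).comp h3)).post
    (h1.ext W) (h2.comp (isChannel_relabel (X := bobSys N l ⊠ QSys.unit) (Y := bobSys N l)
      (prodPUnit _)))
  rw [List.append_nil] at h6
  refine h6.congr ?_ fun ρ hρ => ⟨?_, _root_.trivial⟩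
  · rfl
  · have := h5 _ hρ
    have e := LinearMap.congr_fun (ext_comp_extL (ptrace : SuperOp (M ⊠ W) M) E) ρ
    refine (congrArg (ly.Valid η) ((Matrix.ext fun p q => ?_).trans e)).mpr this
    exact Fintype.sum_equiv (prodPUnit W) _ _ fun _ => rfl

/-- Alice acts before the program. -/
theorem Impl.pre {σ : Op S} {F : SuperOp (M ⊠ S) (A ⊠ B)} {Vd : Op (M ⊠ S) → Prop}
    (h : Impl N η l σ F Vd) {C : SuperOp M₁ M} (hC : IsChannel C) :
    Impl N η l σ (F ∘ₗ ext C S) fun ρ => Vd (ext C S ρ) := by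
  obtain ⟨d⟩ := exists_dilation hC
  have h1 := ((h.idle d.Env).pre_iso ⟨_, d.isometry (), rfl⟩).post (isChannel_ptrace) isChannel_id
  have hd : ptrace ∘ₗ conj (d.V ()) = C := LinearMap.ext fun ρ => d.dilates () ρ
  refine h1.congr ?_ fun ρ hρ => ?_
  · rw [tensor_id_right, ← comp_assoc, discard_idle, comp_assoc, ← ext_comp, hd]
  · rwa [idleState, ← comp_apply, ← ext_comp, hd]

/-- Two programs, one after the other. -/
theorem Impl.seq {σ₁ : Op S₁} {F₁ : SuperOp (M ⊠ S₁) (A₁ ⊠ B₁)} {Vd₁ : Op (M ⊠ S₁) → Prop}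
    (h₁ : Impl N η l₁ σ₁ F₁ Vd₁) {σ₂ : Op S₂} {F₂ : SuperOp ((A₁ ⊠ W) ⊠ S₂) (A ⊠ B₂)}
    {Vd₂ : Op ((A₁ ⊠ W) ⊠ S₂) → Prop} (h₂ : Impl N η l₂ σ₂ F₂ Vd₂) :
    Impl N η (l₁ ++ l₂) (S := S₁ ⊠ S₂) (σ₁ ⊗ₖ σ₂) (seqMap F₁ F₂) fun ρ =>
      Vd₁ (seqFirst ρ) ∧ Vd₂ (seqMid F₁ ρ) := by
  obtain ⟨M', ly, Φ, Ψ, E, h1, h2, h3, rfl, h5⟩ := h₁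
  have h6 := ((ly.impl_seq (h₂.pre (h1.ext W))).source (h3.tensor (isSplit_refl σ₂))).post
    isChannel_id (h2.ext B₂)
  refine h6.congr ?_ fun ρ hρ => ⟨?_, ?_⟩
  · rw [seqMap_comp]
    rfl
  · have := h5 _ hρ.1
    exact (congrArg (ly.Valid η) (seqFirst_source E ρ)).mpr this
  · exact (congrArg Vd₂ (seqMid_comp ly.out Φ h2 E ρ)).mp hρ.2

end Rules

section Rules

variable {M S S₁ S₂ A A' A₁ A₂ B B' B₁ B₂ M₁ M₂ W X Y Q Q' : QSys} {ι : Type} {N : ι → Resource}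
  {η : ℝ} {l l₁ l₂ : List ι}

/-- The input of the second of two parallel maps. -/
def seqSecond (ρ : Op ((M₁ ⊠ M₂) ⊠ (S₁ ⊠ S₂))) : Op (M₂ ⊠ S₂) :=
  ptraceLeft (relabel (X := (M₁ ⊠ M₂) ⊠ (S₁ ⊠ S₂)) (Y := (M₁ ⊠ S₁) ⊠ (M₂ ⊠ S₂))
    (prodProdProdComm _ _ _ _) ρ)

/-- Two maps in parallel. -/
def parMap (F₁ : SuperOp (M₁ ⊠ S₁) (A₁ ⊠ B₁)) (F₂ : SuperOp (M₂ ⊠ S₂) (A₂ ⊠ B₂)) :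
    SuperOp ((M₁ ⊠ M₂) ⊠ (S₁ ⊠ S₂)) ((A₁ ⊠ A₂) ⊠ (B₁ ⊠ B₂)) :=
  relabel (X := (A₁ ⊠ B₁) ⊠ (A₂ ⊠ B₂)) (Y := (A₁ ⊠ A₂) ⊠ (B₁ ⊠ B₂))
      (prodProdProdComm _ _ _ _) ∘ₗ tensor F₁ F₂ ∘ₗ
    relabel (X := (M₁ ⊠ M₂) ⊠ (S₁ ⊠ S₂)) (Y := (M₁ ⊠ S₁) ⊠ (M₂ ⊠ S₂))
      (prodProdProdComm _ _ _ _)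

theorem Impl.par {σ₁ : Op S₁} {F₁ : SuperOp (M₁ ⊠ S₁) (A₁ ⊠ B₁)} {Vd₁ : Op (M₁ ⊠ S₁) → Prop}
    (h₁ : Impl N η l₁ σ₁ F₁ Vd₁) {σ₂ : Op S₂} {F₂ : SuperOp (M₂ ⊠ S₂) (A₂ ⊠ B₂)}
    {Vd₂ : Op (M₂ ⊠ S₂) → Prop} (h₂ : Impl N η l₂ σ₂ F₂ Vd₂) :
    Impl N η (l₁ ++ l₂) (S := S₁ ⊠ S₂) (σ₁ ⊗ₖ σ₂) (parMap F₁ F₂) fun ρ =>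
      Vd₁ (seqFirst ρ) ∧ Vd₂ (seqSecond ρ) := by
  have h := h₁.seq (((h₂.idle A₁).pre_iso (isConj_relabel (X := A₁ ⊠ M₂) (Y := M₂ ⊠ A₁)
    (prodComm _ _))).post (isChannel_relabel (X := A₂ ⊠ A₁) (Y := A₁ ⊠ A₂)
    (prodComm _ _)) isChannel_id)
  refine h.congr rfl fun ρ hρ => ⟨hρ.1, ?_⟩
  refine (congrArg Vd₂ (Eq.trans (Matrix.ext fun p q => ?_) (ptraceLeft_ext
    h₁.isChannel.tracePreserving (relabel (X := (M₁ ⊠ M₂) ⊠ (S₁ ⊠ S₂))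
    (Y := (M₁ ⊠ S₁) ⊠ (M₂ ⊠ S₂)) (prodProdProdComm _ _ _ _) ρ)))).mpr hρ.2
  exact (sum_prod_type (f := fun z : A₁ × B₁ => ext F₁ (M₂ ⊠ S₂)
    (relabel (X := (M₁ ⊠ M₂) ⊠ (S₁ ⊠ S₂)) (Y := (M₁ ⊠ S₁) ⊠ (M₂ ⊠ S₂))
      (prodProdProdComm _ _ _ _) ρ) (z, p) (z, q))).symm

/-- A further program without sources. -/
def thenMap (F : SuperOp (M ⊠ S) (A ⊠ B)) (G : SuperOp A (A' ⊠ B')) :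
    SuperOp (M ⊠ S) (A' ⊠ (B ⊠ B')) :=
  relabel (X := (A' ⊠ B') ⊠ B) (Y := A' ⊠ (B ⊠ B'))
      ⟨fun p => (p.1.1, (p.2, p.1.2)), fun q => ((q.1, q.2.2), q.2.1), fun _ => rfl, fun _ => rfl⟩ ∘ₗ ext G B ∘ₗ F

theorem isSplit_append_unit (σ : Op S) : IsSplit (S := S ⊠ QSys.unit) (σ ⊗ₖ 1) σ
    (relabel (Y := S ⊠ QSys.unit) (prodPUnit _).symm) :=
  isSplit_relabel _ (Matrix.ext fun _ _ => (mul_one _).symm)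

theorem ptrace_unit_eq : (ptrace : SuperOp (X ⊠ QSys.unit) X) = relabel (prodPUnit _) :=
  LinearMap.ext ptrace_unit

theorem trace_seqMid {G : SuperOp (M ⊠ S₁) (A₁ ⊠ B₁)} (hG : IsChannel G)
    (ρ : Op ((M ⊠ W) ⊠ (S₁ ⊠ S₂))) : (seqMid G ρ).trace = ρ.trace :=
  (isChannel_ptrace.comp ((isChannel_relabel _).comp ((hG.ext _).comp
    (isChannel_relabel _)))).tracePreserving ρ

theorem ptrace_seqFirst (ρ : Op ((M ⊠ W) ⊠ (S₁ ⊠ S₂))) :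
    ptrace (seqFirst ρ) = ptrace (ptrace ρ) := by
  refine Matrix.ext fun p q => ?_
  change ∑ s, ∑ z : W × S₂, ρ ((p, z.1), (s, z.2)) ((q, z.1), (s, z.2))
    = ∑ w, ∑ z : S₁ × S₂, ρ ((p, w), z) ((q, w), z)
  simp only [sum_prod_type]
  exact sum_comm

theorem Impl.andThen {σ : Op S} {F : SuperOp (M ⊠ S) (A ⊠ B)} {Vd : Op (M ⊠ S) → Prop}
    (h₁ : Impl N η l₁ σ F Vd) {G : SuperOp A (A' ⊠ B')}
    (h₂ : Impl N η l₂ (1 : Op QSys.unit) (G ∘ₗ ptrace) fun ρ => ρ.trace = 1) :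
    Impl N η (l₁ ++ l₂) σ (thenMap F G) fun ρ => Vd ρ ∧ ρ.trace = 1 := by
  have h := ((h₁.seq (h₂.pre_iso (isConj_relabel (X := A ⊠ QSys.unit) (Y := A)
    (prodPUnit _)))).source (isSplit_append_unit σ)).pre_iso
    (isConj_relabel (X := M) (Y := M ⊠ QSys.unit) (prodPUnit _).symm)
  refine h.congr ?_ fun ρ hρ => ⟨?_, ?_⟩
  · rw [ptrace_unit_eq]
    rfl
  · refine (congrArg Vd (Matrix.ext fun p q => ?_)).mpr hρ.1
    change ∑ _z : Unit × Unit, ρ p q = ρ p q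
    simp
  · have hA : IsChannel (ext (relabel (X := A ⊠ QSys.unit) (Y := A) (prodPUnit _))
      QSys.unit) := (isChannel_relabel _).ext _
    have hB : IsChannel (extL (relabel (X := S) (Y := S ⊠ QSys.unit) (prodPUnit _).symm)
      (M ⊠ QSys.unit)) := (isChannel_relabel _).extL _
    have hC : IsChannel (ext (relabel (X := M) (Y := M ⊠ QSys.unit) (prodPUnit _).symm) S) :=
      (isChannel_relabel _).ext _
    exact (hA.tracePreserving _).trans ((trace_seqMid h₁.isChannel _).trans
      ((hB.tracePreserving _).trans ((hC.tracePreserving _).trans hρ.2)))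

/-- Alice's use of a resource whose source system is not used. -/
def useMap (r : Resource) (W : QSys) : SuperOp (r.Alice ⊠ W) ((r.Aout ⊠ W) ⊠ r.Bout) :=
  relabel (X := (r.Aout ⊠ r.Bout) ⊠ W) (Y := (r.Aout ⊠ W) ⊠ r.Bout)
      ⟨fun p => ((p.1.1, p.2), p.1.2), fun p => ((p.1.1, p.2), p.1.2), fun _ => rfl, fun _ => rfl⟩ ∘ₗ ext (r.chan ∘ₗ append r.source) W

theorem Impl.single {j : ι} {r : Resource} (hj : N j = r) (W : QSys) :
    Impl N η [j] (1 : Op QSys.unit) (useMap r W ∘ₗ ptrace) fun ρ =>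
      traceNorm (ptraceLeft (ptrace (ptrace ρ)) - r.test) ≤ η := by
  have h := ((Impl.use hj (Impl.nil (N := N) (η := η) (isChannel_id (X := r.Aout ⊠ W))
    fun _ => True)).source ((isSplit_append_unit r.source).comp
      (isSplit_unit r.isState_source))).post isChannel_id
      (isChannel_relabel (X := r.Bout ⊠ QSys.unit) (Y := r.Bout) (prodPUnit _))
  refine h.congr ?_ fun ρ hρ => ⟨?_, _root_.trivial⟩
  · rw [ptrace_unit_eq]
    rfl
  · rw [ptrace_seqFirst, ptrace_extL ((isSplit_append_unit r.source).comp
      (isSplit_unit r.isState_source)).isChannel.tracePreserving]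
    exact hρ

theorem tensor_ptraceLeft_useMap (r : Resource) (Ψ : SuperOp r.Bout B) (x : Op r.Alice)
    (a : Op W) : tensor ptraceLeft Ψ (useMap r W (x ⊗ₖ a))
      = a ⊗ₖ Ψ (ptraceLeft (r.chan (x ⊗ₖ r.source))) := by
  rw [useMap, comp_apply, ext_kron]
  refine Matrix.ext fun p q => ?_
  let Y := r.chan (x ⊗ₖ r.source)
  change Ψ (Matrix.of fun b b' => ∑ o, Y (o, b) (o, b') * a p.1 q.1) p.2 q.2
    = a p.1 q.1 * Ψ (ptraceLeft Y) p.2 q.2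
  have : (Matrix.of fun b b' => ∑ o, Y (o, b) (o, b') * a p.1 q.1 : Op r.Bout)
      = a p.1 q.1 • ptraceLeft Y := by
    refine Matrix.ext fun b b' => ?_
    change ∑ o, Y (o, b) (o, b') * a p.1 q.1 = a p.1 q.1 * ∑ o, Y (o, b) (o, b')
    rw [← sum_mul, mul_comm]
  rw [this, map_smul]
  rfl

/-- A resource is used for the transmission of a system from Alice to Bob. -/
theorem Impl.single_transmit {j : ι} {r : Resource} (hj : N j = r) {enc : SuperOp Q r.Alice}
    {dec : SuperOp r.Bout Q'} (he : IsChannel enc) (hd : IsChannel dec) {A : QSys}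
    {Vd : Op ((A ⊠ Q) ⊠ QSys.unit) → Prop}
    (hV : ∀ ρ, Vd ρ → traceNorm (ptraceLeft (enc (ptraceLeft (ptrace ρ))) - r.test) ≤ η) :
    Impl N η [j] (1 : Op QSys.unit)
      (extL (dec ∘ₗ ptraceLeft ∘ₗ r.chan ∘ₗ append r.source ∘ₗ enc) A ∘ₗ ptrace) Vd := by
  have h := ((Impl.single (η := η) hj A).pre ((isChannel_relabel (X := A ⊠ r.Alice)
    (Y := r.Alice ⊠ A) (prodComm _ _)).comp (he.extL A))).post isChannel_ptraceLeft hd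
  refine h.congr ?_ fun ρ hρ => ?_
  · have h1 : ∀ M : Op ((A ⊠ Q) ⊠ QSys.unit), ptrace (ext (relabel (X := A ⊠ r.Alice)
        (Y := r.Alice ⊠ A) (prodComm _ _) ∘ₗ extL enc A) QSys.unit M) = _ :=
      fun M => ptrace_ext _ M
    have h2 : extL (dec ∘ₗ ptraceLeft ∘ₗ r.chan ∘ₗ append r.source ∘ₗ enc) A
        = tensor ptraceLeft dec ∘ₗ useMap r A ∘ₗ relabel (X := A ⊠ r.Alice)
        (Y := r.Alice ⊠ A) (prodComm _ _) ∘ₗ extL enc A := by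
      refine superOp_ext_kron fun a q => ?_
      have h3 : relabel (X := A ⊠ r.Alice) (Y := r.Alice ⊠ A) (prodComm _ _)
          (extL enc A (a ⊗ₖ q)) = enc q ⊗ₖ a := by
        rw [extL_kron]; exact Matrix.ext fun _ _ => mul_comm _ _
      simp only [comp_apply]
      rw [h3, tensor_ptraceLeft_useMap, extL_kron]
      rfl
    rw [h2]
    refine LinearMap.ext fun M => ?_
    simp only [comp_apply]
    rw [h1]
    rfl
  · refine (congrArg (fun z => traceNorm (ptraceLeft z - r.test)) ?_).trans_le (hV ρ hρ)
    rw [ptrace_ext]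
    exact ptraceLeft_extL enc (ptrace ρ)

/-- A resource that is not needed is fed with its test state. -/
theorem Impl.feed (j : ι) (hη : 0 ≤ η) (A : QSys) :
    Impl N η [j] (1 : Op QSys.unit) (relabel (X := A) (Y := A ⊠ QSys.unit)
      (prodPUnit _).symm ∘ₗ ptrace) fun ρ => ρ.trace = 1 := by
  obtain ⟨v, hv⟩ : ∃ v : (N j).Aabs → ℂ, IsState (rankOne v) := by
    refine ⟨Pi.single (Classical.arbitrary _) 1, posSemidef_rankOne _, ?_⟩
    rw [trace_rankOne, nsq, sum_eq_single (Classical.arbitrary _)]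
    · simp
    · intro b _ hb; simp [hb]
    · simp
  let τ : Op (N j).Alice := rankOne v ⊗ₖ (N j).test
  have hτ : IsState τ := hv.kron (N j).isState_test
  let enc : SuperOp QSys.unit (N j).Alice := relabel (X := QSys.unit ⊠ (N j).Alice)
    (Y := (N j).Alice) (punitProd _) ∘ₗ append τ
  have henc : ∀ u, enc u = u () () • τ := fun u => rfl
  have he : IsChannel enc := (isChannel_relabel _).comp (isChannel_append hτ)
  have h := (Impl.single_transmit (η := η) (rfl : N j = N j) he
    (isChannel_discard (N j).Bout) (A := A) (Vd := fun ρ => ρ.trace = 1) fun ρ hρ => ?_).pre_iso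
    (isConj_relabel (X := A) (Y := A ⊠ QSys.unit) (prodPUnit _).symm)
  · refine h.congr ?_ fun ρ hρ =>
      (((isChannel_relabel _).ext _).tracePreserving ρ).trans hρ
    have h1 : discard (N j).Bout ∘ₗ ptraceLeft ∘ₗ (N j).chan ∘ₗ append (N j).source ∘ₗ enc
        = LinearMap.id := by
      refine LinearMap.ext fun u => ?_
      simp only [comp_apply]
      rw [discard_apply, trace_ptraceLeft, (N j).isChannel.tracePreserving]
      have h2 := trace_kron (enc u) (N j).source
      refine (congrArg (· • (1 : Op QSys.unit)) h2).trans ?_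
      rw [(N j).isState_source.2, henc, trace_smul, hτ.2]
      refine Matrix.ext fun a b => ?_
      simp [Matrix.smul_apply]
    rw [h1, extL_id]
    rw [ptrace_unit_eq, ptrace_unit_eq]
    rfl
  · have h1 : (ptraceLeft (ptrace ρ)) () () = 1 := by
      have : (ptraceLeft (ptrace ρ)).trace = 1 := by rw [trace_ptraceLeft, trace_ptrace, hρ]
      rw [← this]
      exact (Fintype.sum_unique _).symm
    rw [henc, h1, one_smul, ptraceLeft_kron, hv.2, one_smul, sub_self, traceNorm_zero]
    exact hη

/-- The resource transmits the system `Q` perfectly. -/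
def Sends (r : Resource) (Q : QSys) : Prop :=
  Subsingleton r.Arel ∧ ∃ (enc : SuperOp Q r.Alice) (dec : SuperOp r.Bout Q),
    IsChannel enc ∧ IsChannel dec ∧
    dec ∘ₗ ptraceLeft ∘ₗ r.chan ∘ₗ append r.source ∘ₗ enc = LinearMap.id

theorem eq_of_trace_eq [Subsingleton X] {a b : Op X} (h : a.trace = b.trace) : a = b := by
  refine Matrix.ext fun i j => ?_
  rw [Subsingleton.elim j i]
  have : ∀ c : Op X, c.trace = c i i := fun c =>
    (sum_eq_single i (fun k _ hk => absurd (Subsingleton.elim k i) hk) (by simp))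
  rw [← this a, ← this b, h]

theorem Impl.send {j : ι} (hη : 0 ≤ η) (h : Sends (N j) Q) (A : QSys) :
    Impl N η [j] (1 : Op QSys.unit) ((LinearMap.id : SuperOp (A ⊠ Q) (A ⊠ Q)) ∘ₗ ptrace)
      fun ρ => ρ.trace = 1 := by
  obtain ⟨hs, enc, dec, he, hd, h1⟩ := h
  have h2 := Impl.single_transmit (η := η) (rfl : N j = N j) he hd (A := A)
    (Vd := fun ρ => ρ.trace = 1) fun ρ hρ => ?_
  · rw [h1, extL_id] at h2
    exact h2
  · rw [eq_of_trace_eq (a := ptraceLeft (enc (ptraceLeft (ptrace ρ)))) (b := (N j).test),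
      sub_self, traceNorm_zero]
    · exact hη
    · rw [trace_ptraceLeft, he.tracePreserving, trace_ptraceLeft, trace_ptrace, hρ,
        (N j).isState_test.2]

end Rules

section LeftInverse

variable {X Y : QSys}

/-- An isometry is inverted by a channel. -/
theorem exists_leftInverse {V : Matrix Y X ℂ} (hV : Vᴴ * V = 1) :
    ∃ Λ : SuperOp Y X, IsChannel Λ ∧ Λ ∘ₗ conj V = LinearMap.id := by
  let x₀ : X := Classical.arbitrary _
  let P : Op Y := 1 - V * Vᴴ
  have hP : Pᴴ * P = P := by
    have h1 : V * Vᴴ * (V * Vᴴ) = V * Vᴴ := by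
      rw [Matrix.mul_assoc, ← Matrix.mul_assoc Vᴴ, hV, Matrix.one_mul]
    simp only [P, Matrix.conjTranspose_sub, Matrix.conjTranspose_one, conjTranspose_mul,
      Matrix.conjTranspose_conjTranspose, Matrix.sub_mul, Matrix.mul_sub, Matrix.one_mul,
      Matrix.mul_one, h1]
    abel
  have hPV : P * V = 0 := by
    simp only [P, Matrix.sub_mul, Matrix.one_mul, Matrix.mul_assoc, hV, Matrix.mul_one, sub_self]
  let K : Option Y → Matrix X Y ℂ := fun o => o.elim Vᴴ fun y =>
    Matrix.single x₀ y (1 : ℂ) * P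
  have hK : ∑ o, (K o)ᴴ * K o = 1 := by
    rw [Fintype.sum_option]
    have h1 : ∀ y, (K (some y))ᴴ * K (some y) = Pᴴ * Matrix.single y y (1 : ℂ) * P := by
      intro y
      simp only [K, Option.elim_some, conjTranspose_mul, Matrix.conjTranspose_single, star_one]
      rw [Matrix.mul_assoc, ← Matrix.mul_assoc (Matrix.single y x₀ (1 : ℂ)),
        Matrix.single_mul_single_same, mul_one, Matrix.mul_assoc]
    have h2 : ∑ y : Y, Matrix.single y y (1 : ℂ) = (1 : Op Y) := by
      refine Matrix.ext fun a b => ?_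
      rw [Matrix.sum_apply, sum_eq_single a]
      · simp [single_apply, one_apply]
      · intro c _ hc; simp [hc]
      · simp
    simp only [h1]
    rw [← Matrix.sum_mul, ← Matrix.mul_sum, h2, Matrix.mul_one, hP]
    simp [K, P]
  refine ⟨∑ o, conj (K o), ⟨_, inferInstance, K, hK, fun ρ => by
    rw [LinearMap.sum_apply]; rfl⟩, ?_⟩
  refine LinearMap.ext fun ρ => ?_
  rw [comp_apply, LinearMap.sum_apply, Fintype.sum_option, sum_eq_zero, add_zero]
  · simp only [K, conj_apply, Option.elim_none, Matrix.conjTranspose_conjTranspose]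
    rw [← Matrix.mul_assoc, ← Matrix.mul_assoc, hV, Matrix.one_mul, Matrix.mul_assoc, hV,
      Matrix.mul_one]
    rfl
  · intro y _
    simp only [K, conj_apply, Option.elim_some]
    have : Matrix.single x₀ y (1 : ℂ) * P * (V * ρ * Vᴴ) = 0 := by
      rw [Matrix.mul_assoc V, Matrix.mul_assoc, ← Matrix.mul_assoc P, hPV]
      simp
    rw [this, Matrix.zero_mul]

end LeftInverse

section Rules

variable {M S A A' B G Q : QSys} {ι : Type} {N : ι → Resource} {η : ℝ} {l : List ι}

theorem Impl.sendList (hη : 0 ≤ η) : ∀ {js : List ι}, (∀ j ∈ js, Sends (N j) Q) → ∀ A : QSys,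
    Impl N η js (1 : Op QSys.unit) ((LinearMap.id : SuperOp (A ⊠ sysList (fun _ => Q) js)
      (A ⊠ sysList (fun _ => Q) js)) ∘ₗ ptrace) fun ρ => ρ.trace = 1
  | [], _, A => by
    refine (Impl.nil (isChannel_relabel (X := A ⊠ QSys.unit) (Y := A) (prodPUnit _))
      fun _ => True).congr ?_ fun _ _ => _root_.trivial
    rw [ptrace_unit_eq]
    rfl
  | j :: js, h, A => by
    have h1 := ((Impl.send hη (h j (by simp)) (A ⊠ sysList (fun _ => Q) js)).pre_iso
      (isConj_relabel (X := A ⊠ (Q ⊠ sysList (fun _ => Q) js))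
        (Y := (A ⊠ sysList (fun _ => Q) js) ⊠ Q)
        ⟨fun p => ((p.1, p.2.2), p.2.1),
         fun p => (p.1.1, (p.2, p.1.2)), fun _ => rfl, fun _ => rfl⟩)).andThen
      (Impl.sendList hη (fun i hi => h i (by simp [hi])) A)
    refine h1.congr ?_ fun ρ hρ => ⟨(((isChannel_relabel _).ext _).tracePreserving ρ).trans hρ, hρ⟩
    rw [ptrace_unit_eq, ptrace_unit_eq]
    rfl

/-- Alice transmits a part of her memory to Bob. -/
theorem Impl.transmit {σ : Op S} {F : SuperOp (M ⊠ S) ((A ⊠ G) ⊠ B)} {Vd : Op (M ⊠ S) → Prop}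
    (h : Impl N η l σ F Vd) (hη : 0 ≤ η) {js : List ι} (hj : ∀ j ∈ js, Sends (N j) Q)
    (hc : Fintype.card G ≤ Fintype.card (sysList (fun _ : ι => Q) js)) :
    Impl N η (l ++ js) σ (relabel (X := (A ⊠ G) ⊠ B) (Y := A ⊠ (B ⊠ G))
      ⟨fun p => (p.1.1, (p.2, p.1.2)), fun q => ((q.1, q.2.2), q.2.1), fun _ => rfl, fun _ => rfl⟩ ∘ₗ F) fun ρ => Vd ρ ∧ ρ.trace = 1 := by
  obtain ⟨f⟩ := Function.Embedding.nonempty_of_card_le hc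
  obtain ⟨Λ, hΛ, hΛf⟩ := exists_leftInverse (basisMap_isometry f.injective)
  have h1 := ((Impl.sendList hη hj A).pre ((isChannel_push f.injective).extL A)).post isChannel_id hΛ
  have h2 : Impl N η js (1 : Op QSys.unit)
      ((LinearMap.id : SuperOp (A ⊠ G) (A ⊠ G)) ∘ₗ ptrace) fun ρ => ρ.trace = 1 := by
    refine h1.congr ?_ fun ρ hρ => ?_
    · rw [tensor_id_left]
      refine LinearMap.ext fun M => ?_
      have h3 := ptrace_ext (extL (push f) A) M
      have h4 : extL Λ A ∘ₗ extL (push f) A = LinearMap.id := by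
        rw [← extL_comp, push, hΛf, extL_id]
      have h5 := LinearMap.congr_fun h4 (ptrace M)
      exact (h5.symm.trans (congrArg (extL Λ A) h3.symm))
    · exact ((((isChannel_push f.injective).extL A).ext _).tracePreserving ρ).trans hρ
  exact (h.andThen h2).congr rfl fun _ h => h

theorem Impl.feedAll (hη : 0 ≤ η) : ∀ (js : List ι) {l : List ι} {σ : Op S}
    {F : SuperOp (M ⊠ S) (A ⊠ B)} {Vd : Op (M ⊠ S) → Prop}, Impl N η l σ F Vd →
    (∀ ρ, Vd ρ → ρ.trace = 1) → Impl N η (l ++ js) σ F Vd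
  | [], _, _, _, _, h, _ => by rwa [List.append_nil]
  | j :: js, l, σ, F, Vd, h, ht => by
    have h1 := (h.andThen (Impl.feed j hη A)).post isChannel_id
      (isChannel_relabel (X := B ⊠ QSys.unit) (Y := B) (prodPUnit _))
    have h2 := Impl.feedAll hη js (h1.congr (F' := F) (Vd' := Vd) rfl fun ρ hρ => ⟨hρ, ht ρ hρ⟩) ht
    rwa [List.append_assoc] at h2

/-- The states on the input of a resource with its test and source states as marginals. -/
def Resource.Adm (T : Resource) (ρ : Op T.In) : Prop :=
  IsState ρ ∧ T.marginal ρ = T.test ⊗ₖ T.source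

theorem Resource.IsExtension.adm {T : Resource} {R : QSys} {ξ : Op (T.In ⊠ R)}
    (h : T.IsExtension ξ) : T.Adm (ptrace ξ) :=
  ⟨isChannel_ptrace.isState h.1, (T.isExtension_iff ξ).mp h |>.2⟩

theorem Impl.exists_protocol [Fintype ι] [DecidableEq ι] {T : Resource} {F : SuperOp T.In T.Out}
    (hη : 0 ≤ η) (h : Impl N η l T.source F T.Adm) (hl : l.Nodup) :
    ∃ P : Protocol N T, P.Valid η ∧ P.chan = F := by
  obtain ⟨M', ly, Φ, Ψ, E, h1, h2, ⟨c, rfl⟩, rfl, h5⟩ := h.feedAll hη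
    (Finset.univ.toList.filter (· ∉ l)) fun ρ hρ => hρ.1.2
  refine ⟨⟨_, ?_, fun j => ?_, c, T.Alice, M', LinearMap.id, isChannel_id, ly, Φ, h1, Ψ, h2⟩,
    fun R ξ hξ => h5 _ hξ.adm, rfl⟩
  · refine List.Nodup.append hl ((Finset.nodup_toList _).filter _) fun j hj hj' => ?_
    simp [hj] at hj'
  · by_cases hj : j ∈ l <;> simp [hj]

end Rules

section RunStep

/-- The outputs of a resource other than Alice's are moved to the right. -/
def stepIn (Ao Bo K aux S : Type) : ((Ao × Bo) × K) × (aux × S) ≃ ((Ao × aux) × S) × (Bo × K) where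
  toFun p := (((p.1.1.1, p.2.1), p.2.2), (p.1.1.2, p.1.2))
  invFun q := (((q.1.1.1, q.2.1), q.2.2), (q.1.1.2, q.1.2))
  left_inv _ := rfl
  right_inv _ := rfl

/-- The outputs of a resource are joined with those of the remaining resources. -/
def stepOut (M' Bl Kl Bo K : Type) : ((M' × Bl) × Kl) × (Bo × K) ≃ (M' × (Bo × Bl)) × (K × Kl) where
  toFun p := ((p.1.1.1, (p.2.1, p.1.1.2)), (p.2.2, p.1.2))
  invFun q := (((q.1.1, q.1.2.2), q.2.2), (q.1.2.1, q.2.1))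
  left_inv _ := rfl
  right_inv _ := rfl

/-- Bob's output is moved to the right. -/
def moveOut (A B W S : Type) : (A × B) × (W × S) ≃ ((A × W) × S) × B where
  toFun p := (((p.1.1, p.2.1), p.2.2), p.1.2)
  invFun q := ((q.1.1.1, q.2), (q.1.1.2, q.1.2))
  left_inv _ := rfl
  right_inv _ := rfl

/-- Two systems are exchanged. -/
def swapRight (A B W : Type) : (A × B) × W ≃ (A × W) × B where
  toFun p := ((p.1.1, p.2), p.1.2)
  invFun p := ((p.1.1, p.2), p.1.2)
  left_inv _ := rfl
  right_inv _ := rfl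

/-- Bob's output is moved back. -/
def moveBack (A B B' : Type) : (A × B') × B ≃ A × (B × B') where
  toFun p := (p.1.1, (p.2, p.1.2))
  invFun q := ((q.1, q.2.2), q.2.1)
  left_inv _ := rfl
  right_inv _ := rfl

variable {Al Sj Ao Bo K aux S M M' Kl B Bl : QSys}

/-- One layer, with the channel `m` and the remaining layers `R`. -/
def runStep (m : SuperOp (Al ⊠ Sj) ((Ao ⊠ Bo) ⊠ K)) (R : SuperOp ((Ao ⊠ aux) ⊠ S) ((M' ⊠ Bl) ⊠ Kl)) :
    SuperOp ((Al ⊠ Sj) ⊠ (aux ⊠ S)) ((M' ⊠ (Bo ⊠ Bl)) ⊠ (K ⊠ Kl)) :=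
  relabel (X := ((M' ⊠ Bl) ⊠ Kl) ⊠ (Bo ⊠ K)) (Y := (M' ⊠ (Bo ⊠ Bl)) ⊠ (K ⊠ Kl)) (stepOut _ _ _ _ _)
    ∘ₗ ext R (Bo ⊠ K)
    ∘ₗ relabel (X := ((Ao ⊠ Bo) ⊠ K) ⊠ (aux ⊠ S)) (Y := ((Ao ⊠ aux) ⊠ S) ⊠ (Bo ⊠ K))
      (stepIn _ _ _ _ _)
    ∘ₗ ext m (aux ⊠ S)

/-- Bob's outputs from the reduced ones and the registers. -/
abbrev recover (g : B × Kl → Bl) :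
    SuperOp ((M' ⊠ Kl) ⊠ B) ((M' ⊠ Bl) ⊠ Kl) := push fun p => ((p.1.1, g (p.2, p.1.2)), p.1.2)

theorem runStep_chan (n : SuperOp (Al ⊠ Sj) (Ao ⊠ Bo)) (u : K)
    (F : SuperOp ((Ao ⊠ aux) ⊠ S) ((M' ⊠ Kl) ⊠ B)) (g : B × Kl → Bl) :
    runStep (push (Y := (Ao ⊠ Bo) ⊠ K) (fun x => (x, u)) ∘ₗ n) (recover g ∘ₗ F)
      ∘ₗ relabel (X := (Al ⊠ aux) ⊠ (Sj ⊠ S)) (Y := (Al ⊠ Sj) ⊠ (aux ⊠ S))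
        (prodProdProdComm _ _ _ _)
    = recover (M' := M') (B := Bo ⊠ B) (Kl := K ⊠ Kl) (Bl := Bo ⊠ Bl)
        (fun p => (p.1.1, g (p.1.2, p.2.2))) ∘ₗ
      tensor (push (X := M' ⊠ Kl) (Y := M' ⊠ (K ⊠ Kl)) fun p => (p.1, (u, p.2))) LinearMap.id ∘ₗ
      seqMap n F := by
  let P : SuperOp Bo (Bo ⊠ K) := push fun b => (b, u)
  let y (ρ : Op ((Al ⊠ aux) ⊠ (Sj ⊠ S))) := ext n (aux ⊠ S) (relabel (X := (Al ⊠ aux) ⊠ (Sj ⊠ S))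
    (Y := (Al ⊠ Sj) ⊠ (aux ⊠ S)) (prodProdProdComm _ _ _ _) ρ)
  have h1 : relabel (X := ((Ao ⊠ Bo) ⊠ K) ⊠ (aux ⊠ S)) (Y := ((Ao ⊠ aux) ⊠ S) ⊠ (Bo ⊠ K))
      (stepIn _ _ _ _ _) ∘ₗ ext (push (X := Ao ⊠ Bo) (Y := (Ao ⊠ Bo) ⊠ K) fun x => (x, u)) (aux ⊠ S)
      = extL P ((Ao ⊠ aux) ⊠ S) ∘ₗ relabel (X := (Ao ⊠ Bo) ⊠ (aux ⊠ S))
        (Y := ((Ao ⊠ aux) ⊠ S) ⊠ Bo) (moveOut _ _ _ _) := by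
    rw [← push_equiv, ← push_equiv, ext_push, extL_push, push_comp, push_comp]
    rfl
  have h2 := ext_comp_extL F P
  have h3 : relabel (X := ((M' ⊠ Bl) ⊠ Kl) ⊠ (Bo ⊠ K)) (Y := (M' ⊠ (Bo ⊠ Bl)) ⊠ (K ⊠ Kl))
      (stepOut _ _ _ _ _) ∘ₗ ext (recover g) (Bo ⊠ K) ∘ₗ extL P ((M' ⊠ Kl) ⊠ B)
      = recover (M' := M') (B := Bo ⊠ B) (Kl := K ⊠ Kl) (Bl := Bo ⊠ Bl)
        (fun p => (p.1.1, g (p.1.2, p.2.2))) ∘ₗ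
      ext (push (X := M' ⊠ Kl) (Y := M' ⊠ (K ⊠ Kl)) fun p => (p.1, (u, p.2))) (Bo ⊠ B) ∘ₗ
      relabel (X := ((M' ⊠ Kl) ⊠ B) ⊠ Bo) (Y := (M' ⊠ Kl) ⊠ (Bo ⊠ B)) (moveBack _ _ _) := by
    rw [← push_equiv, ← push_equiv, recover, ext_push, extL_push, ext_push, push_comp, push_comp,
      push_comp, push_comp]
    rfl
  refine LinearMap.ext fun ρ => ?_
  refine (congrArg (fun t => relabel (X := ((M' ⊠ Bl) ⊠ Kl) ⊠ (Bo ⊠ K))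
    (Y := (M' ⊠ (Bo ⊠ Bl)) ⊠ (K ⊠ Kl)) (stepOut _ _ _ _ _) (ext (recover g) (Bo ⊠ K)
      (ext F (Bo ⊠ K) t))) (LinearMap.congr_fun h1 (y ρ))).trans ?_
  refine (congrArg (fun t => relabel (X := ((M' ⊠ Bl) ⊠ Kl) ⊠ (Bo ⊠ K))
    (Y := (M' ⊠ (Bo ⊠ Bl)) ⊠ (K ⊠ Kl)) (stepOut _ _ _ _ _) (ext (recover g) (Bo ⊠ K) t))
    (LinearMap.congr_fun h2 _)).trans ?_
  exact LinearMap.congr_fun h3 _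

theorem stepIn_copy (out : (Al ⊠ Sj) → (Ao ⊠ Bo))
    (e : (Al ⊠ Sj) ≃ K) (s₀ : Sj) (hs : ∀ s, s = s₀)
    (es : (Sj ⊠ S) ≃ S) (hes : ∀ p, es p = p.2) :
    relabel (X := ((Ao ⊠ Bo) ⊠ K) ⊠ (aux ⊠ S)) (Y := ((Ao ⊠ aux) ⊠ S) ⊠ (Bo ⊠ K))
      (stepIn _ _ _ _ _) ∘ₗ ext (push (X := Al ⊠ Sj) (Y := (Ao ⊠ Bo) ⊠ K) fun x => (out x, e x))
        (aux ⊠ S) ∘ₗ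
      relabel (X := (Al ⊠ aux) ⊠ (Sj ⊠ S)) (Y := (Al ⊠ Sj) ⊠ (aux ⊠ S))
        (prodProdProdComm _ _ _ _)
      = extL (push (X := K) (Y := Bo ⊠ K) fun k => ((out (e.symm k)).2, k)) ((Ao ⊠ aux) ⊠ S) ∘ₗ
        relabel (X := ((Ao ⊠ aux) ⊠ K) ⊠ S) (Y := ((Ao ⊠ aux) ⊠ S) ⊠ K) (swapRight _ _ _) ∘ₗ
        ext (push (X := Al ⊠ aux) (Y := (Ao ⊠ aux) ⊠ K)
        fun p => (((out (p.1, s₀)).1, p.2), e (p.1, s₀))) S ∘ₗ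
      extL (relabel (X := Sj ⊠ S) (Y := S) es) (Al ⊠ aux) := by
  rw [← push_equiv, ← push_equiv, ← push_equiv, ← push_equiv, ext_push, extL_push, ext_push,
    extL_push, push_comp, push_comp, push_comp, push_comp, push_comp]
  refine congrArg push (funext fun p => ?_)
  obtain ⟨⟨a, x⟩, s, t⟩ := p
  obtain rfl := hs s
  have := hes (s, t)
  simp [stepIn, swapRight, Prod.map, this]

theorem runStep_copy (out : (Al ⊠ Sj) → (Ao ⊠ Bo))
    (e : (Al ⊠ Sj) ≃ K) (s₀ : Sj) (hs : ∀ s, s = s₀)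
    (F : SuperOp ((Ao ⊠ aux) ⊠ S) ((M' ⊠ Kl) ⊠ B)) (g : B × Kl → Bl)
    (es : (Sj ⊠ S) ≃ S) (hes : ∀ p, es p = p.2) :
    runStep (push (X := Al ⊠ Sj) (Y := (Ao ⊠ Bo) ⊠ K) (fun x => (out x, e x))) (recover g ∘ₗ F)
      ∘ₗ relabel (X := (Al ⊠ aux) ⊠ (Sj ⊠ S)) (Y := (Al ⊠ Sj) ⊠ (aux ⊠ S))
        (prodProdProdComm _ _ _ _)
    = recover (M' := M') (Kl := K ⊠ Kl) (Bl := Bo ⊠ Bl)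
        (fun p => ((out (e.symm p.2.1)).2, g (p.1, p.2.2))) ∘ₗ
      tensor (relabel (X := (M' ⊠ Kl) ⊠ K) (Y := M' ⊠ (K ⊠ Kl))
        ⟨fun p => (p.1.1, (p.2, p.1.2)),
         fun q => ((q.1, q.2.2), q.2.1), fun _ => rfl, fun _ => rfl⟩) LinearMap.id ∘ₗ
      idleMap F K ∘ₗ ext (push (X := Al ⊠ aux) (Y := (Ao ⊠ aux) ⊠ K)
        fun p => (((out (p.1, s₀)).1, p.2), e (p.1, s₀))) S ∘ₗ
      extL (relabel (X := Sj ⊠ S) (Y := S) es) (Al ⊠ aux) := by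
  let P : SuperOp K (Bo ⊠ K) := push fun k => ((out (e.symm k)).2, k)
  have h2 := ext_comp_extL F P
  have h3 : relabel (X := ((M' ⊠ Bl) ⊠ Kl) ⊠ (Bo ⊠ K)) (Y := (M' ⊠ (Bo ⊠ Bl)) ⊠ (K ⊠ Kl))
      (stepOut _ _ _ _ _) ∘ₗ ext (recover g) (Bo ⊠ K) ∘ₗ extL P ((M' ⊠ Kl) ⊠ B)
      = recover (M' := M') (Kl := K ⊠ Kl) (Bl := Bo ⊠ Bl)
        (fun p => ((out (e.symm p.2.1)).2, g (p.1, p.2.2))) ∘ₗ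
      ext (relabel (X := (M' ⊠ Kl) ⊠ K) (Y := M' ⊠ (K ⊠ Kl)) (moveBack _ _ _)) B ∘ₗ
      relabel (X := ((M' ⊠ Kl) ⊠ B) ⊠ K) (Y := ((M' ⊠ Kl) ⊠ K) ⊠ B) (swapRight _ _ _) := by
    rw [← push_equiv, ← push_equiv, ← push_equiv, recover, ext_push, extL_push, ext_push, push_comp,
      push_comp, push_comp, push_comp]
    rfl
  refine LinearMap.ext fun ρ => ?_
  refine (congrArg (fun t => relabel (X := ((M' ⊠ Bl) ⊠ Kl) ⊠ (Bo ⊠ K))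
    (Y := (M' ⊠ (Bo ⊠ Bl)) ⊠ (K ⊠ Kl)) (stepOut _ _ _ _ _) (ext (recover g) (Bo ⊠ K)
      (ext F (Bo ⊠ K) t))) (LinearMap.congr_fun (stepIn_copy out e s₀ hs es hes) ρ)).trans ?_
  refine (congrArg (fun t => relabel (X := ((M' ⊠ Bl) ⊠ Kl) ⊠ (Bo ⊠ K))
    (Y := (M' ⊠ (Bo ⊠ Bl)) ⊠ (K ⊠ Kl)) (stepOut _ _ _ _ _) (ext (recover g) (Bo ⊠ K) t))
    (LinearMap.congr_fun h2 _)).trans ?_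
  exact LinearMap.congr_fun h3 _

/-- The memory after the use of a channel, one output of which is a copy kept by Alice. -/
theorem seqMid_copy {n : SuperOp (Al ⊠ Sj) (Ao ⊠ Bo)} (out : (Al ⊠ Sj) → (Ao ⊠ Bo))
    (e : (Al ⊠ Sj) ≃ K) (s₀ : Sj) (hs : ∀ s, s = s₀)
    (es : (Sj ⊠ S) ≃ S) (hes : ∀ p, es p = p.2)
    (hn : ∀ ρ, ptrace (push (X := Al ⊠ Sj) (Y := (Ao ⊠ Bo) ⊠ K) (fun x => (out x, e x)) ρ) = n ρ)
    (ρ : Op ((Al ⊠ aux) ⊠ (Sj ⊠ S))) :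
    seqMid n ρ = idleState (ext (push (X := Al ⊠ aux) (Y := (Ao ⊠ aux) ⊠ K)
        fun p => (((out (p.1, s₀)).1, p.2), e (p.1, s₀))) S
      (extL (relabel (X := Sj ⊠ S) (Y := S) es) (Al ⊠ aux) ρ)) := by
  have hP : IsChannel (push (X := K) (Y := Bo ⊠ K) fun k => ((out (e.symm k)).2, k)) :=
    isChannel_push fun _ _ h => congrArg Prod.snd h
  have h1 := (congrArg ptrace (LinearMap.congr_fun (stepIn_copy (aux := aux) out e s₀ hs es hes)
    ρ)).trans (ptrace_extL hP.tracePreserving _)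
  refine Eq.trans ?_ h1
  obtain rfl : n = ptrace ∘ₗ push (X := Al ⊠ Sj) (Y := (Ao ⊠ Bo) ⊠ K) (fun x => (out x, e x)) :=
    LinearMap.ext fun ρ => (hn ρ).symm
  refine Matrix.ext fun p q => ?_
  exact (sum_prod_type (f := fun z : Bo × K =>
    relabel (X := ((Ao ⊠ Bo) ⊠ K) ⊠ (aux ⊠ S)) (Y := ((Ao ⊠ aux) ⊠ S) ⊠ (Bo ⊠ K))
      (stepIn _ _ _ _ _) (ext (push (X := Al ⊠ Sj) (Y := (Ao ⊠ Bo) ⊠ K) fun x => (out x, e x))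
        (aux ⊠ S) (relabel (X := (Al ⊠ aux) ⊠ (Sj ⊠ S)) (Y := (Al ⊠ Sj) ⊠ (aux ⊠ S))
        (prodProdProdComm _ _ _ _) ρ)) (p, z) (q, z))).symm

end RunStep

section Build

variable {ι ι' : Type} {N : ι → Resource} {N' : ι' → Resource} {η : ℝ}

theorem CopyDil.ptrace_kept {r : Resource} (c : CopyDil r) (ρ : Op r.In) :
    ptrace (c.kept.map () ρ) = r.chan ρ := by
  rw [← c.dilates ρ]
  refine Matrix.ext fun p q => ?_
  change ∑ k, ∑ w, conj c.V ρ (p, (k, w)) (q, (k, w))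
    = ∑ z : c.K × c.W, conj c.V ρ (p, z) (q, z)
  rw [sum_prod_type]

theorem append_unit_eq (M : QSys) : append (X := M ⊠ QSys.unit) (W := QSys.unit) 1 =
    recover (B := QSys.unit) (Bl := QSys.unit) (Kl := QSys.unit) (fun _ => ()) ∘ₗ
    ext (relabel (X := M) (Y := M ⊠ QSys.unit) (prodPUnit _).symm) QSys.unit := by
  rw [← push_equiv, ext_push, recover, push_comp]
  have h : (fun p : (M ⊠ QSys.unit) => (((Prod.map (prodPUnit M).symm id
      p).1.1, ()), (Prod.map (prodPUnit M).symm id p).1.2)) =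
      ((prodPUnit (M ⊠ QSys.unit)).symm :
        (M ⊠ QSys.unit) → ((M ⊠ QSys.unit) ⊠ QSys.unit)) := rfl
  refine Eq.trans ?_ ((congrArg (fun f => push (X := M ⊠ QSys.unit)
    (Y := (M ⊠ QSys.unit) ⊠ QSys.unit) f) h).trans (push_equiv _)).symm
  exact LinearMap.ext fun ρ => Matrix.ext fun a b => mul_one _

/-- The layers without the classical channels, whose inputs are kept by Alice. -/
theorem Layers.exists_impl (c : ∀ j, CopyDil (N j)) (f : ι → ι') (p : ι → Bool)
    (hp : ∀ j, p j = true → N' (f j) = N j ∧ ∃ u : (c j).K, (c j).kept.map () =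
      push (X := (N j).Out) (Y := (N j).Out ⊠ (c j).K) (fun x => (x, u)) ∘ₗ (N j).chan)
    (hc : ∀ j, p j = false → ∃ (out : (N j).In → (N j).Out)
      (e : (N j).In ≃ (c j).K) (s₀ : (N j).S), (∀ s, s = s₀) ∧
      (c j).kept.map () = push (X := (N j).In) (Y := (N j).Out ⊠ (c j).K)
        (fun x => (out x, e x))) :
    ∀ {l : List ι} {M M' : QSys} (ly : Layers N l M M'),
      ∃ (B : QSys) (F : SuperOp (M ⊠ srcSys N l) ((M' ⊠ sysList (fun j => (c j).K) l) ⊠ B))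
        (g : B × (sysList (fun j => (c j).K) l) → (bobSys N l)),
        (Function.Injective fun q : B × (sysList (fun j => (c j).K) l) =>
          (g q, q.2)) ∧
        Impl N' η ((l.filter p).map f) (srcState N l) F (fun ρ => ly.Valid η ρ) ∧
        ly.keptRun c = recover g ∘ₗ F
  | _, _, _, .nil M => by
    refine ⟨QSys.unit, _, fun _ => (), fun a b _ => Subsingleton.elim (α := Unit × Unit) a b,
      Impl.nil (isChannel_relabel (X := M) (Y := M ⊠ QSys.unit) (prodPUnit _).symm) _, ?_⟩
    exact append_unit_eq M
  | _, _, M', .cons (M := M) j (l := l) aux V hV rest => by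
    obtain ⟨B, F, g, hg, hF, hR⟩ := Layers.exists_impl c f p hp hc rest
    have hrun : (Layers.cons j aux V hV rest).keptRun c = runStep ((c j).kept.map ())
        (rest.keptRun c) ∘ₗ relabel (X := ((N j).Alice ⊠ aux) ⊠ ((N j).S ⊠ srcSys N l))
          (Y := ((N j).Alice ⊠ (N j).S) ⊠ (aux ⊠ srcSys N l)) (prodProdProdComm _ _ _ _) ∘ₗ
        ext (conj (Y := (N j).Alice ⊠ aux) V) ((N j).S ⊠ srcSys N l) := rfl
    rcases hj : p j with _ | _
    · obtain ⟨out, e, s₀, hs, hk⟩ := hc j hj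
      let es : ((N j).S ⊠ srcSys N l) ≃ (srcSys N l) :=
        { toFun := fun p => p.2
          invFun := fun s => (s₀, s)
          left_inv := fun p => Prod.ext (hs p.1).symm rfl
          right_inv := fun _ => rfl }
      have hes : ∀ p, es p = p.2 := fun _ => rfl
      have hcp : IsConj (push (X := (N j).Alice ⊠ aux) (Y := ((N j).Aout ⊠ aux) ⊠ (c j).K)
          fun p => (((out (p.1, s₀)).1, p.2), e (p.1, s₀))) := isConj_push fun a b h => by
        have h1 := congrArg (fun q => (e.symm q.2).1) h
        simp only [Equiv.symm_apply_apply] at h1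
        exact Prod.ext h1 (congrArg (fun q => q.1.2) h)
      have hn : ∀ ρ, ptrace (push (X := (N j).Alice ⊠ (N j).S) (Y := (N j).Out ⊠ (c j).K)
          (fun x => (out x, e x)) ρ) = (N j).chan ρ := fun ρ =>
        (congrArg (fun Φ => ptrace (Φ ρ)) hk.symm).trans ((c j).ptrace_kept ρ)
      have hsrc : relabel es ((N j).source ⊗ₖ srcState N l) = srcState N l := by
        have h1 : (N j).source s₀ s₀ = 1 := by
          have : Subsingleton (N j).S := ⟨fun a b => (hs a).trans (hs b).symm⟩
          exact congrFun (congrFun (eq_of_trace_eq (a := (N j).source) (b := 1) (by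
            rw [(N j).isState_source.2, Matrix.trace_one, Fintype.card_eq_one_iff.2 ⟨s₀, hs⟩]
            simp)) s₀) s₀ |>.trans (Matrix.one_apply_eq _)
        exact Matrix.ext fun a b => (congrArg (· * srcState N l a b) h1).trans (one_mul _)
      have hI := (((((hF.idle (c j).K).pre_iso hcp).source (isSplit_relabel es hsrc)).pre_iso
          ⟨V, hV, rfl⟩).post (isChannel_relabel (X := (M' ⊠ sysList (fun j => (c j).K) l) ⊠ (c j).K)
            (Y := M' ⊠ ((c j).K ⊠ sysList (fun j => (c j).K) l)) (moveBack _ _ _)) isChannel_id)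
      have hI' := hI.mono (Vd' := (Layers.cons j aux V hV rest).Valid η) fun ρ hρ => by
        rw [Layers.valid_cons, seqMid_copy out e s₀ hs es hes hn] at hρ
        exact hρ.2
      rw [List.filter_cons_of_neg (by simp [hj])]
      refine ⟨B, _, fun p => ((out (e.symm p.2.1)).2, g (p.1, p.2.2)), ?_, hI', ?_⟩
      rotate_left
      · rw [hrun, hk, hR]
        exact (congrArg (fun t : SuperOp (((N j).Alice ⊠ aux) ⊠ ((N j).S ⊠ srcSys N l)) _ =>
          t ∘ₗ ext (conj (Y := (N j).Alice ⊠ aux) V) ((N j).S ⊠ srcSys N l))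
          (runStep_copy out e s₀ hs F g es hes))
      · rintro ⟨b, k, z⟩ ⟨b', k', z'⟩ h
        simp only [Prod.mk.injEq] at h
        have := hg (a₁ := (b, z)) (a₂ := (b', z')) (Prod.ext (by
          have := h.1.2; simpa using this) h.2.2)
        simp only [Prod.mk.injEq] at this
        simp [h.2.1, this.1, this.2]
    · obtain ⟨hN, u, hu⟩ := hp j hj
      have hpush : IsChannel (push (X := M' ⊠ sysList (fun j => (c j).K) l)
          (Y := M' ⊠ ((c j).K ⊠ sysList (fun j => (c j).K) l)) fun p => (p.1, (u, p.2))) :=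
        isChannel_push fun a b h => by
          simp only [Prod.mk.injEq, true_and] at h
          exact Prod.ext h.1 h.2
      have hI := ((((Impl.use hN hF).pre_iso ⟨V, hV, rfl⟩).post hpush isChannel_id)).mono
        (Vd' := (Layers.cons j aux V hV rest).Valid η) fun ρ hρ => by
          rw [Layers.valid_cons] at hρ
          exact hρ
      rw [List.filter_cons_of_pos hj, List.map_cons]
      refine ⟨(N j).Bout ⊠ B, _, fun p => (p.1.1, g (p.1.2, p.2.2)), ?_, hI, ?_⟩
      rotate_left
      · rw [hrun, hu, hR]
        exact (congrArg (fun t : SuperOp (((N j).Alice ⊠ aux) ⊠ ((N j).S ⊠ srcSys N l)) _ =>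
          t ∘ₗ ext (conj (Y := (N j).Alice ⊠ aux) V) ((N j).S ⊠ srcSys N l))
          (runStep_chan (N j).chan u F g))
      · rintro ⟨⟨b, x⟩, k, z⟩ ⟨⟨b', x'⟩, k', z'⟩ h
        simp only [Prod.mk.injEq] at h
        have := hg (a₁ := (x, z)) (a₂ := (x', z')) (Prod.ext h.1.2 h.2.2)
        simp only [Prod.mk.injEq] at this
        simp [h.1.1, h.2.1, this.1, this.2]

end Build

section CoherentImpl

variable {A A' O B Bl Kl Y : QSys}

/-- Alice hands a copy of her register to Bob. -/
def copyOut (O K B : QSys) : SuperOp ((O ⊠ K) ⊠ B) ((O ⊠ K) ⊠ (B ⊠ K)) :=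
  push fun p => (p.1, (p.2, p.1.2))

theorem ext_recover (Φ : SuperOp A A') (g : B × Kl → Bl) :
    ext (ext Φ Bl) Kl ∘ₗ recover (M' := A) g = recover (M' := A') g ∘ₗ ext (ext Φ Kl) B := by
  let h : SuperOp (Kl ⊠ B) (Bl ⊠ Kl) := push fun p => (g (p.2, p.1), p.1)
  have h1 : ∀ A : QSys, recover (M' := A) g =
      relabel (X := A ⊠ (Bl ⊠ Kl)) (Y := (A ⊠ Bl) ⊠ Kl) (prodAssoc _ _ _).symm ∘ₗ extL h A ∘ₗ
        relabel (X := (A ⊠ Kl) ⊠ B) (Y := A ⊠ (Kl ⊠ B)) (prodAssoc _ _ _) := fun A => by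
    rw [← push_equiv, ← push_equiv, extL_push, push_comp, push_comp]
    rfl
  rw [h1, h1]
  refine LinearMap.ext fun ρ => ?_
  exact congrArg (relabel (X := A' ⊠ (Bl ⊠ Kl)) (Y := (A' ⊠ Bl) ⊠ Kl) (prodAssoc _ _ _).symm)
    (LinearMap.congr_fun (ext_comp_extL Φ h) _)

variable {ι ι' : Type} [Fintype ι] [DecidableEq ι]

theorem spread_keptPipe {K : ι → QSys} {l : List ι} (h : l.Nodup) (h' : ∀ j, j ∈ l)
    (E₁ : SuperOp A O) (F : SuperOp Y ((A ⊠ sysList K l) ⊠ B))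
    (g : B × (sysList K l) → Bl) :
    spread O Bl (QSys.pi K) ∘ₗ keptPipe h h' E₁ (recover g ∘ₗ F)
      = extL (push (X := B ⊠ QSys.pi K) (Y := Bl ⊠ QSys.pi K)
          fun p => (g (p.1, (sysPi h h').symm p.2), p.2)) (O ⊠ QSys.pi K) ∘ₗ
        copyOut O (QSys.pi K) B ∘ₗ
        ext (extL (relabel (Y := QSys.pi K) (sysPi h h')) O ∘ₗ ext E₁ (sysList K l)) B ∘ₗ F := by
  have h1 : spread O Bl (QSys.pi K) ∘ₗ
      extL (relabel (Y := QSys.pi K) (sysPi h h')) (O ⊠ Bl) ∘ₗ recover g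
      = extL (push (X := B ⊠ QSys.pi K) (Y := Bl ⊠ QSys.pi K)
          fun p => (g (p.1, (sysPi h h').symm p.2), p.2)) (O ⊠ QSys.pi K) ∘ₗ
        copyOut O (QSys.pi K) B ∘ₗ
        ext (extL (relabel (Y := QSys.pi K) (sysPi h h')) O) B := by
    rw [← push_equiv, extL_push, extL_push, extL_push, ext_push, spread, copyOut, recover,
      push_comp, push_comp, push_comp, push_comp]
    refine congrArg push (funext fun p => ?_)
    simp [Prod.map]
  refine LinearMap.ext fun ρ => ?_
  refine (congrArg (fun t => spread O Bl (QSys.pi K)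
    (extL (relabel (Y := QSys.pi K) (sysPi h h')) (O ⊠ Bl) t))
    (LinearMap.congr_fun (ext_recover E₁ g) (F ρ))).trans ?_
  exact LinearMap.congr_fun h1 _

variable {N : ι → Resource} {N' : ι' → Resource} {T : Resource}

theorem Resource.Adm.isExtension {ρ : Op T.In} (h : T.Adm ρ) :
    T.IsExtension (R := QSys.unit) (append (X := T.In) (W := QSys.unit) 1 ρ) ∧
      ptrace (append (X := T.In) (W := QSys.unit) 1 ρ) = ρ := by
  have h1 : ptrace (append (X := T.In) (W := QSys.unit) 1 ρ) = ρ :=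
    (ptrace_kron ρ (1 : Op QSys.unit)).trans (by rw [isState_unit.2, one_smul])
  refine ⟨(T.isExtension_iff _).2 ⟨(isChannel_append isState_unit).isState h.1, ?_⟩, h1⟩
  rw [h1, h.2]

theorem CopyDil.ofOption_some {r : Resource} (h : CbitLike r) :
    (CopyDil.ofOption (some h)).kept.map () = push (X := r.In) (Y := r.Out ⊠ r.In)
      (fun x => (h.out x, x)) := by
  change extL (ptrace : SuperOp (r.In ⊠ QSys.unit) r.In) r.Out ∘ₗ
    push (X := r.In) (Y := r.Out ⊠ (r.In ⊠ QSys.unit)) (fun x => (h.out x, (x, ()))) = _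
  rw [ptrace_unit_eq, ← push_equiv, extL_push, push_comp]
  rfl

theorem CopyDil.ofOption_none {r : Resource} :
    (CopyDil.ofOption (r := r) none).kept.map () = push (X := r.Out) (Y := r.Out ⊠ QSys.unit)
      (fun x => (x, ())) ∘ₗ r.chan := by
  refine LinearMap.ext fun ρ => ?_
  have h := (CopyDil.ofOption (r := r) none).ptrace_kept ρ
  change ptrace (W := QSys.unit) _ = _ at h
  rw [ptrace_unit_eq] at h
  refine Eq.trans ?_ (congrArg (push (X := r.Out) (Y := r.Out ⊠ QSys.unit) fun x => (x, ())) h)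
  refine Eq.trans ?_ (LinearMap.congr_fun
    (push_equiv (X := r.Out) (Y := r.Out ⊠ QSys.unit) (prodPUnit r.Out).symm) _).symm
  rfl

theorem isState_maxEntOp (K : QSys) : IsState (maxEntOp K) := by
  have h0 : (Fintype.card K : ℂ) ≠ 0 := by simp
  constructor
  · have h : maxEntOp K = (Fintype.card K : ℂ)⁻¹ •
        rankOne (X := K ⊠ K) fun p => if p.1 = p.2 then 1 else 0 := by
      ext p q
      simp only [maxEntOp, rankOne, of_apply, Matrix.smul_apply, Matrix.vecMulVec_apply,
        Pi.star_apply, smul_eq_mul]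
      by_cases h1 : p.1 = p.2 <;> by_cases h2 : q.1 = q.2 <;> simp [h1, h2]
    rw [h]
    refine (posSemidef_rankOne _).smul ?_
    rw [← Complex.ofReal_natCast, ← Complex.ofReal_inv, Complex.zero_le_real]
    positivity
  · change ∑ p : K × K, maxEntOp K p p = 1
    rw [sum_prod_type]
    simp [maxEntOp, h0]

theorem isChannel_entangle (O B K : QSys) : IsChannel (entangle O B K) :=
  (isChannel_relabel _).comp (isChannel_append (isState_maxEntOp K))

theorem isChannel_push_reindex {K' : QSys} {g : B × Kl → Bl}
    (hg : Function.Injective fun q : B × Kl => (g q, q.2))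
    (s : K' ≃ Kl) :
    IsChannel (push (X := B ⊠ K') (Y := Bl ⊠ K') fun p => (g (p.1, s p.2), p.2)) :=
  isChannel_push fun a b h => by
    obtain ⟨h1, h2⟩ := Prod.mk.inj h
    have h3 := hg (a₁ := (a.1, s a.2)) (a₂ := (b.1, s b.2)) (Prod.ext h1 (congrArg s h2))
    exact Prod.ext (Prod.mk.inj h3).1 h2

/-- The part of a protocol other than the classical channels, whose inputs are made coherent. -/
theorem Protocol.coherent_impl (P : Protocol N T) (o : ∀ j, Option (CbitLike (N j))) (f : ι → ι')
    (hf : ∀ j, o j = none → N' (f j) = N j) {ε η : ℝ} (hε : 0 ≤ ε) (hη' : 0 ≤ η) (hη : P.Valid η)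
    (hdec : ∀ j h, o j = some h → P.CohDecoupled j ε) {ν : ℝ} (hν : P.Close ν) {t : ℝ}
    (ht : 0 < t) :
    ∃ (B : QSys) (F : SuperOp T.In ((T.Aout ⊠ QSys.pi fun j => (CopyDil.ofOption (o j)).K) ⊠ B))
      (D : SuperOp (B ⊠ QSys.pi fun j => (CopyDil.ofOption (o j)).K)
        (T.Bout ⊠ QSys.pi fun j => (CopyDil.ofOption (o j)).K)), IsChannel D ∧
      Impl N' η ((P.order.filter fun j => (o j).isNone).map f) T.source F T.Adm ∧
      Near T (2 * t + 2 * (2 ^ Fintype.card ι - 1) * (128 * (2 * ε + η)) / (2 * t) + ν)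
        (extL D (T.Aout ⊠ QSys.pi fun j => (CopyDil.ofOption (o j)).K) ∘ₗ
          copyOut T.Aout (QSys.pi fun j => (CopyDil.ofOption (o j)).K) B ∘ₗ F)
        (entangle T.Aout T.Bout (QSys.pi fun j => (CopyDil.ofOption (o j)).K) ∘ₗ T.chan) := by
  obtain ⟨Dn, hDn, hnear⟩ := P.coherent_block o hε hη' hη hdec ht
  obtain ⟨B, F, g, hg, hF, hrun⟩ := Layers.exists_impl (N' := N') (η := η)
    (fun j => CopyDil.ofOption (o j)) f (fun j => (o j).isNone) (fun j hj => by
      have h1 : o j = none := Option.isNone_iff_eq_none.1 hj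
      refine ⟨hf j h1, ?_⟩
      rw [h1]
      exact ⟨(), CopyDil.ofOption_none⟩) (fun j hj => by
      rcases h1 : o j with _ | h
      · rw [h1] at hj; cases hj
      · have : Subsingleton (N j).S := h.src
        exact ⟨h.out, Equiv.refl _, Classical.arbitrary _, fun s => Subsingleton.elim _ _,
          CopyDil.ofOption_some h⟩) P.layers
  have hI := (((hF.source ⟨P.split, rfl⟩).pre P.isChannel_E₀).post
    (((isChannel_relabel (Y := QSys.pi fun j => (CopyDil.ofOption (o j)).K)
      (sysPi P.nodup P.complete)).extL T.Aout).comp (P.isChannel_E₁.ext _)) isChannel_id).mono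
    (Vd' := T.Adm) fun ρ hρ => by
      have h1 := hη _ _ hρ.isExtension.1
      rw [hρ.isExtension.2] at h1
      exact h1
  refine ⟨B, _, _, hDn.comp (isChannel_push_reindex hg (sysPi P.nodup P.complete).symm), hI, ?_⟩
  · have h1 := hnear.trans (Near.comp (isChannel_entangle _ _ _) hν)
    have h2 := spread_keptPipe P.nodup P.complete P.E₁ (F ∘ₗ tensor P.E₀ P.split.embed) g
    rw [← comp_assoc, ← hrun] at h2
    have h3 := congrArg (fun t => extL Dn (T.Aout ⊠ QSys.pi fun j => (CopyDil.ofOption (o j)).K) ∘ₗ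
      t) h2
    exact (congrArg (fun t => Near T _ t _) h3).mp h1

end CoherentImpl

/-! ### Powers of the unit channels -/

section Powers

variable {X Y W : QSys}

theorem ptraceLeft_eq_push [Subsingleton W] :
    (ptraceLeft : SuperOp (W ⊠ X) X) = push Prod.snd := by
  have : Unique W := ⟨⟨Classical.arbitrary _⟩, fun _ => Subsingleton.elim _ _⟩
  refine Eq.trans ?_ (push_equiv (X := W ⊠ X) (Y := X) (Equiv.uniqueProd X W)).symm
  exact LinearMap.ext fun M => Matrix.ext fun x x' => Fintype.sum_unique _

theorem append_eq_push [Subsingleton W] {σ : Op W} (h : IsState σ) (w : W) :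
    (append σ : SuperOp X (X ⊠ W)) = push fun x => (x, w) := by
  let _ : Unique W := ⟨⟨w⟩, fun _ => Subsingleton.elim _ _⟩
  refine Eq.trans ?_ (push_equiv (X := X) (Y := X ⊠ W) (Equiv.prodUnique X W).symm).symm
  rw [eq_of_trace_eq (a := σ) (b := 1) (by rw [h.2, Matrix.trace_one, Fintype.card_unique]; simp)]
  refine LinearMap.ext fun M => Matrix.ext fun x x' => ?_
  change M x.1 x'.1 * (1 : Op W) x.2 x'.2 = M x.1 x'.1
  rw [Subsingleton.elim x.2 x'.2, Matrix.one_apply_eq, mul_one]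

/-- The inputs of the tensor product of two resources. -/
def tensorIn (r s : Resource) : (r.tensor s).In ≃ (r.In ⊠ s.In) where
  toFun p := (((p.1.1.1, p.1.2.1), p.2.1), ((p.1.1.2, p.1.2.2), p.2.2))
  invFun q := (((q.1.1.1, q.2.1.1), (q.1.1.2, q.2.1.2)), (q.1.2, q.2.2))
  left_inv _ := rfl
  right_inv _ := rfl

/-- The tensor product of two maps from the inputs of two resources. -/
def tensorMap {r s : Resource} {A₁ B₁ A₂ B₂ : QSys} (F₁ : SuperOp r.In (A₁ ⊠ B₁))
    (F₂ : SuperOp s.In (A₂ ⊠ B₂)) : SuperOp (r.tensor s).In ((A₁ ⊠ A₂) ⊠ (B₁ ⊠ B₂)) :=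
  relabel (X := (A₁ ⊠ B₁) ⊠ (A₂ ⊠ B₂)) (Y := (A₁ ⊠ A₂) ⊠ (B₁ ⊠ B₂))
      (prodProdProdComm _ _ _ _) ∘ₗ tensor F₁ F₂ ∘ₗ
    relabel (X := (r.tensor s).In) (Y := r.In ⊠ s.In) (tensorIn r s)

theorem chan_tensor (r s : Resource) : (r.tensor s).chan = tensorMap r.chan s.chan := rfl

/-- The resource relabels Alice's absolute input. -/
def IsWire (r : Resource) : Prop :=
  Subsingleton r.Arel ∧ Subsingleton r.S ∧ Subsingleton r.Aout ∧
    ∃ e : r.In ≃ r.Out, r.chan = relabel e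

theorem IsWire.tensor {r s : Resource} (hr : IsWire r) (hs : IsWire s) : IsWire (r.tensor s) := by
  obtain ⟨h1, h2, h3, e, he⟩ := hr
  obtain ⟨k1, k2, k3, f, hf⟩ := hs
  refine ⟨inferInstanceAs (Subsingleton (_ × _)), inferInstanceAs (Subsingleton (_ × _)),
    inferInstanceAs (Subsingleton (_ × _)), (tensorIn r s).trans ((e.prodCongr f).trans (prodProdProdComm _ _ _ _)), ?_⟩
  rw [chan_tensor, he, hf]
  rfl

theorem isWire_pow {r : Resource} (h : IsWire r) : ∀ q, IsWire (r.pow q)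
  | 0 => ⟨inferInstanceAs (Subsingleton Unit), inferInstanceAs (Subsingleton Unit),
      inferInstanceAs (Subsingleton Unit), _, rfl⟩
  | q + 1 => (isWire_pow h q).tensor h

theorem IsWire.sends {r : Resource} (h : IsWire r) : Sends r r.Aabs := by
  obtain ⟨h1, h2, h3, e, he⟩ := h
  let a₀ : r.Arel := Classical.arbitrary _
  let s₀ : r.S := Classical.arbitrary _
  let o₀ : r.Aout := Classical.arbitrary _
  refine ⟨h1, push (Y := r.Alice) fun a => (a, a₀), push fun b => (e.symm (o₀, b)).1.1,
    isChannel_push fun a b h => (Prod.mk.inj h).1, isChannel_push fun a b h => ?_, ?_⟩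
  · have : e.symm (o₀, a) = e.symm (o₀, b) :=
      Prod.ext (Prod.ext h (Subsingleton.elim _ _)) (Subsingleton.elim _ _)
    exact (Prod.mk.inj (e.symm.injective this)).2
  · rw [he, ptraceLeft_eq_push, append_eq_push r.isState_source s₀, ← push_equiv, push_comp,
      push_comp, push_comp, push_comp, ← push_id]
    refine congrArg push (funext fun a => ?_)
    have : (o₀, (e ((a, a₀), s₀)).2) = e ((a, a₀), s₀) := Prod.ext (Subsingleton.elim _ _) rfl
    simp only [Function.comp_apply, this, Equiv.symm_apply_apply]

theorem isWire_qubitChannel : IsWire qubitChannel :=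
  ⟨inferInstanceAs (Subsingleton Unit), inferInstanceAs (Subsingleton Unit),
    inferInstanceAs (Subsingleton Unit), _, rfl⟩

theorem card_qubitChannel_pow : ∀ q, Fintype.card (qubitChannel.pow q).Aabs = 2 ^ q
  | 0 => rfl
  | q + 1 => (Fintype.card_prod _ _).trans (by
      rw [card_qubitChannel_pow q, pow_succ]; rfl)

/-- The input is measured in the preferred basis, and the value `out x` is prepared. -/
def measure (out : X → Y) : SuperOp X Y :=
  ∑ x, conj (X := X) (Y := Y) (Matrix.single (out x) x (1 : ℂ))

theorem measure_single (out : X → Y) (x x' : X) :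
    measure out (Matrix.single x x' 1) =
      if x = x' then Matrix.single (out x) (out x) 1 else 0 := by
  rw [measure, LinearMap.sum_apply]
  simp only [conj_single_matrix, single_apply]
  by_cases hx : x = x'
  · subst hx
    rw [if_pos rfl, sum_eq_single x (fun b _ hb => by
      rw [if_neg fun h => hb h.1.symm, zero_smul]) (by simp)]
    simp
  · rw [if_neg hx, sum_eq_zero fun b _ => ?_]
    rw [if_neg fun h => hx (h.1.trans h.2.symm), zero_smul]

theorem relabel_single (e : X ≃ Y) (x x' : X) :
    relabel e (Matrix.single x x' 1) = Matrix.single (e x) (e x') 1 := by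
  rw [← push_equiv, push_single]

theorem relabel_measure {Z : QSys} (out : X → Y) (e : Y ≃ Z) :
    relabel e ∘ₗ measure out = measure fun x => e (out x) := superOp_ext fun x x' => by
  rw [comp_apply, measure_single, measure_single, apply_ite (relabel e), relabel_single,
    map_zero]

theorem measure_relabel {Z : QSys} (out : X → Y) (e : Z ≃ X) :
    measure out ∘ₗ relabel e = measure fun z => out (e z) := superOp_ext fun x x' => by
  rw [comp_apply, relabel_single, measure_single, measure_single]
  simp only [e.injective.eq_iff]

theorem tensor_measure {X' Y' : QSys} (f : X → Y) (g : X' → Y') :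
    tensor (measure f) (measure g) = measure (X := X ⊠ X') (Y := Y ⊠ Y') (Prod.map f g) := by
  refine superOp_ext fun p q => ?_
  have h : (Matrix.single p q (1 : ℂ) : Op (X ⊠ X'))
      = Matrix.single p.1 q.1 1 ⊗ₖ Matrix.single p.2 q.2 1 := by
    rw [single_kronecker_single]; simp
  rw [measure_single, h, tensor_kron, measure_single, measure_single]
  by_cases h1 : p.1 = q.1
  · by_cases h2 : p.2 = q.2
    · rw [if_pos h1, if_pos h2, if_pos (Prod.ext h1 h2), single_kronecker_single, one_mul]
      rfl
    · rw [if_neg h2, if_neg fun h => h2 (congrArg Prod.snd h), Matrix.kronecker_zero]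
  · rw [if_neg h1, if_neg fun h => h1 (congrArg Prod.fst h), Matrix.zero_kronecker]

def CbitLike.tensor {r s : Resource} (hr : CbitLike r) (hs : CbitLike s) : CbitLike (r.tensor s) where
  out p := (((hr.out ((p.1.1.1, p.1.2.1), p.2.1)).1, (hs.out ((p.1.1.2, p.1.2.2), p.2.2)).1),
    ((hr.out ((p.1.1.1, p.1.2.1), p.2.1)).2, (hs.out ((p.1.1.2, p.1.2.2), p.2.2)).2))
  chan_eq := by
    have h1 : r.chan = measure hr.out := hr.chan_eq
    have h2 : s.chan = measure hs.out := hs.chan_eq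
    change _ = measure _
    rw [chan_tensor, h1, h2, tensorMap, tensor_measure, measure_relabel]
    exact relabel_measure _ _
  abs := @instSubsingletonProd _ _ hr.abs hs.abs
  src := @instSubsingletonProd _ _ hr.src hs.src
  test := by
    change r.test ⊗ₖ s.test = (Fintype.card (r.Arel × s.Arel) : ℂ)⁻¹ • 1
    rw [hr.test, hs.test, Matrix.smul_kronecker, Matrix.kronecker_smul, smul_smul,
      Matrix.one_kronecker_one, Fintype.card_prod, Nat.cast_mul, mul_inv]

def cbitLikeTrivial : CbitLike Resource.trivial where
  out _ := ((), ())
  chan_eq := by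
    change _ = measure _
    refine superOp_ext fun x x' => (relabel_single _ _ _).trans (Eq.symm ((measure_single _ _ _).trans
      (if_pos (Subsingleton.elim (α := (Unit × Unit) × Unit) x x'))))
  abs := inferInstanceAs (Subsingleton Unit)
  src := inferInstanceAs (Subsingleton Unit)
  test := by
    change 1 = (Fintype.card Unit : ℂ)⁻¹ • 1
    rw [Fintype.card_unit, Nat.cast_one, inv_one, one_smul]
    rfl

def cbitLikeCbit : CbitLike cbitChannelRel where
  out p := ((), p.1.2)
  chan_eq := by
    change relabel (X := (QSys.unit ⊠ QSys.qubit) ⊠ QSys.unit) (Y := QSys.unit ⊠ QSys.qubit) _ ∘ₗ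
      measure (fun x => x) = measure _
    exact relabel_measure _ _
  abs := inferInstanceAs (Subsingleton Unit)
  src := inferInstanceAs (Subsingleton Unit)
  test := by
    change mixedQubit = (Fintype.card (Fin 2) : ℂ)⁻¹ • 1
    simp [mixedQubit]

def CbitLike.pow {r : Resource} (h : CbitLike r) : ∀ M, CbitLike (r.pow M)
  | 0 => cbitLikeTrivial
  | M + 1 => (h.pow M).tensor h

theorem card_cbitChannelRel_pow : ∀ M, Fintype.card (cbitChannelRel.pow M).In = 2 ^ M
  | 0 => rfl
  | M + 1 => by
    refine (Fintype.card_congr (tensorIn (cbitChannelRel.pow M) cbitChannelRel)).trans ?_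
    rw [Fintype.card_prod,
      card_cbitChannelRel_pow M, pow_succ]
    rfl

end Powers

/-! ### Dense coding -/

section DenseCoding

variable {X Y K : QSys}

/-- A permutation of the basis, followed by phases. -/
def monomial (e : X ≃ Y) (c : Y → ℂ) : Matrix Y X ℂ :=
  Matrix.of fun y x => if x = e.symm y then c y else 0

theorem conj_monomial (e : X ≃ Y) (c : Y → ℂ) (ρ : Op X)
    (y y' : Y) :
    conj (monomial e c) ρ y y' = c y * ρ (e.symm y) (e.symm y') * star (c y') := by
  rw [conj_apply, mul_apply, sum_eq_single (e.symm y'), mul_apply,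
    sum_eq_single (e.symm y)]
  · simp [monomial]
  · intro b _ hb; simp [monomial, hb]
  · simp
  · intro b _ hb; simp [monomial, hb]
  · simp

theorem monomial_isometry (e : X ≃ Y) {c : Y → ℂ}
    (hc : ∀ y, star (c y) * c y = 1) : (monomial e c)ᴴ * monomial e c = 1 := by
  ext x x'
  rw [mul_apply, sum_eq_single (e x)]
  · rw [one_apply]
    by_cases h : x = x'
    · subst h; simpa [monomial] using hc (e x)
    · simp [monomial, h, Ne.symm h]
  · intro b _ hb
    have : x ≠ e.symm b := fun h => hb (by rw [h, e.apply_symm_apply])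
    simp [monomial, this]
  · simp

variable (g : ℕ) [NeZero g]

/-- The system of dimension `g`. -/
abbrev cyclic : QSys := ⟨ZMod g⟩

variable {g} (κ : K → ZMod g × ZMod g)

/-- The shifts, controlled by the register `K`. -/
def ctrlShift : (K ⊠ cyclic g) ≃ (K ⊠ cyclic g) where
  toFun p := (p.1, p.2 + (κ p.1).1)
  invFun p := (p.1, p.2 - (κ p.1).1)
  left_inv p := by simp
  right_inv p := by simp

theorem star_stdAddChar (x : ZMod g) :
    star (ZMod.stdAddChar x) = ZMod.stdAddChar (-x) :=
  (AddChar.map_neg_eq_conj ZMod.stdAddChar x).symm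

theorem star_stdAddChar_mul (x : ZMod g) :
    star (ZMod.stdAddChar x) * ZMod.stdAddChar x = 1 := by
  rw [star_stdAddChar, ← AddChar.map_add_eq_mul]; simp

/-- The controlled Weyl operators. -/
def ctrlWeyl : Matrix (K ⊠ cyclic g) (K ⊠ cyclic g) ℂ :=
  monomial (ctrlShift κ) fun p => ZMod.stdAddChar ((κ p.1).2 * p.2)

/-- The Bell vectors. -/
def bellVec : Matrix (cyclic g ⊠ cyclic g) K ℂ :=
  Matrix.of fun p k => if p.1 - (κ k).1 = p.2 then
    ((√g : ℝ) : ℂ)⁻¹ * ZMod.stdAddChar ((κ k).2 * p.1) else 0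

theorem bellVec_isometry (hκ : Function.Injective κ) : (bellVec κ)ᴴ * bellVec κ = 1 := by
  have hg : ((√(g : ℝ) : ℝ) : ℂ)⁻¹ * ((√(g : ℝ) : ℝ) : ℂ)⁻¹ = (g : ℂ)⁻¹ := by
    rw [← mul_inv, ← Complex.ofReal_mul, Real.mul_self_sqrt (Nat.cast_nonneg g)]
    simp
  ext k k'
  rw [mul_apply]
  change ∑ p : ZMod g × ZMod g, star (bellVec κ p k) * bellVec κ p k' = _
  have h1 : ∀ z w : ZMod g, star (bellVec κ (z, w) k) * bellVec κ (z, w) k' =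
      if z - (κ k).1 = w then (if (κ k).1 = (κ k').1 then
        (g : ℂ)⁻¹ * ZMod.stdAddChar (z * ((κ k').2 - (κ k).2)) else 0) else 0 := fun z w => by
    simp only [bellVec, of_apply]
    by_cases h : z - (κ k).1 = w
    · rw [if_pos h, if_pos h]
      by_cases h2 : (κ k).1 = (κ k').1
      · rw [if_pos h2, if_pos (by rw [← h2, h]), star_mul']
        have h4 : star ((√(g : ℝ) : ℝ) : ℂ)⁻¹ = ((√(g : ℝ) : ℝ) : ℂ)⁻¹ := by simp
        rw [star_stdAddChar, h4, mul_mul_mul_comm, hg, ← AddChar.map_add_eq_mul]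
        congr 2
        ring
      · rw [if_neg h2, if_neg fun h3 => h2 ?_, mul_zero]
        rw [← h] at h3
        exact (sub_right_injective h3).symm
    · rw [if_neg h, if_neg h, star_zero, zero_mul]
  rw [sum_prod_type]
  simp only [h1, Finset.sum_ite_eq, Finset.mem_univ, if_true]
  by_cases h2 : (κ k).1 = (κ k').1
  · simp only [if_pos h2]
    rw [← mul_sum, AddChar.sum_mulShift _ (ZMod.isPrimitive_stdAddChar g), ZMod.card,
      one_apply]
    by_cases h3 : (κ k).2 = (κ k').2
    · rw [if_pos (by rw [h3, sub_self]), if_pos (hκ (Prod.ext h2 h3))]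
      exact inv_mul_cancel₀ (Nat.cast_ne_zero.2 (NeZero.ne g))
    · rw [if_neg fun h => h3 (sub_eq_zero.1 h).symm, if_neg fun h => h3 (by rw [h])]
      simp
  · simp only [if_neg h2, Finset.sum_const_zero]
    rw [one_apply, if_neg fun h => h2 (by rw [h])]

/-- The register is encoded into one half of the maximally entangled state. -/
def denseEncode : SuperOp K (K ⊠ (cyclic g ⊠ cyclic g)) :=
  relabel (X := (K ⊠ cyclic g) ⊠ cyclic g) (Y := K ⊠ (cyclic g ⊠ cyclic g))
    (prodAssoc _ _ _) ∘ₗ ext (conj (X := K ⊠ cyclic g) (ctrlWeyl κ)) (cyclic g) ∘ₗ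
    relabel (X := K ⊠ (cyclic g ⊠ cyclic g)) (Y := (K ⊠ cyclic g) ⊠ cyclic g)
      (prodAssoc _ _ _).symm ∘ₗ append (maxEntOp (cyclic g))

theorem denseEncode_eq : denseEncode κ =
    extL (conj (bellVec κ)) K ∘ₗ push (X := K) (Y := K ⊠ K) fun k => (k, k) := by
  refine LinearMap.ext fun M => Matrix.ext fun ⟨k, z, w⟩ ⟨k', z', w'⟩ => ?_
  have h : (Matrix.of fun y y' => push (X := K) (Y := K ⊠ K) (fun k => (k, k)) M (k, y) (k', y') :
      Op K) = M k k' • Matrix.single k k' 1 := by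
    ext y y'
    rw [of_apply, push_apply, sum_eq_single k, sum_eq_single k']
    · simp [single_apply, ite_and]
    · intro b _ hb; simp [hb]
    · simp
    · intro b _ hb; simp [hb]
    · simp
  change conj (X := K ⊠ cyclic g) (Y := K ⊠ cyclic g) (ctrlWeyl κ)
      (Matrix.of fun x x' => M x.1 x'.1 * maxEntOp (cyclic g) (x.2, w) (x'.2, w')) (k, z) (k', z') =
    conj (bellVec κ) (Matrix.of fun y y' => push (X := K) (Y := K ⊠ K) (fun k => (k, k)) M
      (k, y) (k', y')) (z, w) (z', w')
  rw [h, map_smul, ctrlWeyl, conj_monomial]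
  have hb : conj (bellVec κ) (Matrix.single k k' 1) (z, w) (z', w') =
      bellVec κ (z, w) k * star (bellVec κ (z', w') k') := by
    rw [conj_apply, mul_apply, sum_eq_single k', mul_apply,
      sum_eq_single k]
    · simp
    · intro b _ hb; simp [hb.symm]
    · simp
    · intro b _ hb; simp [mul_apply, hb.symm]
    · simp
  rw [Matrix.smul_apply, hb]
  have hg : ((√(g : ℝ) : ℝ) : ℂ)⁻¹ * ((√(g : ℝ) : ℝ) : ℂ)⁻¹ = (g : ℂ)⁻¹ := by
    rw [← mul_inv, ← Complex.ofReal_mul, Real.mul_self_sqrt (Nat.cast_nonneg g)]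
    simp
  have h4 : star ((√(g : ℝ) : ℝ) : ℂ)⁻¹ = ((√(g : ℝ) : ℝ) : ℂ)⁻¹ := by simp
  have hc : Fintype.card (cyclic g) = g := ZMod.card g
  simp only [bellVec, maxEntOp, of_apply, ctrlShift, Equiv.coe_fn_symm_mk, smul_eq_mul, hc]
  by_cases h1 : z - (κ k).1 = w
  · by_cases h2 : z' - (κ k').1 = w'
    · rw [if_pos ⟨h1, h2⟩, if_pos h1, if_pos h2, star_mul', h4, ← hg]
      ring
    · simp [h1, h2]
  · simp [h1]

theorem exists_bell (hκ : Function.Injective κ) :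
    ∃ Λ : SuperOp (cyclic g ⊠ cyclic g) K, IsChannel Λ ∧
      extL Λ K ∘ₗ denseEncode κ = push (X := K) (Y := K ⊠ K) fun k => (k, k) := by
  obtain ⟨Λ, hΛ, h⟩ := exists_leftInverse (bellVec_isometry κ hκ)
  refine ⟨Λ, hΛ, ?_⟩
  rw [denseEncode_eq, ← comp_assoc, ← extL_comp, h, extL_id, LinearMap.id_comp]

end DenseCoding

/-! ### Tensor products of resources -/

section TensorMap

variable {r s : Resource} {Y Z A₁ B₁ A₂ B₂ : QSys}

theorem Resource.trace_marginal (T : Resource) : TracePreserving T.marginal :=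
  (isChannel_ptraceLeft.ext _).tracePreserving

theorem Resource.Adm.tensor {ρ : Op (r.tensor s).In} (h : (r.tensor s).Adm ρ) :
    r.Adm (ptrace (relabel (Y := r.In ⊠ s.In) (tensorIn r s) ρ)) ∧
      s.Adm (ptraceLeft (relabel (Y := r.In ⊠ s.In) (tensorIn r s) ρ)) := by
  have hst : IsState (relabel (Y := r.In ⊠ s.In) (tensorIn r s) ρ) :=
    (isChannel_relabel _).isState h.1
  have h1 : QShannon.tensor r.marginal s.marginal (relabel (Y := r.In ⊠ s.In) (tensorIn r s) ρ) =
      (r.test ⊗ₖ r.source) ⊗ₖ (s.test ⊗ₖ s.source) := by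
    have h2 : QShannon.tensor r.marginal s.marginal
        (relabel (Y := r.In ⊠ s.In) (tensorIn r s) ρ) =
        relabel (X := (r.Arel ⊠ s.Arel) ⊠ (r.S ⊠ s.S)) (Y := (r.Arel ⊠ r.S) ⊠ (s.Arel ⊠ s.S))
        (prodProdProdComm _ _ _ _) ((r.tensor s).marginal ρ) := by
      refine Matrix.ext fun p q => ?_
      exact Finset.sum_comm.trans (sum_prod_type (f := fun z : r.Aabs ×
        s.Aabs => ρ ((z, (p.1.1, p.2.1)), (p.1.2, p.2.2))
          ((z, (q.1.1, q.2.1)), (q.1.2, q.2.2)))).symm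
    rw [h2, h.2]
    refine Matrix.ext fun p q => ?_
    exact mul_mul_mul_comm _ _ _ _
  refine ⟨⟨isChannel_ptrace.isState hst, ?_⟩, isChannel_ptraceLeft.isState hst, ?_⟩
  · rw [← ptrace_ext, ← ptrace_extL s.trace_marginal, ← comp_apply (extL _ _), ← tensor_eq,
      h1, ptrace_kron, (s.isState_test.kron s.isState_source).2, one_smul]
  · rw [← ptraceLeft_ext r.trace_marginal, ← ptraceLeft_extL, ← comp_apply (extL _ _),
      ← tensor_eq, h1, ptraceLeft_kron, (r.isState_test.kron r.isState_source).2, one_smul]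

theorem Near.tensor_left {ε : ℝ} {Φ Ψ : SuperOp r.In Y} (h : Near r ε Φ Ψ) {Θ : SuperOp s.In Z}
    (hΘ : IsChannel Θ) : Near (r.tensor s) ε
      (tensor Φ Θ ∘ₗ relabel (Y := r.In ⊠ s.In) (tensorIn r s))
      (tensor Ψ Θ ∘ₗ relabel (Y := r.In ⊠ s.In) (tensorIn r s)) := fun R ξ hξ => by
  let e : SuperOp ((r.tensor s).In ⊠ R) (r.In ⊠ (s.In ⊠ R)) :=
    relabel (X := (r.In ⊠ s.In) ⊠ R)
      ⟨fun p => (p.1.1, (p.1.2, p.2)), fun q => ((q.1, q.2.1), q.2.2), fun _ => rfl, fun _ => rfl⟩ ∘ₗ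
      ext (relabel (Y := r.In ⊠ s.In) (tensorIn r s)) R
  let e' : SuperOp (Y ⊠ (s.In ⊠ R)) ((Y ⊠ s.In) ⊠ R) := relabel
      ⟨fun q => ((q.1, q.2.1), q.2.2), fun p => (p.1.1, (p.1.2, p.2)), fun _ => rfl, fun _ => rfl⟩
  have h1 : r.IsExtension (e ξ) := by
    rw [Resource.isExtension_iff]
    have h2 := hξ.adm.tensor.1.2
    refine ⟨((isChannel_relabel _).comp ((isChannel_relabel _).ext _)).isState hξ.1, ?_⟩
    rw [← h2]
    refine congrArg _ (Matrix.ext fun p q => ?_)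
    exact sum_prod_type (f := fun z : s.In × R => e ξ (p, z) (q, z))
  have h3 : ∀ Φ : SuperOp r.In Y, ext (tensor Φ Θ ∘ₗ relabel (Y := r.In ⊠ s.In) (tensorIn r s)) R ξ
      = ext (extL Θ Y) R (e' (ext Φ (s.In ⊠ R) (e ξ))) := fun Φ => by
    rw [tensor_eq]
    rfl
  rw [h3, h3, ← map_sub, ← map_sub]
  have hc : IsChannel (ext (extL Θ Y) R ∘ₗ e') := ((hΘ.extL Y).ext R).comp (isChannel_relabel _)
  exact (traceNorm_channel_le hc _).trans (h _ _ h1)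

theorem Near.tensor_right {ε : ℝ} {Φ Ψ : SuperOp s.In Z} (h : Near s ε Φ Ψ) {Θ : SuperOp r.In Y}
    (hΘ : IsChannel Θ) : Near (r.tensor s) ε
      (tensor Θ Φ ∘ₗ relabel (Y := r.In ⊠ s.In) (tensorIn r s))
      (tensor Θ Ψ ∘ₗ relabel (Y := r.In ⊠ s.In) (tensorIn r s)) := fun R ξ hξ => by
  let e : SuperOp ((r.tensor s).In ⊠ R) (s.In ⊠ (r.In ⊠ R)) :=
    relabel (X := (r.In ⊠ s.In) ⊠ R)
      ⟨fun p => (p.1.2, (p.1.1, p.2)), fun q => ((q.2.1, q.1), q.2.2), fun _ => rfl, fun _ => rfl⟩ ∘ₗ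
      ext (relabel (Y := r.In ⊠ s.In) (tensorIn r s)) R
  let e' : SuperOp (Z ⊠ (r.In ⊠ R)) ((r.In ⊠ Z) ⊠ R) := relabel
      ⟨fun q => ((q.2.1, q.1), q.2.2), fun p => (p.1.2, (p.1.1, p.2)), fun _ => rfl, fun _ => rfl⟩
  have h1 : s.IsExtension (e ξ) := by
    rw [Resource.isExtension_iff]
    have h2 := hξ.adm.tensor.2.2
    refine ⟨((isChannel_relabel _).comp ((isChannel_relabel _).ext _)).isState hξ.1, ?_⟩
    rw [← h2]
    refine congrArg _ (Matrix.ext fun p q => ?_)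
    exact sum_prod_type (f := fun z : r.In × R => e ξ (p, z) (q, z))
  have h3 : ∀ Φ : SuperOp s.In Z, ext (tensor Θ Φ ∘ₗ relabel (Y := r.In ⊠ s.In) (tensorIn r s)) R ξ
      = ext (ext Θ Z) R (e' (ext Φ (r.In ⊠ R) (e ξ))) := fun Φ => by
    rw [tensor_eq, ← ext_comp_extL]
    rfl
  rw [h3, h3, ← map_sub, ← map_sub]
  exact (traceNorm_channel_le (((hΘ.ext _).ext _).comp (isChannel_relabel _)) _).trans (h _ _ h1)

variable {ι : Type} {N : ι → Resource} {η : ℝ} {l₁ l₂ : List ι}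

theorem Impl.tensorMap {F₁ : SuperOp r.In (A₁ ⊠ B₁)} {F₂ : SuperOp s.In (A₂ ⊠ B₂)}
    (h₁ : Impl N η l₁ r.source F₁ r.Adm) (h₂ : Impl N η l₂ s.source F₂ s.Adm) :
    Impl N η (l₁ ++ l₂) (r.tensor s).source (tensorMap F₁ F₂) (r.tensor s).Adm := by
  have h := (h₁.par h₂).pre_iso (isConj_relabel (X := (r.tensor s).Alice) (Y := r.Alice ⊠ s.Alice)
    (prodProdProdComm _ _ _ _))
  exact h.congr rfl fun ρ hρ => hρ.tensor

end TensorMap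

/-! ### Accumulation of shared entanglement -/

section Accumulate

variable {A A' Bo Bo' X G B B' K Z I I' : QSys} (U : SuperOp (K ⊠ Z) (K ⊠ Z))

/-- Alice encodes the register `K` into her half of a maximally entangled state. -/
def aliceStep : SuperOp (((A ⊠ (X ⊠ Z)) ⊠ G) ⊠ (A' ⊠ K))
    (((A ⊠ A') ⊠ (X ⊠ K)) ⊠ (G ⊠ Z)) :=
  relabel (X := (((A ⊠ A') ⊠ X) ⊠ G) ⊠ (K ⊠ Z))
      (Y := ((A ⊠ A') ⊠ (X ⊠ K)) ⊠ (G ⊠ Z))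
      ⟨fun p => ((p.1.1.1, (p.1.1.2, p.2.1)), (p.1.2, p.2.2)),
        fun q => (((q.1.1, q.1.2.1), q.2.1), (q.1.2.2, q.2.2)), fun _ => rfl, fun _ => rfl⟩ ∘ₗ
    extL U (((A ⊠ A') ⊠ X) ⊠ G) ∘ₗ
    relabel (X := ((A ⊠ (X ⊠ Z)) ⊠ G) ⊠ (A' ⊠ K))
      (Y := (((A ⊠ A') ⊠ X) ⊠ G) ⊠ (K ⊠ Z))
      ⟨fun p => ((((p.1.1.1, p.2.1), p.1.1.2.1), p.1.2), (p.2.2, p.1.1.2.2)),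
        fun q => (((q.1.1.1.1, (q.1.1.2, q.2.2)), q.1.2), (q.1.1.1.2, q.2.1)),
        fun _ => rfl, fun _ => rfl⟩

/-- Bob measures in the Bell basis and decodes. -/
def bobFinish (Λ : SuperOp (Z ⊠ Z) K) (D' : SuperOp (B' ⊠ K) (Bo' ⊠ K)) :
    SuperOp ((Bo ⊠ (X ⊠ Z)) ⊠ (B' ⊠ Z)) ((Bo ⊠ Bo') ⊠ (X ⊠ K)) :=
  relabel (X := (Bo ⊠ X) ⊠ (Bo' ⊠ K)) (Y := (Bo ⊠ Bo') ⊠ (X ⊠ K))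
      (prodProdProdComm _ _ _ _) ∘ₗ
    extL D' (Bo ⊠ X) ∘ₗ extL (extL Λ B') (Bo ⊠ X) ∘ₗ
    relabel (X := (Bo ⊠ (X ⊠ Z)) ⊠ (B' ⊠ Z))
      (Y := (Bo ⊠ X) ⊠ (B' ⊠ (Z ⊠ Z)))
      ⟨fun p => ((p.1.1, p.1.2.1), (p.2.1, (p.2.2, p.1.2.2))),
        fun q => ((q.1.1, (q.1.2, q.2.2.2)), (q.2.1, q.2.2.1)), fun _ => rfl, fun _ => rfl⟩

/-- Bob's decoding, by means of the decodings for the two parts. -/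
def bobStep (D : SuperOp (B ⊠ G) (Bo ⊠ (X ⊠ Z))) (Λ : SuperOp (Z ⊠ Z) K)
    (D' : SuperOp (B' ⊠ K) (Bo' ⊠ K)) :
    SuperOp ((B ⊠ B') ⊠ (G ⊠ Z)) ((Bo ⊠ Bo') ⊠ (X ⊠ K)) :=
  bobFinish Λ D' ∘ₗ ext D (B' ⊠ Z) ∘ₗ
    relabel (X := (B ⊠ B') ⊠ (G ⊠ Z)) (Y := (B ⊠ G) ⊠ (B' ⊠ Z))
      (prodProdProdComm _ _ _ _)

/-- The systems that take part in the decoding are put to the right. -/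
def decodeIn (A A' X B' K Z C : Type) :
    ((A × (X × Z)) × C) × ((A' × K) × B') ≃ ((((A × A') × X) × B') × (K × Z)) × C :=
  ⟨fun p => (((((p.1.1.1, p.2.1.1), p.1.1.2.1), p.2.2), (p.2.1.2, p.1.1.2.2)), p.1.2),
    fun q => (((q.1.1.1.1.1, (q.1.1.1.2, q.1.2.2)), q.2), ((q.1.1.1.1.2, q.1.2.1), q.1.1.2)),
    fun _ => rfl, fun _ => rfl⟩

/-- Alice's and Bob's systems are put in order. -/
def decodeOut (A A' X B' K Z C : Type) :
    ((((A × A') × X) × B') × (K × Z)) × C ≃ ((A × A') × (X × K)) × (C × (B' × Z)) :=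
  ⟨fun p => ((p.1.1.1.1, (p.1.1.1.2, p.1.2.1)), (p.2, (p.1.1.2, p.1.2.2))),
    fun q => ((((q.1.1, q.1.2.1), q.2.2.1), (q.1.2.2, q.2.2.2)), q.2.1), fun _ => rfl, fun _ => rfl⟩

/-- The dense coding, if the maximally entangled state has already been decoded. -/
def denseStep (Λ : SuperOp (Z ⊠ Z) K) (D' : SuperOp (B' ⊠ K) (Bo' ⊠ K)) :
    SuperOp (((A ⊠ (X ⊠ Z)) ⊠ (Bo ⊠ (X ⊠ Z))) ⊠ ((A' ⊠ K) ⊠ B'))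
      (((A ⊠ A') ⊠ (X ⊠ K)) ⊠ ((Bo ⊠ Bo') ⊠ (X ⊠ K))) :=
  extL (bobFinish Λ D') ((A ⊠ A') ⊠ (X ⊠ K)) ∘ₗ
    relabel (X := ((((A ⊠ A') ⊠ X) ⊠ B') ⊠ (K ⊠ Z)) ⊠ (Bo ⊠ (X ⊠ Z)))
      (Y := ((A ⊠ A') ⊠ (X ⊠ K)) ⊠ ((Bo ⊠ (X ⊠ Z)) ⊠ (B' ⊠ Z)))
      (decodeOut _ _ _ _ _ _ _) ∘ₗ
    ext (extL U (((A ⊠ A') ⊠ X) ⊠ B'))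
      (Bo ⊠ (X ⊠ Z)) ∘ₗ
    relabel (X := ((A ⊠ (X ⊠ Z)) ⊠ (Bo ⊠ (X ⊠ Z))) ⊠ ((A' ⊠ K) ⊠ B'))
      (Y := ((((A ⊠ A') ⊠ X) ⊠ B') ⊠ (K ⊠ Z)) ⊠ (Bo ⊠ (X ⊠ Z)))
      (decodeIn _ _ _ _ _ _ _)

theorem accumulate_eq (F : SuperOp I (((A ⊠ (X ⊠ Z)) ⊠ G) ⊠ B))
    (F' : SuperOp I' ((A' ⊠ K) ⊠ B')) (D : SuperOp (B ⊠ G) (Bo ⊠ (X ⊠ Z)))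
    (Λ : SuperOp (Z ⊠ Z) K) (D' : SuperOp (B' ⊠ K) (Bo' ⊠ K)) :
    extL (bobStep D Λ D') ((A ⊠ A') ⊠ (X ⊠ K)) ∘ₗ
      relabel (X := (((A ⊠ A') ⊠ (X ⊠ K)) ⊠ (G ⊠ Z)) ⊠ (B ⊠ B'))
        (Y := ((A ⊠ A') ⊠ (X ⊠ K)) ⊠ ((B ⊠ B') ⊠ (G ⊠ Z))) (moveBack _ _ _) ∘ₗ
      ext (aliceStep U) (B ⊠ B') ∘ₗ
      relabel (X := (((A ⊠ (X ⊠ Z)) ⊠ G) ⊠ B) ⊠ ((A' ⊠ K) ⊠ B'))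
        (Y := (((A ⊠ (X ⊠ Z)) ⊠ G) ⊠ (A' ⊠ K)) ⊠ (B ⊠ B'))
        (prodProdProdComm _ _ _ _) ∘ₗ tensor F F' =
    denseStep U Λ D' ∘ₗ tensor (extL D (A ⊠ (X ⊠ Z)) ∘ₗ
      relabel (X := ((A ⊠ (X ⊠ Z)) ⊠ G) ⊠ B) (Y := (A ⊠ (X ⊠ Z)) ⊠ (B ⊠ G))
        (moveBack _ _ _) ∘ₗ F) F' := by
  have h1 := ext_comp_extL (extL U (((A ⊠ A') ⊠ X) ⊠ B')) D
  have h2 := ext_comp_extL F F'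
  have h3 := ext_comp_extL (extL D (A ⊠ (X ⊠ Z)) ∘ₗ
      relabel (X := ((A ⊠ (X ⊠ Z)) ⊠ G) ⊠ B) (Y := (A ⊠ (X ⊠ Z)) ⊠ (B ⊠ G))
        (moveBack _ _ _) ∘ₗ F) F'
  rw [tensor_eq, tensor_eq, ← h2, ← h3]
  let W1 : SuperOp ((((A ⊠ (X ⊠ Z)) ⊠ G) ⊠ B) ⊠ ((A' ⊠ K) ⊠ B'))
      (((((A ⊠ A') ⊠ X) ⊠ B') ⊠ (K ⊠ Z)) ⊠ (B ⊠ G)) := relabel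
      ⟨fun p => (((((p.1.1.1.1, p.2.1.1), p.1.1.1.2.1), p.2.2), (p.2.1.2, p.1.1.1.2.2)),
          (p.1.2, p.1.1.2)),
        fun q => ((((q.1.1.1.1.1, (q.1.1.1.2, q.1.2.2)), q.2.2), q.2.1),
          ((q.1.1.1.1.2, q.1.2.1), q.1.1.2)), fun _ => rfl, fun _ => rfl⟩
  let W2 : SuperOp (((((A ⊠ A') ⊠ X) ⊠ B') ⊠ (K ⊠ Z)) ⊠ (Bo ⊠ (X ⊠ Z)))
      (((A ⊠ A') ⊠ (X ⊠ K)) ⊠ ((Bo ⊠ (X ⊠ Z)) ⊠ (B' ⊠ Z))) := relabel (decodeOut _ _ _ _ _ _ _)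
  let W3 : SuperOp (((A ⊠ (X ⊠ Z)) ⊠ (Bo ⊠ (X ⊠ Z))) ⊠ ((A' ⊠ K) ⊠ B'))
      (((((A ⊠ A') ⊠ X) ⊠ B') ⊠ (K ⊠ Z)) ⊠ (Bo ⊠ (X ⊠ Z))) := relabel (decodeIn _ _ _ _ _ _ _)
  have ha : extL (ext D (B' ⊠ Z) ∘ₗ relabel (X := (B ⊠ B') ⊠ (G ⊠ Z)) (Y := (B ⊠ G) ⊠ (B' ⊠ Z))
      (prodProdProdComm _ _ _ _)) ((A ⊠ A') ⊠ (X ⊠ K)) ∘ₗ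
      relabel (X := (((A ⊠ A') ⊠ (X ⊠ K)) ⊠ (G ⊠ Z)) ⊠ (B ⊠ B'))
        (Y := ((A ⊠ A') ⊠ (X ⊠ K)) ⊠ ((B ⊠ B') ⊠ (G ⊠ Z))) (moveBack _ _ _) ∘ₗ
      ext (aliceStep U) (B ⊠ B') ∘ₗ
      relabel (X := (((A ⊠ (X ⊠ Z)) ⊠ G) ⊠ B) ⊠ ((A' ⊠ K) ⊠ B'))
        (Y := (((A ⊠ (X ⊠ Z)) ⊠ G) ⊠ (A' ⊠ K)) ⊠ (B ⊠ B'))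
        (prodProdProdComm _ _ _ _) =
      W2 ∘ₗ extL D ((((A ⊠ A') ⊠ X) ⊠ B') ⊠ (K ⊠ Z)) ∘ₗ
        ext (extL U (((A ⊠ A') ⊠ X) ⊠ B')) (B ⊠ G) ∘ₗ W1 := rfl
  have hb : extL D ((((A ⊠ A') ⊠ X) ⊠ B') ⊠ (K ⊠ Z)) ∘ₗ W1 ∘ₗ ext F ((A' ⊠ K) ⊠ B') = W3 ∘ₗ
      ext (extL D (A ⊠ (X ⊠ Z)) ∘ₗ relabel (X := ((A ⊠ (X ⊠ Z)) ⊠ G) ⊠ B)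
        (Y := (A ⊠ (X ⊠ Z)) ⊠ (B ⊠ G)) (moveBack _ _ _) ∘ₗ F) ((A' ⊠ K) ⊠ B') := rfl
  have hd : denseStep U Λ D' = extL (bobFinish Λ D') ((A ⊠ A') ⊠ (X ⊠ K)) ∘ₗ W2 ∘ₗ
    ext (extL U (((A ⊠ A') ⊠ X) ⊠ B')) (Bo ⊠ (X ⊠ Z)) ∘ₗ W3 := rfl
  rw [hd]
  clear_value W1 W2 W3
  refine LinearMap.ext fun ρ => ?_
  have ha' := LinearMap.congr_fun ha (ext F ((A' ⊠ K) ⊠ B') (extL F' I ρ))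
  have h1' := LinearMap.congr_fun h1 (W1 (ext F ((A' ⊠ K) ⊠ B') (extL F' I ρ)))
  have hb' := LinearMap.congr_fun hb (extL F' I ρ)
  rw [bobStep, extL_comp]
  simp only [comp_apply] at ha' h1' hb' ⊢
  rw [ha', ← h1', hb']

end Accumulate

section Dense

variable {A A' Bo Bo' X Y G B B' K Z I I' : QSys}

theorem maxEntOp_prod (X Y : QSys) (p q : (X ⊠ Y) × (X ⊠ Y)) :
    maxEntOp (X ⊠ Y) p q = maxEntOp X (p.1.1, p.2.1) (q.1.1, q.2.1) *
      maxEntOp Y (p.1.2, p.2.2) (q.1.2, q.2.2) := by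
  obtain ⟨⟨a, b⟩, c, d⟩ := p
  obtain ⟨⟨a', b'⟩, c', d'⟩ := q
  have h : Fintype.card (X ⊠ Y) = Fintype.card X * Fintype.card Y :=
    Fintype.card_prod _ _
  simp only [maxEntOp, of_apply, Prod.mk.injEq, h, Nat.cast_mul, mul_inv]
  by_cases h1 : a = c <;> by_cases h2 : b = d <;> by_cases h3 : a' = c' <;>
    by_cases h4 : b' = d' <;> simp [h1, h2, h3, h4]

theorem entangle_relabel (e : X ≃ Y) :
    tensor (extL (relabel e) A) (extL (relabel e) B) ∘ₗ entangle A B X = entangle A B Y := by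
  refine LinearMap.ext fun M => Matrix.ext fun p q => ?_
  change M (p.1.1, p.2.1) (q.1.1, q.2.1) * maxEntOp X (e.symm p.1.2, e.symm p.2.2)
    (e.symm q.1.2, e.symm q.2.2) = M (p.1.1, p.2.1) (q.1.1, q.2.1) * maxEntOp Y (p.1.2, p.2.2)
    (q.1.2, q.2.2)
  simp only [maxEntOp, of_apply, e.symm.injective.eq_iff, Fintype.card_congr e]

/-- The parts of a maximally entangled state are joined with the other systems. -/
def joinPairs (A B X Z : Type) : ((A × X) × (B × X)) × (Z × Z) ≃ (A × (X × Z)) × (B × (X × Z)) :=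
  ⟨fun p => ((p.1.1.1, (p.1.1.2, p.2.1)), (p.1.2.1, (p.1.2.2, p.2.2))),
    fun q => (((q.1.1, q.1.2.1), (q.2.1, q.2.2.1)), (q.1.2.2, q.2.2.2)), fun _ => rfl, fun _ => rfl⟩

theorem entangle_prod : entangle A B (X ⊠ Y) =
    relabel (X := ((A ⊠ X) ⊠ (B ⊠ X)) ⊠ (Y ⊠ Y)) (Y := (A ⊠ (X ⊠ Y)) ⊠ (B ⊠ (X ⊠ Y)))
      (joinPairs _ _ _ _) ∘ₗ append (maxEntOp Y) ∘ₗ entangle A B X := by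
  refine LinearMap.ext fun M => Matrix.ext fun p q => ?_
  change M (p.1.1, p.2.1) (q.1.1, q.2.1) * maxEntOp (X ⊠ Y) (p.1.2, p.2.2) (q.1.2, q.2.2) =
    M (p.1.1, p.2.1) (q.1.1, q.2.1) * maxEntOp X (p.1.2.1, p.2.2.1) (q.1.2.1, q.2.2.1) *
      maxEntOp Y (p.1.2.2, p.2.2.2) (q.1.2.2, q.2.2.2)
  rw [maxEntOp_prod, mul_assoc]

/-- A register is coupled with the first part of a state. -/
def couple (U : SuperOp (K ⊠ Z) (K ⊠ Z)) (τ : Op (Z ⊠ Z)) : SuperOp K (K ⊠ (Z ⊠ Z)) :=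
  relabel (X := (K ⊠ Z) ⊠ Z) (Y := K ⊠ (Z ⊠ Z)) (prodAssoc _ _ _) ∘ₗ ext U Z ∘ₗ
    relabel (X := K ⊠ (Z ⊠ Z)) (Y := (K ⊠ Z) ⊠ Z) (prodAssoc _ _ _).symm ∘ₗ append τ

/-- Alice's and Bob's systems of two parts are put in order. -/
def joinOut (A A' B B' X K : Type) : ((A × X) × (B × X)) × ((A' × K) × (B' × K)) ≃
    ((A × A') × (X × K)) × ((B × B') × (X × K)) :=
  ⟨fun p => (((p.1.1.1, p.2.1.1), (p.1.1.2, p.2.1.2)), ((p.1.2.1, p.2.2.1), (p.1.2.2, p.2.2.2))),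
    fun q => (((q.1.1.1, q.1.2.1), (q.2.1.1, q.2.2.1)), ((q.1.1.2, q.1.2.2), (q.2.1.2, q.2.2.2))),
    fun _ => rfl, fun _ => rfl⟩

/-- As `joinOut`, before Bob's decoding. -/
def joinMid (A A' B B' X K C : Type) : ((A × X) × (B × X)) × ((A' × B') × (K × C)) ≃
    ((A × A') × (X × K)) × ((B × X) × (B' × C)) :=
  ⟨fun p => (((p.1.1.1, p.2.1.1), (p.1.1.2, p.2.2.1)), (p.1.2, (p.2.1.2, p.2.2.2))),
    fun q => (((q.1.1.1, q.1.2.1), q.2.1), ((q.1.1.2, q.2.2.1), (q.1.2.2, q.2.2.2))),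
    fun _ => rfl, fun _ => rfl⟩

theorem denseStep_append (U : SuperOp (K ⊠ Z) (K ⊠ Z)) (τ : Op (Z ⊠ Z)) (Λ : SuperOp (Z ⊠ Z) K)
    (D' : SuperOp (B' ⊠ K) (Bo' ⊠ K)) :
    denseStep (A := A) (A' := A') (Bo := Bo) (X := X) U Λ D' ∘ₗ
      ext (relabel (X := ((A ⊠ X) ⊠ (Bo ⊠ X)) ⊠ (Z ⊠ Z)) (Y := (A ⊠ (X ⊠ Z)) ⊠ (Bo ⊠ (X ⊠ Z)))
        (joinPairs _ _ _ _) ∘ₗ append τ) ((A' ⊠ K) ⊠ B') =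
    relabel (X := ((A ⊠ X) ⊠ (Bo ⊠ X)) ⊠ ((A' ⊠ K) ⊠ (Bo' ⊠ K)))
      (Y := ((A ⊠ A') ⊠ (X ⊠ K)) ⊠ ((Bo ⊠ Bo') ⊠ (X ⊠ K))) (joinOut _ _ _ _ _ _) ∘ₗ
    extL (extL D' (A' ⊠ K) ∘ₗ relabel (X := (A' ⊠ B') ⊠ (K ⊠ K)) (Y := (A' ⊠ K) ⊠ (B' ⊠ K))
      (prodProdProdComm _ _ _ _) ∘ₗ extL (extL Λ K ∘ₗ couple U τ) (A' ⊠ B') ∘ₗ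
      relabel (X := (A' ⊠ K) ⊠ B') (Y := (A' ⊠ B') ⊠ K) (swapRight _ _ _))
      ((A ⊠ X) ⊠ (Bo ⊠ X)) := by
  let T (C : QSys) : SuperOp (((A ⊠ X) ⊠ (Bo ⊠ X)) ⊠ ((A' ⊠ B') ⊠ (K ⊠ C)))
    (((A ⊠ A') ⊠ (X ⊠ K)) ⊠ ((Bo ⊠ X) ⊠ (B' ⊠ C))) := relabel (joinMid _ _ _ _ _ _ _)
  have h1 : extL (relabel (X := (Bo ⊠ (X ⊠ Z)) ⊠ (B' ⊠ Z)) (Y := (Bo ⊠ X) ⊠ (B' ⊠ (Z ⊠ Z)))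
      ⟨fun p => ((p.1.1, p.1.2.1), (p.2.1, (p.2.2, p.1.2.2))),
        fun q => ((q.1.1, (q.1.2, q.2.2.2)), (q.2.1, q.2.2.1)), fun _ => rfl, fun _ => rfl⟩)
        ((A ⊠ A') ⊠ (X ⊠ K)) ∘ₗ
      relabel (X := ((((A ⊠ A') ⊠ X) ⊠ B') ⊠ (K ⊠ Z)) ⊠ (Bo ⊠ (X ⊠ Z)))
        (Y := ((A ⊠ A') ⊠ (X ⊠ K)) ⊠ ((Bo ⊠ (X ⊠ Z)) ⊠ (B' ⊠ Z))) (decodeOut _ _ _ _ _ _ _) ∘ₗ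
      ext (extL U (((A ⊠ A') ⊠ X) ⊠ B')) (Bo ⊠ (X ⊠ Z)) ∘ₗ
      relabel (X := ((A ⊠ (X ⊠ Z)) ⊠ (Bo ⊠ (X ⊠ Z))) ⊠ ((A' ⊠ K) ⊠ B'))
        (Y := ((((A ⊠ A') ⊠ X) ⊠ B') ⊠ (K ⊠ Z)) ⊠ (Bo ⊠ (X ⊠ Z))) (decodeIn _ _ _ _ _ _ _) ∘ₗ
      ext (relabel (X := ((A ⊠ X) ⊠ (Bo ⊠ X)) ⊠ (Z ⊠ Z)) (Y := (A ⊠ (X ⊠ Z)) ⊠ (Bo ⊠ (X ⊠ Z)))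
        (joinPairs _ _ _ _) ∘ₗ append τ) ((A' ⊠ K) ⊠ B') =
    T (Z ⊠ Z) ∘ₗ extL (extL (couple U τ) (A' ⊠ B')) ((A ⊠ X) ⊠ (Bo ⊠ X)) ∘ₗ
      extL (relabel (X := (A' ⊠ K) ⊠ B') (Y := (A' ⊠ B') ⊠ K) (swapRight _ _ _))
        ((A ⊠ X) ⊠ (Bo ⊠ X)) := rfl
  have h2 : extL (extL (extL Λ B') (Bo ⊠ X)) ((A ⊠ A') ⊠ (X ⊠ K)) ∘ₗ T (Z ⊠ Z) =
    T K ∘ₗ extL (extL (extL Λ K) (A' ⊠ B')) ((A ⊠ X) ⊠ (Bo ⊠ X)) := rfl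
  have h3 : extL (relabel (X := (Bo ⊠ X) ⊠ (Bo' ⊠ K)) (Y := (Bo ⊠ Bo') ⊠ (X ⊠ K))
      (prodProdProdComm _ _ _ _)) ((A ⊠ A') ⊠ (X ⊠ K)) ∘ₗ
      extL (extL D' (Bo ⊠ X)) ((A ⊠ A') ⊠ (X ⊠ K)) ∘ₗ T K =
    relabel (X := ((A ⊠ X) ⊠ (Bo ⊠ X)) ⊠ ((A' ⊠ K) ⊠ (Bo' ⊠ K)))
      (Y := ((A ⊠ A') ⊠ (X ⊠ K)) ⊠ ((Bo ⊠ Bo') ⊠ (X ⊠ K))) (joinOut _ _ _ _ _ _) ∘ₗ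
    extL (extL D' (A' ⊠ K)) ((A ⊠ X) ⊠ (Bo ⊠ X)) ∘ₗ
    extL (relabel (X := (A' ⊠ B') ⊠ (K ⊠ K)) (Y := (A' ⊠ K) ⊠ (B' ⊠ K))
      (prodProdProdComm _ _ _ _)) ((A ⊠ X) ⊠ (Bo ⊠ X)) := rfl
  clear_value T
  rw [denseStep, bobFinish, extL_comp, extL_comp, extL_comp, extL_comp, extL_comp, extL_comp,
    extL_comp, extL_comp]
  refine LinearMap.ext fun ρ => ?_
  have h1' := LinearMap.congr_fun h1 ρ
  have h2' := fun x => LinearMap.congr_fun h2 x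
  have h3' := fun x => LinearMap.congr_fun h3 x
  simp only [comp_apply] at h1' h2' h3' ⊢
  rw [h1', h2', h3']

theorem copyOut_eq : copyOut A K B =
    relabel (X := (A ⊠ B) ⊠ (K ⊠ K)) (Y := (A ⊠ K) ⊠ (B ⊠ K)) (prodProdProdComm _ _ _ _) ∘ₗ
      extL (push (X := K) (Y := K ⊠ K) fun k => (k, k)) (A ⊠ B) ∘ₗ
      relabel (X := (A ⊠ K) ⊠ B) (Y := (A ⊠ B) ⊠ K) (swapRight _ _ _) := by
  rw [← push_equiv, ← push_equiv, extL_push, push_comp, push_comp]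
  rfl

theorem denseStep_entangle {U : SuperOp (K ⊠ Z) (K ⊠ Z)} {Λ : SuperOp (Z ⊠ Z) K}
    (h : extL Λ K ∘ₗ couple U (maxEntOp Z) = push (X := K) (Y := K ⊠ K) fun k => (k, k))
    (D' : SuperOp (B' ⊠ K) (Bo' ⊠ K)) (C : SuperOp I (A ⊠ Bo)) (F' : SuperOp I' ((A' ⊠ K) ⊠ B')) :
    denseStep U Λ D' ∘ₗ tensor (entangle A Bo (X ⊠ Z) ∘ₗ C) F' =
    relabel (X := ((A ⊠ X) ⊠ (Bo ⊠ X)) ⊠ ((A' ⊠ K) ⊠ (Bo' ⊠ K)))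
      (Y := ((A ⊠ A') ⊠ (X ⊠ K)) ⊠ ((Bo ⊠ Bo') ⊠ (X ⊠ K))) (joinOut _ _ _ _ _ _) ∘ₗ
    tensor (entangle A Bo X ∘ₗ C) (extL D' (A' ⊠ K) ∘ₗ copyOut A' K B' ∘ₗ F') := by
  have h1 := denseStep_append (A := A) (A' := A') (Bo := Bo) (X := X) U (maxEntOp Z) Λ D'
  rw [h] at h1
  rw [entangle_prod, copyOut_eq]
  refine LinearMap.ext fun ρ => ?_
  have h2 := LinearMap.congr_fun h1 (tensor (entangle A Bo X ∘ₗ C) F' ρ)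
  have h3 := LinearMap.congr_fun (ext_comp_extL (relabel (X := ((A ⊠ X) ⊠ (Bo ⊠ X)) ⊠ (Z ⊠ Z))
    (Y := (A ⊠ (X ⊠ Z)) ⊠ (Bo ⊠ (X ⊠ Z))) (joinPairs _ _ _ _) ∘ₗ append (maxEntOp Z)) F')
    (ext (entangle A Bo X ∘ₗ C) I' ρ)
  refine Eq.trans ?_ (h2.trans ?_)
  · refine congrArg (denseStep U Λ D') (Eq.trans ?_ h3.symm)
    rfl
  · rw [tensor_eq, tensor_eq]
    rfl

theorem joinOut_entangle (C : SuperOp I (A ⊠ Bo)) (C' : SuperOp I' (A' ⊠ Bo')) :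
    relabel (X := ((A ⊠ X) ⊠ (Bo ⊠ X)) ⊠ ((A' ⊠ K) ⊠ (Bo' ⊠ K)))
      (Y := ((A ⊠ A') ⊠ (X ⊠ K)) ⊠ ((Bo ⊠ Bo') ⊠ (X ⊠ K))) (joinOut _ _ _ _ _ _) ∘ₗ
    tensor (entangle A Bo X ∘ₗ C) (entangle A' Bo' K ∘ₗ C') =
    entangle (A ⊠ A') (Bo ⊠ Bo') (X ⊠ K) ∘ₗ
      relabel (X := (A ⊠ Bo) ⊠ (A' ⊠ Bo')) (Y := (A ⊠ A') ⊠ (Bo ⊠ Bo'))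
        (prodProdProdComm _ _ _ _) ∘ₗ tensor C C' := by
  rw [tensor_comp]
  refine LinearMap.ext fun ρ => Matrix.ext fun p q => ?_
  refine Eq.trans ?_ ((congrArg (fun t => tensor C C' ρ ((p.1.1.1, p.2.1.1), (p.1.1.2, p.2.1.2))
    ((q.1.1.1, q.2.1.1), (q.1.1.2, q.2.1.2)) * t) (maxEntOp_prod X K (p.1.2, p.2.2)
      (q.1.2, q.2.2))).trans (mul_assoc _ _ _).symm).symm
  rfl

end Dense

section Shared

variable {ι : Type} {N : ι → Resource} {η : ℝ} {l l' : List ι} {r t T : Resource}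

/-- A program for `T` that also creates a maximally entangled state of rank `2 ^ e`, once `s` qubits
have been sent to Bob. -/
def SharesEnt (N : ι → Resource) (η : ℝ) (l : List ι) (T : Resource) (e s : ℕ) (ε : ℝ) : Prop :=
  ∃ (X G B : QSys) (F : SuperOp T.In (((T.Aout ⊠ X) ⊠ G) ⊠ B))
    (D : SuperOp (B ⊠ G) (T.Bout ⊠ X)), Fintype.card X = 2 ^ e ∧
    Fintype.card G = 2 ^ s ∧ IsChannel D ∧ Impl N η l T.source F T.Adm ∧
    Near T ε (extL D (T.Aout ⊠ X) ∘ₗ relabel (X := ((T.Aout ⊠ X) ⊠ G) ⊠ B)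
      (Y := (T.Aout ⊠ X) ⊠ (B ⊠ G)) (moveBack _ _ _) ∘ₗ F) (entangle T.Aout T.Bout X ∘ₗ T.chan)

/-- A program for `T` that also creates a maximally entangled state of rank `2 ^ b`, once a register
has been copied to Bob. -/
def CoherentBlock (N : ι → Resource) (η : ℝ) (l : List ι) (T : Resource) (b : ℕ) (ε : ℝ) : Prop :=
  ∃ (K B : QSys) (F : SuperOp T.In ((T.Aout ⊠ K) ⊠ B)) (D : SuperOp (B ⊠ K) (T.Bout ⊠ K)),
    Fintype.card K = 2 ^ b ∧ IsChannel D ∧ Impl N η l T.source F T.Adm ∧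
    Near T ε (extL D (T.Aout ⊠ K) ∘ₗ copyOut T.Aout K B ∘ₗ F)
      (entangle T.Aout T.Bout K ∘ₗ T.chan)

theorem isChannel_bobFinish {Bo Bo' X B' K Z : QSys} {Λ : SuperOp (Z ⊠ Z) K}
    (hΛ : IsChannel Λ) {D' : SuperOp (B' ⊠ K) (Bo' ⊠ K)} (hD' : IsChannel D') :
    IsChannel (bobFinish (Bo := Bo) (X := X) Λ D') :=
  (isChannel_relabel _).comp ((hD'.extL _).comp (((hΛ.extL _).extL _).comp (isChannel_relabel _)))

theorem isChannel_denseStep {A A' Bo Bo' X B' K Z : QSys} {U : SuperOp (K ⊠ Z) (K ⊠ Z)}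
    (hU : IsChannel U) {Λ : SuperOp (Z ⊠ Z) K}
    (hΛ : IsChannel Λ) {D' : SuperOp (B' ⊠ K) (Bo' ⊠ K)} (hD' : IsChannel D') :
    IsChannel (denseStep (A := A) (A' := A') (Bo := Bo) (X := X) U Λ D') :=
  ((isChannel_bobFinish hΛ hD').extL _).comp ((isChannel_relabel _).comp
    (((hU.extL _).ext _).comp (isChannel_relabel _)))

theorem sharesEnt_trivial (h : ℕ) : SharesEnt N η [] Resource.trivial h h 0 := by
  let Z : QSys := ⟨Fin (2 ^ h)⟩
  let Φ : SuperOp (QSys.unit ⊠ QSys.unit) ((QSys.unit ⊠ Z) ⊠ Z) :=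
    relabel (X := (QSys.unit ⊠ QSys.unit) ⊠ (Z ⊠ Z)) (Y := (QSys.unit ⊠ Z) ⊠ Z)
      ⟨fun p => ((p.1.1, p.2.1), p.2.2), fun q => ((q.1.1, ()), (q.1.2, q.2)), fun _ => rfl,
        fun _ => rfl⟩ ∘ₗ append (maxEntOp Z)
  have hΦ : IsChannel Φ := (isChannel_relabel _).comp (isChannel_append (isState_maxEntOp Z))
  refine ⟨Z, Z, QSys.unit, ext Φ QSys.unit, LinearMap.id, Fintype.card_fin _, Fintype.card_fin _,
    isChannel_id, Impl.nil hΦ _, ?_⟩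
  exact Near.refl le_rfl _

theorem SharesEnt.relabel {e s : ℕ} {ε : ℝ} (h : SharesEnt N η l T e s ε) {X₁ : QSys}
    (hX : Fintype.card X₁ = 2 ^ e) :
    ∃ (G B : QSys) (F : SuperOp T.In (((T.Aout ⊠ X₁) ⊠ G) ⊠ B))
    (D : SuperOp (B ⊠ G) (T.Bout ⊠ X₁)),
    Fintype.card G = 2 ^ s ∧ IsChannel D ∧ Impl N η l T.source F T.Adm ∧
    Near T ε (extL D (T.Aout ⊠ X₁) ∘ₗ QShannon.relabel (X := ((T.Aout ⊠ X₁) ⊠ G) ⊠ B)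
      (Y := (T.Aout ⊠ X₁) ⊠ (B ⊠ G)) (moveBack _ _ _) ∘ₗ F)
      (entangle T.Aout T.Bout X₁ ∘ₗ T.chan) := by
  obtain ⟨X, G, B, F, D, hX', hG, hD, hI, hN⟩ := h
  let eX : X ≃ X₁ := Fintype.equivOfCardEq (hX'.trans hX.symm)
  have hr : IsChannel (QShannon.relabel eX) := isChannel_relabel eX
  refine ⟨G, B, _, extL (QShannon.relabel eX) T.Bout ∘ₗ D, hG, (hr.extL _).comp hD,
    hI.post ((hr.extL T.Aout).ext G) isChannel_id, ?_⟩
  have h1 := hN.comp ((hr.extL T.Aout).tensor (hr.extL T.Bout))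
  refine (congrArg₂ (fun a b => Near T ε a b) ?_
    (congrArg (· ∘ₗ T.chan) (entangle_relabel eX))).mp h1
  have h2 := ext_comp_extL (extL (QShannon.relabel eX) T.Aout) D
  rw [tensor_eq, extL_comp]
  refine LinearMap.ext fun ρ => ?_
  exact congrArg (extL (extL (QShannon.relabel eX) T.Bout) (T.Aout ⊠ X₁))
    (LinearMap.congr_fun h2 _)

theorem exists_dense_coding (K : QSys) {g : ℕ} [NeZero g] (hK : Fintype.card K ≤ g * g) :
    ∃ (Z : QSys) (U : SuperOp (K ⊠ Z) (K ⊠ Z)) (Λ : SuperOp (Z ⊠ Z) K),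
      Fintype.card Z = g ∧ IsChannel U ∧ IsChannel Λ ∧
      extL Λ K ∘ₗ couple U (maxEntOp Z) = push (X := K) (Y := K ⊠ K) fun k => (k, k) := by
  obtain ⟨κ⟩ := Function.Embedding.nonempty_of_card_le (α := K)
    (β := ZMod g × ZMod g) (by rwa [Fintype.card_prod, ZMod.card])
  obtain ⟨Λ, hΛ, hbell⟩ := exists_bell κ κ.injective
  exact ⟨cyclic g, _, Λ, ZMod.card g, isChannel_conj _
    (monomial_isometry _ fun p => star_stdAddChar_mul ((κ p.1).2 * p.2)), hΛ, hbell⟩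

set_option maxRecDepth 8000 in
theorem SharesEnt.step {e s b h : ℕ} {ε ε' : ℝ} (h₁ : SharesEnt N η l r e s ε)
    (h₂ : CoherentBlock N η l' t b ε') (he : h ≤ e) (hb : b ≤ 2 * h) :
    SharesEnt N η (l ++ l') (r.tensor t) (e - h + b) (s + h) (ε + ε') := by
  obtain ⟨X, hX⟩ : ∃ X : QSys, Fintype.card X = 2 ^ (e - h) :=
    ⟨⟨Fin (2 ^ (e - h))⟩, Fintype.card_fin _⟩
  obtain ⟨K, B', F', D', hK, hD', hI', hN'⟩ := h₂
  obtain ⟨Z, U, Λ, hZ, hU, hΛ, hbell⟩ := exists_dense_coding K (g := 2 ^ h) (by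
    rw [hK, ← pow_add]
    exact Nat.pow_le_pow_right two_pos (by omega))
  obtain ⟨G, B, F, D, hG, hD, hI, hN⟩ := h₁.relabel (X₁ := X ⊠ Z) (by
    refine (Fintype.card_prod _ _).trans ?_
    rw [hX, hZ, ← pow_add, Nat.sub_add_cancel he])
  have hA : IsChannel (aliceStep (A := r.Aout) (A' := t.Aout) (X := X) (G := G) U) :=
    (isChannel_relabel _).comp ((hU.extL _).comp (isChannel_relabel _))
  refine ⟨X ⊠ K, G ⊠ Z, B ⊠ B', _, bobStep D Λ D', ?_, ?_, ?_,
    (hI.tensorMap hI').post hA isChannel_id, ?_⟩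
  · refine (Fintype.card_prod _ _).trans ?_
    rw [hX, hK, ← pow_add]
  · refine (Fintype.card_prod _ _).trans ?_
    rw [hG, hZ, ← pow_add]
  · exact (isChannel_bobFinish hΛ hD').comp
      ((hD.ext _).comp (isChannel_relabel _))
  · have h1 := (hN.tensor_left hI'.isChannel).comp
      (isChannel_denseStep (A := r.Aout) (A' := t.Aout) hU hΛ hD')
    have h2 := (hN'.tensor_right (r := r) ((isChannel_entangle r.Aout r.Bout X).comp
      r.isChannel)).comp (isChannel_relabel (X := ((r.Aout ⊠ X) ⊠ (r.Bout ⊠ X)) ⊠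
        ((t.Aout ⊠ K) ⊠ (t.Bout ⊠ K))) (Y := ((r.Aout ⊠ t.Aout) ⊠ (X ⊠ K)) ⊠
        ((r.Bout ⊠ t.Bout) ⊠ (X ⊠ K))) (joinOut _ _ _ _ _ _))
    rw [← comp_assoc, ← comp_assoc _ _ (denseStep _ _ _), ← accumulate_eq,
      denseStep_entangle hbell] at h1
    have e₃ := congrArg (· ∘ₗ QShannon.relabel (Y := r.In ⊠ t.In) (tensorIn r t))
      (joinOut_entangle (X := X) (K := K) r.chan t.chan)
    have h2' := (congrArg (fun b => Near (r.tensor t) ε' _ b) e₃).mp h2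
    exact h1.trans h2'

end Shared

section Realizes

variable {ι : Type} {N : ι → Resource} {η : ℝ} {l l' : List ι} {r t T : Resource}

theorem SharesEnt.blocks {b h : ℕ} {ε : ℝ} {l : ℕ → List ι} (hh : h ≤ b) (hb : b ≤ 2 * h) :
    ∀ m : ℕ, (∀ i < m, CoherentBlock N η (l i) T b ε) →
      SharesEnt N η ((List.range m).flatMap l) (T.pow m) (h + m * (b - h)) (h * (m + 1)) (m * ε)
  | 0, _ => by
    have h1 := sharesEnt_trivial (N := N) (η := η) h
    rw [zero_mul, add_zero, zero_add, mul_one, Nat.cast_zero, zero_mul]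
    exact h1
  | m + 1, hl => by
    have h1 := (SharesEnt.blocks hh hb m fun i hi => hl i (hi.trans m.lt_succ_self)).step
      (hl m m.lt_succ_self) (Nat.le_add_right _ _) hb
    rw [List.range_succ, List.flatMap_append, List.flatMap_singleton]
    have e1 : h + m * (b - h) - h + b = h + (m + 1) * (b - h) := by
      rw [Nat.add_sub_cancel_left, add_mul, one_mul]; omega
    have e2 : (m * ε + ε : ℝ) = ((m + 1 : ℕ) : ℝ) * ε := by push_cast; ring
    rw [e1, e2] at h1
    exact h1

/-- The resource `T` together with a maximally entangled state of `X`. -/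
def Resource.withEnt (T : Resource) (X : QSys) : Resource where
  Aabs := T.Aabs
  Arel := T.Arel
  S := T.S
  Aout := T.Aout ⊠ X
  Bout := T.Bout ⊠ X
  chan := entangle T.Aout T.Bout X ∘ₗ T.chan
  isChannel := (isChannel_entangle _ _ _).comp T.isChannel
  test := T.test
  isState_test := T.isState_test
  source := T.source
  isState_source := T.isState_source

/-- The resources listed in `l` can be used to simulate `T` with error `ε`. -/
def Realizes (N : ι → Resource) (η : ℝ) (l : List ι) (T : Resource) (ε : ℝ) : Prop :=
  ∃ F : SuperOp T.In T.Out, Impl N η l T.source F T.Adm ∧ Near T ε F T.chan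

theorem card_sysList_const (Q : QSys) : ∀ l : List ι,
    Fintype.card (sysList (fun _ : ι => Q) l) = Fintype.card Q ^ l.length
  | [] => rfl
  | _ :: l => by
    refine (Fintype.card_prod _ _).trans ?_
    rw [card_sysList_const Q l, List.length_cons, pow_succ, mul_comm]

theorem SharesEnt.realizes {e s q : ℕ} {ε : ℝ} (h : SharesEnt N η l T e s ε) (hη : 0 ≤ η)
    {Q : QSys} (hQ : Fintype.card Q = 2 ^ q) {js : List ι} (hj : ∀ j ∈ js, Sends (N j) Q)
    (hs : s ≤ q * js.length) :
    ∃ X : QSys, Fintype.card X = 2 ^ e ∧ Realizes N η (l ++ js) (T.withEnt X) ε := by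
  obtain ⟨X, G, B, F, D, hX, hG, hD, hI, hN⟩ := h
  have h1 := (hI.transmit hη hj (by
    rw [hG, card_sysList_const, hQ, ← pow_mul]
    exact Nat.pow_le_pow_right two_pos hs)).post isChannel_id hD
  refine ⟨X, hX, _, h1.mono fun ρ hρ => ⟨hρ, hρ.1.2⟩, ?_⟩
  rw [tensor_id_left]
  exact hN

end Realizes

section Slice

variable {X Y S : QSys}

/-- The partial expectation with respect to a vector of the right factor. -/
def slice (v : S → ℂ) (M : Op (X ⊠ S)) : Op X :=
  ∑ s, ∑ s', (v s * star (v s')) • Matrix.of fun x x' => M (x, s) (x', s')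

theorem slice_ext (Φ : SuperOp X Y) (v : S → ℂ) (M : Op (X ⊠ S)) :
    slice v (ext Φ S M) = Φ (slice v M) := by
  simp only [slice, map_sum, map_smul]
  rfl

theorem slice_kronecker (v : S → ℂ) (ω : Op X) (σ : Op S) :
    slice v (ω ⊗ₖ σ : Op (X ⊠ S)) = (∑ s, ∑ s', v s * star (v s') * σ s s') • ω := by
  ext x x'
  simp only [slice, Matrix.sum_apply, Matrix.smul_apply, of_apply,
    kroneckerMap_apply, smul_eq_mul, sum_mul]
  exact sum_congr rfl fun _ _ => sum_congr rfl fun _ _ => by ring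

theorem slice_posSemidef (v : S → ℂ) {M : Op (X ⊠ S)} (hM : M.PosSemidef) :
    (slice v M).PosSemidef := by
  let V : Matrix X (X ⊠ S) ℂ :=
    Matrix.of fun x p => if x = p.1 then v p.2 else 0
  have h : slice v M = V * M * Vᴴ := by
    ext x x'
    have h1 : ∀ q : (X ⊠ S), (V * M) x q = ∑ s, v s * M (x, s) q := fun q => by
      simp [V, mul_apply, sum_prod_type, ite_mul, Finset.sum_ite_eq]
    have h2 : ∀ f : (X ⊠ S) → ℂ, ∑ q, f q * star (V x' q) = ∑ s, f (x', s) * star (v s) := by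
      intro f
      simp [V, sum_prod_type, apply_ite (starRingEnd ℂ), Finset.sum_ite_eq]
    rw [mul_apply]
    simp only [conjTranspose_apply]
    rw [h2]
    simp only [h1, slice, Matrix.sum_apply, Matrix.smul_apply, of_apply, smul_eq_mul]
    rw [sum_comm]
    refine sum_congr rfl fun s _ => ?_
    rw [sum_mul]
    exact sum_congr rfl fun s' _ => by ring
  rw [h]
  exact hM.mul_mul_conjTranspose_same V

theorem eq_zero_of_slice {M : Op (X ⊠ S)} (h : ∀ v, slice v M = 0) : M = 0 := by
  refine Matrix.ext fun p q => ?_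
  obtain ⟨x, s⟩ := p
  obtain ⟨x', s'⟩ := q
  let m : Matrix S S ℂ := Matrix.of fun s s' => M (x, s) (x', s')
  have hm : ∀ v : S → ℂ, v ⬝ᵥ (m *ᵥ star v) = 0 := fun v => by
    have h1 := congrFun (congrFun (h v) x) x'
    simp only [slice, Matrix.sum_apply, Matrix.smul_apply, of_apply, smul_eq_mul,
      Matrix.zero_apply] at h1
    rw [← h1]
    simp only [dotProduct, Matrix.mulVec, m, of_apply, mul_sum, Pi.star_apply]
    exact sum_congr rfl fun _ _ => sum_congr rfl fun _ _ => by ring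
  have hz : ∀ z : ℂ, star z * m s s' + z * m s' s = 0 := fun z => by
    have e : ∀ (a b : S) (u w : ℂ),
        Pi.single a u ⬝ᵥ (m *ᵥ Pi.single b w) = u * w * m a b := fun a b u w => by
      rw [single_dotProduct, Matrix.mulVec_single]
      simp [Matrix.col_apply]; ring
    have h0 := hm (Pi.single s 1 + Pi.single s' z)
    have h1 := hm (Pi.single s 1)
    have h2 := hm (Pi.single s' z)
    simp only [star_add, Matrix.mulVec_add, dotProduct_add, add_dotProduct, ← Pi.single_star,
      e] at h0 h1 h2
    rw [h1, h2, zero_add, add_zero] at h0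
    rw [← h0, star_one]; ring
  have h1 := hz 1
  have h2 := hz Complex.I
  rw [star_one] at h1
  have h3 : star Complex.I = -Complex.I := Complex.conj_I
  rw [h3] at h2
  have h4 : m s s' = m s' s := by
    refine mul_left_cancel₀ Complex.I_ne_zero ?_
    linear_combination -h2
  have h5 : m s s' = 0 := by linear_combination (1 / 2 : ℂ) * h1 + (1 / 2 : ℂ) * h4
  exact h5

theorem ext_eq_kronecker_of_forall_state {E : QSys} {Φ : SuperOp X Y} {Θ : SuperOp X E} {ω : Op Y} {ω' : Op E}
    (hΘ : IsChannel Θ) (hω : ω'.trace = 1)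
    (h : ∀ ξ : Op X, IsState ξ → Θ ξ = ω' → Φ ξ = ω) {ρ : Op (X ⊠ S)} (hρ : ρ.PosSemidef)
    {σ : Op S} (hm : ext Θ S ρ = ω' ⊗ₖ σ) : ext Φ S ρ = ω ⊗ₖ σ := by
  refine sub_eq_zero.mp (eq_zero_of_slice fun v => ?_)
  have hsub : ∀ a b : Op (Y ⊠ S), slice v (a - b) = slice v a - slice v b := fun a b => by
    ext x x'
    simp only [slice, Matrix.sum_apply, Matrix.smul_apply, of_apply, Matrix.sub_apply,
      smul_eq_mul, mul_sub, Finset.sum_sub_distrib]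
  have h0 := slice_posSemidef v hρ
  have h1 := congrArg (slice v) hm
  rw [slice_ext, slice_kronecker] at h1
  rw [hsub, slice_ext, slice_kronecker]
  generalize slice v ρ = M at h0 h1 ⊢
  generalize (∑ s, ∑ s', v s * star (v s') * σ s s') = c at h1 ⊢
  have hc : M.trace = c := by
    rw [← hΘ.tracePreserving M, h1, trace_smul, hω, smul_eq_mul, mul_one]
  rcases eq_or_ne c 0 with rfl | hc0
  · rw [h0.trace_eq_zero_iff.mp hc, map_zero, zero_smul, sub_zero]
  · have h2 : 0 ≤ c⁻¹ := inv_nonneg.mpr (hc ▸ h0.trace_nonneg)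
    have h3 := h (c⁻¹ • M) ⟨h0.smul h2, by
      rw [trace_smul, hc, smul_eq_mul, inv_mul_cancel₀ hc0]⟩ (by
      rw [map_smul, h1, smul_smul, inv_mul_cancel₀ hc0, one_smul])
    rw [← h3, map_smul, smul_smul, mul_inv_cancel₀ hc0, one_smul, sub_self]

end Slice

theorem Resource.Adm.reduces {T T' : Resource} {EA : SuperOp T'.Alice T.Alice}
    (hEA : IsChannel EA) (c : SourceSplit T.source T'.source)
    (hm : ∀ ξ : Op T'.Alice, IsState ξ → ptraceLeft ξ = T'.test → ptraceLeft (EA ξ) = T.test)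
    {ρ : Op T'.In} (hρ : T'.Adm ρ) : T.Adm (QShannon.tensor EA c.embed ρ) := by
  have hc : IsChannel c.embed := (isChannel_relabel _).comp (isChannel_append c.isState)
  refine ⟨(hEA.tensor hc).isState hρ.1, ?_⟩
  have h1 := ext_eq_kronecker_of_forall_state (Φ := ptraceLeft ∘ₗ EA) isChannel_ptraceLeft
    T'.isState_test.2 hm hρ.1.1 hρ.2
  have h2 : T.marginal (QShannon.tensor EA c.embed ρ) =
      extL c.embed T.Arel (ext (ptraceLeft ∘ₗ EA) T'.S ρ) := by
    rw [tensor_eq, Resource.marginal, ext_comp]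
    exact LinearMap.congr_fun (ext_comp_extL ptraceLeft c.embed) _
  rw [h2, h1, extL_kron]
  exact congrArg _ c.eq

theorem Realizes.reduces {ι : Type} {N : ι → Resource} {η ε : ℝ} {l : List ι} {T T' : Resource}
    (h : Realizes N η l T ε) (hT : T.Reduces T') : Realizes N η l T' ε := by
  obtain ⟨F, hI, hN⟩ := h
  obtain ⟨EA, c, DA, DB, hEA, hDA, hDB, hm, hch⟩ := hT
  have hc : IsChannel c.embed := (isChannel_relabel _).comp (isChannel_append c.isState)
  refine ⟨_, (((hI.source ⟨c, rfl⟩).pre hEA).post hDA hDB).mono fun ρ hρ => ?_, ?_⟩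
  · have := hρ.reduces hEA c hm
    rwa [tensor_eq] at this
  · have h1 : Near T' ε (F ∘ₗ tensor EA c.embed) (T.chan ∘ₗ tensor EA c.embed) := fun R ξ hξ => by
      rw [ext_comp, ext_comp]
      refine hN R _ ?_
      rw [Resource.isExtension_iff]
      refine ⟨((hEA.tensor hc).ext R).isState hξ.1, ?_⟩
      rw [ptrace_ext]
      exact (hξ.adm.reduces hEA c hm).2
    rw [hch]
    exact h1.comp (hDA.tensor hDB)

theorem Realizes.exists_protocol {ι : Type} [Fintype ι] [DecidableEq ι] {N : ι → Resource}
    {η ε : ℝ} {l : List ι} {T : Resource} (h : Realizes N η l T ε) (hη : 0 ≤ η) (hl : l.Nodup) :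
    ∃ P : Protocol N T, P.Valid η ∧ P.Close ε := by
  obtain ⟨F, hI, hN⟩ := h
  obtain ⟨P, hP, rfl⟩ := hI.exists_protocol hη hl
  exact ⟨P, hP, hN⟩

/-! ### Reductions -/

section Reductions

variable {r r' s s' t u : Resource}

theorem Resource.reduces_iff : r.Reduces r' ↔
    ∃ (EA : SuperOp r'.Alice r.Alice) (E : SuperOp r'.S r.S)
      (DA : SuperOp r.Aout r'.Aout) (DB : SuperOp r.Bout r'.Bout),
      IsChannel EA ∧ IsSplit r.source r'.source E ∧ IsChannel DA ∧ IsChannel DB ∧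
      (∀ ξ : Op r'.Alice, IsState ξ → ptraceLeft ξ = r'.test → ptraceLeft (EA ξ) = r.test) ∧
      r'.chan = QShannon.tensor DA DB ∘ₗ r.chan ∘ₗ QShannon.tensor EA E := by
  constructor
  · rintro ⟨EA, c, DA, DB, h1, h2, h3, h4, h5⟩
    exact ⟨EA, _, DA, DB, h1, ⟨c, rfl⟩, h2, h3, h4, h5⟩
  · rintro ⟨EA, _, DA, DB, h1, ⟨c, rfl⟩, h2, h3, h4, h5⟩
    exact ⟨EA, c, DA, DB, h1, h2, h3, h4, h5⟩

theorem Resource.Reduces.trans (h : r.Reduces s) (h' : s.Reduces t) : r.Reduces t := by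
  rw [Resource.reduces_iff] at *
  obtain ⟨EA, E, DA, DB, h1, h2, h3, h4, h5, h6⟩ := h
  obtain ⟨EA', E', DA', DB', h1', h2', h3', h4', h5', h6'⟩ := h'
  refine ⟨EA ∘ₗ EA', E ∘ₗ E', DA' ∘ₗ DA, DB' ∘ₗ DB, h1.comp h1', h2.comp h2', h3'.comp h3,
    h4'.comp h4, fun ξ hξ hm => h5 _ (h1'.isState hξ) (h5' ξ hξ hm), ?_⟩
  rw [h6', h6, tensor_comp, tensor_comp]
  rfl

theorem ptraceLeft_relabel_prodCongr {X Y X' Y' : QSys} (e : X ≃ X')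
    (f : Y ≃ Y') (ξ : Op (X ⊠ Y)) :
    ptraceLeft (relabel (X := X ⊠ Y) (Y := X' ⊠ Y') (e.prodCongr f) ξ) =
      relabel f (ptraceLeft ξ) :=
  Matrix.ext fun y y' =>
    Equiv.sum_comp e.symm fun w => ξ (w, f.symm y) (w, f.symm y')

theorem Resource.reduces_of_equiv (ea : s.Aabs ≃ r.Aabs)
    (er : s.Arel ≃ r.Arel) (es : s.S ≃ r.S)
    (eo : r.Aout ≃ s.Aout) (eb : r.Bout ≃ s.Bout)
    (ht : relabel er s.test = r.test) (hs : relabel es s.source = r.source)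
    (hc : s.chan = relabel (X := r.Out) (Y := s.Out) (eo.prodCongr eb) ∘ₗ r.chan ∘ₗ
      relabel (X := s.In) (Y := r.In) ((ea.prodCongr er).prodCongr es)) : r.Reduces s :=
  Resource.reduces_iff.mpr ⟨relabel (X := s.Alice) (Y := r.Alice) (ea.prodCongr er), relabel es,
    relabel eo, relabel eb, isChannel_relabel _, isSplit_relabel es hs, isChannel_relabel _,
    isChannel_relabel _, fun ξ _ h => by rw [ptraceLeft_relabel_prodCongr, h, ht], hc⟩

theorem Resource.Reduces.refl (r : Resource) : r.Reduces r :=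
  Resource.reduces_of_equiv (Equiv.refl _) (Equiv.refl _) (Equiv.refl _) (Equiv.refl _)
    (Equiv.refl _) rfl rfl rfl

theorem extL_eq_kronecker_of_forall_state {X Y E S : QSys} {Φ : SuperOp X Y} {Θ : SuperOp X E}
    {ω : Op Y} {ω' : Op E} (hΘ : IsChannel Θ) (hω : ω'.trace = 1)
    (h : ∀ ξ : Op X, IsState ξ → Θ ξ = ω' → Φ ξ = ω) {ρ : Op (S ⊠ X)} (hρ : ρ.PosSemidef)
    {σ : Op S} (hm : extL Θ S ρ = σ ⊗ₖ ω') : extL Φ S ρ = σ ⊗ₖ ω := by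
  have h1 := ext_eq_kronecker_of_forall_state (S := S) (Φ := Φ) hΘ hω h
    (ρ := relabel (X := S ⊠ X) (Y := X ⊠ S) (prodComm _ _) ρ) (hρ.submatrix _) (σ := σ) (by
      have := congrArg (relabel (X := S ⊠ E) (Y := E ⊠ S) (prodComm _ _)) hm
      refine this.trans (Matrix.ext fun p q => mul_comm _ _))
  have h2 := congrArg (relabel (X := Y ⊠ S) (Y := S ⊠ Y) (prodComm _ _)) h1
  exact h2.trans (Matrix.ext fun p q => mul_comm _ _)

theorem eq_of_comp_relabel {X Y Z : QSys} (e : X ≃ Y) {Φ Ψ : SuperOp Y Z}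
    (h : Φ ∘ₗ relabel e = Ψ ∘ₗ relabel e) : Φ = Ψ :=
  LinearMap.ext fun M => by
    have := LinearMap.congr_fun h (relabel e.symm M)
    rwa [comp_apply, comp_apply, relabel_relabel_symm] at this

theorem superOp_ext_kron₄ {X Y Z W V : QSys} {Φ Ψ : SuperOp ((X ⊠ Y) ⊠ (Z ⊠ W)) V}
    (h : ∀ (a : Op X) (b : Op Y) (c : Op Z) (d : Op W),
      Φ ((a ⊗ₖ b : Op (X ⊠ Y)) ⊗ₖ (c ⊗ₖ d : Op (Z ⊠ W))) =
        Ψ ((a ⊗ₖ b : Op (X ⊠ Y)) ⊗ₖ (c ⊗ₖ d : Op (Z ⊠ W)))) : Φ = Ψ := by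
  have hs : ∀ {X Y : QSys} (p q : (X ⊠ Y)), (Matrix.single p q (1 : ℂ) : Op (X ⊠ Y))
      = Matrix.single p.1 q.1 1 ⊗ₖ Matrix.single p.2 q.2 1 := fun p q => by
    rw [single_kronecker_single]; simp
  refine superOp_ext fun p q => ?_
  rw [hs p q, hs p.1 q.1, hs p.2 q.2]
  exact h _ _ _ _

theorem tensor_tensor_interchange {X₁ X₂ Y₁ Y₂ X₁' X₂' Y₁' Y₂' : QSys} (Φ₁ : SuperOp X₁ X₁')
    (Φ₂ : SuperOp X₂ X₂') (Ψ₁ : SuperOp Y₁ Y₁') (Ψ₂ : SuperOp Y₂ Y₂') :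
    tensor (tensor Φ₁ Φ₂) (tensor Ψ₁ Ψ₂) ∘ₗ
        relabel (X := (X₁ ⊠ Y₁) ⊠ (X₂ ⊠ Y₂)) (Y := (X₁ ⊠ X₂) ⊠ (Y₁ ⊠ Y₂))
          (prodProdProdComm _ _ _ _) =
      relabel (X := (X₁' ⊠ Y₁') ⊠ (X₂' ⊠ Y₂')) (Y := (X₁' ⊠ X₂') ⊠ (Y₁' ⊠ Y₂'))
          (prodProdProdComm _ _ _ _) ∘ₗ tensor (tensor Φ₁ Ψ₁) (tensor Φ₂ Ψ₂) := by
  have hr : ∀ {A B C D : QSys} (a : Op A) (b : Op B) (c : Op C) (d : Op D),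
      relabel (X := (A ⊠ B) ⊠ (C ⊠ D)) (Y := (A ⊠ C) ⊠ (B ⊠ D)) (prodProdProdComm _ _ _ _)
        ((a ⊗ₖ b : Op (A ⊠ B)) ⊗ₖ (c ⊗ₖ d : Op (C ⊠ D))) =
      (a ⊗ₖ c : Op (A ⊠ C)) ⊗ₖ (b ⊗ₖ d : Op (B ⊠ D)) := fun a b c d =>
    Matrix.ext fun _ _ => mul_mul_mul_comm _ _ _ _
  refine superOp_ext_kron₄ fun a b c d => ?_
  rw [comp_apply, comp_apply, hr, tensor_kron, tensor_kron, tensor_kron,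
    tensor_kron, tensor_kron, tensor_kron, hr]

/-- The product of two operators on the inputs. -/
def prodIn (a : Op r.In) (b : Op s.In) : Op (r.tensor s).In :=
  relabel (X := r.In ⊠ s.In) (tensorIn r s).symm (a ⊗ₖ b)

theorem chan_prodIn (a : Op r.In) (b : Op s.In) : (r.tensor s).chan (prodIn a b) =
    relabel (X := r.Out ⊠ s.Out) (Y := (r.tensor s).Out) (prodProdProdComm _ _ _ _)
      (r.chan a ⊗ₖ s.chan b) :=
  congrArg (relabel (X := r.Out ⊠ s.Out) (Y := (r.tensor s).Out) (prodProdProdComm _ _ _ _))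
    (tensor_kron r.chan s.chan a b)

/-- Alice's inputs of the tensor product of two resources. -/
def aliceIn (r s : Resource) : (r.tensor s).Alice ≃ (r.Alice ⊠ s.Alice) :=
  prodProdProdComm _ _ _ _

theorem ptraceLeft_aliceIn (M : Op (r.tensor s).Alice) :
    ptraceLeft M = QShannon.tensor (X := r.Alice) (X' := s.Alice) ptraceLeft ptraceLeft
      (relabel (X := (r.tensor s).Alice) (Y := r.Alice ⊠ s.Alice) (aliceIn r s) M) :=
  Matrix.ext fun p q => (sum_prod_type (f := fun z : r.Aabs × s.Aabs =>
    M (z, p) (z, q))).trans sum_comm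

theorem tensor_interchange_conj {A₁ A₂ S₁ S₂ P A₁' A₂' S₁' S₂' P' : QSys} (Φ₁ : SuperOp A₁ A₁')
    (Φ₂ : SuperOp A₂ A₂') (Ψ₁ : SuperOp S₁ S₁') (Ψ₂ : SuperOp S₂ S₂')
    (f : P ≃ (A₁ ⊠ A₂)) (f' : P' ≃ (A₁' ⊠ A₂')) :
    tensor (tensor Φ₁ Ψ₁) (tensor Φ₂ Ψ₂) ∘ₗ
        relabel (X := P ⊠ (S₁ ⊠ S₂)) (Y := (A₁ ⊠ S₁) ⊠ (A₂ ⊠ S₂))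
          ((f.prodCongr (Equiv.refl _)).trans (prodProdProdComm _ _ _ _)) =
      relabel (X := P' ⊠ (S₁' ⊠ S₂')) (Y := (A₁' ⊠ S₁') ⊠ (A₂' ⊠ S₂'))
          ((f'.prodCongr (Equiv.refl _)).trans (prodProdProdComm _ _ _ _)) ∘ₗ
        tensor (relabel (X := A₁' ⊠ A₂') (Y := P') f'.symm ∘ₗ tensor Φ₁ Φ₂ ∘ₗ
          relabel (Y := A₁ ⊠ A₂) f) (tensor Ψ₁ Ψ₂) := by
  have h : ∀ {A₁ A₂ S₁ S₂ P : QSys} (f : P ≃ (A₁ ⊠ A₂)),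
      relabel (X := P ⊠ (S₁ ⊠ S₂)) (Y := (A₁ ⊠ S₁) ⊠ (A₂ ⊠ S₂))
          ((f.prodCongr (Equiv.refl _)).trans (prodProdProdComm _ _ _ _)) =
      relabel (X := (A₁ ⊠ A₂) ⊠ (S₁ ⊠ S₂)) (Y := (A₁ ⊠ S₁) ⊠ (A₂ ⊠ S₂))
        (prodProdProdComm _ _ _ _) ∘ₗ
        tensor (relabel (X := P) (Y := A₁ ⊠ A₂) f) (LinearMap.id : SuperOp (S₁ ⊠ S₂) (S₁ ⊠ S₂)) :=
    fun _ => rfl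
  have h2 : relabel (X := P') (Y := A₁' ⊠ A₂') f' ∘ₗ (relabel (X := A₁' ⊠ A₂') (Y := P') f'.symm ∘ₗ
      tensor Φ₁ Φ₂ ∘ₗ relabel (Y := A₁ ⊠ A₂) f) = tensor Φ₁ Φ₂ ∘ₗ relabel (Y := A₁ ⊠ A₂) f :=
    LinearMap.ext fun M => relabel_relabel_symm (X := P') (Y := A₁' ⊠ A₂') f' _
  rw [h, h, ← comp_assoc, tensor_tensor_interchange, comp_assoc,
    comp_assoc, ← tensor_comp, ← tensor_comp, h2, LinearMap.id_comp, LinearMap.comp_id]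

set_option maxRecDepth 8000 in
theorem Resource.Reduces.tensor (h : r.Reduces r') (h' : s.Reduces s') :
    (r.tensor s).Reduces (r'.tensor s') := by
  rw [Resource.reduces_iff] at *
  obtain ⟨EA, E, DA, DB, h1, h2, h3, h4, h5, h6⟩ := h
  obtain ⟨EA', E', DA', DB', h1', h2', h3', h4', h5', h6'⟩ := h'
  refine ⟨relabel (X := r.Alice ⊠ s.Alice) (Y := (r.tensor s).Alice) (aliceIn r s).symm ∘ₗ
    QShannon.tensor EA EA' ∘ₗ relabel (X := (r'.tensor s').Alice) (Y := r'.Alice ⊠ s'.Alice)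
    (aliceIn r' s'), QShannon.tensor E E', QShannon.tensor DA DA', QShannon.tensor DB DB',
    (isChannel_relabel _).comp ((h1.tensor h1').comp (isChannel_relabel _)), h2.tensor h2',
    h3.tensor h3', h4.tensor h4', fun ξ hξ hm => ?_, ?_⟩
  · have hp : (relabel (X := (r'.tensor s').Alice) (Y := r'.Alice ⊠ s'.Alice) (aliceIn r' s')
        ξ).PosSemidef := hξ.1.submatrix _
    have hm' : QShannon.tensor ptraceLeft ptraceLeft (relabel (X := (r'.tensor s').Alice)
        (Y := r'.Alice ⊠ s'.Alice) (aliceIn r' s') ξ) = r'.test ⊗ₖ s'.test := by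
      rw [← ptraceLeft_aliceIn, hm]; rfl
    rw [ptraceLeft_aliceIn, comp_apply, comp_apply,
      relabel_relabel_symm (X := (r.tensor s).Alice) (Y := r.Alice ⊠ s.Alice) (aliceIn r s)]
    generalize relabel (X := (r'.tensor s').Alice) (Y := r'.Alice ⊠ s'.Alice) (aliceIn r' s') ξ = M
      at hp hm' ⊢
    rw [← comp_apply, ← tensor_comp]
    rw [tensor_eq, ← ext_comp_extL] at hm'
    have e1 := ext_eq_kronecker_of_forall_state (Φ := ptraceLeft ∘ₗ EA) isChannel_ptraceLeft
      r'.isState_test.2 h5 ((isChannel_ptraceLeft.extL r'.Alice).posSemidef hp) hm'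
    rw [← comp_apply, ext_comp_extL] at e1
    rw [tensor_eq]
    exact extL_eq_kronecker_of_forall_state (Φ := ptraceLeft ∘ₗ EA') isChannel_ptraceLeft
      s'.isState_test.2 h5' (((isChannel_ptraceLeft.comp h1).ext s'.Alice).posSemidef hp) e1
  · rw [chan_tensor, chan_tensor, h6, h6', tensorMap, tensorMap, tensor_comp, tensor_comp]
    refine LinearMap.ext fun M => ?_
    have e3 : QShannon.tensor (QShannon.tensor EA E) (QShannon.tensor EA' E')
        (relabel (X := (r'.tensor s').In) (Y := r'.In ⊠ s'.In) (tensorIn r' s') M) =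
      relabel (X := (r.tensor s).In) (Y := r.In ⊠ s.In) (tensorIn r s)
        (QShannon.tensor (relabel (X := r.Alice ⊠ s.Alice) (Y := (r.tensor s).Alice)
          (aliceIn r s).symm ∘ₗ QShannon.tensor EA EA' ∘ₗ relabel (X := (r'.tensor s').Alice)
          (Y := r'.Alice ⊠ s'.Alice) (aliceIn r' s')) (QShannon.tensor E E') M) :=
      LinearMap.congr_fun (tensor_interchange_conj EA EA' E E' (aliceIn r' s') (aliceIn r s)) M
    have e1 := LinearMap.congr_fun (tensor_tensor_interchange DA DA' DB DB')
      (QShannon.tensor r.chan s.chan (relabel (X := (r.tensor s).In) (Y := r.In ⊠ s.In)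
        (tensorIn r s) (QShannon.tensor (relabel (X := r.Alice ⊠ s.Alice)
          (Y := (r.tensor s).Alice) (aliceIn r s).symm ∘ₗ QShannon.tensor EA EA' ∘ₗ
          relabel (X := (r'.tensor s').Alice) (Y := r'.Alice ⊠ s'.Alice) (aliceIn r' s'))
          (QShannon.tensor E E') M)))
    rw [comp_apply, comp_apply] at e1
    rw [comp_apply, comp_apply, comp_apply, comp_apply, e3]
    exact e1.symm

theorem Resource.reduces_middleFour (r s t u : Resource) :
    ((r.tensor s).tensor (t.tensor u)).Reduces ((r.tensor t).tensor (s.tensor u)) := by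
  refine Resource.reduces_of_equiv (prodProdProdComm _ _ _ _)
    (prodProdProdComm _ _ _ _) (prodProdProdComm _ _ _ _)
    (prodProdProdComm _ _ _ _) (prodProdProdComm _ _ _ _)
    (Matrix.ext fun _ _ => mul_mul_mul_comm _ _ _ _)
    (Matrix.ext fun _ _ => mul_mul_mul_comm _ _ _ _) ?_
  let e₀ : ((r.In ⊠ s.In) ⊠ (t.In ⊠ u.In)) ≃
      ((r.tensor t).tensor (s.tensor u)).In :=
    ((prodProdProdComm _ _ _ _).trans
      (((tensorIn r t).symm.prodCongr (tensorIn s u).symm).trans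
        (tensorIn (r.tensor t) (s.tensor u)).symm))
  let e : SuperOp ((r.In ⊠ s.In) ⊠ (t.In ⊠ u.In)) ((r.tensor t).tensor (s.tensor u)).In :=
    relabel e₀
  have he : ∀ a b c d, e ((a ⊗ₖ b : Op (r.In ⊠ s.In)) ⊗ₖ (c ⊗ₖ d : Op (t.In ⊠ u.In))) =
      prodIn (prodIn a c) (prodIn b d) := fun a b c d =>
    Matrix.ext fun _ _ => mul_mul_mul_comm _ _ _ _
  refine eq_of_comp_relabel e₀ (superOp_ext_kron₄ fun a b c d => ?_)
  change (_ ∘ₗ e) _ = (_ ∘ₗ e) _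
  rw [comp_apply, comp_apply, he, chan_prodIn, chan_prodIn, chan_prodIn,
    comp_apply, comp_apply]
  have h2 : relabel (X := ((r.tensor t).tensor (s.tensor u)).In)
      (Y := ((r.tensor s).tensor (t.tensor u)).In)
      (((prodProdProdComm _ _ _ _).prodCongr (prodProdProdComm _ _ _ _)).prodCongr
        (prodProdProdComm _ _ _ _)) (prodIn (prodIn a c) (prodIn b d)) =
      prodIn (prodIn a b) (prodIn c d) := Matrix.ext fun _ _ => mul_mul_mul_comm _ _ _ _
  refine Eq.trans ?_ (congrArg _ (congrArg _ h2.symm))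
  rw [chan_prodIn, chan_prodIn, chan_prodIn]
  exact Matrix.ext fun _ _ => mul_mul_mul_comm _ _ _ _

end Reductions

section ReduceLists

variable {r s t u : Resource}

theorem Resource.reduces_of_equiv_symm (ea : s.Aabs ≃ r.Aabs)
    (er : s.Arel ≃ r.Arel) (es : s.S ≃ r.S)
    (eo : r.Aout ≃ s.Aout) (eb : r.Bout ≃ s.Bout)
    (ht : relabel er s.test = r.test) (hs : relabel es s.source = r.source)
    (hc : s.chan = relabel (X := r.Out) (Y := s.Out) (eo.prodCongr eb) ∘ₗ r.chan ∘ₗ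
      relabel (X := s.In) (Y := r.In) ((ea.prodCongr er).prodCongr es)) : s.Reduces r := by
  refine Resource.reduces_of_equiv ea.symm er.symm es.symm eo.symm eb.symm ?_ ?_ ?_
  · rw [← ht, relabel_symm_relabel]
  · rw [← hs, relabel_symm_relabel]
  · rw [hc]
    refine LinearMap.ext fun M => ?_
    have h1 := relabel_symm_relabel (X := r.Out) (Y := s.Out) (eo.prodCongr eb) (r.chan M)
    have h2 := relabel_relabel_symm (X := s.In) (Y := r.In) ((ea.prodCongr er).prodCongr es) M
    exact h1.symm.trans (congrArg (fun Z => relabel (X := s.Out) (Y := r.Out)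
      (eo.prodCongr eb).symm (relabel (X := r.Out) (Y := s.Out) (eo.prodCongr eb) (r.chan Z)))
      h2.symm)

theorem exists_isState (X : QSys) : ∃ ρ : Op X, IsState ρ :=
  ⟨_, isChannel_ptrace.isState (isState_maxEntOp X)⟩

theorem exists_discard (X : QSys) : ∃ Φ : SuperOp X QSys.unit, IsChannel Φ :=
  ⟨ptraceLeft ∘ₗ relabel (X := X) (Y := X ⊠ QSys.unit) (prodPUnit _).symm,
    isChannel_ptraceLeft.comp (isChannel_relabel _)⟩

theorem Resource.reduces_trivial (r : Resource) : r.Reduces trivial := by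
  obtain ⟨τ, hτ⟩ := exists_isState r.Aabs
  obtain ⟨DA, hDA⟩ := exists_discard r.Aout
  obtain ⟨DB, hDB⟩ := exists_discard r.Bout
  obtain ⟨EA, h1⟩ : ∃ EA, IsSplit (S := r.Alice) (τ ⊗ₖ r.test) (1 : Op QSys.unit) EA :=
    ⟨_, isSplit_unit (hτ.kron r.isState_test)⟩
  obtain ⟨E, h2⟩ : ∃ E, IsSplit r.source (1 : Op QSys.unit) E := ⟨_, isSplit_unit r.isState_source⟩
  have hEA : IsChannel (EA ∘ₗ relabel (X := QSys.unit ⊠ QSys.unit) (Y := QSys.unit)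
      (prodPUnit _)) := h1.isChannel.comp (isChannel_relabel _)
  refine Resource.reduces_iff.mpr ⟨EA ∘ₗ relabel (X := QSys.unit ⊠ QSys.unit) (Y := QSys.unit)
      (prodPUnit _), E, DA, DB, hEA, h2, hDA, hDB, fun ξ hξ _ => ?_, ?_⟩
  · have h3 : relabel (X := QSys.unit ⊠ QSys.unit) (Y := QSys.unit) (prodPUnit _) ξ = 1 :=
      eq_of_trace_eq (X := QSys.unit) ((trace_relabel _ _).trans (hξ.2.trans isState_unit.2.symm))
    refine (congrArg ptraceLeft ((congrArg EA h3).trans h1.apply)).trans ?_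
    rw [ptraceLeft_kron, hτ.2, one_smul]
  · refine LinearMap.ext fun M => eq_of_trace_eq (X := QSys.unit ⊠ QSys.unit) ?_
    refine (trivial.isChannel.tracePreserving M).trans ?_
    exact (((hDA.tensor hDB).comp (r.isChannel.comp
      (hEA.tensor h2.isChannel))).tracePreserving M).symm

theorem chan_trivial_tensor (r : Resource) : (Resource.trivial.tensor r).chan =
    relabel (X := r.Out) (Y := (Resource.trivial.tensor r).Out)
      ((punitProd _).symm.prodCongr (punitProd _).symm) ∘ₗ r.chan ∘ₗ
    relabel (X := (Resource.trivial.tensor r).In) (Y := r.In) (((punitProd _).prodCongr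
      (punitProd _)).prodCongr (punitProd _)) := by
  refine eq_of_comp_relabel (X := Resource.trivial.In ⊠ r.In) (tensorIn Resource.trivial r).symm
    (superOp_ext_kron fun a b => ?_)
  refine (chan_prodIn a b).trans ?_
  have h : relabel (X := (Resource.trivial.tensor r).In) (Y := r.In) (((punitProd _).prodCongr
      (punitProd _)).prodCongr (punitProd _)) (prodIn a b) =
      a (((), ()), ()) (((), ()), ()) • b := Matrix.ext fun _ _ => rfl
  have h2 : r.chan (a (((), ()), ()) (((), ()), ()) • b) =
    a (((), ()), ()) (((), ()), ()) • r.chan b := map_smul _ _ _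
  refine Eq.trans ?_ (congrArg (relabel (X := r.Out) (Y := (Resource.trivial.tensor r).Out)
    ((punitProd _).symm.prodCongr (punitProd _).symm))
    ((congrArg r.chan h).trans h2)).symm
  exact Matrix.ext fun _ _ => rfl

theorem chan_tensor_trivial (r : Resource) : (r.tensor Resource.trivial).chan =
    relabel (X := r.Out) (Y := (r.tensor Resource.trivial).Out)
      ((prodPUnit _).symm.prodCongr (prodPUnit _).symm) ∘ₗ r.chan ∘ₗ
    relabel (X := (r.tensor Resource.trivial).In) (Y := r.In) (((prodPUnit _).prodCongr
      (prodPUnit _)).prodCongr (prodPUnit _)) := by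
  refine eq_of_comp_relabel (X := r.In ⊠ Resource.trivial.In) (tensorIn r Resource.trivial).symm
    (superOp_ext_kron fun b a => ?_)
  refine (chan_prodIn b a).trans ?_
  have h : relabel (X := (r.tensor Resource.trivial).In) (Y := r.In) (((prodPUnit _).prodCongr
      (prodPUnit _)).prodCongr (prodPUnit _)) (prodIn b a) =
      a (((), ()), ()) (((), ()), ()) • b := Matrix.ext fun _ _ => mul_comm _ _
  have h2 : r.chan (a (((), ()), ()) (((), ()), ()) • b) =
    a (((), ()), ()) (((), ()), ()) • r.chan b := map_smul _ _ _
  refine Eq.trans ?_ (congrArg (relabel (X := r.Out) (Y := (r.tensor Resource.trivial).Out)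
    ((prodPUnit _).symm.prodCongr (prodPUnit _).symm))
    ((congrArg r.chan h).trans h2)).symm
  exact Matrix.ext fun _ _ => mul_comm _ _

theorem one_mul_op {X : QSys} (ρ : Op X) :
    relabel (X := QSys.unit ⊠ X) (Y := X) (punitProd _) ((1 : Op QSys.unit) ⊗ₖ ρ) = ρ := by
  ext a b
  simp [relabel_apply]

theorem mul_one_op {X : QSys} (ρ : Op X) :
    relabel (X := X ⊠ QSys.unit) (Y := X) (prodPUnit _) (ρ ⊗ₖ (1 : Op QSys.unit)) = ρ := by
  ext a b
  simp [relabel_apply]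

theorem Resource.reduces_trivial_tensor (r : Resource) :
    r.Reduces (trivial.tensor r) ∧ (trivial.tensor r).Reduces r :=
  ⟨Resource.reduces_of_equiv _ _ _ _ _ (one_mul_op r.test) (one_mul_op r.source)
      (chan_trivial_tensor r),
    Resource.reduces_of_equiv_symm _ _ _ _ _ (one_mul_op r.test) (one_mul_op r.source)
      (chan_trivial_tensor r)⟩

theorem Resource.reduces_tensor_trivial (r : Resource) :
    r.Reduces (r.tensor trivial) ∧ (r.tensor trivial).Reduces r :=
  ⟨Resource.reduces_of_equiv _ _ _ _ _ (mul_one_op r.test) (mul_one_op r.source)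
      (chan_tensor_trivial r),
    Resource.reduces_of_equiv_symm _ _ _ _ _ (mul_one_op r.test) (mul_one_op r.source)
      (chan_tensor_trivial r)⟩

theorem Resource.tensor_reduces_right (r s : Resource) : (r.tensor s).Reduces s :=
  ((r.reduces_trivial).tensor (.refl s)).trans s.reduces_trivial_tensor.2

theorem Resource.reduces_leftComm (r s t : Resource) :
    (r.tensor (s.tensor t)).Reduces (s.tensor (r.tensor t)) :=
  (r.reduces_trivial_tensor.1.tensor (.refl _)).trans
    ((reduces_middleFour trivial r s t).trans (s.reduces_trivial_tensor.2.tensor (.refl _)))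

theorem Resource.reduces_assoc (r s t : Resource) :
    ((r.tensor s).tensor t).Reduces (r.tensor (s.tensor t)) :=
  ((Reduces.refl _).tensor t.reduces_trivial_tensor.1).trans
    ((reduces_middleFour r s trivial t).trans (r.reduces_tensor_trivial.2.tensor (.refl _)))

open Resource

theorem reduces_of_perm {L L' : List Resource} (h : L.Perm L') :
    (tensorList L).Reduces (tensorList L') := by
  induction h with
  | nil => exact .refl _
  | cons x _ ih => exact (Reduces.refl x).tensor ih
  | swap x y l => exact reduces_leftComm y x _
  | trans _ _ h1 h2 => exact h1.trans h2

theorem reduces_of_sublist {L L' : List Resource} (h : L'.Sublist L) :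
    (tensorList L).Reduces (tensorList L') := by
  induction h with
  | slnil => exact .refl _
  | cons x _ ih => exact (tensor_reduces_right x _).trans ih
  | cons_cons x _ ih => exact (Reduces.refl x).tensor ih

theorem reduces_of_forall₂ {L L' : List Resource} (h : List.Forall₂ Reduces L L') :
    (tensorList L).Reduces (tensorList L') := by
  induction h with
  | nil => exact .refl _
  | cons h _ ih => exact h.tensor ih

theorem tensorList_tensor_reduces (x : Resource) : ∀ L : List Resource,
    ((tensorList L).tensor x).Reduces (tensorList (L ++ [x]))
  | [] => x.reduces_trivial_tensor.2.trans x.reduces_tensor_trivial.1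
  | r :: L => (reduces_assoc r _ x).trans ((Reduces.refl r).tensor (tensorList_tensor_reduces x L))

theorem tensorList_map_tensor_reduces (f g : Resource → Resource) : ∀ L : List Resource,
    ((tensorList (L.map f)).tensor (tensorList (L.map g))).Reduces
      (tensorList (L.map fun r => (f r).tensor (g r)))
  | [] => trivial.reduces_trivial_tensor.2
  | _ :: L => (reduces_middleFour _ _ _ _).trans
      ((Reduces.refl _).tensor (tensorList_map_tensor_reduces f g L))

theorem tensorList_pow_reduces (L : List Resource) : ∀ m : ℕ,
    ((tensorList L).pow m).Reduces (tensorList (L.map fun r => r.pow m))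
  | 0 => by
    induction L with
    | nil => exact .refl _
    | cons _ L ih => exact trivial.reduces_trivial_tensor.1.trans ((Reduces.refl _).tensor ih)
  | m + 1 => by
    have h := ((tensorList_pow_reduces L m).tensor (Reduces.refl (tensorList L)))
    have h2 := tensorList_map_tensor_reduces (fun r => r.pow m) id L
    rw [List.map_id] at h2
    exact h.trans h2

open ResourceSeq

theorem ResourceSeq.DepthReduces.flat {ℓ ℓ' : ℕ} {M : Fin ℓ → Resource} {M' : Fin ℓ' → Resource}
    (h : DepthReduces M M') :
    (ResourceSeq.flat M).Reduces (ResourceSeq.flat M') := by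
  obtain ⟨f, hf, h⟩ := h
  have h1 : List.Forall₂ Reduces (List.ofFn (M ∘ f)) (List.ofFn M') := by
    rw [List.forall₂_iff_get]
    exact ⟨by simp, fun i h1 h2 => by simpa using h _⟩
  obtain ⟨L, hp, hs⟩ : ((List.finRange ℓ').map f).Subperm (List.finRange ℓ) :=
    List.subperm_of_subset ((List.nodup_finRange _).map hf) fun x _ => List.mem_finRange x
  rw [List.ofFn_eq_map, ← List.map_map] at h1
  have h2 : (ResourceSeq.flat M).Reduces (tensorList (L.map M)) := by
    rw [ResourceSeq.flat, List.ofFn_eq_map]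
    exact reduces_of_sublist (hs.map M)
  exact h2.trans ((reduces_of_perm (hp.map M)).trans (reduces_of_forall₂ h1))

theorem flat_pow_reduces {ℓ : ℕ} (M : Fin ℓ → Resource) (m : ℕ) :
    ((flat M).pow m).Reduces (flat (depthPow M m)) := by
  have h := tensorList_pow_reduces (List.ofFn M) m
  rwa [List.map_ofFn] at h

theorem flat_append_reduces {ℓ : ℕ} (M : Fin ℓ → Resource) (M' : Fin 1 → Resource) :
    ((flat M).tensor (M' 0)).Reduces (flat (Fin.append M M')) := by
  have h := tensorList_tensor_reduces (M' 0) (List.ofFn M)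
  change ((flat M).tensor (M' 0)).Reduces (tensorList (List.ofFn (Fin.append M M')))
  rw [List.ofFn_fin_append, show List.ofFn M' = [M' 0] by simp]
  exact h

theorem ResourceSeq.IsAsymptotic.mono {β : ResourceSeq} (hβ : β.IsAsymptotic) :
    ∃ n₀ : ℕ, ∀ a b : ℕ, n₀ ≤ b → b ≤ a → (flat (β.comp a)).Reduces (flat (β.comp b)) := by
  obtain ⟨n₀, h⟩ := hβ.1
  refine ⟨n₀, fun a b hb hab => ?_⟩
  induction a, hab using Nat.le_induction with
  | base => exact .refl _
  | succ n hn ih => exact (h (n + 1) (by omega)).flat.trans ih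

end ReduceLists

section EntTarget

variable {r s T : Resource}

/-- The resource hands a maximally entangled state to Alice and Bob. -/
def IsEnt (r : Resource) : Prop :=
  Subsingleton r.Aabs ∧ Subsingleton r.Arel ∧ Subsingleton r.S ∧
    ∃ e : r.Bout ≃ r.Aout, ∀ M p q,
      r.chan M p q = M.trace * maxEntOp r.Aout (p.1, e p.2) (q.1, e q.2)

theorem IsEnt.tensor (hr : IsEnt r) (hs : IsEnt s) : IsEnt (r.tensor s) := by
  obtain ⟨h1, h2, h3, e, he⟩ := hr
  obtain ⟨k1, k2, k3, f, hf⟩ := hs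
  refine ⟨inferInstanceAs (Subsingleton (_ × _)), inferInstanceAs (Subsingleton (_ × _)),
    inferInstanceAs (Subsingleton (_ × _)), e.prodCongr f, fun M p q => ?_⟩
  let Ω : SuperOp (r.tensor s).In (r.tensor s).Out :=
    { toFun := fun M => M.trace • Matrix.of fun p q => maxEntOp (r.tensor s).Aout
        (p.1, (e.prodCongr f) p.2) (q.1, (e.prodCongr f) q.2)
      map_add' := fun a b => by rw [Matrix.trace_add, add_smul]
      map_smul' := fun c a => by rw [trace_smul, smul_assoc]; rfl }
  have h : (r.tensor s).chan = Ω := by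
    refine eq_of_comp_relabel (X := r.In ⊠ s.In) (tensorIn r s).symm
      (superOp_ext_kron fun a b => (chan_prodIn a b).trans (Matrix.ext fun p q => ?_))
    have h4 : Matrix.trace (prodIn a b) = a.trace * b.trace :=
      (trace_relabel (X := r.In ⊠ s.In) (tensorIn r s).symm _).trans (trace_kron a b)
    change r.chan a (p.1.1, p.2.1) (q.1.1, q.2.1) * s.chan b (p.1.2, p.2.2) (q.1.2, q.2.2) =
      Matrix.trace (prodIn a b) * maxEntOp (r.Aout ⊠ s.Aout) _ _
    rw [he, hf, h4]
    refine Eq.trans ?_ (congrArg _ (maxEntOp_prod r.Aout s.Aout _ _).symm)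
    exact mul_mul_mul_comm _ _ _ _
  rw [h]; rfl

theorem isEnt_trivial : IsEnt Resource.trivial :=
  ⟨inferInstanceAs (Subsingleton Unit), inferInstanceAs (Subsingleton Unit),
    inferInstanceAs (Subsingleton Unit), Equiv.refl _, fun M p q => by
    have h : M.trace = M (((), ()), ()) (((), ()), ()) :=
      Fintype.sum_subsingleton (fun i : (Unit × Unit) × Unit => M i i) _
    have h2 : ∀ p q : Unit × Unit, maxEntOp QSys.unit p q = 1 := fun p q => by simp [maxEntOp]
    have h3 : Resource.trivial.chan M p q = M (((), ()), ()) (((), ()), ()) := rfl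
    rw [h, h3]
    exact ((congrArg _ (h2 _ _)).trans (mul_one _)).symm⟩

theorem conj_apply_of_subsingleton {A B : Type} [Fintype B] [Subsingleton B] (V : Matrix A B ℂ)
    (M : Matrix B B ℂ) (d : B) (p q : A) : (V * M * Vᴴ) p q = V p d * M d d * star (V q d) := by
  simp only [mul_apply, conjTranspose_apply]
  rw [Fintype.sum_subsingleton _ d, Fintype.sum_subsingleton _ d]

theorem isEnt_ebitState : IsEnt ebitState :=
  ⟨inferInstanceAs (Subsingleton Unit), inferInstanceAs (Subsingleton Unit),
    inferInstanceAs (Subsingleton Unit), Equiv.refl _, fun M p q => by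
    have h : M.trace = M (((), ()), ()) (((), ()), ()) :=
      Fintype.sum_subsingleton (fun i : (Unit × Unit) × Unit => M i i) _
    have h2 : (((√2 : ℝ) : ℂ))⁻¹ * ((√2 : ℝ) : ℂ)⁻¹ = 2⁻¹ := by
      rw [← mul_inv, ← Complex.ofReal_mul, Real.mul_self_sqrt (by norm_num)]
      norm_num
    have h3 : ∀ (c : ℂ) (p q : Fin 2 × Fin 2), ebitVec p (((), ()), ()) * c *
        star (ebitVec q (((), ()), ())) =
        c * maxEntOp QSys.qubit p q := fun c p q => by
      by_cases hp : p.1 = p.2 <;> by_cases hq : q.1 = q.2 <;>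
        simp [ebitVec, maxEntOp, hp, hq]
      linear_combination c * h2
    rw [h]
    exact (conj_apply_of_subsingleton (B := (Unit × Unit) × Unit) ebitVec M _ p q).trans (h3 _ p q)⟩

theorem isEnt_pow (hr : IsEnt r) : ∀ q, IsEnt (r.pow q)
  | 0 => isEnt_trivial
  | q + 1 => (isEnt_pow hr q).tensor hr

theorem card_ebitState_pow : ∀ q, Fintype.card (ebitState.pow q).Aout = 2 ^ q
  | 0 => rfl
  | q + 1 => by
    refine (Fintype.card_prod _ _).trans ?_
    rw [card_ebitState_pow q, pow_succ]; rfl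

theorem tensor_relabel_maxEntOp {X Y : QSys} (g : X ≃ Y) :
    tensor (relabel g) (relabel g) (maxEntOp X) = maxEntOp Y := by
  refine Matrix.ext fun p q => ?_
  change (if g.symm p.1 = g.symm p.2 ∧ g.symm q.1 = g.symm q.2 then
    (Fintype.card X : ℂ)⁻¹ else 0) = if p.1 = p.2 ∧ q.1 = q.2 then
    (Fintype.card Y : ℂ)⁻¹ else 0
  simp only [g.symm.injective.eq_iff, Fintype.card_congr g]

theorem tensor_ptrace_maxEntOp (Y W : QSys) :
    tensor (ptrace (X := Y) (W := W)) (ptrace (X := Y) (W := W)) (maxEntOp (Y ⊠ W)) =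
      maxEntOp Y := by
  refine Matrix.ext fun p q => ?_
  change ∑ w', ∑ w, maxEntOp (Y ⊠ W) ((p.1, w), (p.2, w')) ((q.1, w), (q.2, w')) = _
  have h : (Fintype.card W : ℂ) ≠ 0 := Nat.cast_ne_zero.mpr Fintype.card_ne_zero
  simp only [maxEntOp_prod, ← mul_sum]
  simp [maxEntOp, h]

theorem withEnt_reduces (hr : IsEnt r) {X W : QSys} (g : X ≃ (r.Aout ⊠ W)) :
    (T.withEnt X).Reduces (T.tensor r) := by
  obtain ⟨h1, h2, h3, e, he⟩ := hr
  let _ : Unique r.Aabs := ⟨⟨Classical.arbitrary _⟩, fun _ => Subsingleton.elim _ _⟩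
  let _ : Unique r.Arel := ⟨⟨Classical.arbitrary _⟩, fun _ => Subsingleton.elim _ _⟩
  let _ : Unique r.S := ⟨⟨Classical.arbitrary _⟩, fun _ => Subsingleton.elim _ _⟩
  let DA : SuperOp X r.Aout := ptrace ∘ₗ relabel (Y := r.Aout ⊠ W) g
  let DB : SuperOp X r.Bout := relabel e.symm ∘ₗ DA
  have hDA : IsChannel DA := isChannel_ptrace.comp (isChannel_relabel _)
  have hDB : IsChannel DB := (isChannel_relabel _).comp hDA
  have hDD : QShannon.tensor DA DA (maxEntOp X) = maxEntOp r.Aout := by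
    rw [show QShannon.tensor DA DA = QShannon.tensor _ _ from rfl, tensor_comp,
      comp_apply, tensor_relabel_maxEntOp, tensor_ptrace_maxEntOp]
  have hD : ∀ p q, QShannon.tensor DA DB (maxEntOp X) p q =
      maxEntOp r.Aout (p.1, e p.2) (q.1, e q.2) := fun p q => by
    rw [← hDD]; rfl
  have hone : ∀ {X Y : QSys} [Unique Y] (ρ : Op X) (σ : Op Y), σ.trace = 1 →
      relabel (X := X ⊠ Y) (Y := X) (Equiv.prodUnique _ _) (ρ ⊗ₖ σ) = ρ := fun ρ σ h =>
    Matrix.ext fun a b => by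
      have h4 : σ.trace = σ default default := Fintype.sum_unique _
      change ρ a b * σ default default = ρ a b
      rw [← h4, h, mul_one]
  refine Resource.reduces_iff.mpr ⟨relabel (X := (T.tensor r).Alice) (Y := T.Alice)
    ((Equiv.prodUnique _ _).prodCongr (Equiv.prodUnique _ _)),
    relabel (X := T.S ⊠ r.S) (Y := T.S) (Equiv.prodUnique _ _), extL DA T.Aout, extL DB T.Bout,
    isChannel_relabel _, isSplit_relabel (S' := T.S ⊠ r.S) _ (hone _ _ r.isState_source.2),
    hDA.extL _, hDB.extL _, fun ξ _ h => ?_, ?_⟩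
  · refine (ptraceLeft_relabel_prodCongr (X := T.Aabs ⊠ r.Aabs) (Y := T.Arel ⊠ r.Arel)
      (X' := T.Aabs) (Y' := T.Arel) _ _ ξ).trans ?_
    exact (congrArg _ h).trans (hone _ _ r.isState_test.2)
  · refine eq_of_comp_relabel (X := T.In ⊠ r.In) (tensorIn T r).symm
      (superOp_ext_kron fun a b => (chan_prodIn a b).trans ?_)
    have h5 : relabel (X := (T.tensor r).In) (Y := T.In)
        (((Equiv.prodUnique _ _).prodCongr (Equiv.prodUnique _ _)).prodCongr
          (Equiv.prodUnique _ _)) (prodIn a b) = b.trace • a := by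
      refine Matrix.ext fun p q => ?_
      have h6 : b.trace = b ((default, default), default) ((default, default), default) :=
        Fintype.sum_subsingleton
          (fun i : (r.Aabs × r.Arel) × r.S => b i i) _
      rw [h6]
      exact mul_comm _ _
    have h7 := LinearMap.congr_fun (tensor_tensor_interchange
      (LinearMap.id : SuperOp T.Aout T.Aout) DA (LinearMap.id : SuperOp T.Bout T.Bout) DB)
      (T.chan a ⊗ₖ maxEntOp X)
    rw [comp_apply, comp_apply, tensor_kron, tensor_id_right, ext_id,
      LinearMap.id_apply] at h7
    let C : SuperOp T.In ((T.Aout ⊠ r.Aout) ⊠ (T.Bout ⊠ r.Bout)) := QShannon.tensor (extL DA T.Aout) (extL DB T.Bout) ∘ₗ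
      entangle T.Aout T.Bout X ∘ₗ T.chan
    have h8 : C (b.trace • a) = b.trace • C a := map_smul _ _ _
    refine Eq.trans ?_ ((congrArg C h5).trans (h8.trans (congrArg _ h7))).symm
    refine Matrix.ext fun p q => ?_
    change T.chan a _ _ * r.chan b _ _ = b.trace * (T.chan a _ _ * QShannon.tensor DA DB (maxEntOp X) _ _)
    rw [he, hD]
    exact mul_left_comm _ _ _

end EntTarget

section Rates

variable {R δ : ℝ} {k m : ℕ}

theorem exists_forall_mul_ge {c : ℝ} (hc : 0 < c) (x : ℝ) :
    ∃ C : ℕ, ∀ n : ℕ, C ≤ n → x ≤ c * n := by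
  obtain ⟨C, hC⟩ := exists_nat_ge (x / c)
  refine ⟨C, fun n hn => ?_⟩
  have h : x / c ≤ n := hC.trans (Nat.cast_le.mpr hn)
  rwa [div_le_iff₀ hc, mul_comm] at h

theorem sent_le (hR : 0 < R) (k m : ℕ) {n : ℕ} (hn : 2 * k * (m + 2) + m + 1 ≤ k * R * (n : ℝ)) :
    (k * ⌊R * n⌋₊ + 1) / 2 * (m + 1) ≤ ⌊R / 2 * n⌋₊ * (k * (m + 2)) := by
  have h1 : ((⌊R * n⌋₊ : ℕ) : ℝ) ≤ R * n := Nat.floor_le (by positivity)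
  have h2 : R / 2 * n < (⌊R / 2 * n⌋₊ : ℕ) + 1 := Nat.lt_floor_add_one _
  generalize ⌊R * n⌋₊ = M at h1 ⊢
  generalize ⌊R / 2 * n⌋₊ = q at h2 ⊢
  obtain ⟨h, hh⟩ : ∃ h, h = (k * M + 1) / 2 := ⟨_, rfl⟩
  rw [← hh]
  have h3 : 2 * h ≤ k * M + 1 := by omega
  have h4 : (2 * h : ℝ) ≤ k * M + 1 := by exact_mod_cast h3
  have hk : (0 : ℝ) ≤ k := Nat.cast_nonneg _
  have hm : (0 : ℝ) ≤ m := Nat.cast_nonneg _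
  have h5 := mul_le_mul_of_nonneg_left h1 hk
  have h6 : (2 * h : ℝ) * (m + 1) ≤ (k * (R * n) + 1) * (m + 1) :=
    mul_le_mul_of_nonneg_right (by linarith) (by linarith)
  have h7 : (R * n - 2) * (k * (m + 2)) ≤ 2 * q * (k * (m + 2)) :=
    mul_le_mul_of_nonneg_right (by linarith) (by positivity)
  have h8 : (h * (m + 1) : ℝ) ≤ q * (k * (m + 2)) := by nlinarith
  exact_mod_cast h8

theorem rank_le (hR : 0 < R) (hδ : 0 < δ) (hδ1 : δ < 1) (hm : 8 ≤ δ * m) {n n₁ : ℕ}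
    (hn : n ≤ k * (m + 2) * (n₁ + 1))
    (hn₁ : (m + 1) * k + m + R * k * m ≤ k * R * (n₁ : ℝ)) :
    ⌊R / 2 * (⌊(1 - δ) * (n : ℝ)⌋₊ : ℕ)⌋₊ ≤
      (k * ⌊R * n₁⌋₊ + 1) / 2 + m * (k * ⌊R * n₁⌋₊ - (k * ⌊R * n₁⌋₊ + 1) / 2) := by
  have h0 : (0 : ℝ) ≤ 1 - δ := by linarith
  have h1 : R * n₁ < (⌊R * n₁⌋₊ : ℕ) + 1 := Nat.lt_floor_add_one _
  have h2 : ((⌊(1 - δ) * (n : ℝ)⌋₊ : ℕ) : ℝ) ≤ (1 - δ) * n := Nat.floor_le (by positivity)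
  generalize ⌊R * n₁⌋₊ = M at h1 ⊢
  obtain ⟨h, hh⟩ : ∃ h, h = (k * M + 1) / 2 := ⟨_, rfl⟩
  obtain ⟨d, hd⟩ : ∃ d, d = k * M - h := ⟨_, rfl⟩
  rw [← hh, ← hd]
  have h3 : k * M ≤ 2 * h := by omega
  have h4 : k * M ≤ 2 * d + 1 := by omega
  have h3' : (k * M : ℝ) ≤ 2 * h := by exact_mod_cast h3
  have h4' : (k * M : ℝ) ≤ 2 * d + 1 := by exact_mod_cast h4
  have hk : (0 : ℝ) ≤ k := Nat.cast_nonneg _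
  have hm0 : (0 : ℝ) ≤ m := Nat.cast_nonneg _
  have hn' : (n : ℝ) ≤ k * (m + 2) * (n₁ + 1) := by exact_mod_cast hn
  refine Nat.floor_le_of_le ?_
  push_cast
  have h5 : (1 - δ) * n ≤ k * m * (n₁ + 1) := by
    refine (mul_le_mul_of_nonneg_left hn' h0).trans ?_
    have : (1 - δ) * (m + 2) ≤ m := by linarith
    have h6 := mul_le_mul_of_nonneg_right this (show (0 : ℝ) ≤ k * (n₁ + 1) by positivity)
    linarith
  have h6 : R / 2 * (⌊(1 - δ) * (n : ℝ)⌋₊ : ℕ) ≤ R / 2 * (k * m * (n₁ + 1)) :=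
    mul_le_mul_of_nonneg_left (h2.trans h5) (by linarith)
  have h7 : k * (R * n₁ - 1) ≤ (k * M : ℝ) := mul_le_mul_of_nonneg_left (by linarith) hk
  have h8 := mul_le_mul_of_nonneg_left h4' hm0
  have h9 := mul_le_mul_of_nonneg_left h7 hm0
  nlinarith

theorem target_le (hδ : 0 < δ) (hδ1 : δ < 1) (hm : 8 ≤ δ * m) {n n₁ : ℕ}
    (hn : n ≤ k * (m + 2) * (n₁ + 1)) (hn₁ : m + (m + 2) * k ≤ k * 2 * (n₁ : ℝ)) :
    ⌊(1 - δ) * (n : ℝ)⌋₊ ≤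
      ⌊((m * ⌊(1 - δ / 4) * ((k * n₁ : ℕ) : ℝ)⌋₊ : ℕ) : ℝ) * (1 - δ / 4)⌋₊ := by
  have h0 : (0 : ℝ) ≤ 1 - δ := by linarith
  have h1 : (1 - δ / 4) * ((k * n₁ : ℕ) : ℝ) < (⌊(1 - δ / 4) * ((k * n₁ : ℕ) : ℝ)⌋₊ : ℕ) + 1 :=
    Nat.lt_floor_add_one _
  generalize ⌊(1 - δ / 4) * ((k * n₁ : ℕ) : ℝ)⌋₊ = n' at h1 ⊢
  have hk : (0 : ℝ) ≤ k := Nat.cast_nonneg _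
  have hm0 : (0 : ℝ) ≤ m := Nat.cast_nonneg _
  have hn' : (n : ℝ) ≤ k * (m + 2) * (n₁ + 1) := by exact_mod_cast hn
  refine Nat.floor_le_floor ?_
  push_cast at h1 ⊢
  have hp : (0 : ℝ) ≤ k * n₁ := by positivity
  have h5 : (1 - δ) * n ≤ ((1 - δ) * m + 2) * (k * (n₁ + 1)) := by
    refine (mul_le_mul_of_nonneg_left hn' h0).trans ?_
    have : (1 - δ) * (m + 2) ≤ (1 - δ) * m + 2 := by linarith
    have h6 := mul_le_mul_of_nonneg_right this (show (0 : ℝ) ≤ k * (n₁ + 1) by positivity)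
    linarith
  have h6 : m * (1 - δ / 4) * ((1 - δ / 4) * (k * n₁) - 1) ≤ m * n' * (1 - δ / 4) := by
    have := mul_le_mul_of_nonneg_left h1.le (show (0 : ℝ) ≤ m * (1 - δ / 4) by
      exact mul_nonneg hm0 (by linarith))
    linarith
  have h7 : (1 - δ / 2) * (m * (k * n₁)) ≤ (1 - δ / 4) * (1 - δ / 4) * (m * (k * n₁)) :=
    mul_le_mul_of_nonneg_right (by nlinarith) (by positivity)
  have h8 := mul_le_mul_of_nonneg_right hm hp
  have h9 : δ * m * k ≥ 0 := by positivity
  have h10 : δ * m ≥ 0 := by positivity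
  linarith

end Rates

theorem Layers.Valid.mono {ι : Type} {N : ι → Resource} {η η' : ℝ} (h : η ≤ η') :
    ∀ {l : List ι} {M M' : QSys} (ly : Layers N l M M') (ρ : Op (M ⊠ srcSys N l)),
      ly.Valid η ρ → ly.Valid η' ρ
  | _, _, _, .nil _, _, _ => _root_.trivial
  | _, _, _, .cons _ _ _ _ rest, _, hρ => ⟨hρ.1.trans h, Layers.Valid.mono h rest _ hρ.2⟩

/-- The accuracy of a program that is obtained from a coherently decoupled protocol. -/
def coherentError (ι : Type) [Fintype ι] (t ε : ℝ) : ℝ :=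
  2 * t + 2 * (2 ^ Fintype.card ι - 1) * (128 * (2 * ε + ε)) / (2 * t) + ε

theorem exists_coherentBlock {k a M : ℕ} {N : Fin k × Fin (a + 1) → Resource} {T : Resource}
    (hN : ∀ c, N (c, Fin.natAdd a 0) = cbitChannelRel.pow M) (P : Protocol N T) {ε t : ℝ}
    (hε : 0 ≤ ε) (ht : 0 < t) (hV : P.Valid ε) (hC : P.Close ε)
    (hd : ∀ c, P.CohDecoupled (c, Fin.natAdd a 0) ε) {ι' : Type} {N' : ι' → Resource}
    {f : Fin k × Fin (a + 1) → ι'} (hf : f.Injective)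
    (hN' : ∀ c i, N' (f (c, Fin.castAdd 1 i)) = N (c, Fin.castAdd 1 i)) :
    ∃ l : List ι', CoherentBlock N' ε l T (k * M) (coherentError (Fin k × Fin (a + 1)) t ε) ∧
      l.Nodup ∧ ∀ j ∈ l, ∃ c i, j = f (c, Fin.castAdd 1 i) := by
  have hnat : ∀ j : Fin k × Fin (a + 1), ¬ j.2.val < a → j = (j.1, Fin.natAdd a 0) := fun j hj =>
    Prod.ext rfl (Fin.ext (by have := j.2.isLt; simp; omega))
  have hcast : ∀ j : Fin k × Fin (a + 1), ∀ h : j.2.val < a,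
      j = (j.1, Fin.castAdd 1 ⟨j.2.val, h⟩) := fun j h => rfl
  have hcl : ∀ j : Fin k × Fin (a + 1), ¬ j.2.val < a → Nonempty (CbitLike (N j)) := fun j hj => by
    rw [hnat j hj, hN]
    exact ⟨cbitLikeCbit.pow M⟩
  let o : ∀ j, Option (CbitLike (N j)) := fun j =>
    if h : j.2.val < a then none else some (hcl j h).some
  have ho : ∀ j, o j = none ↔ j.2.val < a := fun j => by
    by_cases h : j.2.val < a <;> simp [o, h]
  obtain ⟨B, F, D, hD, hI, hn⟩ := P.coherent_impl (N' := N') o f (fun j hj => by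
    rw [hcast j ((ho j).mp hj), hN']) hε hε hV (fun j _ hj => by
      have h1 : ¬ j.2.val < a := fun h => by rw [(ho j).mpr h] at hj; cases hj
      rw [hnat j h1]
      exact hd _) hC ht
  refine ⟨_, ⟨_, B, F, D, ?_, hD, hI, hn⟩, (P.nodup.filter _).map hf, fun j hj => ?_⟩
  · refine Fintype.card_pi.trans ?_
    have h1 : ∀ j, Fintype.card (CopyDil.ofOption (o j)).K =
        if j.2 = Fin.natAdd a 0 then 2 ^ M else 1 := fun j => by
      by_cases h : j.2.val < a
      · rw [(ho j).mpr h, if_neg fun h2 => by rw [h2] at h; simp at h]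
        rfl
      · obtain ⟨c, hc⟩ : ∃ c, o j = some c := ⟨_, dif_neg h⟩
        rw [hc, if_pos (congrArg Prod.snd (hnat j h))]
        change Fintype.card (N j).In = _
        rw [hnat j h, hN, card_cbitChannelRel_pow]
    rw [Finset.prod_congr rfl fun j _ => h1 j, Fintype.prod_prod_type]
    simp [← pow_mul, mul_comm]
  · obtain ⟨i, hi, rfl⟩ := List.mem_map.mp hj
    have h1 := (ho i).mp (Option.isNone_iff_eq_none.mp (by simpa using (List.mem_filter.mp hi).2))
    exact ⟨_, _, congrArg f (hcast i h1)⟩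

theorem exists_accuracy (ι : Type) [Fintype ι] {m : ℕ} (hm : 0 < m) {ε : ℝ} (hε : 0 < ε) :
    ∃ t ε' : ℝ, 0 < t ∧ 0 < ε' ∧ ε' ≤ ε ∧ m * coherentError ι t ε' ≤ ε := by
  have hm' : (0 : ℝ) < m := Nat.cast_pos.mpr hm
  have h1 : (1 : ℝ) ≤ 2 ^ Fintype.card ι := one_le_pow₀ (by norm_num)
  obtain ⟨t, ht⟩ : ∃ t : ℝ, t = ε / (4 * m) := ⟨_, rfl⟩
  have ht0 : 0 < t := ht ▸ by positivity
  obtain ⟨C, hC⟩ : ∃ C : ℝ, C = 2 * (2 ^ Fintype.card ι - 1) * (128 * 3) / (2 * t) + 1 := ⟨_, rfl⟩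
  have hC0 : 0 < C := by
    have : 0 ≤ 2 * ((2 : ℝ) ^ Fintype.card ι - 1) * (128 * 3) / (2 * t) := by
      have : 0 ≤ (2 : ℝ) ^ Fintype.card ι - 1 := by linarith
      positivity
    linarith
  refine ⟨t, min ε (ε / (2 * m * C)), ht0, lt_min hε (by positivity), min_le_left _ _, ?_⟩
  have h2 : min ε (ε / (2 * m * C)) ≤ ε / (2 * m * C) := min_le_right _ _
  generalize min ε (ε / (2 * m * C)) = ε' at h2 ⊢
  have h3 : coherentError ι t ε' = 2 * t + C * ε' := by
    rw [coherentError, hC]; ring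
  rw [le_div_iff₀ (by positivity)] at h2
  have h4 : m * (2 * t) = ε / 2 := by rw [ht]; field_simp; ring
  rw [h3, mul_add, h4]
  linarith

open ResourceSeq

variable {α β : ResourceSeq} {R : ℝ}

/-- The copies of `k` consecutive components among those of a larger collection. -/
def blockIndex (k K d b : ℕ) (hb : (b + 1) * k ≤ K) (j : Fin k × Fin d) : Fin K × Fin d :=
  (⟨b * k + j.1.val, by have := j.1.isLt; rw [add_mul, one_mul] at hb; omega⟩, j.2)

theorem blockIndex_injective {k K d b : ℕ} (hb : (b + 1) * k ≤ K) :
    (blockIndex k K d b hb).Injective := fun x y h => by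
  have h1 := congrArg (fun p => p.1.val) h
  have h2 := congrArg Prod.snd h
  exact Prod.ext (Fin.ext (by simpa [blockIndex] using h1)) h2

theorem blockIndex_div {k K d b : ℕ} (hb : (b + 1) * k ≤ K) (j : Fin k × Fin d) :
    (blockIndex k K d b hb j).1.val / k = b := by
  have hk : 0 < k := j.1.pos
  simp only [blockIndex]
  rw [mul_comm, Nat.mul_add_div hk, Nat.div_eq_of_lt j.1.isLt, add_zero]

/-- `m` runs of a coherently decoupled protocol, together with dense coding. -/
theorem exists_realizes_blocks {k m n₁ : ℕ} {T : Resource} {ε t : ℝ} (hε : 0 ≤ ε) (ht : 0 < t)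
    (P : Protocol (copies ((α.add (R • cbitsRel)).comp n₁) k) T) (hV : P.Valid ε) (hC : P.Close ε)
    (hd : ∀ c, P.CohDecoupled (c, Fin.natAdd α.depth (0 : Fin 1)) ε)
    (hs : (k * ⌊R * n₁⌋₊ + 1) / 2 * (m + 1) ≤ ⌊R / 2 * n₁⌋₊ * (k * (m + 2))) :
    ∃ (X : QSys) (l : List (Fin (k * (m + 2)) × Fin (α.depth + 1))),
      Fintype.card X = 2 ^ ((k * ⌊R * n₁⌋₊ + 1) / 2 +
        m * (k * ⌊R * n₁⌋₊ - (k * ⌊R * n₁⌋₊ + 1) / 2)) ∧ l.Nodup ∧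
      Realizes (copies ((α + (R / 2) • qubits).comp n₁) (k * (m + 2))) ε l
        ((T.pow m).withEnt X) (m * coherentError (Fin k × Fin (α.depth + 1)) t ε) := by
  obtain ⟨N, hN⟩ : ∃ N : Fin k × Fin (α.depth + 1) → Resource,
    N = copies ((α.add (R • cbitsRel)).comp n₁) k := ⟨_, rfl⟩
  obtain ⟨N', hN'⟩ : ∃ N' : Fin (k * (m + 2)) × Fin (α.depth + 1) → Resource,
    N' = copies ((α + (R / 2) • qubits).comp n₁) (k * (m + 2)) := ⟨_, rfl⟩
  have hNc : ∀ c, N (c, Fin.natAdd α.depth 0) = cbitChannelRel.pow ⌊R * n₁⌋₊ := fun c => by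
    rw [hN]
    exact Fin.append_right _ _ (0 : Fin 1)
  have hNq : ∀ c, N' (c, Fin.natAdd α.depth 0) = qubitChannel.pow ⌊R / 2 * n₁⌋₊ := fun c => by
    rw [hN']
    exact Fin.append_right _ _ (0 : Fin 1)
  have hNN : ∀ c c' i, N' (c, Fin.castAdd 1 i) = N (c', Fin.castAdd 1 i) := fun c c' i => by
    rw [hN, hN']
    exact (Fin.append_left (α.comp n₁) _ i).trans (Fin.append_left (α.comp n₁) _ i).symm
  change ∃ (X : QSys) (l : List (Fin (k * (m + 2)) × Fin (α.depth + 1))), _ ∧ _ ∧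
    Realizes (copies ((α + (R / 2) • qubits).comp n₁) (k * (m + 2))) ε l _ _
  rw [← hN']
  have hblock : ∀ b, ∃ l : List (Fin (k * (m + 2)) × Fin (α.depth + 1)), b < m →
      CoherentBlock N' ε l T (k * ⌊R * n₁⌋₊) (coherentError (Fin k × Fin (α.depth + 1)) t ε) ∧
      l.Nodup ∧ ∀ j ∈ l, j.1.val / k = b ∧ j.2.val < α.depth := fun b => by
    by_cases hb : b < m
    · have hbk : (b + 1) * k ≤ k * (m + 2) := by
        rw [mul_comm]; exact Nat.mul_le_mul_left k (by omega)
      subst hN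
      obtain ⟨l, h1, h2, h3⟩ := exists_coherentBlock (N' := N') hNc P hε ht hV hC hd
        (blockIndex_injective hbk) fun c i => hNN _ _ _
      refine ⟨l, fun _ => ⟨h1, h2, fun j hj => ?_⟩⟩
      obtain ⟨c, i, rfl⟩ := h3 j hj
      exact ⟨blockIndex_div hbk _, i.isLt⟩
    · exact ⟨[], fun h => absurd h hb⟩
  choose l hl using hblock
  have hB := SharesEnt.blocks (l := l) (h := (k * ⌊R * n₁⌋₊ + 1) / 2)
    (by omega) (by omega) m fun i hi => (hl i hi).1
  obtain ⟨X, hX, hr⟩ := hB.realizes hε (card_qubitChannel_pow ⌊R / 2 * n₁⌋₊)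
    (js := (List.finRange (k * (m + 2))).map fun c => (c, Fin.natAdd α.depth 0)) (fun j hj => by
      obtain ⟨c, -, rfl⟩ := List.mem_map.mp hj
      rw [hNq]
      exact (isWire_pow isWire_qubitChannel _).sends) (by
      rwa [List.length_map, List.length_finRange])
  refine ⟨X, _, hX, ?_, hr⟩
  have hmem : ∀ j, j ∈ (List.range m).flatMap l → ∃ b, b < m ∧ j ∈ l b := fun j hj => by
    obtain ⟨b, hb, hj⟩ := List.mem_flatMap.mp hj
    exact ⟨b, List.mem_range.mp hb, hj⟩
  refine List.Nodup.append (List.nodup_flatMap.mpr ⟨fun b hb => (hl b (List.mem_range.mp hb)).2.1,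
    ?_⟩) ((List.nodup_finRange _).map fun a b h => congrArg Prod.fst h) fun j hj hj' => ?_
  · refine (List.nodup_range (n := m)).imp_of_mem fun {a b} ha hb hab j hj hj' => hab ?_
    exact (((hl a (List.mem_range.mp ha)).2.2 j hj).1).symm.trans
      ((hl b (List.mem_range.mp hb)).2.2 j hj').1
  · obtain ⟨b, hb, hj⟩ := hmem j hj
    obtain ⟨c, -, rfl⟩ := List.mem_map.mp hj'
    exact absurd ((hl b hb).2.2 _ hj).2 (by simp)

theorem Realizes.target {β : ResourceSeq} {ι : Type} {N : ι → Resource} {η ε : ℝ} {l : List ι}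
    {X : QSys} {m n' n₀ e : ℕ}
    (h : Realizes N η l (((flat (β.comp n')).pow m).withEnt X) ε)
    (hβ : ((flat (β.comp n')).pow m).Reduces (flat (β.comp n₀)))
    (hX : Fintype.card X = 2 ^ e) (he : ⌊R / 2 * n₀⌋₊ ≤ e) :
    Realizes N η l (flat ((β + (R / 2) • ebits).comp n₀)) ε := by
  let W : QSys := ⟨Fin (2 ^ (e - ⌊R / 2 * n₀⌋₊))⟩
  let g : X ≃ ((ebitState.pow ⌊R / 2 * n₀⌋₊).Aout ⊠ W) :=
    Fintype.equivOfCardEq (by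
      refine hX.trans (Eq.symm ((Fintype.card_prod _ _).trans ?_))
      rw [card_ebitState_pow, Fintype.card_fin, ← pow_add, Nat.add_sub_cancel' he])
  exact h.reduces ((withEnt_reduces (isEnt_pow isEnt_ebitState _) g).trans
    ((hβ.tensor (.refl _)).trans (flat_append_reduces (β.comp n₀) fun _ => ebitState.pow _)))

theorem coherent_rule (hβ : β.IsAsymptotic) (hR : 0 < R)
    (h : IneqCohDecoupled α (R • cbitsRel) β) :
    Ineq (α + (R / 2) • qubits) (β + (R / 2) • ebits) := fun δ hδ hδ1 => by
  obtain ⟨k, hk, h⟩ := h (δ / 4) (by linarith) (by linarith)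
  obtain ⟨m, hm⟩ := exists_nat_ge (8 / δ)
  rw [div_le_iff₀' hδ] at hm
  have hm0 : 0 < m := Nat.pos_of_ne_zero fun h0 => by rw [h0] at hm; norm_num at hm
  have hK : 0 < k * (m + 2) := by positivity
  refine ⟨k * (m + 2), hK, fun ε hε => ?_⟩
  obtain ⟨t, ε', ht, hε', hle, hacc⟩ := exists_accuracy (Fin k × Fin (α.depth + 1)) hm0 hε
  obtain ⟨C₀, hC₀⟩ := h ε' hε'
  obtain ⟨C₁, hC₁⟩ := hβ.mono
  obtain ⟨C₂, hC₂⟩ := hβ.2 (δ / 4) (by linarith) (by linarith) m hm0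
  have hk' : (0 : ℝ) < k := Nat.cast_pos.mpr hk
  obtain ⟨C₃, hC₃⟩ := exists_forall_mul_ge (mul_pos hk' hR) (2 * k * (m + 2) + m + 1)
  obtain ⟨C₄, hC₄⟩ := exists_forall_mul_ge (mul_pos hk' hR) ((m + 1) * k + m + R * k * m)
  obtain ⟨C₅, hC₅⟩ := exists_forall_mul_ge (mul_pos hk' two_pos) (m + (m + 2) * k)
  obtain ⟨C₆, hC₆⟩ := exists_forall_mul_ge (sub_pos.mpr hδ1) C₁
  refine ⟨max C₆ (k * (m + 2) * (C₀ + 2 * C₂ + C₃ + C₄ + C₅)), fun n hn => ?_⟩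
  obtain ⟨n₁, hn₁⟩ : ∃ n₁, n₁ = n / (k * (m + 2)) := ⟨_, rfl⟩
  have hge : C₀ + 2 * C₂ + C₃ + C₄ + C₅ ≤ n₁ := by
    rw [hn₁, Nat.le_div_iff_mul_le hK, mul_comm]
    exact (le_max_right _ _).trans hn
  have hlt : n ≤ k * (m + 2) * (n₁ + 1) := by
    rw [hn₁]; exact (Nat.lt_mul_div_succ n hK).le
  rw [← hn₁]
  have h0 := hC₀ (k * n₁) ((show C₀ ≤ n₁ by omega).trans (Nat.le_mul_of_pos_left n₁ hk))
  rw [Nat.mul_div_cancel_left _ hk] at h0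
  obtain ⟨P, hV, hC, hd⟩ := h0
  obtain ⟨X, l, hX, hl, hr⟩ := exists_realizes_blocks (m := m) hε'.le ht P hV hC
    (fun c => hd c (0 : Fin 1)) (sent_le hR k m (hC₃ n₁ (by omega)))
  have hn' : C₂ ≤ ⌊(1 - δ / 4) * ((k * n₁ : ℕ) : ℝ)⌋₊ := by
    refine Nat.le_floor ?_
    have h1 : (2 * C₂ : ℝ) ≤ n₁ := by exact_mod_cast (show 2 * C₂ ≤ n₁ by omega)
    have h2 : (n₁ : ℝ) ≤ ((k * n₁ : ℕ) : ℝ) := Nat.cast_le.mpr (Nat.le_mul_of_pos_left n₁ hk)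
    nlinarith
  have hred : ((flat (β.comp ⌊(1 - δ / 4) * ((k * n₁ : ℕ) : ℝ)⌋₊)).pow m).Reduces
      (flat (β.comp ⌊(1 - δ) * (n : ℝ)⌋₊)) := by
    have h1 := (hC₂ (m * ⌊(1 - δ / 4) * ((k * n₁ : ℕ) : ℝ)⌋₊)
      (hn'.trans (Nat.le_mul_of_pos_left _ hm0))).2
    rw [Nat.mul_div_cancel_left _ hm0] at h1
    exact (flat_pow_reduces _ m).trans (h1.flat.trans (hC₁ _ _
      (Nat.le_floor (hC₆ n ((le_max_left _ _).trans hn))) (target_le hδ hδ1 hm hlt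
        (hC₅ n₁ (by omega)))))
  obtain ⟨P', hV', hC'⟩ := (hr.target hred hX (rank_le hR hδ hδ1 hm hlt
    (hC₄ n₁ (by omega)))).exists_protocol hε'.le hl
  exact ⟨P', fun R ξ hξ => (hV' R ξ hξ).mono hle, fun R ξ hξ => (hC' R ξ hξ).trans hacc⟩

end QShannon

end

theorem mainTheorem3 (α β : QShannon.ResourceSeq) (hα : α.IsAsymptotic) (hβ : β.IsAsymptotic)
    (R : ℝ) (hR : 0 < R)
    (h : QShannon.ResourceSeq.IneqCohDecoupled α (R • QShannon.cbitsRel) β) :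
    QShannon.ResourceSeq.Ineq (α + (R / 2) • QShannon.qubits) (β + (R / 2) • QShannon.ebits) :=
  QShannon.coherent_rule hβ hR h
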